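/- Let $n\ge 1$, let $B=\{z\in\mathbb C^n : |z|<1\}$, and put $d^c=\frac{\sqrt{-1}}{2}(\bar\partial-\partial)$, so that $dd^c=\sqrt{-1}\,\partial\bar\partial$. Let $\omega_B=-(n+1)\,dd^c\log(1-|z|^2)$ be the Bergman form. For $a\in B$ let $$F_a(z)=\frac{a-P_az-\sqrt{1-|a|^2}\,(z-P_az)}{1-\langle z,a\rangle},\qquad P_az=\frac{\langle z,a\rangle}{|a|^{2}}\,a,\qquad F_0(z)=-z,$$ be the holomorphic involution of $B$ exchanging $0$ and $a$. For $0<r<1$ put $$E(a,r)=\{z\in B: |F_a(z)|<r\},\qquad V_n(r)=\int_{B(0,r)}\omega_B^n .$$ Let $G_B(\cdot,a)$ be the Green's function of $\omega_B$ with pole $a\in B$, that is, $dd^cG_B(\cdot,a)\wedge\omega_B^{n-1}=\delta_a$ and $G_B(\cdot,a)|_{\partial B}=0$; explicitly $$G_B(z,a)=-\frac{1}{(2\pi)^{n}(n+1)^{n-1}}\int_{|F_a(z)|^2}^1\frac{(1-u)^{n-1}}{u^n}\,du,\qquad G_B(a,a)=-\infty .$$ Set $$\Gamma_r(z,\zeta)=G_B(z,\zeta)-\frac1{V_n(r)}\int_{E(z,r)}G_B(x,\zeta)\,\omega_B^n(x).$$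 Let $W\subset B$ be a closed nonsingular complex hypersurface and let $T$ be a holomorphic function on $B$ with $W=T^{-1}(0)$ and $dT$ nowhere zero on $W$. Then $\omega_B^{n-1}\wedge dd^c\log|T|^2$, taken in the sense of currents, is a positive measure on $B$, and the function $$s_r(z)=\int_B\Gamma_r(z,\zeta)\,\omega_B^{n-1}(\zeta)\wedge dd^c\log|T|^2(\zeta)\in[-\infty,\infty)$$ satisfies, for every $z\in B$ (both sides being $-\infty$ when $z\in W$), $$s_r(z)=\log|T(z)|^2-\frac1{V_n(r)}\int_{E(z,r)}\log|T(\zeta)|^2\,\omega_B^n(\zeta).$$ In particular $s_r$ is locally integrable on $B$ and, in the sense of currents on $B$, $$\frac1{2\pi}\,dd^cs_r=[W]-\frac1{2\pi}\Upsilon_r^W .$$ Here $[W]$ is the current of integration along $W$, and $$\Upsilon_r^W(z)=\frac1{V_n(r)}\sum_{i,j}\left(\int_{B(0,r)}\frac{\partial^2\log|T(F_z(\zeta))|^2}{\partial z_i\,\partial\bar z_j}\,\omega_B^n(\zeta)\right)\sqrt{-1}\,dz_i\wedge d\bar z_j$$ is the total density tensor. The derivatives with respect to $z$ are taken in the sense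 of distributions, i.e. $\Upsilon_r^W$ is the average over $\zeta\in B(0,r)$ with respect to $\omega_B^n$ of the currents $dd^c_z\log|T(F_z(\zeta))|^2$. -/

import Mathlib

open Set Filter Topology MeasureTheory
open scoped ENNReal ContDiff

noncomputable section

namespace BergmanBall

/-- `ℂⁿ` with its Hermitian norm; `volume` is Lebesgue measure on `ℝ²ⁿ`. -/
abbrev Cn (n : ℕ) : Type := EuclideanSpace ℂ (Fin n)

/-- The open unit ball `B` of `ℂⁿ`. -/
def unitBall (n : ℕ) : Set (Cn n) := Metric.ball 0 1

/-! ### Wirtinger derivatives and the Bergman metric -/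

/-- `∂u/∂z_j = (1/2)(∂u/∂x_j - √-1 ∂u/∂y_j)`. -/
def dz {n : ℕ} (j : Fin n) (u : Cn n → ℂ) (z : Cn n) : ℂ :=
  (1 / 2) * (fderiv ℝ u z (EuclideanSpace.single j 1)
    - Complex.I * fderiv ℝ u z (EuclideanSpace.single j Complex.I))

/-- `∂u/∂z̄_k = (1/2)(∂u/∂x_k + √-1 ∂u/∂y_k)`. -/
def dzbar {n : ℕ} (k : Fin n) (u : Cn n → ℂ) (z : Cn n) : ℂ :=
  (1 / 2) * (fderiv ℝ u z (EuclideanSpace.single k 1)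
    + Complex.I * fderiv ℝ u z (EuclideanSpace.single k Complex.I))

/-- The coefficient matrix `(∂²u/∂z_j∂z̄_k)` of
`dd^c u = √-1 ∂∂̄u = √-1 ∑ (∂²u/∂z_j∂z̄_k) dz_j ∧ dz̄_k`, where `d^c = (√-1/2)(∂̄ - ∂)`. -/
def leviMatrix {n : ℕ} (u : Cn n → ℝ) (z : Cn n) : Matrix (Fin n) (Fin n) ℂ :=
  Matrix.of fun j k => dz j (dzbar k fun x => (u x : ℂ)) z

/-- `λ(z) = log (1 - |z|²) - (n/(n+1)) log (n+1)`. -/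
def lam {n : ℕ} (z : Cn n) : ℝ :=
  Real.log (1 - ‖z‖ ^ 2) - (n / (n + 1) : ℝ) * Real.log (n + 1)

/-- The coefficient matrix of the Bergman form `ω_B = -(n+1) dd^c λ`. -/
def bergmanMetric {n : ℕ} (z : Cn n) : Matrix (Fin n) (Fin n) ℂ :=
  leviMatrix (fun x => -((n : ℝ) + 1) * lam x) z

/-- The density of `ω_B^n = e^{-(n+1)λ} ω_E^n` with respect to Lebesgue measure; here
`ω_E = dd^c|z|² = 2 ∑ dx_j ∧ dy_j`, so `ω_E^n = 2^n n! dx_1 ∧ dy_1 ∧ ⋯ ∧ dx_n ∧ dy_n`. -/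
def bergmanDensity {n : ℕ} (z : Cn n) : ℝ :=
  2 ^ n * (n.factorial : ℝ) * Real.exp (-((n : ℝ) + 1) * lam z)

/-- The Bergman Laplacian, `(Δ_B φ) ω_B^n = dd^c φ ∧ ω_B^{n-1}`.  For every `(1,1)`-form `α` one
has `α ∧ ω^{n-1} = (1/n) (tr_ω α) ω^n`, and `tr_ω α` is the trace of (coefficients of `α`) times
(coefficients of `ω`)`⁻¹`. -/
def bergmanLaplacian {n : ℕ} (φ : Cn n → ℝ) (z : Cn n) : ℝ :=
  (1 / (n : ℝ)) * ((leviMatrix φ z * (bergmanMetric z)⁻¹).trace).re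

/-! ### Automorphisms and balls -/

/-- The involution
`F_a(z) = (a - P_a z - s_a Q_a z) / (1 - ⟨z,a⟩)`, `P_a = |a|⁻² a a†`, `Q_a = I - P_a`,
`s_a = √(1-|a|²)`.  For `a = 0` the division convention gives `P_0 = 0` and `F_0(z) = -z`. -/
def F {n : ℕ} (a z : Cn n) : Cn n :=
  let P : Cn n := (inner ℂ a z / ((‖a‖ ^ 2 : ℝ) : ℂ)) • a
  (1 - inner ℂ a z)⁻¹ • (a - P - ((Real.sqrt (1 - ‖a‖ ^ 2) : ℝ) : ℂ) • (z - P))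

/-- The Bergman-Green ball `E(a,r) = {z ∈ B : |F_a(z)| < r}`. -/
def bgBall {n : ℕ} (a : Cn n) (r : ℝ) : Set (Cn n) := {z ∈ unitBall n | ‖F a z‖ < r}

/-- `V_n(r) = ∫_{B(0,r)} ω_B^n`. -/
def V (n : ℕ) (r : ℝ) : ℝ := ∫ z in Metric.ball (0 : Cn n) r, bergmanDensity z

/-! ### The Green's function -/

/-- Smooth real functions with compact support in `B`. -/
def IsTestFunction {n : ℕ} (φ : Cn n → ℝ) : Prop :=
  ContDiff ℝ ∞ φ ∧ HasCompactSupport φ ∧ tsupport φ ⊆ unitBall n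

/-- `C_n ∫_t^1 (1-u)^{n-1} u^{-n} du ∈ [0,∞]` with `C_n = (2π)^{-n} (n+1)^{-(n-1)}`;
the value at `t = 0` is `∞`. -/
def greenProfile (n : ℕ) (t : ℝ) : ℝ≥0∞ :=
  ENNReal.ofReal (((2 * Real.pi) ^ n * ((n : ℝ) + 1) ^ (n - 1))⁻¹) *
    ∫⁻ u in Ioo t 1, ENNReal.ofReal ((1 - u) ^ (n - 1) / u ^ n)

/-- The Green's function `G_B(z,a) = γ_B(F_a(z))`, with value `-∞` at the pole `z = a`. -/
def green {n : ℕ} (z a : Cn n) : EReal := -((greenProfile n (‖F a z‖ ^ 2) : ℝ≥0∞) : EReal)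

/-- `G` is a Green's function of `Δ_B` with pole `a`: as a distribution on `B`,
`(Δ_B G) ω_B^n = dd^c G ∧ ω_B^{n-1} = δ_a`, and `G = 0` on `∂B`. -/
structure IsGreenFunction {n : ℕ} (a : Cn n) (G : Cn n → EReal) : Prop where
  locallyIntegrable : LocallyIntegrableOn (fun z => (G z).toReal) (unitBall n)
  laplacian : ∀ φ : Cn n → ℝ, IsTestFunction φ →
    ∫ z in unitBall n, (G z).toReal * bergmanLaplacian φ z * bergmanDensity z = φ a
  boundary : ∀ ξ : Cn n, ‖ξ‖ = 1 → Tendsto G (𝓝[unitBall n] ξ) (𝓝 0)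

/-- `Γ_r(z,ζ) = G_B(z,ζ) - V_n(r)⁻¹ ∫_{E(z,r)} G_B(x,ζ) ω_B^n(x)`. -/
def Gam {n : ℕ} (r : ℝ) (z ζ : Cn n) : EReal :=
  green z ζ - (((V n r)⁻¹ * ∫ x in bgBall z r, (green x ζ).toReal * bergmanDensity x : ℝ) : EReal)

/-! ### The measure `ω_B^{n-1} ∧ dd^c u` and the function `s_r` -/

/-- `μ` is the measure `ω_B^{n-1} ∧ dd^c u` on `B`, where `dd^c u` is taken in the sense of
currents: `μ` is a Radon measure on `B` with
`∫ φ dμ = ∫_B u dd^c φ ∧ ω_B^{n-1}` for all test functions `φ` (recall that `ω_B` is closed). -/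
structure IsWedgeMeasure {n : ℕ} (u : Cn n → ℝ) (μ : Measure (Cn n)) : Prop where
  locallyIntegrable : LocallyIntegrableOn u (unitBall n)
  supported : μ (unitBall n)ᶜ = 0
  finite_on_compact : ∀ K ⊆ unitBall n, IsCompact K → μ K < ⊤
  pairing : ∀ φ : Cn n → ℝ, IsTestFunction φ →
    ∫ z, φ z ∂μ = ∫ z in unitBall n, u z * bergmanLaplacian φ z * bergmanDensity z

open Classical in
/-- The measure `ω_B^{n-1} ∧ dd^c u` (the zero measure if this current is not a positive
measure).  A measure with the defining property is unique. -/
def wedgeMeasure {n : ℕ} (u : Cn n → ℝ) : Measure (Cn n) :=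
  if h : ∃ μ : Measure (Cn n), IsWedgeMeasure u μ then h.choose else 0

/-- The function `log |T|²` (used in integrals only; its value at the zeros of `T` is `-∞`,
which the real logarithm does not record). -/
def logSq {n : ℕ} (T : Cn n → ℂ) (z : Cn n) : ℝ := Real.log (‖T z‖ ^ 2)

/-- The Lebesgue integral over `B` of an extended real function, `∫ g⁺ dμ - ∫ g⁻ dμ`. -/
def eintegral {n : ℕ} (μ : Measure (Cn n)) (g : Cn n → EReal) : EReal :=
  ((∫⁻ ζ in unitBall n, (g ζ).toENNReal ∂μ : ℝ≥0∞) : EReal)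
    - ((∫⁻ ζ in unitBall n, (-(g ζ)).toENNReal ∂μ : ℝ≥0∞) : EReal)

/-- `s_r(z) = ∫_B Γ_r(z,ζ) ω_B^{n-1}(ζ) ∧ dd^c log|T|²(ζ) ∈ [-∞,∞]`. -/
def sFun {n : ℕ} (T : Cn n → ℂ) (r : ℝ) (z : Cn n) : EReal :=
  eintegral (wedgeMeasure (logSq T)) (Gam r z)

/-! ### Differential forms and currents -/

/-- Real `k`-forms on `ℂⁿ = ℝ²ⁿ`. -/
abbrev RForm (n k : ℕ) : Type := Cn n → (Cn n) [⋀^Fin k]→L[ℝ] ℝ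

/-- Multiplication by `√-1` as a real linear map. -/
def J (n : ℕ) : Cn n →L[ℝ] Cn n :=
  Complex.I • ContinuousLinearMap.id ℝ (Cn n)

/-- Real test forms of bidegree `(n-1,n-1)` on `B`: smooth, compactly supported in `B`, and
invariant under `J`.  (On forms of type `(p,q)`, `J` acts by pull-back as `(√-1)^{p-q}`; a form of
degree `2(n-1)` has components of types `(n,n-2)`, `(n-1,n-1)` and `(n-2,n)` only, on which this
factor is `-1`, `1`, `-1`.) -/
def IsTestForm {n : ℕ} (θ : RForm n (2 * (n - 1))) : Prop :=
  ContDiff ℝ ∞ θ ∧ HasCompactSupport θ ∧ tsupport θ ⊆ unitBall n ∧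
    ∀ z, (θ z).compContinuousLinearMap (J n) = θ z

/-- `dd^c θ` for a form `θ` of type `(p,p)`.  Then `dθ = ∂θ + ∂̄θ` has types `(p+1,p)` and
`(p,p+1)`, the pull-back by `J` multiplies these by `√-1` and `-√-1`, and therefore
`d^c θ = (√-1/2)(∂̄θ - ∂θ) = -(1/2) J^*(dθ)`. -/
def ddc {n k : ℕ} (θ : RForm n k) : RForm n (k + 1 + 1) :=
  extDeriv fun z => (-(1 / 2 : ℝ)) • (extDeriv θ z).compContinuousLinearMap (J n)

/-- The positively oriented real frame `e_1, √-1 e_1, e_2, √-1 e_2, …` of `ℂⁿ`, counted from `0`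
(and `0` from index `2n` on). -/
def frame (n : ℕ) (i : ℕ) : Cn n :=
  if h : i / 2 < n then EuclideanSpace.single ⟨i / 2, h⟩ (if i % 2 = 0 then 1 else Complex.I)
  else 0

/-- The current `dd^c u` of a locally integrable function `u` on `B`, paired with a test form of
bidegree `(n-1,n-1)`: `⟨dd^c u, θ⟩ = ∫_B u dd^c θ`. -/
def ddcCurrent {n : ℕ} (u : Cn n → ℝ) (θ : RForm n (2 * (n - 1))) : ℝ :=
  ∫ z in unitBall n, u z * ddc θ z (fun i => frame n i)

/-- The total density tensor
`Υ_r^W = V_n(r)⁻¹ (∫_{B(0,r)} ∂²log|T(F_z(ζ))|²/∂z_i∂z̄_j ω_B^n(ζ)) √-1 dz_i ∧ dz̄_j`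
as a current in `z`: the average over `ζ ∈ B(0,r)` of the currents
`dd^c_z log |T(F_z(ζ))|²` (distributional derivatives). -/
def Upsilon {n : ℕ} (T : Cn n → ℂ) (r : ℝ) (θ : RForm n (2 * (n - 1))) : ℝ :=
  (V n r)⁻¹ * ∫ ζ in Metric.ball (0 : Cn n) r,
    ddcCurrent (fun z => logSq T (F z ζ)) θ * bergmanDensity ζ

/-- `Φ : U → W` is a holomorphic parametrization of a relatively open piece of the
hypersurface `W ⊆ ℂⁿ`. -/
structure IsParam {n : ℕ} (W : Set (Cn n)) (U : Set (Cn (n - 1)))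
    (Φ : Cn (n - 1) → Cn n) : Prop where
  isOpen : IsOpen U
  holomorphic : DifferentiableOn ℂ Φ U
  injOn : InjOn Φ U
  immersion : ∀ y ∈ U, Function.Injective (fderiv ℂ Φ y)
  image : ∃ O : Set (Cn n), IsOpen O ∧ Φ '' U = W ∩ O

/-- `∫_U Φ^* θ` for a form of top degree `2(n-1)` on `U ⊆ ℂ^{n-1}`. -/
def paramIntegral {n : ℕ} (U : Set (Cn (n - 1))) (Φ : Cn (n - 1) → Cn n)
    (θ : RForm n (2 * (n - 1))) : ℝ :=
  ∫ y in U, θ (Φ y) (fun i => fderiv ℂ Φ y (frame (n - 1) i))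

/-- `c = ∫_W θ`, computed with a finite partition of unity `(χ_i)` along `W ∩ supp θ` that is
subordinate to parametrizations `Φ_i : U_i → W`: `c = ∑ ∫_{U_i} Φ_i^*(χ_i θ)`. -/
def HasIntegralOver {n : ℕ} (W : Set (Cn n)) (θ : RForm n (2 * (n - 1))) (c : ℝ) : Prop :=
  ∃ (N : ℕ) (U : Fin N → Set (Cn (n - 1))) (Φ : Fin N → Cn (n - 1) → Cn n)
    (χ : Fin N → Cn n → ℝ),
    (∀ i, IsParam W (U i) (Φ i) ∧ ContDiff ℝ ∞ (χ i) ∧ tsupport (χ i) ∩ W ⊆ Φ i '' U i) ∧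
    (∀ w ∈ W ∩ tsupport θ, ∑ i, χ i w = 1) ∧
    c = ∑ i, paramIntegral (U i) (Φ i) (fun z => χ i z • θ z)

open Classical in
/-- The current of integration `[W]`: `⟨[W], θ⟩ = ∫_W θ`. -/
def integrationCurrent {n : ℕ} (W : Set (Cn n)) (θ : RForm n (2 * (n - 1))) : ℝ :=
  if h : ∃ c, HasIntegralOver W θ c then h.choose else 0

end BergmanBall

end

open BergmanBall

/-! The engine is a mean-value formula. If `dd^c u ∧ ω_B^{n-1} = μ` on `B`, then the average of `u`
over `E(z,r)` minus `u(z)` is the `μ`-integral of a nonnegative kernel depending only on `|F_z|²`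
(`lintegral_rieszKernel`). It comes from testing `∫ φ dμ = ∫ u Δ_B φ ω_B^n` on radial `φ`. A radial
potential is encoded by its mass distribution `M`, a function of relative volume, and its Laplacian
has density `M'/V_n(r)` (`lapDensity_profile`). The distribution `1 - y` on `0 < y < 1` is a unit
mass at `z` minus normalised volume on `E(z,r)`. The smooth `bumpMass k` increase to it, and their
potentials are test functions. In the limit, monotone convergence handles the `μ`-side and an
approximate identity handles the `u`-side, where `u(z) = -∞` is allowed.

The formula is used twice. With `u = G_B(·,ζ)` and `μ = δ_ζ` it identifies the kernel with `-Γ_r`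
(`rieszKernel_gap_eq`); with `u = log|T|²` it gives the closed form of `s_r` (`sFun_eq`). Hence
`Γ_r` never has to be computed, and no exchange of its two integrals is needed. The Green's function
property itself is proved with the potentials of the masses `rise k`, whose Laplacians concentrate
at the pole. The measure `ω_B^{n-1} ∧ dd^c log|T|²` exists because `log(|T|²+ε)` is
plurisubharmonic, so that `log|T|²` defines a positive functional on test functions, which extends
to compactly supported continuous functions.

It remains to apply `dd^c` to the closed form. The first term is the Poincaré–Lelong formula `dd^c
log|T|² = 2π[W]` (`ddcCurrent_logSq`). A holomorphic chart with `T` as first coordinate reduces it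
to `log|z₀|²`, Fubini reduces that to the disc, and there it is the Green's function property for `n
= 1`. The second term, the average, becomes an integral over the fixed ball `B(0,r)` by invariance
of `ω_B^n` under `F_z`; Fubini against `dd^c θ` then gives `Υ_r^W` (`integral_bgAverage_mul`). -/

noncomputable section
namespace BergmanBall

open scoped ComplexConjugate

/-! ### Wirtinger calculus -/

section Wirtinger

variable {n : ℕ} {z : Cn n}

theorem single_I (j : Fin n) : (EuclideanSpace.single j Complex.I : Cn n)
    = Complex.I • EuclideanSpace.single j (1 : ℂ) := by
  ext i
  by_cases h : i = j <;> simp [h]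

theorem dz_congr {u v : Cn n → ℂ} (h : u =ᶠ[𝓝 z] v) (j : Fin n) : dz j u z = dz j v z := by
  simp only [dz, h.fderiv_eq]

theorem dzbar_congr {u v : Cn n → ℂ} (h : u =ᶠ[𝓝 z] v) (j : Fin n) :
    dzbar j u z = dzbar j v z := by
  simp only [dzbar, h.fderiv_eq]

theorem dzbar_eventuallyEq {u v : Cn n → ℂ} (h : u =ᶠ[𝓝 z] v) (j : Fin n) :
    dzbar j u =ᶠ[𝓝 z] dzbar j v := by
  filter_upwards [h.eventuallyEq_nhds] with x hx using dzbar_congr hx j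

theorem dz_const (c : ℂ) (j : Fin n) : dz j (fun _ => c) z = 0 := by
  simp [dz]

theorem dzbar_const (c : ℂ) (j : Fin n) : dzbar j (fun _ => c) z = 0 := by
  simp [dzbar]

theorem dz_add {u v : Cn n → ℂ} (hu : DifferentiableAt ℝ u z) (hv : DifferentiableAt ℝ v z)
    (j : Fin n) : dz j (fun x => u x + v x) z = dz j u z + dz j v z := by
  simp only [dz, fderiv_fun_add hu hv, add_apply]; ring

theorem dzbar_add {u v : Cn n → ℂ} (hu : DifferentiableAt ℝ u z) (hv : DifferentiableAt ℝ v z)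
    (j : Fin n) : dzbar j (fun x => u x + v x) z = dzbar j u z + dzbar j v z := by
  simp only [dzbar, fderiv_fun_add hu hv, add_apply]; ring

theorem dz_mul {u v : Cn n → ℂ} (hu : DifferentiableAt ℝ u z) (hv : DifferentiableAt ℝ v z)
    (j : Fin n) : dz j (fun x => u x * v x) z = dz j u z * v z + u z * dz j v z := by
  simp only [dz, fderiv_fun_mul hu hv, add_apply,
    smul_apply, smul_eq_mul]; ring

theorem dzbar_mul {u v : Cn n → ℂ} (hu : DifferentiableAt ℝ u z) (hv : DifferentiableAt ℝ v z)
    (j : Fin n) : dzbar j (fun x => u x * v x) z = dzbar j u z * v z + u z * dzbar j v z := by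
  simp only [dzbar, fderiv_fun_mul hu hv, add_apply,
    smul_apply, smul_eq_mul]; ring

theorem dz_const_mul {u : Cn n → ℂ} (hu : DifferentiableAt ℝ u z) (c : ℂ) (j : Fin n) :
    dz j (fun x => c * u x) z = c * dz j u z := by
  rw [dz_mul (differentiableAt_const c) hu, dz_const]; ring

theorem dz_sum {ι : Type*} (S : Finset ι) {u : ι → Cn n → ℂ}
    (hu : ∀ i ∈ S, DifferentiableAt ℝ (u i) z) (j : Fin n) :
    dz j (fun x => ∑ i ∈ S, u i x) z = ∑ i ∈ S, dz j (u i) z := by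
  simp only [dz, fderiv_fun_sum hu, sum_apply, Finset.mul_sum,
    ← Finset.sum_sub_distrib]

theorem dzbar_sum {ι : Type*} (S : Finset ι) {u : ι → Cn n → ℂ}
    (hu : ∀ i ∈ S, DifferentiableAt ℝ (u i) z) (j : Fin n) :
    dzbar j (fun x => ∑ i ∈ S, u i x) z = ∑ i ∈ S, dzbar j (u i) z := by
  simp only [dzbar, fderiv_fun_sum hu, sum_apply, Finset.mul_sum,
    ← Finset.sum_add_distrib]

theorem fderiv_conj_comp {u : Cn n → ℂ} (hu : DifferentiableAt ℝ u z) (v : Cn n) :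
    fderiv ℝ (fun x => conj (u x)) z v = conj (fderiv ℝ u z v) := by
  have := (Complex.conjCLE.toContinuousLinearMap.hasFDerivAt (x := u z)).comp z hu.hasFDerivAt
  have h2 : fderiv ℝ (fun x => conj (u x)) z = _ := this.fderiv
  rw [h2]; rfl

theorem differentiableAt_conj_comp {u : Cn n → ℂ} (hu : DifferentiableAt ℝ u z) :
    DifferentiableAt ℝ (fun x => conj (u x)) z :=
  (Complex.conjCLE.toContinuousLinearMap.differentiableAt (x := u z)).comp z hu

theorem dz_conj {u : Cn n → ℂ} (hu : DifferentiableAt ℝ u z) (j : Fin n) :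
    dz j (fun x => conj (u x)) z = conj (dzbar j u z) := by
  simp only [dz, dzbar, fderiv_conj_comp hu, map_mul, map_add, map_div₀, map_one, Complex.conj_I]
  simp only [map_ofNat]
  ring

theorem dzbar_conj {u : Cn n → ℂ} (hu : DifferentiableAt ℝ u z) (j : Fin n) :
    dzbar j (fun x => conj (u x)) z = conj (dz j u z) := by
  simp only [dz, dzbar, fderiv_conj_comp hu, map_mul, map_sub, map_div₀, map_one, Complex.conj_I]
  simp only [map_ofNat]
  ring

theorem dz_holomorphic {f : Cn n → ℂ} (hf : DifferentiableAt ℂ f z) (j : Fin n) :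
    dz j f z = fderiv ℂ f z (EuclideanSpace.single j 1) := by
  simp only [dz, hf.fderiv_restrictScalars ℝ, ContinuousLinearMap.coe_restrictScalars', single_I,
    map_smul, smul_eq_mul]
  rw [← mul_assoc, Complex.I_mul_I]; ring

theorem dzbar_holomorphic {f : Cn n → ℂ} (hf : DifferentiableAt ℂ f z) (j : Fin n) :
    dzbar j f z = 0 := by
  simp only [dzbar, hf.fderiv_restrictScalars ℝ, ContinuousLinearMap.coe_restrictScalars',
    single_I, map_smul, smul_eq_mul]
  rw [← mul_assoc, Complex.I_mul_I]; ring

theorem differentiableAt_coord (k : Fin n) : DifferentiableAt ℂ (fun x : Cn n => x k) z :=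
  (EuclideanSpace.proj (𝕜 := ℂ) k : Cn n →L[ℂ] ℂ).differentiableAt

theorem contDiff_coord (k : Fin n) {m : WithTop ℕ∞} : ContDiff ℝ m (fun x : Cn n => x k) :=
  ((EuclideanSpace.proj (𝕜 := ℂ) k : Cn n →L[ℂ] ℂ).restrictScalars ℝ).contDiff

theorem contDiff_conj_coord (k : Fin n) {m : WithTop ℕ∞} :
    ContDiff ℝ m (fun x : Cn n => conj (x k)) :=
  Complex.conjCLE.toContinuousLinearMap.contDiff.comp (contDiff_coord k)

theorem dz_coord (j k : Fin n) : dz j (fun x : Cn n => x k) z = if j = k then 1 else 0 := by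
  rw [dz_holomorphic (differentiableAt_coord k)]
  have : fderiv ℂ (fun x : Cn n => x k) z = (EuclideanSpace.proj (𝕜 := ℂ) k : Cn n →L[ℂ] ℂ) :=
    (EuclideanSpace.proj (𝕜 := ℂ) k : Cn n →L[ℂ] ℂ).fderiv
  rw [this]
  simp [eq_comm]

theorem dzbar_coord (j k : Fin n) : dzbar j (fun x : Cn n => x k) z = 0 :=
  dzbar_holomorphic (differentiableAt_coord k) j

theorem dz_conj_coord (j k : Fin n) : dz j (fun x : Cn n => conj (x k)) z = 0 := by
  rw [dz_conj ((differentiableAt_coord k).restrictScalars ℝ), dzbar_coord, map_zero]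

theorem fderiv_ofReal_comp {u : Cn n → ℝ} (hu : DifferentiableAt ℝ u z) (v : Cn n) :
    fderiv ℝ (fun x => (u x : ℂ)) z v = (fderiv ℝ u z v : ℂ) := by
  have := (Complex.ofRealCLM.hasFDerivAt (x := u z)).comp z hu.hasFDerivAt
  have h2 : fderiv ℝ (fun x => (u x : ℂ)) z = _ := this.fderiv
  rw [h2]; rfl

theorem differentiableAt_ofReal_comp {u : Cn n → ℝ} (hu : DifferentiableAt ℝ u z) :
    DifferentiableAt ℝ (fun x => (u x : ℂ)) z :=
  (Complex.ofRealCLM.differentiableAt (x := u z)).comp z hu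

theorem contDiffAt_ofReal_comp {u : Cn n → ℝ} {m : WithTop ℕ∞} (hu : ContDiffAt ℝ m u z) :
    ContDiffAt ℝ m (fun x => (u x : ℂ)) z :=
  (Complex.ofRealCLM.contDiff.contDiffAt (x := u z)).comp z hu

theorem dzbar_ofReal {u : Cn n → ℝ} (hu : DifferentiableAt ℝ u z) (j : Fin n) :
    dzbar j (fun x => (u x : ℂ)) z = conj (dz j (fun x => (u x : ℂ)) z) := by
  rw [← dzbar_conj (differentiableAt_ofReal_comp hu)]
  simp

theorem dz_comp {u : Cn n → ℝ} {g : ℝ → ℝ} {g' : ℝ} (hu : DifferentiableAt ℝ u z)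
    (hg : HasDerivAt g g' (u z)) (j : Fin n) :
    dz j (fun x => (g (u x) : ℂ)) z = g' * dz j (fun x => (u x : ℂ)) z := by
  have h : HasFDerivAt (fun x => g (u x)) (g' • fderiv ℝ u z) z :=
    hg.comp_hasFDerivAt z hu.hasFDerivAt
  simp only [dz, fderiv_ofReal_comp hu, fderiv_ofReal_comp h.differentiableAt, h.fderiv]
  simp only [smul_apply, smul_eq_mul]
  push_cast
  ring

theorem dzbar_comp {u : Cn n → ℝ} {g : ℝ → ℝ} {g' : ℝ} (hu : DifferentiableAt ℝ u z)
    (hg : HasDerivAt g g' (u z)) (j : Fin n) :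
    dzbar j (fun x => (g (u x) : ℂ)) z = g' * dzbar j (fun x => (u x : ℂ)) z := by
  have h : HasFDerivAt (fun x => g (u x)) (g' • fderiv ℝ u z) z :=
    hg.comp_hasFDerivAt z hu.hasFDerivAt
  simp only [dzbar, fderiv_ofReal_comp hu, fderiv_ofReal_comp h.differentiableAt, h.fderiv]
  simp only [smul_apply, smul_eq_mul]
  push_cast
  ring

theorem contDiffAt_dz {u : Cn n → ℂ} {m k : WithTop ℕ∞} (hu : ContDiffAt ℝ k u z)
    (hmk : m + 1 ≤ k) (j : Fin n) : ContDiffAt ℝ m (dz j u) z := by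
  have h := hu.fderiv_right hmk
  exact contDiffAt_const.mul ((h.clm_apply contDiffAt_const).sub
    (contDiffAt_const.mul (h.clm_apply contDiffAt_const)))

theorem contDiffAt_dzbar {u : Cn n → ℂ} {m k : WithTop ℕ∞} (hu : ContDiffAt ℝ k u z)
    (hmk : m + 1 ≤ k) (j : Fin n) : ContDiffAt ℝ m (dzbar j u) z := by
  have h := hu.fderiv_right hmk
  exact contDiffAt_const.mul ((h.clm_apply contDiffAt_const).add
    (contDiffAt_const.mul (h.clm_apply contDiffAt_const)))

theorem dz_dzbar_comm {u : Cn n → ℂ} (hu : ContDiffAt ℝ ∞ u z) (j k : Fin n) :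
    dz j (dzbar k u) z = dzbar k (dz j u) z := by
  have h : DifferentiableAt ℝ (fderiv ℝ u) z :=
    (hu.fderiv_right (m := 1) (by norm_cast)).differentiableAt (by norm_num)
  have hs : IsSymmSndFDerivAt ℝ u z :=
    hu.isSymmSndFDerivAt (by simp; norm_cast)
  have e (v w : Cn n) : fderiv ℝ (fun x => fderiv ℝ u x v) z w = fderiv ℝ (fderiv ℝ u) z w v := by
    rw [fderiv_clm_apply h (differentiableAt_const v)]; simp
  have d (v : Cn n) : DifferentiableAt ℝ (fun x => fderiv ℝ u x v) z :=
    h.clm_apply (differentiableAt_const v)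
  unfold dz dzbar
  have e1 (v w v' : Cn n) : fderiv ℝ (fun x => 1 / 2 * (fderiv ℝ u x v
      + Complex.I * fderiv ℝ u x w)) z v' = 1 / 2 * (fderiv ℝ (fderiv ℝ u) z v' v
      + Complex.I * fderiv ℝ (fderiv ℝ u) z v' w) := by
    rw [fderiv_const_mul ((d _).fun_add ((d _).const_mul _)), fderiv_fun_add (d _)
      ((d _).const_mul _), fderiv_const_mul (d _)]
    simp [e]
    ring
  have e2 (v w v' : Cn n) : fderiv ℝ (fun x => 1 / 2 * (fderiv ℝ u x v
      - Complex.I * fderiv ℝ u x w)) z v' = 1 / 2 * (fderiv ℝ (fderiv ℝ u) z v' v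
      - Complex.I * fderiv ℝ (fderiv ℝ u) z v' w) := by
    rw [fderiv_const_mul ((d _).fun_sub ((d _).const_mul _)), fderiv_fun_sub (d _)
      ((d _).const_mul _), fderiv_const_mul (d _)]
    simp [e]
  simp only [e1, e2]
  rw [hs.eq (EuclideanSpace.single j 1) (EuclideanSpace.single k 1),
    hs.eq (EuclideanSpace.single j 1) (EuclideanSpace.single k Complex.I),
    hs.eq (EuclideanSpace.single j Complex.I) (EuclideanSpace.single k 1),
    hs.eq (EuclideanSpace.single j Complex.I) (EuclideanSpace.single k Complex.I)]
  ring

/-- The Levi matrix of a composition `g ∘ u`. -/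
theorem leviMatrix_comp {u : Cn n → ℝ} {g g₁ : ℝ → ℝ} {g₂ : ℝ} (hu : ContDiffAt ℝ ∞ u z)
    (hg : ∀ᶠ t in 𝓝 (u z), HasDerivAt g (g₁ t) t) (hg₁ : HasDerivAt g₁ g₂ (u z)) (j k : Fin n) :
    leviMatrix (fun x => g (u x)) z j k = g₁ (u z) * leviMatrix u z j k
      + g₂ * dz j (fun x => (u x : ℂ)) z * dzbar k (fun x => (u x : ℂ)) z := by
  simp only [leviMatrix, Matrix.of_apply]
  have hud : ∀ᶠ x in 𝓝 z, DifferentiableAt ℝ u x := by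
    filter_upwards [(hu.of_le (m := 1) (by norm_cast)).eventually (by simp)] with x hx
      using hx.differentiableAt (by norm_num)
  have hgd := hu.continuousAt.eventually hg
  have h1 : (dzbar k fun x => (g (u x) : ℂ)) =ᶠ[𝓝 z]
      fun x => (g₁ (u x) : ℂ) * dzbar k (fun x => (u x : ℂ)) x := by
    filter_upwards [hud, hgd] with x hx hgx using dzbar_comp hx hgx k
  have hu1 := hud.self_of_nhds
  have h2 : DifferentiableAt ℝ (dzbar k (fun x => (u x : ℂ))) z :=
    (contDiffAt_dzbar (m := 1) (contDiffAt_ofReal_comp hu) (by norm_cast) k).differentiableAt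
      (by norm_num)
  have h3 : DifferentiableAt ℝ (fun x => (g₁ (u x) : ℂ)) z :=
    differentiableAt_ofReal_comp (hg₁.differentiableAt.comp z hu1)
  rw [dz_congr h1, dz_mul h3 h2, dz_comp hu1 hg₁]
  ring

theorem leviMatrix_congr {u v : Cn n → ℝ} (h : u =ᶠ[𝓝 z] v) : leviMatrix u z = leviMatrix v z := by
  ext j k
  simp only [leviMatrix, Matrix.of_apply]
  exact dz_congr (dzbar_eventuallyEq (h.fun_comp (fun t : ℝ => (t : ℂ))) k) j

theorem leviMatrix_add {u v : Cn n → ℝ} (hu : ContDiffAt ℝ ∞ u z) (hv : ContDiffAt ℝ ∞ v z) :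
    leviMatrix (fun x => u x + v x) z = leviMatrix u z + leviMatrix v z := by
  ext j k
  simp only [leviMatrix, Matrix.of_apply, Matrix.add_apply]
  have h : ∀ {w : Cn n → ℝ}, ContDiffAt ℝ ∞ w z → ∀ᶠ x in 𝓝 z, DifferentiableAt ℝ w x := by
    intro w hw
    filter_upwards [(hw.of_le (m := 1) (by norm_cast)).eventually (by simp)] with x hx
      using hx.differentiableAt (by norm_num)
  have h2 : ∀ {w : Cn n → ℝ}, ContDiffAt ℝ ∞ w z →
      DifferentiableAt ℝ (dzbar k (fun x => (w x : ℂ))) z := fun hw =>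
    (contDiffAt_dzbar (m := 1) (contDiffAt_ofReal_comp hw) (by norm_cast) k).differentiableAt
      (by norm_num)
  rw [← dz_add (h2 hu) (h2 hv)]
  apply dz_congr
  filter_upwards [h hu, h hv] with x hx hy
  rw [← dzbar_add (differentiableAt_ofReal_comp hx) (differentiableAt_ofReal_comp hy)]
  push_cast
  rfl

theorem leviMatrix_const (c : ℝ) : leviMatrix (fun _ : Cn n => c) z = 0 := by
  ext j k
  simp only [leviMatrix, Matrix.of_apply, Matrix.zero_apply]
  have : (dzbar k fun _ : Cn n => (c : ℂ)) = fun _ => 0 := by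
    ext x; exact dzbar_const _ k
  rw [this, dz_const]

end Wirtinger

/-! ### The function `1 - |z|²` -/

section Defining

variable {n : ℕ} {z : Cn n}

theorem ofReal_norm_sq (x : Cn n) : ((‖x‖ ^ 2 : ℝ) : ℂ) = ∑ i, x i * conj (x i) := by
  rw [EuclideanSpace.norm_sq_eq]
  push_cast
  exact Finset.sum_congr rfl fun i _ => (Complex.mul_conj' (x i)).symm

/-- The defining function `1 - |x|²` of the ball. -/
def defFun (x : Cn n) : ℝ := 1 - ‖x‖ ^ 2

theorem contDiff_defFun {m : WithTop ℕ∞} : ContDiff ℝ m (defFun (n := n)) :=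
  contDiff_const.sub (contDiff_norm_sq ℝ)

theorem defFun_pos (hz : z ∈ unitBall n) : 0 < defFun z := by
  have : ‖z‖ < 1 := by simpa [unitBall] using hz
  unfold defFun
  nlinarith [norm_nonneg z]

theorem isOpen_unitBall : IsOpen (unitBall n) := Metric.isOpen_ball

theorem dz_defFun (j : Fin n) : dz j (fun x => (defFun x : ℂ)) z = -conj (z j) := by
  have h : (fun x : Cn n => (defFun x : ℂ)) = fun x => 1 + (-1) * ∑ i, x i * conj (x i) := by
    ext x; rw [← ofReal_norm_sq, defFun]; push_cast; ring
  have hd (i : Fin n) : DifferentiableAt ℝ (fun x : Cn n => x i) z :=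
    (differentiableAt_coord i).restrictScalars ℝ
  have hd2 (i : Fin n) := differentiableAt_conj_comp (hd i)
  have hd3 : DifferentiableAt ℝ (fun x : Cn n => ∑ i, x i * conj (x i)) z :=
    DifferentiableAt.fun_sum fun i _ => (hd i).mul (hd2 i)
  rw [h, dz_add (differentiableAt_const _) (hd3.const_mul _), dz_const, dz_const_mul hd3,
    dz_sum (u := fun i (x : Cn n) => x i * conj (x i)) _ fun i _ => (hd i).mul (hd2 i)]
  simp only [dz_mul (hd _) (hd2 _), dz_coord, dz_conj_coord]
  simp

theorem dzbar_defFun (j : Fin n) : dzbar j (fun x => (defFun x : ℂ)) z = -z j := by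
  rw [dzbar_ofReal ((contDiff_defFun (m := 1)).differentiable (by norm_num) z), dz_defFun]
  simp

theorem leviMatrix_defFun : leviMatrix (defFun (n := n)) z = -1 := by
  ext j k
  simp only [leviMatrix, Matrix.of_apply, Matrix.neg_apply, Matrix.one_apply]
  have : (dzbar k fun x : Cn n => (defFun x : ℂ)) = fun x => (-1) * x k := by
    ext x; rw [dzbar_defFun]; ring
  rw [this, dz_const_mul ((differentiableAt_coord k).restrictScalars ℝ), dz_coord]
  ring

theorem leviMatrix_log_defFun (hz : z ∈ unitBall n) (j k : Fin n) :
    leviMatrix (fun x => Real.log (defFun x)) z j k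
      = -(if j = k then 1 else 0) / defFun z - conj (z j) * z k / defFun z ^ 2 := by
  have hs := defFun_pos hz
  rw [leviMatrix_comp (g₁ := fun t => t⁻¹) (g₂ := -(defFun z ^ 2)⁻¹) contDiff_defFun.contDiffAt
    ?_ (hasDerivAt_inv hs.ne'), leviMatrix_defFun, dz_defFun, dzbar_defFun]
  · simp only [Matrix.neg_apply, Matrix.one_apply]
    push_cast
    have : (defFun z : ℂ) ≠ 0 := by exact_mod_cast hs.ne'
    field_simp
    ring
  · filter_upwards [lt_mem_nhds hs] with t ht using Real.hasDerivAt_log ht.ne'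

theorem contDiffAt_log_defFun (hz : z ∈ unitBall n) {m : WithTop ℕ∞} :
    ContDiffAt ℝ m (fun x : Cn n => Real.log (defFun x)) z :=
  contDiff_defFun.contDiffAt.log (defFun_pos hz).ne'

/-- `∑ (δ_{jk} - z_j z̄_k) ∂²φ/∂z_j∂z̄_k`. -/
def cLap (φ : Cn n → ℂ) (z : Cn n) : ℂ :=
  ∑ j, ∑ k, ((if j = k then 1 else 0) - z j * conj (z k)) * dz j (dzbar k φ) z

theorem bergmanMetric_apply (hz : z ∈ unitBall n) (j k : Fin n) :
    bergmanMetric z j k = (n + 1) * ((if j = k then 1 else 0) / defFun z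
      + conj (z j) * z k / defFun z ^ 2) := by
  have h : (fun x : Cn n => -((n : ℝ) + 1) * lam x) = fun x =>
      (fun t => -((n : ℝ) + 1) * (t - (n / (n + 1) : ℝ) * Real.log (n + 1)))
        (Real.log (defFun x)) := by
    ext x; rfl
  unfold bergmanMetric
  rw [h, leviMatrix_comp (u := fun x => Real.log (defFun x))
    (g := fun t => -((n : ℝ) + 1) * (t - (n / (n + 1) : ℝ) * Real.log (n + 1)))
    (g₁ := fun t => -((n : ℝ) + 1)) (g₂ := 0) (contDiffAt_log_defFun hz) ?_
    (hasDerivAt_const _ _), leviMatrix_log_defFun hz]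
  · push_cast; ring
  · refine Eventually.of_forall fun t => ?_
    simpa using ((hasDerivAt_id t).sub_const
      ((n / (n + 1) : ℝ) * Real.log (n + 1))).const_mul (-((n : ℝ) + 1))

/-- The metric is a multiple of the identity plus a rank-one matrix, so its inverse has the same
shape; the verification only uses `∑ |z_i|² = 1 - defFun z`. -/
theorem bergmanMetric_inv (hz : z ∈ unitBall n) : (bergmanMetric z)⁻¹ = Matrix.of fun j k =>
    (defFun z : ℂ) / (n + 1) * ((if j = k then 1 else 0) - conj (z j) * z k) := by
  apply Matrix.inv_eq_right_inv
  have hs : (defFun z : ℂ) ≠ 0 := by exact_mod_cast (defFun_pos hz).ne'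
  have hn : ((n : ℂ) + 1) ≠ 0 := by exact_mod_cast Nat.succ_ne_zero n
  have hsum : ∑ i, z i * conj (z i) = 1 - (defFun z : ℂ) := by
    rw [← ofReal_norm_sq, defFun]; push_cast; ring
  ext j k
  simp only [Matrix.mul_apply, bergmanMetric_apply hz, Matrix.of_apply, Matrix.one_apply]
  have e (i : Fin n) : ((n : ℂ) + 1) * ((if j = i then 1 else 0) / (defFun z : ℂ)
      + conj (z j) * z i / defFun z ^ 2) * ((defFun z : ℂ) / (n + 1)
        * ((if i = k then 1 else 0) - conj (z i) * z k))
      = (if j = i then (if i = k then 1 else 0) - conj (z i) * z k else 0)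
        + conj (z j) / defFun z * (if i = k then z i else 0)
        - conj (z j) * z k / defFun z * (z i * conj (z i)) := by
    split_ifs <;> field_simp <;> ring
  simp only [e, Finset.sum_add_distrib, Finset.sum_sub_distrib, ← Finset.mul_sum, hsum,
    Finset.sum_ite_eq, Finset.sum_ite_eq', Finset.mem_univ, if_true]
  field_simp
  split_ifs <;> ring

/-- The additive constant in `λ` is what produces the factor `(n+1)^n`; up to `2^n n!` the right
side is the determinant of the Bergman metric. -/
theorem bergmanDensity_eq (hz : z ∈ unitBall n) :
    bergmanDensity z = 2 ^ n * n.factorial * ((n : ℝ) + 1) ^ n * (defFun z ^ (n + 1))⁻¹ := by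
  have hs := defFun_pos hz
  have hn : (0 : ℝ) < (n : ℝ) + 1 := by positivity
  have : -((n : ℝ) + 1) * lam z = Real.log (((n : ℝ) + 1) ^ n * (defFun z ^ (n + 1))⁻¹) := by
    rw [Real.log_mul (by positivity) (by positivity), Real.log_inv, Real.log_pow, Real.log_pow]
    unfold lam defFun
    push_cast
    field_simp
    ring
  rw [bergmanDensity, this, Real.exp_log (by positivity)]
  ring

theorem bergmanDensity_pos (z : Cn n) : 0 < bergmanDensity z := by
  unfold bergmanDensity; positivity

theorem bergmanLaplacian_eq (hz : z ∈ unitBall n) (φ : Cn n → ℝ) :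
    bergmanLaplacian φ z = defFun z / (n * (n + 1)) * (cLap (fun x => (φ x : ℂ)) z).re := by
  unfold bergmanLaplacian
  have : (leviMatrix φ z * (bergmanMetric z)⁻¹).trace
      = ((defFun z / (n + 1) : ℝ) : ℂ) * cLap (fun x => (φ x : ℂ)) z := by
    rw [bergmanMetric_inv hz]
    simp only [Matrix.trace, Matrix.diag, Matrix.mul_apply, Matrix.of_apply, cLap,
      Finset.mul_sum, leviMatrix]
    refine Finset.sum_congr rfl fun j _ => Finset.sum_congr rfl fun k _ => ?_
    simp only [eq_comm (a := k) (b := j)]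
    push_cast
    ring
  rw [this, Complex.re_ofReal_mul]
  field_simp

/-- `Δ_B φ · ω_Bⁿ` as a density with respect to Lebesgue measure. -/
theorem bergmanLaplacian_mul_density (hz : z ∈ unitBall n) (φ : Cn n → ℝ) :
    bergmanLaplacian φ z * bergmanDensity z
      = 2 ^ n * n.factorial * ((n : ℝ) + 1) ^ n / (n * (n + 1)) *
        ((defFun z ^ n)⁻¹ * (cLap (fun x => (φ x : ℂ)) z).re) := by
  rw [bergmanLaplacian_eq hz, bergmanDensity_eq hz]
  have := (defFun_pos hz).ne'
  field_simp
  ring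

end Defining

end BergmanBall
end

noncomputable section
namespace BergmanBall

open scoped ComplexConjugate

/-! ### Symmetry of the Bergman Laplacian -/

section Symmetry

variable {n : ℕ} {z : Cn n}

/-- The coefficients `(1-|x|²)^{-n} (δ_{jk} - x_j x̄_k)` of `ω_B^{n-1}`, up to a constant. -/
def coeffA (x : Cn n) (j k : Fin n) : ℂ :=
  (((defFun x ^ n)⁻¹ : ℝ) : ℂ) * ((if j = k then 1 else 0) - x j * conj (x k))

theorem contDiffAt_coeffA (hz : z ∈ unitBall n) (j k : Fin n) {m : WithTop ℕ∞} :
    ContDiffAt ℝ m (fun x => coeffA x j k) z := by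
  unfold coeffA
  refine ContDiffAt.mul ?_ (contDiffAt_const.sub
    ((contDiff_coord j).contDiffAt.mul (contDiff_conj_coord k).contDiffAt))
  exact contDiffAt_ofReal_comp ((contDiff_defFun.contDiffAt.pow n).inv
    (pow_pos (defFun_pos hz) n).ne')

theorem conj_coeffA (x : Cn n) (j k : Fin n) : conj (coeffA x j k) = coeffA x k j := by
  simp only [coeffA, map_mul, map_sub, Complex.conj_ofReal, Complex.conj_conj]
  rw [mul_comm (conj (x j)), apply_ite conj, map_one, map_zero]
  simp only [eq_comm]

/-- This is the closedness of `ω_B^{n-1}` in coordinates. It removes all first-order terms from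
Green's identity and so makes the Laplacian symmetric. -/
theorem sum_dz_coeffA (hz : z ∈ unitBall n) (k : Fin n) :
    ∑ j, dz j (fun x => coeffA x j k) z = 0 := by
  have hs := defFun_pos hz
  have hsC : (defFun z : ℂ) ≠ 0 := by exact_mod_cast hs.ne'
  have hsum : ∑ i, conj (z i) * z i = 1 - (defFun z : ℂ) := by
    have := ofReal_norm_sq z
    simp only [mul_comm (conj (z _))]
    rw [← this, defFun]; push_cast; ring
  have hd (i : Fin n) : DifferentiableAt ℝ (fun x : Cn n => x i) z :=
    (differentiableAt_coord i).restrictScalars ℝ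
  have hd2 (i : Fin n) := differentiableAt_conj_comp (hd i)
  have hsd : DifferentiableAt ℝ (defFun (n := n)) z :=
    (contDiff_defFun (m := 1)).differentiable (by norm_num) z
  have hg : HasDerivAt (fun t : ℝ => (t ^ n)⁻¹) (-(n * defFun z ^ (n - 1)) / (defFun z ^ n) ^ 2)
      (defFun z) := (hasDerivAt_pow n (defFun z)).fun_inv (pow_pos hs n).ne'
  have e (j : Fin n) : dz j (fun x => coeffA x j k) z =
      (-(n * defFun z ^ (n - 1)) / (defFun z ^ n) ^ 2 : ℝ) * (-conj (z j)) *
        ((if j = k then 1 else 0) - z j * conj (z k))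
      - (((defFun z ^ n)⁻¹ : ℝ) : ℂ) * conj (z k) := by
    unfold coeffA
    have h1 : DifferentiableAt ℝ (fun x : Cn n => (((defFun x ^ n)⁻¹ : ℝ) : ℂ)) z :=
      differentiableAt_ofReal_comp (hg.differentiableAt.comp z hsd)
    have h2 : (fun x : Cn n => (if j = k then (1 : ℂ) else 0) - x j * conj (x k))
        = fun x => (if j = k then (1 : ℂ) else 0) + (-1) * (x j * conj (x k)) := by
      ext x; ring
    have h3 : DifferentiableAt ℝ (fun x : Cn n => x j * conj (x k)) z := (hd j).mul (hd2 k)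
    rw [dz_mul h1 ((differentiableAt_const _).fun_sub h3), dz_comp hsd hg, dz_defFun, h2,
      dz_add (differentiableAt_const _) (h3.const_mul _), dz_const, dz_const_mul h3,
      dz_mul (hd j) (hd2 k), dz_coord, dz_conj_coord]
    simp
    ring
  simp only [e, Finset.sum_sub_distrib, Finset.sum_const, Finset.card_univ, Fintype.card_fin]
  have e2 : ∑ x, ((-(n * defFun z ^ (n - 1)) / (defFun z ^ n) ^ 2 : ℝ) : ℂ) * (-conj (z x)) *
      ((if x = k then 1 else 0) - z x * conj (z k))
      = -((-(n * defFun z ^ (n - 1)) / (defFun z ^ n) ^ 2 : ℝ) : ℂ) *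
        (conj (z k) - conj (z k) * ∑ x, conj (z x) * z x) := by
    rw [mul_sub, Finset.mul_sum, Finset.mul_sum]
    have : conj (z k) = ∑ x, conj (z x) * (if x = k then 1 else 0) := by simp
    conv_rhs => rw [this]
    rw [Finset.mul_sum, ← Finset.sum_sub_distrib, ← this]
    exact Finset.sum_congr rfl fun x _ => by ring
  rw [e2, hsum]
  rcases Nat.eq_zero_or_pos n with h0 | hn
  · subst h0; exact k.elim0
  · obtain ⟨m, rfl⟩ := Nat.exists_eq_add_of_le' hn
    push_cast
    simp only [nsmul_eq_mul]
    push_cast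
    field_simp
    ring

theorem sum_dzbar_coeffA (hz : z ∈ unitBall n) (j : Fin n) :
    ∑ k, dzbar k (fun x => coeffA x j k) z = 0 := by
  have e (k : Fin n) : dzbar k (fun x => coeffA x j k) z
      = conj (dz k (fun x => coeffA x k j) z) := by
    rw [← dzbar_conj ((contDiffAt_coeffA hz k j (m := 1)).differentiableAt (by norm_num))]
    simp only [conj_coeffA]
  simp only [e, ← map_sum, sum_dz_coeffA hz, map_zero]

theorem sum_coeffA_dz_dzbar (u : Cn n → ℂ) :
    ∑ j, ∑ k, coeffA z j k * dz j (dzbar k u) z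
      = (((defFun z ^ n)⁻¹ : ℝ) : ℂ) * cLap u z := by
  simp only [cLap, coeffA, Finset.mul_sum, mul_assoc]

/-- Green's identity in divergence form. -/
theorem cLap_green (hz : z ∈ unitBall n) {u v : Cn n → ℂ} (hu : ContDiffAt ℝ ∞ u z)
    (hv : ContDiffAt ℝ ∞ v z) :
    (((defFun z ^ n)⁻¹ : ℝ) : ℂ) * (u z * cLap v z - v z * cLap u z) =
      ∑ j, dz j (fun x => ∑ k, coeffA x j k * (u x * dzbar k v x)) z
      - ∑ k, dzbar k (fun x => ∑ j, coeffA x j k * (v x * dz j u x)) z := by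
  have hA (j k : Fin n) : DifferentiableAt ℝ (fun x => coeffA x j k) z :=
    (contDiffAt_coeffA hz j k (m := 1)).differentiableAt (by norm_num)
  have hu1 : DifferentiableAt ℝ u z := hu.differentiableAt (by norm_num)
  have hv1 : DifferentiableAt ℝ v z := hv.differentiableAt (by norm_num)
  have hdv (k : Fin n) : DifferentiableAt ℝ (dzbar k v) z :=
    (contDiffAt_dzbar (m := 1) hv (by norm_cast) k).differentiableAt (by norm_num)
  have hdu (k : Fin n) : DifferentiableAt ℝ (dz k u) z :=
    (contDiffAt_dz (m := 1) hu (by norm_cast) k).differentiableAt (by norm_num)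
  have e1 (j : Fin n) : dz j (fun x => ∑ k, coeffA x j k * (u x * dzbar k v x)) z =
      ∑ k, (dz j (fun x => coeffA x j k) z * (u z * dzbar k v z) + coeffA z j k *
        (dz j u z * dzbar k v z + u z * dz j (dzbar k v) z)) := by
    rw [dz_sum (u := fun k x => coeffA x j k * (u x * dzbar k v x)) _
      fun k _ => (hA j k).mul (hu1.mul (hdv k))]
    refine Finset.sum_congr rfl fun k _ => ?_
    rw [dz_mul (hA j k) (hu1.fun_mul (hdv k)), dz_mul hu1 (hdv k)]
  have e2 (k : Fin n) : dzbar k (fun x => ∑ j, coeffA x j k * (v x * dz j u x)) z =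
      ∑ j, (dzbar k (fun x => coeffA x j k) z * (v z * dz j u z) + coeffA z j k *
        (dzbar k v z * dz j u z + v z * dz j (dzbar k u) z)) := by
    rw [dzbar_sum (u := fun j x => coeffA x j k * (v x * dz j u x)) _
      fun j _ => (hA j k).mul (hv1.mul (hdu j))]
    refine Finset.sum_congr rfl fun j _ => ?_
    rw [dzbar_mul (hA j k) (hv1.fun_mul (hdu j)), dzbar_mul hv1 (hdu j), dz_dzbar_comm hu]
  simp only [e1, e2, Finset.sum_add_distrib]
  rw [Finset.sum_comm (f := fun j k => dz j (fun x => coeffA x j k) z * (u z * dzbar k v z)),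
    Finset.sum_comm (f := fun k j => dzbar k (fun x => coeffA x j k) z * (v z * dz j u z)),
    Finset.sum_comm (f := fun k j => coeffA z j k *
      (dzbar k v z * dz j u z + v z * dz j (dzbar k u) z))]
  simp only [← Finset.sum_mul, sum_dz_coeffA hz, sum_dzbar_coeffA hz, zero_mul,
    Finset.sum_const_zero, zero_add]
  rw [mul_sub, mul_left_comm, mul_left_comm _ (v z), ← sum_coeffA_dz_dzbar, ← sum_coeffA_dz_dzbar]
  simp only [Finset.mul_sum, ← Finset.sum_sub_distrib]
  exact Finset.sum_congr rfl fun j _ => Finset.sum_congr rfl fun k _ => by ring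

theorem integral_fderiv_eq_zero {E F : Type*} [NormedAddCommGroup E] [NormedSpace ℝ E]
    [FiniteDimensional ℝ E] [MeasurableSpace E] [BorelSpace E] {μ : Measure E} [μ.IsAddHaarMeasure]
    [NormedAddCommGroup F] [NormedSpace ℝ F] {f : E → F} (hf : ContDiff ℝ 1 f)
    (hc : HasCompactSupport f) (v : E) : ∫ x, fderiv ℝ f x v ∂μ = 0 := by
  have h1 : Continuous fun x => fderiv ℝ f x v :=
    (hf.continuous_fderiv (by norm_num)).clm_apply continuous_const
  have h2 : HasCompactSupport fun x => fderiv ℝ f x v := hc.fderiv_apply (𝕜 := ℝ) v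
  have := integral_smul_fderiv_eq_neg_fderiv_smul_of_integrable (μ := μ) (f := fun _ : E => (1 : ℝ))
    (g := f) (v := v) (by simp) (by simpa using h1.integrable_of_hasCompactSupport h2)
    (by simpa using hf.continuous.integrable_of_hasCompactSupport hc) (by simp)
    (fun x _ => hf.differentiable (by norm_num) x)
  simpa using this

theorem integral_dz {f : Cn n → ℂ} (hf : ContDiff ℝ 1 f) (hc : HasCompactSupport f) (j : Fin n) :
    Integrable (dz j f) ∧ ∫ x, dz j f x = 0 := by
  have h1 (v : Cn n) : Integrable fun x => fderiv ℝ f x v :=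
    ((hf.continuous_fderiv (by norm_num)).clm_apply
      continuous_const).integrable_of_hasCompactSupport (hc.fderiv_apply (𝕜 := ℝ) v)
  refine ⟨((h1 _).sub ((h1 _).const_mul _)).const_mul _, ?_⟩
  unfold dz
  rw [integral_const_mul, integral_sub (h1 _) ((h1 _).const_mul _), integral_const_mul,
    integral_fderiv_eq_zero hf hc, integral_fderiv_eq_zero hf hc]
  simp

theorem integral_dzbar {f : Cn n → ℂ} (hf : ContDiff ℝ 1 f) (hc : HasCompactSupport f)
    (j : Fin n) : Integrable (dzbar j f) ∧ ∫ x, dzbar j f x = 0 := by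
  have h1 (v : Cn n) : Integrable fun x => fderiv ℝ f x v :=
    ((hf.continuous_fderiv (by norm_num)).clm_apply
      continuous_const).integrable_of_hasCompactSupport (hc.fderiv_apply (𝕜 := ℝ) v)
  refine ⟨((h1 _).add ((h1 _).const_mul _)).const_mul _, ?_⟩
  unfold dzbar
  rw [integral_const_mul, integral_add (h1 _) ((h1 _).const_mul _), integral_const_mul,
    integral_fderiv_eq_zero hf hc, integral_fderiv_eq_zero hf hc]
  simp

/-- The density of `dd^c φ ∧ ω_B^{n-1}` with respect to Lebesgue measure. -/
def lapDensity (φ : Cn n → ℝ) (z : Cn n) : ℝ := bergmanLaplacian φ z * bergmanDensity z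

theorem continuousAt_cLap {u : Cn n → ℂ} (hu : ContDiffAt ℝ ∞ u z) : ContinuousAt (cLap u) z := by
  refine tendsto_finsetSum _ fun j _ => tendsto_finsetSum _ fun k _ => ?_
  have h1 : ContinuousAt (dz j (dzbar k u)) z :=
    (contDiffAt_dz (m := 0) (contDiffAt_dzbar (m := 1) hu (by norm_cast) k)
      (by norm_num) j).continuousAt
  have h2 : ContinuousAt (fun x : Cn n => (if j = k then (1 : ℂ) else 0) - x j * conj (x k)) z :=
    (continuous_const.sub ((contDiff_coord j (m := 0)).continuous.mul
      (contDiff_conj_coord k (m := 0)).continuous)).continuousAt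
  exact h2.mul h1

theorem continuousAt_lapDensity {φ : Cn n → ℝ} (hz : z ∈ unitBall n) (hφ : ContDiffAt ℝ ∞ φ z) :
    ContinuousAt (lapDensity φ) z := by
  have h : lapDensity φ =ᶠ[𝓝 z] fun z => 2 ^ n * n.factorial * ((n : ℝ) + 1) ^ n / (n * (n + 1)) *
        ((defFun z ^ n)⁻¹ * (cLap (fun x => (φ x : ℂ)) z).re) := by
    filter_upwards [isOpen_unitBall.mem_nhds hz] with x hx using bergmanLaplacian_mul_density hx φ
  refine ContinuousAt.congr ?_ h.symm
  exact continuousAt_const.mul ((((contDiff_defFun (m := 0)).continuous.continuousAt.pow n).inv₀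
    (pow_pos (defFun_pos hz) n).ne').mul
      (Complex.continuous_re.continuousAt.comp (continuousAt_cLap (contDiffAt_ofReal_comp hφ))))

theorem lapDensity_congr {φ ψ : Cn n → ℝ} (h : φ =ᶠ[𝓝 z] ψ) : lapDensity φ z = lapDensity ψ z := by
  simp only [lapDensity, bergmanLaplacian, leviMatrix_congr h]

theorem lapDensity_const (c : ℝ) : lapDensity (fun _ : Cn n => c) z = 0 := by
  simp [lapDensity, bergmanLaplacian, leviMatrix_const]

theorem lapDensity_add {φ ψ : Cn n → ℝ} (hφ : ContDiffAt ℝ ∞ φ z) (hψ : ContDiffAt ℝ ∞ ψ z) :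
    lapDensity (fun x => φ x + ψ x) z = lapDensity φ z + lapDensity ψ z := by
  simp only [lapDensity, bergmanLaplacian, leviMatrix_add hφ hψ, add_mul, Matrix.trace_add,
    Complex.add_re]
  ring

theorem lapDensity_eq_zero {φ : Cn n → ℝ} (hz : z ∉ tsupport φ) : lapDensity φ z = 0 := by
  rw [lapDensity_congr (notMem_tsupport_iff_eventuallyEq.mp hz)]
  exact lapDensity_const 0

theorem integrableOn_of_zero_off {g : Cn n → ℝ} {K S : Set (Cn n)} (hK : IntegrableOn g K)
    (hS : MeasurableSet S) (h : ∀ x ∈ S, x ∉ K → g x = 0) : IntegrableOn g S :=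
  hK.of_forall_sdiff_eq_zero hS fun x hx => h x hx.1 hx.2

theorem IsTestFunction.integrable_mul_lapDensity {φ u : Cn n → ℝ} (hφ : IsTestFunction φ)
    (hu : LocallyIntegrableOn u (unitBall n)) :
    IntegrableOn (fun x => u x * lapDensity φ x) (unitBall n) := by
  have h1 : IntegrableOn u (tsupport φ) := hu.integrableOn_compact_subset hφ.2.2 hφ.2.1
  have h2 : ContinuousOn (lapDensity φ) (tsupport φ) := fun x hx =>
    (continuousAt_lapDensity (hφ.2.2 hx) hφ.1.contDiffAt).continuousWithinAt
  exact integrableOn_of_zero_off (h1.mul_continuousOn h2 hφ.2.1) isOpen_unitBall.measurableSet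
    fun x _ hx => by rw [lapDensity_eq_zero hx, mul_zero]

theorem IsTestFunction.integrable_mul {φ v : Cn n → ℝ} (hφ : IsTestFunction φ)
    (hv : LocallyIntegrableOn v (unitBall n)) :
    IntegrableOn (fun x => φ x * v x) (unitBall n) := by
  have h1 : IntegrableOn v (tsupport φ) := hv.integrableOn_compact_subset hφ.2.2 hφ.2.1
  exact integrableOn_of_zero_off (h1.continuousOn_mul hφ.1.continuous.continuousOn hφ.2.1)
    isOpen_unitBall.measurableSet
    fun x _ hx => by rw [image_eq_zero_of_notMem_tsupport hx, zero_mul]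

/-- The Bergman Laplacian is symmetric. -/
theorem integral_mul_lapDensity_comm {u φ : Cn n → ℝ} (hu : ∀ x ∈ unitBall n, ContDiffAt ℝ ∞ u x)
    (hφ : IsTestFunction φ) :
    ∫ x in unitBall n, u x * lapDensity φ x = ∫ x in unitBall n, φ x * lapDensity u x := by
  have hB := isOpen_unitBall (n := n)
  have i1 := hφ.integrable_mul_lapDensity
    (ContinuousOn.locallyIntegrableOn (fun x hx => (hu x hx).continuousAt.continuousWithinAt)
      hB.measurableSet)
  have i2 := hφ.integrable_mul (v := lapDensity u) (ContinuousOn.locallyIntegrableOn (fun x hx =>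
    (continuousAt_lapDensity hx (hu x hx)).continuousWithinAt) hB.measurableSet)
  rw [← sub_eq_zero, ← integral_sub i1 i2]
  set U : Cn n → ℂ := fun x => (u x : ℂ) with hU
  set Φ : Cn n → ℂ := fun x => (φ x : ℂ) with hΦ
  have hUd : ∀ x ∈ unitBall n, ContDiffAt ℝ ∞ U x := fun x hx => contDiffAt_ofReal_comp (hu x hx)
  have hΦd : ∀ x, ContDiffAt ℝ ∞ Φ x := fun x => contDiffAt_ofReal_comp hφ.1.contDiffAt
  have hΦ0 : ∀ x, x ∉ tsupport φ → Φ =ᶠ[𝓝 x] 0 := fun x hx => by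
    filter_upwards [notMem_tsupport_iff_eventuallyEq.mp hx] with y hy
    simp [hΦ, hy]
  set f : Fin n → Cn n → ℂ := fun j x => ∑ k, coeffA x j k * (U x * dzbar k Φ x) with hf
  set g : Fin n → Cn n → ℂ := fun k x => ∑ j, coeffA x j k * (Φ x * dz j U x) with hg
  -- `u` is smooth only on the ball, but every term carries a factor `φ` or a derivative of `φ`. The
  -- vector fields therefore extend by zero to compactly supported `C¹` fields on the whole space,
  -- whose divergences integrate to zero.
  have hfz : ∀ j x, x ∉ tsupport φ → f j =ᶠ[𝓝 x] 0 := fun j x hx => by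
    have h : ∀ᶠ y in 𝓝 x, ∀ k, dzbar k Φ y = 0 := by
      filter_upwards [(hΦ0 x hx).eventuallyEq_nhds] with y hy k
      rw [dzbar_congr hy]; exact dzbar_const 0 k
    filter_upwards [h] with y hy
    simp [hf, hy]
  have hgz : ∀ j x, x ∉ tsupport φ → g j =ᶠ[𝓝 x] 0 := fun j x hx => by
    filter_upwards [hΦ0 x hx] with y hy
    simp [hg, hy]
  have hfd : ∀ j, ContDiff ℝ 1 (f j) := fun j => contDiff_iff_contDiffAt.mpr fun x => by
    by_cases hx : x ∈ tsupport φ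
    · refine ContDiffAt.sum fun k _ => (contDiffAt_coeffA (hφ.2.2 hx) j k).mul
        (((hUd x (hφ.2.2 hx)).of_le (by norm_cast)).mul
          (contDiffAt_dzbar (hΦd x) (by norm_cast) k))
    · exact contDiffAt_const.congr_of_eventuallyEq (hfz j x hx)
  have hgd : ∀ j, ContDiff ℝ 1 (g j) := fun k => contDiff_iff_contDiffAt.mpr fun x => by
    by_cases hx : x ∈ tsupport φ
    · refine ContDiffAt.sum fun j _ => (contDiffAt_coeffA (hφ.2.2 hx) j k).mul
        (((hΦd x).of_le (by norm_cast)).mul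
          (contDiffAt_dz (hUd x (hφ.2.2 hx)) (by norm_cast) j))
    · exact contDiffAt_const.congr_of_eventuallyEq (hgz k x hx)
  have hfc : ∀ j, HasCompactSupport (f j) := fun j =>
    HasCompactSupport.intro hφ.2.1 fun x hx => (hfz j x hx).self_of_nhds
  have hgc : ∀ j, HasCompactSupport (g j) := fun j =>
    HasCompactSupport.intro hφ.2.1 fun x hx => (hgz j x hx).self_of_nhds
  set D : Cn n → ℂ := fun x => ∑ j, dz j (f j) x - ∑ k, dzbar k (g k) x with hD
  have hD0 : ∫ x, D x = 0 := by
    rw [hD, integral_sub (integrable_finsetSum _ fun j _ => (integral_dz (hfd j) (hfc j) j).1)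
      (integrable_finsetSum _ fun j _ => (integral_dzbar (hgd j) (hgc j) j).1),
      integral_finsetSum _ fun j _ => (integral_dz (hfd j) (hfc j) j).1,
      integral_finsetSum _ fun j _ => (integral_dzbar (hgd j) (hgc j) j).1]
    simp only [(integral_dz (hfd _) (hfc _) _).2, (integral_dzbar (hgd _) (hgc _) _).2]
    simp
  have hDi : Integrable D := (integrable_finsetSum _ fun j _ => (integral_dz (hfd j) (hfc j) j).1).sub
      (integrable_finsetSum _ fun j _ => (integral_dzbar (hgd j) (hgc j) j).1)
  set c : ℝ := 2 ^ n * n.factorial * ((n : ℝ) + 1) ^ n / (n * (n + 1)) with hc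
  have key : ∀ x ∈ unitBall n, u x * lapDensity φ x - φ x * lapDensity u x = c * (D x).re := by
    intro x hx
    have h : D x = _ := (cLap_green hx (hUd x hx) (hΦd x)).symm
    rw [h, Complex.re_ofReal_mul, lapDensity, lapDensity,
      bergmanLaplacian_mul_density hx, bergmanLaplacian_mul_density hx, Complex.sub_re, hU, hΦ]
    simp only [Complex.re_ofReal_mul]
    ring
  rw [setIntegral_congr_fun hB.measurableSet key, integral_const_mul,
    setIntegral_eq_integral_of_forall_compl_eq_zero]
  · have := integral_re hDi
    simp only [RCLike.re_to_complex] at this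
    rw [this, hD0]
    simp
  · intro x hx
    have hx' : x ∉ tsupport φ := fun h => hx (hφ.2.2 h)
    have e1 (j : Fin n) : dz j (f j) x = 0 := by
      rw [dz_congr (hfz j x hx')]; exact dz_const 0 j
    have e2 (j : Fin n) : dzbar j (g j) x = 0 := by
      rw [dzbar_congr (hgz j x hx')]; exact dzbar_const 0 j
    simp [hD, e1, e2]

end Symmetry

end BergmanBall
end

/-! ### Automorphisms of the ball and the invariance of `ω_B^n`. -/

noncomputable section
namespace BergmanBall

open scoped ComplexConjugate

/-! ### The involutions `F a` -/

section Involution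

variable {n : ℕ} {a x : Cn n}

theorem norm_lt_one (ha : a ∈ unitBall n) : ‖a‖ < 1 := by simpa [unitBall] using ha

theorem mem_unitBall_iff : a ∈ unitBall n ↔ ‖a‖ < 1 := by simp [unitBall]

theorem one_sub_inner_ne_zero (ha : ‖a‖ < 1) (hx : ‖x‖ ≤ 1) : 1 - inner ℂ a x ≠ 0 := by
  intro h
  have h1 : ‖inner ℂ a x‖ ≤ ‖a‖ * ‖x‖ := norm_inner_le_norm a x
  rw [← sub_eq_zero.mp h, norm_one] at h1
  nlinarith [norm_nonneg a, norm_nonneg x]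

/-- `h_a(x) = (1-|a|²)(1-|x|²)/|1-⟨x,a⟩|²`, which is `1 - |F_a(x)|²` on the ball. -/
def gap (a x : Cn n) : ℝ := defFun a * defFun x / ‖1 - inner ℂ a x‖ ^ 2

theorem gap_pos (ha : a ∈ unitBall n) (hx : x ∈ unitBall n) : 0 < gap a x := by
  have := one_sub_inner_ne_zero (norm_lt_one ha) (norm_lt_one hx).le
  have := defFun_pos ha
  have := defFun_pos hx
  unfold gap
  positivity

/-- In the splitting `x = αa + b` with `b ⊥ a` the involution acts by scalars on the two components,
so identities for `F_a` become identities in `α`, `|a|²` and `|b|²`. The case `a = 0` is included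
with `α = 0`. -/
theorem exists_orthogonal_decomp (a x : Cn n) :
    ∃ (α : ℂ) (b : Cn n), inner ℂ a b = 0 ∧ x = α • a + b := by
  by_cases ha : a = 0
  · exact ⟨0, x, by simp [ha], by simp⟩
  · have hna : (‖a‖ : ℂ) ≠ 0 := by exact_mod_cast norm_ne_zero_iff.mpr ha
    refine ⟨inner ℂ a x / (‖a‖ : ℂ) ^ 2, x - (inner ℂ a x / (‖a‖ : ℂ) ^ 2) • a, ?_, by simp⟩
    rw [inner_sub_right, inner_smul_right, inner_self_eq_norm_sq_to_K]
    simp only [Complex.coe_algebraMap]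
    field_simp
    ring

theorem inner_decomp {α : ℂ} {b : Cn n} (hb : inner ℂ a b = 0) :
    inner ℂ a (α • a + b) = α * (‖a‖ : ℂ) ^ 2 := by
  rw [inner_add_right, inner_smul_right, inner_self_eq_norm_sq_to_K, hb, add_zero]
  rfl

theorem norm_sq_decomp {α : ℂ} {b : Cn n} (hb : inner ℂ a b = 0) :
    ‖α • a + b‖ ^ 2 = ‖α‖ ^ 2 * ‖a‖ ^ 2 + ‖b‖ ^ 2 := by
  have := norm_add_sq_eq_norm_sq_add_norm_sq_of_inner_eq_zero (𝕜 := ℂ) (α • a) b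
    (by rw [inner_smul_left, hb, mul_zero])
  rw [norm_smul] at this
  linarith

theorem F_decomp {α : ℂ} {b : Cn n} (hb : inner ℂ a b = 0) :
    F a (α • a + b) = (1 - α * (‖a‖ : ℂ) ^ 2)⁻¹ •
      ((1 - α) • a + (-(Real.sqrt (1 - ‖a‖ ^ 2) : ℂ)) • b) := by
  unfold F
  simp only [inner_decomp hb]
  by_cases ha : a = 0
  · simp [ha]
  · have hna : (‖a‖ : ℂ) ≠ 0 := by exact_mod_cast norm_ne_zero_iff.mpr ha
    have : α * (‖a‖ : ℂ) ^ 2 / ((‖a‖ ^ 2 : ℝ) : ℂ) = α := by push_cast; field_simp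
    rw [this]
    congr 1
    module

/-- Everything radial below is expressed through `1 - gap a x`, which avoids the square root and the
division by `|a|²` in the definition of `F`. -/
theorem norm_F_sq (ha : ‖a‖ < 1) (hx : ‖x‖ ≤ 1) : ‖F a x‖ ^ 2 = 1 - gap a x := by
  obtain ⟨α, b, hb, rfl⟩ := exists_orthogonal_decomp a x
  have hq := one_sub_inner_ne_zero ha hx
  rw [F_decomp hb, gap, defFun, defFun, norm_sq_decomp hb, inner_decomp hb, norm_smul, mul_pow,
    norm_sq_decomp (by rw [inner_smul_right, hb, mul_zero])]
  rw [inner_decomp hb] at hq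
  have hq' : ‖1 - α * (‖a‖ : ℂ) ^ 2‖ ≠ 0 := norm_ne_zero_iff.mpr hq
  rw [norm_inv, norm_smul, mul_pow, norm_neg, Complex.norm_real, Real.norm_eq_abs, sq_abs,
    Real.sq_sqrt (by nlinarith [norm_nonneg a])]
  field_simp
  have e1 : ‖1 - α * (‖a‖ : ℂ) ^ 2‖ ^ 2 = (1 - α.re * ‖a‖ ^ 2) ^ 2 + (α.im * ‖a‖ ^ 2) ^ 2 := by
    rw [← Complex.normSq_eq_norm_sq, Complex.normSq_apply]
    have : (‖a‖ : ℂ) ^ 2 = ((‖a‖ ^ 2 : ℝ) : ℂ) := by push_cast; rfl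
    rw [this]
    simp only [Complex.sub_re, Complex.sub_im, Complex.re_mul_ofReal, Complex.im_mul_ofReal,
      Complex.one_re, Complex.one_im]
    ring
  have e2 : ‖1 - α‖ ^ 2 = (1 - α.re) ^ 2 + α.im ^ 2 := by
    rw [← Complex.normSq_eq_norm_sq, Complex.normSq_apply]
    simp; ring
  have e3 : ‖α‖ ^ 2 = α.re ^ 2 + α.im ^ 2 := by
    rw [← Complex.normSq_eq_norm_sq, Complex.normSq_apply]; ring
  rw [e1, e2, e3]
  ring

theorem F_mem_unitBall (ha : a ∈ unitBall n) (hx : x ∈ unitBall n) : F a x ∈ unitBall n := by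
  rw [mem_unitBall_iff]
  have h1 := norm_F_sq (norm_lt_one ha) (norm_lt_one hx).le
  have h2 := gap_pos ha hx
  nlinarith [norm_nonneg (F a x)]

theorem F_F (ha : ‖a‖ < 1) (hx : ‖x‖ ≤ 1) : F a (F a x) = x := by
  obtain ⟨α, b, hb, rfl⟩ := exists_orthogonal_decomp a x
  have hq := one_sub_inner_ne_zero ha hx
  rw [inner_decomp hb] at hq
  have hs : (0 : ℝ) < 1 - ‖a‖ ^ 2 := by nlinarith [norm_nonneg a]
  have hsC : (1 : ℂ) - (‖a‖ : ℂ) ^ 2 ≠ 0 := by exact_mod_cast hs.ne'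
  set s : ℂ := (Real.sqrt (1 - ‖a‖ ^ 2) : ℂ) with hs'
  have hss : s ^ 2 = 1 - (‖a‖ : ℂ) ^ 2 := by
    rw [hs']; exact_mod_cast Real.sq_sqrt hs.le
  set q := 1 - α * (‖a‖ : ℂ) ^ 2 with hqdef
  have e : F a (α • a + b) = (q⁻¹ * (1 - α)) • a + (q⁻¹ * (-s)) • b := by
    rw [F_decomp hb, smul_add, smul_smul, smul_smul]
  have hb2 : inner ℂ a ((q⁻¹ * (-s)) • b) = 0 := by rw [inner_smul_right, hb, mul_zero]
  rw [e, F_decomp hb2, smul_add, smul_smul, smul_smul, smul_smul, ← hs']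
  have h1 : 1 - q⁻¹ * (1 - α) * (‖a‖ : ℂ) ^ 2 = (1 - (‖a‖ : ℂ) ^ 2) / q := by
    rw [hqdef] at hq ⊢
    field_simp
    ring
  rw [h1]
  congr 1
  · congr 1
    rw [inv_div, div_mul_eq_mul_div, div_eq_iff hsC]
    field_simp
    rw [hqdef]; ring
  · convert one_smul ℂ b using 2
    rw [inv_div]
    field_simp
    linear_combination hss

theorem F_injOn (ha : a ∈ unitBall n) : InjOn (F a) (unitBall n) := fun x hx y hy h => by
  rw [← F_F (norm_lt_one ha) (norm_lt_one hx).le, h, F_F (norm_lt_one ha) (norm_lt_one hy).le]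

theorem F_image_ball (ha : a ∈ unitBall n) {r : ℝ} (hr : r ≤ 1) :
    F a '' Metric.ball 0 r = bgBall a r := by
  ext x
  constructor
  · rintro ⟨y, hy, rfl⟩
    have hy' : y ∈ unitBall n := Metric.ball_subset_ball hr hy
    refine ⟨F_mem_unitBall ha hy', ?_⟩
    rw [F_F (norm_lt_one ha) (norm_lt_one hy').le]
    simpa using hy
  · rintro ⟨hx, hx2⟩
    exact ⟨F a x, by simpa using hx2, F_F (norm_lt_one ha) (norm_lt_one hx).le⟩

theorem F_eq_zero_iff (ha : a ∈ unitBall n) (hx : x ∈ unitBall n) : F a x = 0 ↔ x = a := by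
  have h0 : F a a = 0 := by
    have := F_decomp (a := a) (α := 1) (b := 0) (by simp)
    simpa using this
  exact ⟨fun h => F_injOn ha hx ha (h.trans h0.symm), fun h => h ▸ h0⟩

/-- The complex derivative of `F a`. -/
def Fderiv (a x : Cn n) : Cn n →L[ℂ] Cn n :=
  (-(Real.sqrt (1 - ‖a‖ ^ 2) : ℂ) * (1 - inner ℂ a x)⁻¹) • ContinuousLinearMap.id ℂ (Cn n)
    + (innerSL ℂ a).smulRight
      ((((Real.sqrt (1 - ‖a‖ ^ 2) : ℂ) - 1) / ((‖a‖ ^ 2 : ℝ) : ℂ) * (1 - inner ℂ a x)⁻¹) • a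
        + (1 - inner ℂ a x)⁻¹ • F a x)

theorem hasFDerivAt_F (hx : 1 - inner ℂ a x ≠ 0) : HasFDerivAt (F a) (Fderiv a x) x := by
  have h1 : HasFDerivAt (fun y => inner ℂ a y) (innerSL ℂ a) x := (innerSL ℂ a).hasFDerivAt
  have h2 : HasFDerivAt (fun y => (1 - inner ℂ a y)⁻¹)
      ((-((1 - inner ℂ a x) ^ 2)⁻¹) • (-(innerSL ℂ a))) x :=
    (hasDerivAt_inv hx).comp_hasFDerivAt x (h1.const_sub 1)
  have h3 : HasFDerivAt (fun y => (inner ℂ a y / ((‖a‖ ^ 2 : ℝ) : ℂ)) • a)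
      ((((‖a‖ ^ 2 : ℝ) : ℂ)⁻¹ • innerSL ℂ a).smulRight a) x := by
    simp only [div_eq_inv_mul]
    exact (h1.const_mul _).smul_const a
  have h4 := h2.smul ((h3.const_sub a).sub (((hasFDerivAt_id x).sub h3).const_smul
    (Real.sqrt (1 - ‖a‖ ^ 2) : ℂ)))
  refine h4.congr_fderiv ?_
  ext1 v
  simp only [Fderiv, F, id_eq, Pi.sub_apply, Pi.smul_apply]
  set s : ℂ := (Real.sqrt (1 - ‖a‖ ^ 2) : ℂ)
  set q := (1 - inner ℂ a x)⁻¹ with hq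
  have : ((1 - inner ℂ a x) ^ 2)⁻¹ = q * q := by rw [hq, ← mul_inv, sq]
  rw [this]
  simp only [add_apply, smul_apply, ContinuousLinearMap.smulRight_apply, ContinuousLinearMap.id_apply, sub_apply,
    neg_apply, innerSL_apply_apply, smul_eq_mul, div_eq_inv_mul]
  module

/-- With `s = √(1-|a|²)` and `q = 1 - ⟨x,a⟩`, the derivative is `-s/q` times a transvection. The
determinant of a transvection is one plus the value of its functional on its vector, which here
changes one factor `-s/q` into `-s²/q²`. So `det = (-s/q)^{n-1}(-s²/q²)`, and its squared modulus
has exponent `(n-1) + 2 = n+1`. -/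
theorem norm_det_Fderiv (hn : 1 ≤ n) (ha : ‖a‖ < 1) (hx : ‖x‖ ≤ 1) :
    ‖(Fderiv a x).det‖ ^ 2 = (defFun a / ‖1 - inner ℂ a x‖ ^ 2) ^ (n + 1) := by
  have hq := one_sub_inner_ne_zero ha hx
  have hs : (0 : ℝ) < 1 - ‖a‖ ^ 2 := by nlinarith [norm_nonneg a]
  have hs0 : Real.sqrt (1 - ‖a‖ ^ 2) ≠ 0 := (Real.sqrt_pos.mpr hs).ne'
  set s : ℂ := (Real.sqrt (1 - ‖a‖ ^ 2) : ℂ) with hs'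
  have hsC : s ≠ 0 := by rw [hs']; exact_mod_cast hs0
  have hss : s ^ 2 = 1 - (‖a‖ : ℂ) ^ 2 := by
    rw [hs']; exact_mod_cast Real.sq_sqrt hs.le
  set q := 1 - inner ℂ a x with hqdef
  set w : Cn n := ((s - 1) / ((‖a‖ ^ 2 : ℝ) : ℂ) * q⁻¹) • a + q⁻¹ • F a x with hw
  have hc : -s * q⁻¹ ≠ 0 := mul_ne_zero (neg_ne_zero.mpr hsC) (inv_ne_zero hq)
  have e1 : ((Fderiv a x : Cn n →L[ℂ] Cn n) : Cn n →ₗ[ℂ] Cn n) = (-s * q⁻¹) •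
      LinearMap.transvection ((innerSL ℂ a : Cn n →L[ℂ] ℂ) : Cn n →ₗ[ℂ] ℂ) ((-s * q⁻¹)⁻¹ • w) := by
    ext1 v
    simp only [Fderiv, ← hs', ← hqdef, ← hw, LinearMap.smul_apply, LinearMap.transvection.apply,
      ContinuousLinearMap.coe_coe, add_apply, smul_apply, ContinuousLinearMap.id_apply,
      ContinuousLinearMap.smulRight_apply, smul_add]
    congr 1
    rw [smul_smul, smul_smul, mul_right_comm, mul_inv_cancel₀ hc, one_mul]
  have e2 : inner ℂ a (F a x) = ((‖a‖ : ℂ) ^ 2 - inner ℂ a x) * q⁻¹ := by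
    obtain ⟨α, b, hb, hxe⟩ := exists_orthogonal_decomp a x
    have hi : inner ℂ a x = α * (‖a‖ : ℂ) ^ 2 := by rw [hxe, inner_decomp hb]
    rw [hqdef, hi, hxe, F_decomp hb, inner_smul_right, inner_decomp (by rw [inner_smul_right, hb, mul_zero])]
    ring
  have e3 : inner ℂ a w = -(s ^ 2) * (q⁻¹) ^ 2 - (-s * q⁻¹) := by
    rw [hw, inner_add_right, inner_smul_right, inner_smul_right, e2, inner_self_eq_norm_sq_to_K]
    by_cases ha0 : a = 0
    · have : s = 1 := by rw [hs']; simp [ha0]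
      rw [this, hqdef]
      simp [ha0]
    · have hna : (‖a‖ : ℂ) ≠ 0 := by exact_mod_cast norm_ne_zero_iff.mpr ha0
      have hix : inner ℂ a x = 1 - q := by rw [hqdef]; ring
      rw [hix, hss]
      simp only [Complex.coe_algebraMap]
      push_cast
      field_simp
      ring
  have e4 : (Fderiv a x).det = (-s * q⁻¹) ^ (n - 1) * (-(s ^ 2) * (q⁻¹) ^ 2) := by
    rw [ContinuousLinearMap.det, e1, LinearMap.det_smul, LinearMap.transvection.det, finrank_euclideanSpace_fin]
    obtain ⟨m, rfl⟩ := Nat.exists_eq_add_of_le' hn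
    have : ((innerSL ℂ a : Cn (m + 1) →L[ℂ] ℂ) : Cn (m + 1) →ₗ[ℂ] ℂ) ((-s * q⁻¹)⁻¹ • w)
        = (-s * q⁻¹)⁻¹ * inner ℂ a w := by
      rw [map_smul, smul_eq_mul]; rfl
    rw [this, e3, Nat.add_sub_cancel, pow_succ]
    field_simp
    ring
  obtain ⟨m, rfl⟩ := Nat.exists_eq_add_of_le' hn
  have e5 : ‖s‖ ^ 2 = defFun a := by
    rw [hs', Complex.norm_real, Real.norm_eq_abs, sq_abs, Real.sq_sqrt hs.le, defFun]
  rw [e4]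
  simp only [norm_mul, norm_pow, norm_neg, norm_inv, Nat.add_sub_cancel]
  rw [← e5, div_eq_mul_inv, ← inv_pow]
  ring

theorem abs_det_restrictScalars (f : Cn n →L[ℂ] Cn n) :
    |(f.restrictScalars ℝ).det| = ‖f.det‖ ^ 2 := by
  have : (f.restrictScalars ℝ).det = Algebra.norm ℝ f.det := by
    rw [ContinuousLinearMap.det, ContinuousLinearMap.det, ← LinearMap.det_restrictScalars]
    rfl
  rw [this, Algebra.norm_complex_apply, Complex.normSq_eq_norm_sq, abs_of_nonneg (by positivity)]

theorem abs_det_mul_bergmanDensity (hn : 1 ≤ n) (ha : a ∈ unitBall n) (hx : x ∈ unitBall n) :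
    |((Fderiv a x).restrictScalars ℝ).det| * bergmanDensity (F a x) = bergmanDensity x := by
  rw [abs_det_restrictScalars, norm_det_Fderiv hn (norm_lt_one ha) (norm_lt_one hx).le,
    bergmanDensity_eq hx, bergmanDensity_eq (F_mem_unitBall ha hx)]
  have h1 : defFun (F a x) = defFun a / ‖1 - inner ℂ a x‖ ^ 2 * defFun x := by
    rw [defFun, norm_F_sq (norm_lt_one ha) (norm_lt_one hx).le, gap]; ring
  have h2 := defFun_pos ha
  have h3 := defFun_pos hx
  have h4 : 0 < ‖1 - inner ℂ a x‖ :=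
    norm_pos_iff.mpr (one_sub_inner_ne_zero (norm_lt_one ha) (norm_lt_one hx).le)
  rw [h1, mul_pow]
  field_simp

/-- The measure `ω_Bⁿ` is invariant under the involutions. -/
theorem setIntegral_image_F (hn : 1 ≤ n) (ha : a ∈ unitBall n) {S : Set (Cn n)}
    (hS : MeasurableSet S) (hSB : S ⊆ unitBall n) (g : Cn n → ℝ) :
    ∫ x in F a '' S, g x * bergmanDensity x = ∫ x in S, g (F a x) * bergmanDensity x := by
  rw [integral_image_eq_integral_abs_det_fderiv_smul volume hS
    (f' := fun x => (Fderiv a x).restrictScalars ℝ) (fun x hx =>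
      ((hasFDerivAt_F (one_sub_inner_ne_zero (norm_lt_one ha)
        (norm_lt_one (hSB hx)).le)).restrictScalars ℝ).hasFDerivWithinAt) ((F_injOn ha).mono hSB)]
  refine setIntegral_congr_fun hS fun x hx => ?_
  simp only [smul_eq_mul]
  rw [← abs_det_mul_bergmanDensity hn ha (hSB hx)]
  ring

theorem integrableOn_image_F (hn : 1 ≤ n) (ha : a ∈ unitBall n) {S : Set (Cn n)}
    (hS : MeasurableSet S) (hSB : S ⊆ unitBall n) (g : Cn n → ℝ) :
    IntegrableOn (fun x => g x * bergmanDensity x) (F a '' S) ↔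
      IntegrableOn (fun x => g (F a x) * bergmanDensity x) S := by
  rw [integrableOn_image_iff_integrableOn_abs_det_fderiv_smul volume hS
    (f' := fun x => (Fderiv a x).restrictScalars ℝ) (fun x hx =>
      ((hasFDerivAt_F (one_sub_inner_ne_zero (norm_lt_one ha)
        (norm_lt_one (hSB hx)).le)).restrictScalars ℝ).hasFDerivWithinAt) ((F_injOn ha).mono hSB)]
  refine integrableOn_congr_fun (fun x hx => ?_) hS
  simp only [smul_eq_mul]
  rw [← abs_det_mul_bergmanDensity hn ha (hSB hx)]
  ring

end Involution

/-! ### Radial integrals -/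

section Radial

variable {n : ℕ}

/-- The volume of the ball of radius `√t` relative to that of radius `r`. -/
def relVol (n : ℕ) (r t : ℝ) : ℝ := ((t / (1 - t)) / (r ^ 2 / (1 - r ^ 2))) ^ n

/-- The factor `t^{n-1}(1-t)^{-(n+1)}` is the radial density of `ω_B^n` in the variable `t = |x|²`.
In the coordinate `relVol` the invariant volume is thus a multiple of Lebesgue measure on the line.
-/
theorem hasDerivAt_relVol {r t : ℝ} (ht : t ≠ 1) : HasDerivAt (relVol n r)
    (n * (t ^ (n - 1) * ((1 - t) ^ (n + 1))⁻¹) / (r ^ 2 / (1 - r ^ 2)) ^ n) t := by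
  unfold relVol
  generalize r ^ 2 / (1 - r ^ 2) = R
  have h1 : (1 : ℝ) - t ≠ 0 := sub_ne_zero.mpr ht.symm
  have h0 : HasDerivAt (fun t : ℝ => t / (1 - t)) (((1 - t) ^ 2)⁻¹) t := by
    refine ((hasDerivAt_id t).div ((hasDerivAt_id t).const_sub 1) h1).congr_deriv ?_
    simp only [id]
    field_simp
    ring
  refine ((h0.div_const R).fun_pow n).congr_deriv ?_
  rcases Nat.eq_zero_or_pos n with rfl | hn
  · simp
  · obtain ⟨m, rfl⟩ := Nat.exists_eq_add_of_le' hn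
    simp only [Nat.add_sub_cancel, div_eq_mul_inv, mul_pow, ← inv_pow]
    ring

theorem finrank_Cn : Module.finrank ℝ (Cn n) = 2 * n := by
  rw [← Module.finrank_mul_finrank ℝ ℂ (Cn n), Complex.finrank_real_complex,
    finrank_euclideanSpace_fin]

/-- Integrals over `B(0,ρ)` of functions of the relative volume. -/
theorem integral_ball_relVol (hn : 1 ≤ n) {r ρ : ℝ} (hr0 : 0 < r) (hr1 : r < 1) (hρ0 : 0 < ρ)
    (hρ1 : ρ < 1) {H h : ℝ → ℝ} (hH : ∀ y, HasDerivAt H (h y) y) (hh : Continuous h) :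
    ∫ x in Metric.ball (0 : Cn n) ρ, h (relVol n r (‖x‖ ^ 2)) * bergmanDensity x
      = (2 * Real.pi) ^ n * ((n : ℝ) + 1) ^ n * (r ^ 2 / (1 - r ^ 2)) ^ n *
        (H (relVol n r (ρ ^ 2)) - H 0) := by
  have : Nonempty (Fin n) := ⟨⟨0, hn⟩⟩
  have hr2 : 0 < 1 - r ^ 2 := by nlinarith
  set c : ℝ := 2 ^ n * n.factorial * ((n : ℝ) + 1) ^ n with hc
  set f : ℝ → ℝ := (Iio ρ).indicator
    fun y => h (relVol n r (y ^ 2)) * (c * ((1 - y ^ 2) ^ (n + 1))⁻¹) with hf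
  have e1 : ∫ x in Metric.ball (0 : Cn n) ρ, h (relVol n r (‖x‖ ^ 2)) * bergmanDensity x
      = ∫ x : Cn n, f ‖x‖ := by
    rw [← integral_indicator measurableSet_ball]
    congr 1
    ext x
    by_cases hx : ‖x‖ < ρ
    · have hxB : x ∈ unitBall n := mem_unitBall_iff.mpr (hx.trans hρ1)
      rw [indicator_of_mem (by simpa using hx), hf, indicator_of_mem (by simpa using hx),
        bergmanDensity_eq hxB]
      rfl
    · rw [indicator_of_notMem (by simpa using hx), hf, indicator_of_notMem (by simpa using hx)]
  have e2 : (volume : Measure (Cn n)).real (Metric.ball 0 1) = Real.pi ^ n / n.factorial := by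
    rw [Measure.real, InnerProductSpace.volume_ball_of_dim_even finrank_Cn]
    simp only [ENNReal.ofReal_one, one_pow, one_mul]
    exact ENNReal.toReal_ofReal (by positivity)
  have e3 : ∫ y in Ioi (0 : ℝ), y ^ (2 * n - 1) • f y = c * (r ^ 2 / (1 - r ^ 2)) ^ n / (2 * n) *
      (H (relVol n r (ρ ^ 2)) - H 0) := by
    have i1 : ∫ y in Ioi (0 : ℝ), y ^ (2 * n - 1) • f y = ∫ y in (0 : ℝ)..ρ, y ^ (2 * n - 1) *
        (h (relVol n r (y ^ 2)) * (c * ((1 - y ^ 2) ^ (n + 1))⁻¹)) := by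
      rw [intervalIntegral.integral_of_le hρ0.le, integral_Ioc_eq_integral_Ioo,
        ← Ioi_inter_Iio, ← Measure.restrict_restrict_of_subset (t := Ioi (0 : ℝ)) inter_subset_left,
        inter_comm, ← Measure.restrict_restrict measurableSet_Iio,
        Measure.restrict_restrict_of_subset (Subset.refl (Ioi (0 : ℝ))),
        ← integral_indicator (μ := volume.restrict (Ioi 0)) measurableSet_Iio]
      congr 1
      ext y
      by_cases hy : y < ρ <;> simp [hf, hy]
    rw [i1]
    -- The polar weight `y^{2n-1}(1-y²)^{-(n+1)}` is, up to a constant, the derivative of `y ↦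
    -- relVol n r (y²)`, so the integrand is an exact derivative.
    have hd : ∀ y ∈ uIcc 0 ρ, HasDerivAt (fun y => c * (r ^ 2 / (1 - r ^ 2)) ^ n / (2 * n) *
        H (relVol n r (y ^ 2))) (y ^ (2 * n - 1) *
        (h (relVol n r (y ^ 2)) * (c * ((1 - y ^ 2) ^ (n + 1))⁻¹))) y := by
      intro y hy
      rw [uIcc_of_le hρ0.le] at hy
      have hy1 : y ^ 2 < 1 := by nlinarith [hy.1, hy.2]
      have d0 : HasDerivAt (fun y : ℝ => y ^ 2) (2 * y) y := by simpa using hasDerivAt_pow 2 y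
      have d1 : HasDerivAt (fun y => relVol n r (y ^ 2)) _ y :=
        HasDerivAt.comp (h := fun y : ℝ => y ^ 2) y
          (hasDerivAt_relVol (n := n) (r := r) (t := y ^ 2) hy1.ne) d0
      have d2 : HasDerivAt (fun y => H (relVol n r (y ^ 2))) _ y :=
        (hH (relVol n r (y ^ 2))).comp y d1
      refine (d2.const_mul (c * (r ^ 2 / (1 - r ^ 2)) ^ n / (2 * n))).congr_deriv ?_
      generalize h (relVol n r (y ^ 2)) = A
      have h3 : 1 - y ^ 2 ≠ 0 := by linarith
      obtain ⟨m, rfl⟩ := Nat.exists_eq_add_of_le' hn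
      have hR : (r ^ 2 / (1 - r ^ 2)) ^ (m + 1) ≠ 0 := by positivity
      generalize (r ^ 2 / (1 - r ^ 2)) ^ (m + 1) = B at hR ⊢
      have hm : ((m + 1 : ℕ) : ℝ) ≠ 0 := by positivity
      have : 2 * (m + 1) - 1 = 2 * m + 1 := by omega
      rw [this, Nat.add_sub_cancel]
      generalize ((1 - y ^ 2) ^ (m + 1 + 1))⁻¹ = D
      field_simp
      ring
    rw [intervalIntegral.integral_eq_sub_of_hasDerivAt hd]
    · have : relVol n r (0 ^ 2) = 0 := by simp [relVol]; omega
      rw [this]; ring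
    · apply ContinuousOn.intervalIntegrable
      have hne : ∀ y ∈ uIcc 0 ρ, 1 - y ^ 2 ≠ 0 := by
        intro y hy
        rw [uIcc_of_le hρ0.le] at hy
        nlinarith [hy.1, hy.2]
      refine (continuous_pow _).continuousOn.mul (ContinuousOn.mul (hh.comp_continuousOn ?_)
        (continuousOn_const.mul (ContinuousOn.inv₀ (by fun_prop) fun y hy =>
          pow_ne_zero _ (hne y hy))))
      unfold relVol
      exact ((ContinuousOn.div (by fun_prop) (by fun_prop) hne).div_const _).pow n
  rw [e1, integral_fun_norm_addHaar, finrank_Cn, e2, e3, hc]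
  simp only [nsmul_eq_mul, smul_eq_mul]
  have : (n : ℝ) ≠ 0 := by positivity
  push_cast
  field_simp
  ring

theorem V_eq (hn : 1 ≤ n) {r : ℝ} (hr0 : 0 < r) (hr1 : r < 1) :
    V n r = (2 * Real.pi) ^ n * ((n : ℝ) + 1) ^ n * (r ^ 2 / (1 - r ^ 2)) ^ n := by
  have h := integral_ball_relVol hn hr0 hr1 hr0 hr1 (H := id) (h := fun _ => 1)
    (fun y => hasDerivAt_id y) continuous_const
  have hr2 : 0 < 1 - r ^ 2 := by nlinarith
  have : relVol n r (r ^ 2) = 1 := by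
    rw [relVol, div_self (by positivity), one_pow]
  simpa [V, this] using h

theorem V_pos (hn : 1 ≤ n) {r : ℝ} (hr0 : 0 < r) (hr1 : r < 1) : 0 < V n r := by
  have hr2 : 0 < 1 - r ^ 2 := by nlinarith
  rw [V_eq hn hr0 hr1]
  positivity

end Radial

end BergmanBall
end

/-! ### Radial functions: their Laplacian, and potentials with prescribed mass. -/

noncomputable section
namespace BergmanBall

open scoped ComplexConjugate

/-! ### Levi matrices of logarithms of holomorphic functions -/

section LogHolomorphic

variable {n : ℕ} {z : Cn n} {T : Cn n → ℂ}

theorem ofReal_normSq_add (w : ℂ) (ε : ℝ) : ((‖w‖ ^ 2 + ε : ℝ) : ℂ) = w * conj w + ε := by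
  push_cast
  rw [Complex.mul_conj']

theorem contDiffAt_normSq_add {m : WithTop ℕ∞} (hT : ContDiffAt ℝ m T z) (ε : ℝ) :
    ContDiffAt ℝ m (fun x => ‖T x‖ ^ 2 + ε) z :=
  (hT.norm_sq ℝ).add contDiffAt_const

theorem dz_normSq_add (hT : DifferentiableAt ℂ T z) (ε : ℝ) (j : Fin n) :
    dz j (fun x => ((‖T x‖ ^ 2 + ε : ℝ) : ℂ)) z = dz j T z * conj (T z) := by
  have h1 := hT.restrictScalars ℝ
  have h2 := differentiableAt_conj_comp h1
  simp only [ofReal_normSq_add]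
  rw [dz_add (h1.fun_mul h2) (differentiableAt_const _), dz_const, dz_mul h1 h2, dz_conj h1,
    dzbar_holomorphic hT]
  simp

theorem dzbar_normSq_add (hT : DifferentiableAt ℂ T z) (ε : ℝ) (j : Fin n) :
    dzbar j (fun x => ((‖T x‖ ^ 2 + ε : ℝ) : ℂ)) z = T z * conj (dz j T z) := by
  have h1 := hT.restrictScalars ℝ
  have h2 := differentiableAt_conj_comp h1
  simp only [ofReal_normSq_add]
  rw [dzbar_add (h1.fun_mul h2) (differentiableAt_const _), dzbar_const, dzbar_mul h1 h2,
    dzbar_conj h1, dzbar_holomorphic hT]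
  simp

theorem leviMatrix_normSq_add (hT : ∀ᶠ x in 𝓝 z, DifferentiableAt ℂ T x)
    (hTs : ContDiffAt ℝ ∞ T z) (ε : ℝ) (j k : Fin n) :
    leviMatrix (fun x => ‖T x‖ ^ 2 + ε) z j k = dz j T z * conj (dz k T z) := by
  simp only [leviMatrix, Matrix.of_apply]
  have h1 : (dzbar k fun x => ((‖T x‖ ^ 2 + ε : ℝ) : ℂ)) =ᶠ[𝓝 z] fun x => T x * conj (dz k T x) := by
    filter_upwards [hT] with x hx using dzbar_normSq_add hx ε k
  have h2 : DifferentiableAt ℝ (dz k T) z :=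
    (contDiffAt_dz (m := 1) hTs (by norm_cast) k).differentiableAt (by norm_num)
  have h3 : dzbar j (dz k T) z = 0 := by
    rw [← dz_dzbar_comm hTs, dz_congr (v := fun _ => 0), dz_const]
    filter_upwards [hT] with x hx using dzbar_holomorphic hx j
  rw [dz_congr h1, dz_mul (hT.self_of_nhds.restrictScalars ℝ) (differentiableAt_conj_comp h2),
    dz_conj h2, h3]
  simp

/-- This serves two purposes. For `ε = 0` it says that `log|T|²` is pluriharmonic off the zeros; for
`ε > 0` it exhibits the Levi form of the regularisation as a nonnegative rank-one matrix. -/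
theorem leviMatrix_log_normSq_add (hT : ∀ᶠ x in 𝓝 z, DifferentiableAt ℂ T x)
    (hTs : ContDiffAt ℝ ∞ T z) {ε : ℝ} (hε : 0 < ‖T z‖ ^ 2 + ε) (j k : Fin n) :
    leviMatrix (fun x => Real.log (‖T x‖ ^ 2 + ε)) z j k
      = ε / ((‖T z‖ ^ 2 + ε : ℝ) : ℂ) ^ 2 * (dz j T z * conj (dz k T z)) := by
  rw [leviMatrix_comp (g := Real.log) (u := fun x => ‖T x‖ ^ 2 + ε) (g₁ := fun t => t⁻¹)
    (g₂ := -((‖T z‖ ^ 2 + ε) ^ 2)⁻¹) (contDiffAt_normSq_add hTs ε) ?_ (hasDerivAt_inv hε.ne'),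
    leviMatrix_normSq_add hT hTs, dz_normSq_add hT.self_of_nhds,
    dzbar_normSq_add hT.self_of_nhds]
  · have h1 : ((‖T z‖ ^ 2 + ε : ℝ) : ℂ) ≠ 0 := by exact_mod_cast hε.ne'
    have h2 := ofReal_normSq_add (T z) ε
    push_cast at h1 h2 ⊢
    field_simp
    linear_combination dz j T z * (starRingEnd ℂ) (dz k T z) * h2
  · filter_upwards [lt_mem_nhds hε] with t ht using Real.hasDerivAt_log ht.ne'

end LogHolomorphic

/-! ### Functions of `|F_a|²` -/

section RadialLaplacian

variable {n : ℕ} {a x : Cn n}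

theorem differentiableAt_one_sub_inner (a x : Cn n) :
    DifferentiableAt ℂ (fun y => 1 - inner ℂ a y) x :=
  (differentiableAt_const _).sub (innerSL ℂ a).differentiableAt

theorem contDiff_one_sub_inner (a : Cn n) {m : WithTop ℕ∞} :
    ContDiff ℝ m (fun y => 1 - inner ℂ a y) :=
  contDiff_const.sub ((innerSL ℂ a).restrictScalars ℝ).contDiff

theorem dz_one_sub_inner (j : Fin n) : dz j (fun y => 1 - inner ℂ a y) x = -conj (a j) := by
  have h : HasFDerivAt (fun y => 1 - inner ℂ a y) (-(innerSL ℂ a)) x :=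
    ((innerSL ℂ a).hasFDerivAt).const_sub 1
  rw [dz_holomorphic (differentiableAt_one_sub_inner a x), h.fderiv]
  simp [EuclideanSpace.inner_single_right]

/-- `log (1 - |F_a|²)`. -/
def logGap (a x : Cn n) : ℝ :=
  Real.log (defFun x) + (Real.log (defFun a) + -1 * Real.log (‖1 - inner ℂ a x‖ ^ 2 + 0))

theorem exp_logGap (ha : a ∈ unitBall n) (hx : x ∈ unitBall n) :
    Real.exp (logGap a x) = gap a x := by
  have h1 := norm_pos_iff.mpr (one_sub_inner_ne_zero (norm_lt_one ha) (norm_lt_one hx).le)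
  have h2 := defFun_pos ha
  have h3 := defFun_pos hx
  rw [logGap, neg_one_mul, add_zero, ← sub_eq_add_neg, ← Real.log_div h2.ne' (by positivity),
    ← Real.log_mul h3.ne' (by positivity), Real.exp_log (by positivity), gap]
  ring

theorem contDiffAt_log_one_sub_inner (ha : a ∈ unitBall n) (hx : x ∈ unitBall n) :
    ContDiffAt ℝ ∞ (fun y => Real.log (‖1 - inner ℂ a y‖ ^ 2 + 0)) x := by
  have h1 := norm_pos_iff.mpr (one_sub_inner_ne_zero (norm_lt_one ha) (norm_lt_one hx).le)
  exact (contDiffAt_normSq_add (contDiff_one_sub_inner a).contDiffAt 0).log (by positivity)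

theorem contDiffAt_logGap_aux (ha : a ∈ unitBall n) (hx : x ∈ unitBall n) : ContDiffAt ℝ ∞
    (fun y => Real.log (defFun a) + -1 * Real.log (‖1 - inner ℂ a y‖ ^ 2 + 0)) x :=
  contDiffAt_const.add (contDiffAt_const.mul (contDiffAt_log_one_sub_inner ha hx))

theorem contDiffAt_logGap (ha : a ∈ unitBall n) (hx : x ∈ unitBall n) :
    ContDiffAt ℝ ∞ (logGap a) x :=
  (contDiffAt_log_defFun hx).add (contDiffAt_logGap_aux ha hx)

theorem contDiffAt_gap (ha : a ∈ unitBall n) (hx : x ∈ unitBall n) :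
    ContDiffAt ℝ ∞ (gap a) x := by
  have h1 := norm_pos_iff.mpr (one_sub_inner_ne_zero (norm_lt_one ha) (norm_lt_one hx).le)
  exact (contDiffAt_const.mul contDiff_defFun.contDiffAt).div
    ((contDiff_one_sub_inner a).contDiffAt.norm_sq ℝ) (by positivity)

/-- The term `log|1-⟨x,a⟩|²` is pluriharmonic, so the second-order part of a function of `|F_a|²`
does not depend on `a`. -/
theorem leviMatrix_logGap (ha : a ∈ unitBall n) (hx : x ∈ unitBall n) :
    leviMatrix (logGap a) x = leviMatrix (fun y => Real.log (defFun y)) x := by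
  have h1 := norm_pos_iff.mpr (one_sub_inner_ne_zero (norm_lt_one ha) (norm_lt_one hx).le)
  have h2 : leviMatrix (fun y => Real.log (‖1 - inner ℂ a y‖ ^ 2 + 0)) x = 0 := by
    ext j k
    rw [leviMatrix_log_normSq_add (Eventually.of_forall fun y => differentiableAt_one_sub_inner a y)
      (contDiff_one_sub_inner a).contDiffAt (by positivity)]
    simp
  unfold logGap
  rw [leviMatrix_add (contDiffAt_log_defFun hx) (contDiffAt_logGap_aux ha hx),
    leviMatrix_add contDiffAt_const
      (contDiffAt_const.mul (contDiffAt_log_one_sub_inner ha hx)), leviMatrix_const, zero_add]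
  convert add_zero _
  ext j k
  rw [leviMatrix_comp (g := fun t => -1 * t) (g₁ := fun _ => -1) (g₂ := 0)
    (contDiffAt_log_one_sub_inner ha hx)
    (Eventually.of_forall fun t => by simpa using (hasDerivAt_id t).const_mul (-1))
    (hasDerivAt_const _ _), h2]
  simp

theorem dz_logGap (ha : a ∈ unitBall n) (hx : x ∈ unitBall n) (j : Fin n) :
    dz j (fun y => (logGap a y : ℂ)) x
      = -conj (x j) / defFun x + conj (a j) / (1 - inner ℂ a x) := by
  have hq := one_sub_inner_ne_zero (norm_lt_one ha) (norm_lt_one hx).le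
  have h1 := norm_pos_iff.mpr hq
  have h2 := contDiffAt_log_one_sub_inner ha hx
  have h3 : DifferentiableAt ℝ (fun y : Cn n => Real.log (defFun y)) x :=
    (contDiffAt_log_defFun hx (m := 1)).differentiableAt (by norm_num)
  have h4 := differentiableAt_ofReal_comp (h2.differentiableAt (by norm_num))
  have e : (fun y => (logGap a y : ℂ)) = fun y => (Real.log (defFun y) : ℂ) +
      ((Real.log (defFun a) : ℂ) + -1 * (Real.log (‖1 - inner ℂ a y‖ ^ 2 + 0) : ℂ)) := by
    ext y; simp [logGap]
  have e2 : dz j (fun y => (Real.log (‖1 - inner ℂ a y‖ ^ 2 + 0) : ℂ)) x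
      = -conj (a j) / (1 - inner ℂ a x) := by
    have h5 : (0 : ℝ) < ‖1 - inner ℂ a x‖ ^ 2 + 0 := by positivity
    rw [dz_comp (g := Real.log) (u := fun y => ‖1 - inner ℂ a y‖ ^ 2 + 0)
      ((contDiffAt_normSq_add (m := 1) (contDiff_one_sub_inner a).contDiffAt 0).differentiableAt
        (by norm_num)) (Real.hasDerivAt_log h5.ne'),
      dz_normSq_add (differentiableAt_one_sub_inner a x), dz_one_sub_inner]
    rw [Complex.ofReal_inv, ofReal_normSq_add]
    have hc : conj (1 - inner ℂ a x) ≠ 0 := (map_ne_zero _).mpr hq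
    simp only [Complex.ofReal_zero, add_zero]
    field_simp
  rw [e, dz_add (differentiableAt_ofReal_comp h3) ((differentiableAt_const _).fun_add
    (h4.const_mul _)), dz_add (differentiableAt_const _) (h4.const_mul _), dz_const,
    dz_const_mul h4, e2, dz_comp (g := Real.log) (u := defFun)
      ((contDiff_defFun (m := 1)).differentiable (by norm_num) x)
      (Real.hasDerivAt_log (defFun_pos hx).ne'), dz_defFun]
  push_cast
  ring

theorem sum_hermitian (f g : Fin n → ℂ) : ∑ j, ∑ k,
    ((if j = k then 1 else 0) - x j * conj (x k)) * (f j * g k)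
      = ∑ j, f j * g j - (∑ j, x j * f j) * ∑ k, conj (x k) * g k := by
  rw [Finset.sum_mul_sum, ← Finset.sum_sub_distrib]
  refine Finset.sum_congr rfl fun j _ => ?_
  simp only [sub_mul, Finset.sum_sub_distrib, ite_mul, one_mul, zero_mul, Finset.sum_ite_eq,
    Finset.mem_univ, if_true]
  congr 1
  exact Finset.sum_congr rfl fun k _ => by ring

theorem sum_leviMatrix_log_defFun (hx : x ∈ unitBall n) : ∑ j, ∑ k,
    ((if j = k then 1 else 0) - x j * conj (x k)) *
      leviMatrix (fun y => Real.log (defFun y)) x j k = -n / defFun x := by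
  have hs : (defFun x : ℂ) ≠ 0 := by exact_mod_cast (defFun_pos hx).ne'
  have hsum : ∑ i, x i * conj (x i) = 1 - (defFun x : ℂ) := by
    rw [← ofReal_norm_sq, defFun]; push_cast; ring
  have e (j k : Fin n) : ((if j = k then 1 else 0) - x j * conj (x k)) *
      leviMatrix (fun y => Real.log (defFun y)) x j k
      = (-1 / (defFun x : ℂ)) * (if j = k then 1 - x j * conj (x k) else 0)
        + (-1 / (defFun x : ℂ) ^ 2) *
          (((if j = k then 1 else 0) - x j * conj (x k)) * (conj (x j) * x k)) := by
    rw [leviMatrix_log_defFun hx]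
    split_ifs <;> ring
  simp only [e, Finset.sum_add_distrib, ← Finset.mul_sum, sum_hermitian, Finset.sum_ite_eq,
    Finset.mem_univ, if_true, Finset.sum_sub_distrib]
  have hsum2 : ∑ i, conj (x i) * x i = 1 - (defFun x : ℂ) := by
    rw [← hsum]; exact Finset.sum_congr rfl fun i _ => mul_comm _ _
  rw [hsum, hsum2]
  simp
  field_simp
  ring

/-- Multiplied by `1-|x|²` the left side is, up to a constant, the squared length of the
differential of `log(1-|F_a|²)` in the Bergman metric, and the value becomes `|F_a(x)|²`, as
invariance predicts from the case `a = 0`. -/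
theorem sum_dz_logGap (ha : a ∈ unitBall n) (hx : x ∈ unitBall n) : ∑ j, ∑ k,
    ((if j = k then 1 else 0) - x j * conj (x k)) *
      (dz j (fun y => (logGap a y : ℂ)) x * dzbar k (fun y => (logGap a y : ℂ)) x)
      = ((1 - gap a x : ℝ) : ℂ) / defFun x := by
  have hs : (defFun x : ℂ) ≠ 0 := by exact_mod_cast (defFun_pos hx).ne'
  have hq := one_sub_inner_ne_zero (norm_lt_one ha) (norm_lt_one hx).le
  have hcq : conj (1 - inner ℂ a x) ≠ 0 := (map_ne_zero _).mpr hq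
  have hd : DifferentiableAt ℝ (logGap a) x :=
    (contDiffAt_logGap ha hx).differentiableAt (by norm_num)
  have hb (k : Fin n) : dzbar k (fun y => (logGap a y : ℂ)) x
      = -x k / defFun x + a k / conj (1 - inner ℂ a x) := by
    rw [dzbar_ofReal hd, dz_logGap ha hx]
    simp
  rw [sum_hermitian]
  have s1 : ∑ i, x i * conj (x i) = 1 - (defFun x : ℂ) := by
    rw [← ofReal_norm_sq, defFun]; push_cast; ring
  have s2 : ∑ i, a i * conj (a i) = 1 - (defFun a : ℂ) := by
    rw [← ofReal_norm_sq, defFun]; push_cast; ring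
  have s3 : ∑ i, x i * conj (a i) = inner ℂ a x := by
    rw [PiLp.inner_apply]; rfl
  have s4 : ∑ i, a i * conj (x i) = conj (inner ℂ a x) := by
    rw [inner_conj_symm, PiLp.inner_apply]; rfl
  simp only [hb, dz_logGap ha hx]
  have e1 (i : Fin n) : (-conj (x i) / (defFun x : ℂ) + conj (a i) / (1 - inner ℂ a x)) *
      (-x i / defFun x + a i / conj (1 - inner ℂ a x))
      = (x i * conj (x i)) * (1 / (defFun x : ℂ) ^ 2)
        - (a i * conj (x i)) * (1 / ((defFun x : ℂ) * conj (1 - inner ℂ a x)))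
        - (x i * conj (a i)) * (1 / ((defFun x : ℂ) * (1 - inner ℂ a x)))
        + (a i * conj (a i)) * (1 / ((1 - inner ℂ a x) * conj (1 - inner ℂ a x))) := by
    field_simp
    ring
  have e2 (i : Fin n) : x i * (-conj (x i) / (defFun x : ℂ) + conj (a i) / (1 - inner ℂ a x))
      = (x i * conj (x i)) * (-1 / (defFun x : ℂ)) + (x i * conj (a i)) * (1 / (1 - inner ℂ a x)) := by
    ring
  have e3 (i : Fin n) : conj (x i) * (-x i / (defFun x : ℂ) + a i / conj (1 - inner ℂ a x))
      = (x i * conj (x i)) * (-1 / (defFun x : ℂ))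
        + (a i * conj (x i)) * (1 / conj (1 - inner ℂ a x)) := by
    ring
  simp only [e1, e2, e3, Finset.sum_add_distrib, Finset.sum_sub_distrib, ← Finset.sum_mul, s1, s2,
    s3, s4]
  have hg : (gap a x : ℂ) = defFun a * defFun x / ((1 - inner ℂ a x) * conj (1 - inner ℂ a x)) := by
    rw [gap, Complex.mul_conj']; push_cast; rfl
  have hi : inner ℂ a x = 1 - (1 - inner ℂ a x) := by ring
  have hci : conj (inner ℂ a x) = 1 - conj (1 - inner ℂ a x) := by simp
  rw [Complex.ofReal_sub, hg, hci]
  generalize hp' : conj (1 - inner ℂ a x) = p' at *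
  have hi2 : inner ℂ a x = 1 - (1 - inner ℂ a x) := by ring
  generalize hp : 1 - inner ℂ a x = p at *
  rw [hi2]
  push_cast
  field_simp
  ring

/-- The Bergman Laplacian of a function of `|F_a|²`. -/
theorem bergmanLaplacian_radial (ha : a ∈ unitBall n) (hx : x ∈ unitBall n) {ψ ψ₁ : ℝ → ℝ}
    {ψ₂ : ℝ} (hψ : ∀ᶠ t in 𝓝 (1 - gap a x), HasDerivAt ψ (ψ₁ t) t)
    (hψ₁ : HasDerivAt ψ₁ ψ₂ (1 - gap a x)) :
    bergmanLaplacian (fun y => ψ (1 - gap a y)) x = gap a x / (n * (n + 1)) *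
      ((n - (1 - gap a x)) * ψ₁ (1 - gap a x) + (1 - gap a x) * gap a x * ψ₂) := by
  have hs := (defFun_pos hx).ne'
  have hE := exp_logGap ha hx
  -- In the variable `ℓ = log(1-|F_a|²)` the Levi matrix is explicit, so the function is rewritten
  -- as `ℓ ↦ ψ(1 - e^ℓ)` before the chain rule is applied.
  have hcong : (fun y => ψ (1 - gap a y)) =ᶠ[𝓝 x]
      fun y => (fun ℓ => ψ (1 - Real.exp ℓ)) (logGap a y) := by
    filter_upwards [isOpen_unitBall.mem_nhds hx] with y hy
    simp only [exp_logGap ha hy]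
  have d0 (ℓ : ℝ) : HasDerivAt (fun ℓ : ℝ => 1 - Real.exp ℓ) (-Real.exp ℓ) ℓ :=
    (Real.hasDerivAt_exp ℓ).const_sub 1
  have hev : ∀ᶠ ℓ in 𝓝 (logGap a x), HasDerivAt (fun ℓ => ψ (1 - Real.exp ℓ))
      (ψ₁ (1 - Real.exp ℓ) * -Real.exp ℓ) ℓ := by
    have : Tendsto (fun ℓ => 1 - Real.exp ℓ) (𝓝 (logGap a x)) (𝓝 (1 - gap a x)) := by
      rw [← hE]; exact (d0 _).continuousAt
    filter_upwards [this.eventually hψ] with ℓ hℓ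
    exact HasDerivAt.comp (h := fun ℓ : ℝ => 1 - Real.exp ℓ) ℓ hℓ (d0 ℓ)
  have hd2 : HasDerivAt (fun ℓ => ψ₁ (1 - Real.exp ℓ) * -Real.exp ℓ)
      (ψ₂ * gap a x ^ 2 - ψ₁ (1 - gap a x) * gap a x) (logGap a x) := by
    have h1 : HasDerivAt (fun ℓ => ψ₁ (1 - Real.exp ℓ)) (ψ₂ * -Real.exp (logGap a x))
        (logGap a x) :=
      HasDerivAt.comp (h := fun ℓ : ℝ => 1 - Real.exp ℓ) _ (by rw [hE]; exact hψ₁) (d0 _)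
    refine (h1.mul (Real.hasDerivAt_exp _).neg).congr_deriv ?_
    rw [Pi.neg_apply, hE]; ring
  have hlevi (j k : Fin n) : ((if j = k then 1 else 0) - x j * conj (x k)) *
      dz j (dzbar k fun y => (ψ (1 - gap a y) : ℂ)) x
      = ((ψ₁ (1 - gap a x) * -gap a x : ℝ) : ℂ) * (((if j = k then 1 else 0) - x j * conj (x k)) *
          leviMatrix (fun y => Real.log (defFun y)) x j k)
        + ((ψ₂ * gap a x ^ 2 - ψ₁ (1 - gap a x) * gap a x : ℝ) : ℂ) *
          (((if j = k then 1 else 0) - x j * conj (x k)) *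
            (dz j (fun y => (logGap a y : ℂ)) x * dzbar k (fun y => (logGap a y : ℂ)) x)) := by
    have h : dz j (dzbar k fun y => (ψ (1 - gap a y) : ℂ)) x = _ :=
      (congrFun (congrFun (leviMatrix_congr hcong) j) k).trans
        (leviMatrix_comp (contDiffAt_logGap ha hx) hev hd2 j k)
    rw [h, hE, leviMatrix_logGap ha hx]
    ring
  rw [bergmanLaplacian_eq hx, cLap]
  simp only [hlevi, Finset.sum_add_distrib, ← Finset.mul_sum]
  rw [sum_leviMatrix_log_defFun hx, sum_dz_logGap ha hx]
  have : ((ψ₁ (1 - gap a x) * -gap a x : ℝ) : ℂ) * (-n / defFun x)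
      + ((ψ₂ * gap a x ^ 2 - ψ₁ (1 - gap a x) * gap a x : ℝ) : ℂ) *
        (((1 - gap a x : ℝ) : ℂ) / defFun x)
      = (((ψ₁ (1 - gap a x) * -gap a x) * (-n / defFun x)
      + (ψ₂ * gap a x ^ 2 - ψ₁ (1 - gap a x) * gap a x) * ((1 - gap a x) / defFun x) : ℝ) : ℂ) := by
    push_cast; ring
  rw [this, Complex.ofReal_re]
  field_simp
  ring

end RadialLaplacian

end BergmanBall
end

noncomputable section
namespace BergmanBall

/-! ### Radial potentials -/

section Profile

variable {n : ℕ} {r : ℝ} {M : ℝ → ℝ} {a x : Cn n}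

/-- The constant of the Green's function. -/
def greenConst (n : ℕ) : ℝ := ((2 * Real.pi) ^ n * ((n : ℝ) + 1) ^ (n - 1))⁻¹

theorem greenConst_pos (n : ℕ) : 0 < greenConst n := by
  have := Real.pi_pos
  unfold greenConst; positivity

/-- `(1-u)^{n-1} u^{-n}`. -/
def greenKernel (n : ℕ) (u : ℝ) : ℝ := (1 - u) ^ (n - 1) / u ^ n

/-- In the form `(n-t)κ + t(1-t)κ' = 0` this is the homogeneous radial Laplace equation of
`bergmanLaplacian_radial` for a potential with derivative `κ`. For a potential with derivative `M·κ`
only the term with `M'` survives. -/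
theorem hasDerivAt_greenKernel (hn : 1 ≤ n) {t : ℝ} (ht0 : t ≠ 0) (ht1 : t ≠ 1) :
    HasDerivAt (greenKernel n) ((t - n) / (t * (1 - t)) * greenKernel n t) t := by
  have h1 : 1 - t ≠ 0 := sub_ne_zero.mpr ht1.symm
  have d := (((hasDerivAt_id t).const_sub 1).fun_pow (n - 1)).fun_div (hasDerivAt_pow n t)
    (pow_ne_zero n ht0)
  refine d.congr_deriv ?_
  obtain ⟨m, rfl⟩ := Nat.exists_eq_add_of_le' hn
  rcases m with _ | m
  · simp [greenKernel]
    field_simp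
    ring
  · simp only [greenKernel, Nat.add_sub_cancel, id]
    push_cast
    field_simp
    ring

/-- The radial mass distribution `M`, as derivative of a radial potential. -/
def massKernel (n : ℕ) (r : ℝ) (M : ℝ → ℝ) (u : ℝ) : ℝ :=
  if 0 < u ∧ u < 1 then greenConst n * (M (relVol n r u) * greenKernel n u) else 0

/-- The radial potential with mass distribution `M`. -/
def profile (n : ℕ) (r : ℝ) (M : ℝ → ℝ) (t : ℝ) : ℝ := -∫ u in t..r ^ 2, massKernel n r M u

theorem relVol_zero (hn : 1 ≤ n) : relVol n r 0 = 0 := by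
  simp [relVol]; omega

theorem contDiffAt_relVol {u : ℝ} (hu : u ≠ 1) {k : WithTop ℕ∞} :
    ContDiffAt ℝ k (relVol n r) u := by
  unfold relVol
  exact ((contDiffAt_id.div (contDiffAt_const.sub contDiffAt_id)
    (sub_ne_zero.mpr hu.symm)).div_const _).pow n

theorem relVol_mono (hr0 : 0 < r) (hr1 : r < 1) {t u : ℝ} (ht : 0 ≤ t) (htu : t ≤ u)
    (hu : u < 1) : relVol n r t ≤ relVol n r u := by
  have hr2 : 0 < 1 - r ^ 2 := by nlinarith
  have h1 : t / (1 - t) ≤ u / (1 - u) := by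
    rw [div_le_div_iff₀ (by linarith) (by linarith)]; nlinarith
  have h2 : 0 ≤ t / (1 - t) := div_nonneg ht (by linarith)
  unfold relVol
  gcongr

theorem relVol_sq (hr0 : 0 < r) (hr1 : r < 1) : relVol n r (r ^ 2) = 1 := by
  have hr2 : 0 < 1 - r ^ 2 := by nlinarith
  rw [relVol, div_self (by positivity), one_pow]

theorem relVol_pos (hr0 : 0 < r) (hr1 : r < 1) {t : ℝ} (ht : 0 < t) (ht1 : t < 1) :
    0 < relVol n r t := by
  have hr2 : 0 < 1 - r ^ 2 := by nlinarith
  have : 0 < 1 - t := by linarith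
  unfold relVol
  positivity

theorem relVol_nonneg (hr0 : 0 < r) (hr1 : r < 1) {t : ℝ} (ht : 0 ≤ t) (ht1 : t < 1) :
    0 ≤ relVol n r t := by
  have hr2 : 0 < 1 - r ^ 2 := by nlinarith
  have : 0 < 1 - t := by linarith
  unfold relVol
  positivity

theorem relVol_lt_one (hn : 1 ≤ n) (hr0 : 0 < r) (hr1 : r < 1) {t : ℝ} (ht : 0 ≤ t)
    (htr : t < r ^ 2) : relVol n r t < 1 := by
  have hr2 : 0 < 1 - r ^ 2 := by nlinarith
  have h1 : t / (1 - t) < r ^ 2 / (1 - r ^ 2) := by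
    rw [div_lt_div_iff₀ (by linarith) (by linarith)]; nlinarith
  have h2 : 0 ≤ t / (1 - t) := div_nonneg ht (by linarith)
  unfold relVol
  exact pow_lt_one₀ (by positivity) ((div_lt_one (by positivity)).mpr h1) (by omega)

theorem one_le_relVol (hr0 : 0 < r) (hr1 : r < 1) {t : ℝ} (htr : r ^ 2 ≤ t) (ht : t < 1) :
    1 ≤ relVol n r t := by
  rw [← relVol_sq (n := n) hr0 hr1]
  exact relVol_mono hr0 hr1 (by positivity) htr ht

/-- A mass distribution that vanishes near `0` removes the singularity `u^{-n}` of the kernel, so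
the potentials are smooth at the centre too. -/
theorem massKernel_eventually_zero (hn : 1 ≤ n) {δ : ℝ} (hδ : 0 < δ) (hM0 : ∀ y ≤ δ, M y = 0)
    {u : ℝ} (hu : u ≤ 0) : massKernel n r M =ᶠ[𝓝 u] fun _ => 0 := by
  rcases hu.lt_or_eq with h | rfl
  · filter_upwards [gt_mem_nhds h] with v hv
    exact if_neg fun h => hv.not_gt h.1
  · have hc : ContinuousAt (relVol n r) 0 := (contDiffAt_relVol (k := 0) (by norm_num)).continuousAt
    have : ∀ᶠ v in 𝓝 0, relVol n r v < δ :=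
      hc.eventually (gt_mem_nhds (by rwa [relVol_zero hn]))
    filter_upwards [this] with v hv
    simp [massKernel, hM0 _ hv.le]

theorem contDiffAt_massKernel (hn : 1 ≤ n) (hM : ContDiff ℝ ∞ M) {δ : ℝ} (hδ : 0 < δ)
    (hM0 : ∀ y ≤ δ, M y = 0) {u : ℝ} (hu : u < 1) : ContDiffAt ℝ ∞ (massKernel n r M) u := by
  rcases le_or_gt u 0 with h | h
  · exact contDiffAt_const.congr_of_eventuallyEq (massKernel_eventually_zero hn hδ hM0 h)
  · have e : massKernel n r M =ᶠ[𝓝 u]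
        fun u => greenConst n * (M (relVol n r u) * greenKernel n u) := by
      filter_upwards [lt_mem_nhds h, gt_mem_nhds hu] with v h1 h2
      exact if_pos ⟨h1, h2⟩
    refine ContDiffAt.congr_of_eventuallyEq ?_ e
    unfold greenKernel
    exact contDiffAt_const.mul ((hM.contDiffAt.comp u (contDiffAt_relVol hu.ne)).mul
      (((contDiffAt_const.sub contDiffAt_id).pow _).div (contDiffAt_id.pow n)
        (pow_pos h n).ne'))

theorem continuousOn_massKernel (hn : 1 ≤ n) (hM : ContDiff ℝ ∞ M) {δ : ℝ} (hδ : 0 < δ)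
    (hM0 : ∀ y ≤ δ, M y = 0) : ContinuousOn (massKernel n r M) (Iio 1) := fun _ hu =>
  (contDiffAt_massKernel hn hM hδ hM0 hu).continuousAt.continuousWithinAt

theorem intervalIntegrable_massKernel (hn : 1 ≤ n) (hM : ContDiff ℝ ∞ M) {δ : ℝ} (hδ : 0 < δ)
    (hM0 : ∀ y ≤ δ, M y = 0) {s t : ℝ} (hs : s < 1) (ht : t < 1) :
    IntervalIntegrable (massKernel n r M) volume s t :=
  ((continuousOn_massKernel hn hM hδ hM0).mono fun _ hu =>
    lt_of_le_of_lt hu.2 (max_lt hs ht)).intervalIntegrable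

theorem hasDerivAt_profile (hn : 1 ≤ n) (hr0 : 0 < r) (hr1 : r < 1) (hM : ContDiff ℝ ∞ M)
    {δ : ℝ} (hδ : 0 < δ) (hM0 : ∀ y ≤ δ, M y = 0) {t : ℝ} (ht : t < 1) :
    HasDerivAt (profile n r M) (massKernel n r M t) t := by
  have h := (intervalIntegral.integral_hasDerivAt_left
    (intervalIntegrable_massKernel (r := r) hn hM hδ hM0 ht (show r ^ 2 < 1 by nlinarith))
    ((continuousOn_massKernel hn hM hδ hM0).stronglyMeasurableAtFilter isOpen_Iio t ht)
    (contDiffAt_massKernel hn hM hδ hM0 ht).continuousAt).neg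
  rw [neg_neg] at h
  exact h

theorem contDiffAt_profile (hn : 1 ≤ n) (hr0 : 0 < r) (hr1 : r < 1) (hM : ContDiff ℝ ∞ M)
    {δ : ℝ} (hδ : 0 < δ) (hM0 : ∀ y ≤ δ, M y = 0) {t : ℝ} (ht : t < 1) :
    ContDiffAt ℝ ∞ (profile n r M) t := by
  have h : ContDiffOn ℝ ∞ (profile n r M) (Iio 1) := by
    rw [contDiffOn_infty_iff_deriv_of_isOpen isOpen_Iio]
    refine ⟨fun _ hu => (hasDerivAt_profile hn hr0 hr1 hM hδ hM0
      hu).differentiableAt.differentiableWithinAt, ?_⟩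
    refine ContDiffOn.congr (f := massKernel n r M) (fun u hu =>
      (contDiffAt_massKernel hn hM hδ hM0 hu).contDiffWithinAt) fun u hu =>
      (hasDerivAt_profile hn hr0 hr1 hM hδ hM0 hu).deriv
  exact h.contDiffAt (Iio_mem_nhds ht)

theorem gap_le_one (ha : a ∈ unitBall n) (hx : x ∈ unitBall n) : gap a x ≤ 1 := by
  have := norm_F_sq (norm_lt_one ha) (norm_lt_one hx).le
  nlinarith [sq_nonneg ‖F a x‖]

/-- Outside the ball this gives `1 - gap a x ≥ 1 > r²`. Potentials vanishing beyond `r²` are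
therefore globally defined by the same formula, with no extension by zero. -/
theorem gap_nonpos (ha : a ∈ unitBall n) (hx : x ∉ unitBall n) : gap a x ≤ 0 := by
  have h1 : 1 ≤ ‖x‖ := by simpa [unitBall] using hx
  have h2 : defFun x ≤ 0 := by unfold defFun; nlinarith
  exact div_nonpos_of_nonpos_of_nonneg
    (mul_nonpos_of_nonneg_of_nonpos (defFun_pos ha).le h2) (by positivity)

/-- The Bergman Laplacian of a radial potential is its mass density. -/
theorem lapDensity_profile (hn : 1 ≤ n) (hr0 : 0 < r) (hr1 : r < 1) (ha : a ∈ unitBall n)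
    (hx : x ∈ unitBall n) (hM : ContDiff ℝ ∞ M) {δ : ℝ} (hδ : 0 < δ) (hM0 : ∀ y ≤ δ, M y = 0) :
    lapDensity (fun y => profile n r M (1 - gap a y)) x
      = (V n r)⁻¹ * deriv M (relVol n r (1 - gap a x)) * bergmanDensity x := by
  have hr2 : 0 < 1 - r ^ 2 := by nlinarith
  have hg := gap_pos ha hx
  have hg1 := gap_le_one ha hx
  rw [lapDensity]
  congr 1
  have hev : ∀ᶠ t in 𝓝 (1 - gap a x), HasDerivAt (profile n r M) (massKernel n r M t) t := by
    filter_upwards [gt_mem_nhds (show 1 - gap a x < 1 by linarith)] with t ht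
      using hasDerivAt_profile hn hr0 hr1 hM hδ hM0 ht
  -- Away from the centre the radial equation applies. At the centre, where `1 - gap a x = 0`, both
  -- sides vanish because `M` vanishes near `0`.
  rcases hg1.lt_or_eq with h | h
  · set t := 1 - gap a x with ht
    have hgt : gap a x = 1 - t := by rw [ht]; ring
    have ht0 : 0 < t := by linarith
    have ht1 : t < 1 := by linarith
    have h1t : 0 < 1 - t := by linarith
    have hd : HasDerivAt (massKernel n r M) (greenConst n * (deriv M (relVol n r t) *
        (n * (t ^ (n - 1) * ((1 - t) ^ (n + 1))⁻¹) / (r ^ 2 / (1 - r ^ 2)) ^ n) * greenKernel n t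
        + M (relVol n r t) * ((t - n) / (t * (1 - t)) * greenKernel n t))) t := by
      have hMd : HasDerivAt M (deriv M (relVol n r t)) (relVol n r t) :=
        (hM.differentiable (by norm_num) _).hasDerivAt
      have h1 : HasDerivAt (fun u => M (relVol n r u)) _ t :=
        HasDerivAt.comp (h := relVol n r) t hMd (hasDerivAt_relVol ht1.ne)
      refine ((h1.mul (hasDerivAt_greenKernel hn ht0.ne' ht1.ne)).const_mul
        (greenConst n)).congr_of_eventuallyEq ?_
      filter_upwards [lt_mem_nhds ht0, gt_mem_nhds ht1] with v h1 h2
      exact if_pos ⟨h1, h2⟩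
    rw [bergmanLaplacian_radial ha hx hev hd, hgt, V_eq hn hr0 hr1, massKernel,
      if_pos ⟨by linarith, by linarith⟩]
    rw [sub_sub_cancel]
    have hpi := Real.pi_pos
    obtain ⟨m, rfl⟩ := Nat.exists_eq_add_of_le' hn
    have hR : 0 < (r ^ 2 / (1 - r ^ 2)) ^ (m + 1) := by positivity
    generalize (r ^ 2 / (1 - r ^ 2)) ^ (m + 1) = B at *
    simp only [greenConst, greenKernel, Nat.add_sub_cancel]
    have hn1 : ((m + 1 : ℕ) : ℝ) + 1 ≠ 0 := by positivity
    have hn2 : ((m + 1 : ℕ) : ℝ) ≠ 0 := by positivity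
    generalize deriv M (relVol (m + 1) r t) = D
    generalize M (relVol (m + 1) r t) = E
    generalize ((m + 1 : ℕ) : ℝ) = N at *
    have := hR.ne'
    field_simp
    ring
  · have h0 : 1 - gap a x = 0 := by linarith
    have hz := massKernel_eventually_zero (r := r) hn hδ hM0 (le_refl 0)
    have hd : HasDerivAt (massKernel n r M) 0 (1 - gap a x) := by
      rw [h0]; exact (hasDerivAt_const (0 : ℝ) (0 : ℝ)).congr_of_eventuallyEq hz
    have hM' : deriv M 0 = 0 := by
      have : M =ᶠ[𝓝 0] fun _ => 0 := by
        filter_upwards [gt_mem_nhds hδ] with y hy using hM0 y hy.le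
      rw [this.deriv_eq]; simp
    rw [bergmanLaplacian_radial ha hx hev hd, h0, relVol_zero hn, hM', hz.self_of_nhds]
    simp

/-- `{x ∈ B : |F_a(x)| ≤ r}`. -/
def closedBgBall (a : Cn n) (r : ℝ) : Set (Cn n) := F a '' Metric.closedBall 0 r

theorem continuousOn_F (ha : a ∈ unitBall n) : ContinuousOn (F a) (unitBall n) := fun _ hx =>
  (hasFDerivAt_F (one_sub_inner_ne_zero (norm_lt_one ha)
    (norm_lt_one hx).le)).continuousAt.continuousWithinAt

theorem closedBall_subset_unitBall (hr1 : r < 1) :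
    Metric.closedBall (0 : Cn n) r ⊆ unitBall n := fun x hx => by
  rw [mem_unitBall_iff]
  exact lt_of_le_of_lt (by simpa using hx) hr1

theorem isCompact_closedBgBall (ha : a ∈ unitBall n) (hr1 : r < 1) :
    IsCompact (closedBgBall a r) :=
  (isCompact_closedBall 0 r).image_of_continuousOn
    ((continuousOn_F ha).mono (closedBall_subset_unitBall hr1))

theorem closedBgBall_subset (ha : a ∈ unitBall n) (hr1 : r < 1) :
    closedBgBall a r ⊆ unitBall n := by
  rintro _ ⟨y, hy, rfl⟩
  exact F_mem_unitBall ha (closedBall_subset_unitBall hr1 hy)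

theorem mem_closedBgBall (ha : a ∈ unitBall n) (hx : x ∈ unitBall n) (h : ‖F a x‖ ≤ r) :
    x ∈ closedBgBall a r :=
  ⟨F a x, by simpa using h, F_F (norm_lt_one ha) (norm_lt_one hx).le⟩

theorem bgBall_subset_closedBgBall (ha : a ∈ unitBall n) : bgBall a r ⊆ closedBgBall a r :=
  fun _ hx => mem_closedBgBall ha hx.1 hx.2.le

theorem isOpen_bgBall (ha : a ∈ unitBall n) : IsOpen (bgBall a r) :=
  (continuousOn_F ha).norm.isOpen_inter_preimage isOpen_unitBall isOpen_Iio

theorem profile_eq_zero (hr0 : 0 < r) (hr1 : r < 1) (hM1 : ∀ y, 1 ≤ y → M y = 0) {t : ℝ}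
    (ht : r ^ 2 ≤ t) : profile n r M t = 0 := by
  rw [profile, intervalIntegral.integral_symm, neg_neg,
    intervalIntegral.integral_congr (g := fun _ => 0), intervalIntegral.integral_zero]
  intro u hu
  rw [uIcc_of_le ht] at hu
  by_cases h : 0 < u ∧ u < 1
  · simp only [massKernel]
    rw [if_pos h, hM1 _ (one_le_relVol hr0 hr1 hu.1 h.2)]
    ring
  · exact if_neg h

theorem profile_gap_eq_zero (ha : a ∈ unitBall n) (hr0 : 0 < r) (hr1 : r < 1)
    (hM1 : ∀ y, 1 ≤ y → M y = 0) (hx : x ∉ closedBgBall a r) :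
    profile n r M (1 - gap a x) = 0 := by
  apply profile_eq_zero hr0 hr1 hM1
  by_cases hxB : x ∈ unitBall n
  · by_contra! h
    refine hx (mem_closedBgBall ha hxB ?_)
    rw [← norm_F_sq (norm_lt_one ha) (norm_lt_one hxB).le] at h
    exact (abs_lt_of_sq_lt_sq h hr0.le |> lt_of_abs_lt).le
  · have := gap_nonpos ha hxB
    nlinarith

/-- Radial potentials of compactly supported mass distributions of total mass zero are test
functions. -/
theorem isTestFunction_profile (hn : 1 ≤ n) (hr0 : 0 < r) (hr1 : r < 1) (ha : a ∈ unitBall n)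
    (hM : ContDiff ℝ ∞ M) {δ : ℝ} (hδ : 0 < δ) (hM0 : ∀ y ≤ δ, M y = 0)
    (hM1 : ∀ y, 1 ≤ y → M y = 0) :
    IsTestFunction (fun x => profile n r M (1 - gap a x)) := by
  have hK := isCompact_closedBgBall ha hr1
  have hz : ∀ x ∉ closedBgBall a r, profile n r M (1 - gap a x) = 0 := fun x hx =>
    profile_gap_eq_zero ha hr0 hr1 hM1 hx
  refine ⟨contDiff_iff_contDiffAt.mpr fun x => ?_, HasCompactSupport.intro hK hz, ?_⟩
  · by_cases hx : x ∈ closedBgBall a r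
    · have hxB := closedBgBall_subset ha hr1 hx
      have := gap_pos ha hxB
      exact (contDiffAt_profile hn hr0 hr1 hM hδ hM0 (by linarith)).comp x
        (contDiffAt_const.sub (contDiffAt_gap ha hxB))
    · refine contDiffAt_const (c := 0) |>.congr_of_eventuallyEq ?_
      filter_upwards [hK.isClosed.isOpen_compl.mem_nhds hx] with y hy using hz y hy
  · refine (closure_minimal (fun x hx => ?_) hK.isClosed).trans (closedBgBall_subset ha hr1)
    by_contra h
    exact hx (hz x h)

end Profile

end BergmanBall
end

/-! ### Smooth masses approximating the singular one, and weak limits at a point. -/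

noncomputable section
namespace BergmanBall

/-! ### Cutoff functions -/

section Cutoff

theorem deriv_smoothTransition_of_nonpos {x : ℝ} (hx : x ≤ 0) : deriv Real.smoothTransition x = 0 :=
  IsLocalMin.deriv_eq_zero <| Eventually.of_forall fun y => by
    rw [Real.smoothTransition.zero_of_nonpos hx]; exact Real.smoothTransition.nonneg y

theorem deriv_smoothTransition_of_one_le {x : ℝ} (hx : 1 ≤ x) : deriv Real.smoothTransition x = 0 :=
  IsLocalMax.deriv_eq_zero <| Eventually.of_forall fun y => by
    rw [Real.smoothTransition.one_of_one_le hx]; exact Real.smoothTransition.le_one y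

theorem deriv_smoothTransition_nonneg (x : ℝ) : 0 ≤ deriv Real.smoothTransition x :=
  Real.smoothTransition.monotone.deriv_nonneg

theorem contDiff_smoothTransition : ContDiff ℝ ∞ Real.smoothTransition :=
  Real.smoothTransition.contDiff

theorem hasDerivAt_smoothTransition (x : ℝ) :
    HasDerivAt Real.smoothTransition (deriv Real.smoothTransition x) x :=
  (contDiff_smoothTransition.differentiable (by norm_num) x).hasDerivAt

theorem continuous_deriv_smoothTransition : Continuous (deriv Real.smoothTransition) :=
  contDiff_smoothTransition.continuous_deriv (by norm_num)

theorem exists_deriv_smoothTransition_le :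
    ∃ C : ℝ, 0 ≤ C ∧ ∀ x, |deriv Real.smoothTransition x| ≤ C := by
  obtain ⟨C, hC⟩ := (isCompact_Icc (a := (0 : ℝ)) (b := 1)).exists_bound_of_continuousOn
    continuous_deriv_smoothTransition.continuousOn
  refine ⟨max C 0, le_max_right _ _, fun x => ?_⟩
  by_cases hx : x ∈ Icc (0 : ℝ) 1
  · exact (hC x hx).trans (le_max_left _ _)
  · rcases not_and_or.mp hx with h | h
    · rw [deriv_smoothTransition_of_nonpos (not_le.mp h).le]; simp
    · rw [deriv_smoothTransition_of_one_le (not_le.mp h).le]; simp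

/-- A cutoff function rising from `0` to `1` on `[1/(k+1), 2/(k+1)]`. -/
def rise (k : ℕ) (y : ℝ) : ℝ := Real.smoothTransition ((k + 1) * y - 1)

theorem contDiff_rise (k : ℕ) : ContDiff ℝ ∞ (rise k) :=
  contDiff_smoothTransition.comp ((contDiff_const.mul contDiff_id).sub contDiff_const)

theorem rise_nonneg (k : ℕ) (y : ℝ) : 0 ≤ rise k y := Real.smoothTransition.nonneg _

theorem rise_le_one (k : ℕ) (y : ℝ) : rise k y ≤ 1 := Real.smoothTransition.le_one _

theorem rise_eq_zero {k : ℕ} {y : ℝ} (h : y ≤ 1 / ((k : ℝ) + 1)) : rise k y = 0 := by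
  have hk : (0 : ℝ) < (k : ℝ) + 1 := by positivity
  rw [le_div_iff₀ hk] at h
  exact Real.smoothTransition.zero_of_nonpos (by linarith)

theorem rise_eq_one {k : ℕ} {y : ℝ} (h : 2 / ((k : ℝ) + 1) ≤ y) : rise k y = 1 := by
  have hk : (0 : ℝ) < (k : ℝ) + 1 := by positivity
  rw [div_le_iff₀ hk] at h
  exact Real.smoothTransition.one_of_one_le (by linarith)

theorem rise_mono {k l : ℕ} (hkl : k ≤ l) {y : ℝ} (hy : 0 ≤ y) : rise k y ≤ rise l y := by
  apply Real.smoothTransition.monotone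
  have : (k : ℝ) ≤ l := by exact_mod_cast hkl
  nlinarith

theorem hasDerivAt_rise (k : ℕ) (y : ℝ) :
    HasDerivAt (rise k) ((k + 1) * deriv Real.smoothTransition ((k + 1) * y - 1)) y := by
  have h : HasDerivAt (fun y : ℝ => ((k : ℝ) + 1) * y - 1) ((k : ℝ) + 1) y := by
    simpa using ((hasDerivAt_id y).const_mul ((k : ℝ) + 1)).sub_const 1
  refine (HasDerivAt.comp (h := fun y : ℝ => ((k : ℝ) + 1) * y - 1) y
    (hasDerivAt_smoothTransition _) h).congr_deriv (mul_comm _ _)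

theorem deriv_rise (k : ℕ) (y : ℝ) :
    deriv (rise k) y = (k + 1) * deriv Real.smoothTransition ((k + 1) * y - 1) :=
  (hasDerivAt_rise k y).deriv

theorem deriv_rise_nonneg (k : ℕ) (y : ℝ) : 0 ≤ deriv (rise k) y := by
  rw [deriv_rise]
  exact mul_nonneg (by positivity) (deriv_smoothTransition_nonneg _)

theorem deriv_rise_eq_zero {k : ℕ} {y : ℝ} (h : 2 / ((k : ℝ) + 1) ≤ y) : deriv (rise k) y = 0 := by
  have hk : (0 : ℝ) < (k : ℝ) + 1 := by positivity
  rw [div_le_iff₀ hk] at h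
  rw [deriv_rise, deriv_smoothTransition_of_one_le (by linarith), mul_zero]

theorem continuous_deriv_rise (k : ℕ) : Continuous (deriv (rise k)) :=
  (contDiff_rise k).continuous_deriv (by norm_num)

theorem tendsto_div_succ (c : ℝ) : Tendsto (fun k : ℕ => c / ((k : ℝ) + 1)) atTop (𝓝 0) := by
  have := (tendsto_one_div_add_atTop_nhds_zero_nat (𝕜 := ℝ)).const_mul c
  simpa [div_eq_mul_inv] using this

theorem eventually_div_succ_lt (c : ℝ) {ε : ℝ} (hε : 0 < ε) :
    ∀ᶠ k : ℕ in atTop, c / ((k : ℝ) + 1) < ε :=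
  (tendsto_div_succ c).eventually (gt_mem_nhds hε)

/-- Smooth approximations from below of `(1-y)⁺` on `(0,∞)`, with compact support. -/
def bumpMass (k : ℕ) (y : ℝ) : ℝ := (1 - y) * (rise k y * rise k (1 - y))

theorem contDiff_bumpMass (k : ℕ) : ContDiff ℝ ∞ (bumpMass k) :=
  (contDiff_const.sub contDiff_id).mul ((contDiff_rise k).mul
    ((contDiff_rise k).comp (contDiff_const.sub contDiff_id)))

theorem bumpMass_eq_zero_of_le {k : ℕ} {y : ℝ} (h : y ≤ 1 / ((k : ℝ) + 1)) : bumpMass k y = 0 := by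
  rw [bumpMass, rise_eq_zero h]; ring

theorem bumpMass_eq_zero_of_ge {k : ℕ} {y : ℝ} (h : 1 ≤ y) : bumpMass k y = 0 := by
  have : 1 - y ≤ 1 / ((k : ℝ) + 1) := le_trans (b := 0) (by linarith) (by positivity)
  rw [bumpMass, rise_eq_zero this]; ring

theorem deriv_bumpMass_eq_zero {k : ℕ} {y : ℝ} (h : 1 ≤ y) : deriv (bumpMass k) y = 0 := by
  have hk : 0 < 1 / ((k : ℝ) + 1) := by positivity
  have : bumpMass k =ᶠ[𝓝 y] fun _ => 0 := by
    filter_upwards [lt_mem_nhds (show 1 - 1 / ((k : ℝ) + 1) < y by linarith)] with x hx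
    have : 1 - x ≤ 1 / ((k : ℝ) + 1) := by linarith
    rw [bumpMass, rise_eq_zero this]; ring
  rw [this.deriv_eq]; simp

theorem bumpMass_nonneg (k : ℕ) (y : ℝ) : 0 ≤ bumpMass k y := by
  rcases le_or_gt 1 y with h | h
  · rw [bumpMass_eq_zero_of_ge h]
  · exact mul_nonneg (by linarith) (mul_nonneg (rise_nonneg _ _) (rise_nonneg _ _))

theorem bumpMass_mono {k l : ℕ} (hkl : k ≤ l) (y : ℝ) : bumpMass k y ≤ bumpMass l y := by
  rcases le_or_gt 1 y with h | h
  · rw [bumpMass_eq_zero_of_ge h, bumpMass_eq_zero_of_ge h]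
  rcases le_or_gt y 0 with h0 | h0
  · rw [bumpMass_eq_zero_of_le (h0.trans (by positivity))]
    exact bumpMass_nonneg l y
  · have h1 := rise_mono hkl h0.le
    have h2 := rise_mono hkl (show 0 ≤ 1 - y by linarith)
    have h3 := rise_nonneg k (1 - y)
    have h4 := rise_nonneg l y
    unfold bumpMass
    gcongr

/-- The three terms have separate limits when used as densities: minus the uniform mass on `E(z,r)`,
a unit point mass at the centre, and an error near the boundary sphere that tends to zero. -/
theorem deriv_bumpMass (k : ℕ) (y : ℝ) : deriv (bumpMass k) y
    = -(rise k y * rise k (1 - y)) + (1 - y) * rise k (1 - y) * deriv (rise k) y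
      - (1 - y) * deriv (rise k) (1 - y) * rise k y := by
  have h1 : HasDerivAt (fun y : ℝ => 1 - y) (-1) y := (hasDerivAt_id y).const_sub 1
  have h2 := (contDiff_rise k).differentiable (by norm_num) y |>.hasDerivAt
  have h3 : HasDerivAt (fun y => rise k (1 - y)) (deriv (rise k) (1 - y) * -1) y :=
    HasDerivAt.comp (h := fun y : ℝ => 1 - y) y
      ((contDiff_rise k).differentiable (by norm_num) (1 - y)).hasDerivAt h1
  have h : HasDerivAt (bumpMass k) _ y := h1.mul (h2.mul h3)
  rw [h.deriv]
  ring

end Cutoff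

/-! ### Approximate identities -/

section ApproxIdentity

/-- Each one-sided estimate compares `u` with a real constant near `z`, so an infinite value `u z`
is allowed. The weights have small support and their total mass only needs to tend to `1`. -/
theorem tendsto_integral_approxIdentity {E : Type*} [TopologicalSpace E] [MeasurableSpace E]
    {μ : Measure E} {S : Set E} (hS : MeasurableSet S) {z : E} {u : E → EReal} {w : ℕ → E → ℝ}
    (hu : ContinuousAt u z) (hufin : ∀ᵐ x ∂μ, x ∈ S → u x ≠ ⊥ ∧ u x ≠ ⊤)
    (hw0 : ∀ k, ∀ x ∈ S, 0 ≤ w k x) (hws : ∀ O ∈ 𝓝 z, ∀ᶠ k in atTop, ∀ x ∈ S, x ∉ O → w k x = 0)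
    (hwi : ∀ k, IntegrableOn (w k) S μ) (hw1 : Tendsto (fun k => ∫ x in S, w k x ∂μ) atTop (𝓝 1))
    (huw : ∀ k, IntegrableOn (fun x => (u x).toReal * w k x) S μ) :
    Tendsto (fun k => ((∫ x in S, (u x).toReal * w k x ∂μ : ℝ) : EReal)) atTop (𝓝 (u z)) := by
  rw [tendsto_order]
  constructor
  · intro a ha
    obtain ⟨p, hap, hpz⟩ := EReal.lt_iff_exists_real_btwn.mp ha
    -- Two constants `p < q` are needed: `q` bounds `u` on the support of the weights, and the gap
    -- to `p` absorbs the deviation of the total mass from `1`.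
    obtain ⟨q, hpq, hqz⟩ := EReal.lt_iff_exists_real_btwn.mp hpz
    have hpq' : p < q := by exact_mod_cast hpq
    have h1 : {x | (q : EReal) < u x} ∈ 𝓝 z := hu.eventually (lt_mem_nhds hqz)
    have h2 : Tendsto (fun k => q * ∫ x in S, w k x ∂μ) atTop (𝓝 q) := by
      simpa using hw1.const_mul q
    filter_upwards [hws _ h1, h2.eventually (lt_mem_nhds hpq')] with k hk hk2
    refine hap.trans (EReal.coe_lt_coe_iff.mpr (hk2.trans_le ?_))
    rw [← integral_const_mul]
    refine setIntegral_mono_ae_restrict ((hwi k).const_mul q) (huw k) ?_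
    filter_upwards [ae_restrict_mem hS, ae_restrict_of_ae hufin] with x hx hfin
    by_cases hxO : (q : EReal) < u x
    · refine mul_le_mul_of_nonneg_right ?_ (hw0 k x hx)
      rw [← EReal.coe_le_coe_iff, EReal.coe_toReal (hfin hx).2 (hfin hx).1]
      exact hxO.le
    · rw [hk x hx hxO]; simp
  · intro a ha
    obtain ⟨p, hzp, hpa⟩ := EReal.lt_iff_exists_real_btwn.mp ha
    obtain ⟨q, hzq, hqp⟩ := EReal.lt_iff_exists_real_btwn.mp hzp
    have hpq' : q < p := by exact_mod_cast hqp
    have h1 : {x | u x < (q : EReal)} ∈ 𝓝 z := hu.eventually (gt_mem_nhds hzq)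
    have h2 : Tendsto (fun k => q * ∫ x in S, w k x ∂μ) atTop (𝓝 q) := by
      simpa using hw1.const_mul q
    filter_upwards [hws _ h1, h2.eventually (gt_mem_nhds hpq')] with k hk hk2
    refine lt_trans (EReal.coe_lt_coe_iff.mpr (lt_of_le_of_lt ?_ hk2)) hpa
    rw [← integral_const_mul]
    refine setIntegral_mono_ae_restrict (huw k) ((hwi k).const_mul q) ?_
    filter_upwards [ae_restrict_mem hS, ae_restrict_of_ae hufin] with x hx hfin
    by_cases hxO : u x < (q : EReal)
    · refine mul_le_mul_of_nonneg_right ?_ (hw0 k x hx)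
      rw [← EReal.coe_le_coe_iff, EReal.coe_toReal (hfin hx).2 (hfin hx).1]
      exact hxO.le
    · rw [hk x hx hxO]; simp

end ApproxIdentity

/-! ### Relative volume with respect to a point -/

section RelVolAt

variable {n : ℕ} {r : ℝ} {a x : Cn n}

/-- The relative volume of the ball about `a` through `x`. -/
def relVolAt (r : ℝ) (a x : Cn n) : ℝ := relVol n r (1 - gap a x)

theorem continuousOn_relVolAt (ha : a ∈ unitBall n) : ContinuousOn (relVolAt r a) (unitBall n) := by
  intro x hx
  have hg := gap_pos ha hx
  have h1 : ContinuousAt (fun y => 1 - gap a y) x :=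
    continuousAt_const.sub (contDiffAt_gap ha hx).continuousAt
  exact (ContinuousAt.comp (f := fun y => 1 - gap a y)
    (contDiffAt_relVol (k := 0) (by linarith)).continuousAt h1).continuousWithinAt

theorem continuousOn_bergmanDensity : ContinuousOn (bergmanDensity (n := n)) (unitBall n) := by
  refine ContinuousOn.congr (f := fun z => 2 ^ n * n.factorial * ((n : ℝ) + 1) ^ n *
    (defFun z ^ (n + 1))⁻¹) ?_ fun x hx => bergmanDensity_eq hx
  exact continuousOn_const.mul (((contDiff_defFun (m := 0)).continuous.continuousOn.pow _).inv₀
    fun x hx => (pow_pos (defFun_pos hx) _).ne')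

theorem one_sub_gap_nonneg (ha : a ∈ unitBall n) (hx : x ∈ unitBall n) : 0 ≤ 1 - gap a x := by
  linarith [gap_le_one ha hx]

theorem one_sub_gap_lt_one (ha : a ∈ unitBall n) (hx : x ∈ unitBall n) : 1 - gap a x < 1 := by
  linarith [gap_pos ha hx]

theorem relVolAt_nonneg (hr0 : 0 < r) (hr1 : r < 1) (ha : a ∈ unitBall n) (hx : x ∈ unitBall n) :
    0 ≤ relVolAt r a x :=
  relVol_nonneg hr0 hr1 (one_sub_gap_nonneg ha hx) (one_sub_gap_lt_one ha hx)

theorem one_sub_gap_pos (ha : a ∈ unitBall n) (hx : x ∈ unitBall n) (hxa : x ≠ a) :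
    0 < 1 - gap a x := by
  rw [← norm_F_sq (norm_lt_one ha) (norm_lt_one hx).le]
  have : F a x ≠ 0 := fun h => hxa ((F_eq_zero_iff ha hx).mp h)
  positivity

theorem relVolAt_pos (hr0 : 0 < r) (hr1 : r < 1) (ha : a ∈ unitBall n) (hx : x ∈ unitBall n)
    (hxa : x ≠ a) : 0 < relVolAt r a x :=
  relVol_pos hr0 hr1 (one_sub_gap_pos ha hx hxa) (one_sub_gap_lt_one ha hx)

theorem relVolAt_lt_one (hn : 1 ≤ n) (hr0 : 0 < r) (hr1 : r < 1) (ha : a ∈ unitBall n)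
    (hx : x ∈ bgBall a r) : relVolAt r a x < 1 := by
  refine relVol_lt_one hn hr0 hr1 (one_sub_gap_nonneg ha hx.1) ?_
  rw [← norm_F_sq (norm_lt_one ha) (norm_lt_one hx.1).le]
  have := hx.2
  gcongr

theorem one_le_relVolAt (hr0 : 0 < r) (hr1 : r < 1) (ha : a ∈ unitBall n) (hx : x ∈ unitBall n)
    (hx2 : x ∉ bgBall a r) : 1 ≤ relVolAt r a x := by
  refine one_le_relVol hr0 hr1 ?_ (one_sub_gap_lt_one ha hx)
  rw [← norm_F_sq (norm_lt_one ha) (norm_lt_one hx).le]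
  have : r ≤ ‖F a x‖ := by
    by_contra! h
    exact hx2 ⟨hx, h⟩
  gcongr

/-- Small relative volume means small `|F_a(x)|`. Since `x = F_a(F_a(x))`, continuity of `F_a` at
`0` and `F_a(0) = a` force `x` to be near `a`. -/
theorem exists_relVolAt_lt (hr0 : 0 < r) (hr1 : r < 1) (ha : a ∈ unitBall n) {O : Set (Cn n)}
    (hO : O ∈ 𝓝 a) : ∃ ε > 0, ∀ x ∈ unitBall n, relVolAt r a x < ε → x ∈ O := by
  have h0 : F a 0 = a := by
    have := F_decomp (a := a) (α := 0) (b := 0) (by simp)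
    simpa using this
  have hB0 : (0 : Cn n) ∈ unitBall n := by simp [mem_unitBall_iff]
  have hc : ContinuousAt (F a) 0 := (continuousOn_F ha).continuousAt (isOpen_unitBall.mem_nhds hB0)
  obtain ⟨δ, hδ, hδO⟩ := Metric.mem_nhds_iff.mp (hc.preimage_mem_nhds (by rwa [h0]))
  set η := min δ (1 / 2) with hη
  have hη0 : 0 < η := by positivity
  have hη1 : η ^ 2 < 1 := by
    have : η ≤ 1 / 2 := min_le_right _ _
    nlinarith
  refine ⟨relVol n r (η ^ 2), relVol_pos hr0 hr1 (by positivity) hη1, fun x hx hlt => ?_⟩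
  have hF : ‖F a x‖ < η := by
    by_contra! h
    refine hlt.not_ge (relVol_mono hr0 hr1 (by positivity) ?_ (one_sub_gap_lt_one ha hx))
    rw [← norm_F_sq (norm_lt_one ha) (norm_lt_one hx).le]
    gcongr
  have : F a x ∈ Metric.ball (0 : Cn n) δ := by
    rw [mem_ball_zero_iff]; exact hF.trans_le (min_le_left _ _)
  have := hδO this
  rwa [mem_preimage, F_F (norm_lt_one ha) (norm_lt_one hx).le] at this

theorem integrableOn_bgBall_of_continuous (hr1 : r < 1) (ha : a ∈ unitBall n) {v : Cn n → ℝ}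
    (hv : LocallyIntegrableOn v (unitBall n)) {W : ℝ → ℝ} (hW : Continuous W) :
    IntegrableOn (fun x => v x * (W (relVolAt r a x) * bergmanDensity x)) (bgBall a r) := by
  have hK := isCompact_closedBgBall ha hr1
  have hKB := closedBgBall_subset ha hr1
  refine IntegrableOn.mono_set ?_ (bgBall_subset_closedBgBall ha)
  exact (hv.integrableOn_compact_subset hKB hK).mul_continuousOn
    ((hW.comp_continuousOn ((continuousOn_relVolAt ha).mono hKB)).mul
      (continuousOn_bergmanDensity.mono hKB)) hK

theorem locallyIntegrableOn_const (c : ℝ) : LocallyIntegrableOn (fun _ : Cn n => c) (unitBall n) :=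
  (continuous_const.locallyIntegrable).locallyIntegrableOn _

/-- The cutoff densities have total mass one. -/
theorem integral_deriv_rise (hn : 1 ≤ n) (hr0 : 0 < r) (hr1 : r < 1) (ha : a ∈ unitBall n) {k : ℕ}
    (hk : 1 ≤ k) : ∫ x in bgBall a r, deriv (rise k) (relVolAt r a x) * bergmanDensity x
      = V n r := by
  have h1 : ∀ y ∈ Metric.ball (0 : Cn n) r, deriv (rise k) (relVolAt r a (F a y)) * bergmanDensity y
      = deriv (rise k) (relVol n r (‖y‖ ^ 2)) * bergmanDensity y := by
    intro y hy
    have hyB : y ∈ unitBall n := Metric.ball_subset_ball hr1.le hy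
    rw [relVolAt, ← norm_F_sq (norm_lt_one ha) (norm_lt_one (F_mem_unitBall ha hyB)).le,
      F_F (norm_lt_one ha) (norm_lt_one hyB).le]
  rw [← F_image_ball ha hr1.le, setIntegral_image_F hn ha measurableSet_ball
    (Metric.ball_subset_ball hr1.le), setIntegral_congr_fun measurableSet_ball h1,
    integral_ball_relVol hn hr0 hr1 hr0 hr1 (H := rise k)
      (fun y => ((contDiff_rise k).differentiable (by norm_num) y).hasDerivAt)
      (continuous_deriv_rise k), relVol_sq hr0 hr1, V_eq hn hr0 hr1,
    rise_eq_one (y := 1), rise_eq_zero (y := 0) (by positivity)]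
  · ring
  · have : (1 : ℝ) ≤ k := by exact_mod_cast hk
    rw [div_le_one (by positivity)]; linarith

end RelVolAt

end BergmanBall
end

/-! ### The mean-value formula on Bergman–Green balls. -/

noncomputable section
namespace BergmanBall

/-! ### The Riesz formula -/

section Riesz

variable {n : ℕ} {r : ℝ} {z : Cn n}

theorem massKernel_mono {M N : ℝ → ℝ} (h : ∀ y, M y ≤ N y) (u : ℝ) :
    massKernel n r M u ≤ massKernel n r N u := by
  unfold massKernel greenKernel
  split_ifs with hu
  · have h1 := h (relVol n r u)
    have h2 : 0 ≤ 1 - u := by linarith [hu.2]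
    have h3 := hu.1
    have h4 := greenConst_pos n
    gcongr
  · rfl

theorem neg_profile_bumpMass_mono (hn : 1 ≤ n) (hr0 : 0 < r) (hr1 : r < 1) {k l : ℕ} (hkl : k ≤ l)
    (t : ℝ) : -profile n r (bumpMass k) t ≤ -profile n r (bumpMass l) t := by
  rcases le_or_gt (r ^ 2) t with h | h
  · rw [profile_eq_zero hr0 hr1 (fun y hy => bumpMass_eq_zero_of_ge hy) h,
      profile_eq_zero hr0 hr1 (fun y hy => bumpMass_eq_zero_of_ge hy) h]
  · have hr2 : r ^ 2 < 1 := by nlinarith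
    simp only [profile, neg_neg]
    exact intervalIntegral.integral_mono_on h.le
      (intervalIntegrable_massKernel hn (contDiff_bumpMass k) (δ := 1 / ((k : ℝ) + 1))
        (by positivity) (fun y hy => bumpMass_eq_zero_of_le hy) (h.trans hr2) hr2)
      (intervalIntegrable_massKernel hn (contDiff_bumpMass l) (δ := 1 / ((l : ℝ) + 1))
        (by positivity) (fun y hy => bumpMass_eq_zero_of_le hy) (h.trans hr2) hr2)
      fun u _ => massKernel_mono (bumpMass_mono hkl) u

theorem neg_profile_bumpMass_nonneg (hr0 : 0 < r) (hr1 : r < 1) (k : ℕ) (t : ℝ) :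
    0 ≤ -profile n r (bumpMass k) t := by
  rcases le_or_gt (r ^ 2) t with h | h
  · rw [profile_eq_zero hr0 hr1 (fun y hy => bumpMass_eq_zero_of_ge hy) h, neg_zero]
  · simp only [profile, neg_neg]
    refine intervalIntegral.integral_nonneg h.le fun u _ => ?_
    have : massKernel n r (fun _ => 0) u = 0 := by simp [massKernel]
    rw [← this]
    exact massKernel_mono (fun y => bumpMass_nonneg k y) u

/-- The kernel of the Riesz formula, as a function of `|F_z|²`; it is `-Γ_r`. -/
def rieszKernel (n : ℕ) (r t : ℝ) : ℝ≥0∞ := ⨆ k, ENNReal.ofReal (-profile n r (bumpMass k) t)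

/-- The density of the mass `bumpMass k` decomposes into an average, a point mass, and an error. -/
theorem tendsto_average (hn : 1 ≤ n) (hr0 : 0 < r) (hr1 : r < 1) (hz : z ∈ unitBall n)
    {v : Cn n → ℝ} (hv : LocallyIntegrableOn v (unitBall n)) :
    Tendsto (fun k : ℕ => ∫ x in bgBall z r, v x * ((rise k (relVolAt r z x) *
        rise k (1 - relVolAt r z x)) * bergmanDensity x)) atTop
      (𝓝 (∫ x in bgBall z r, v x * bergmanDensity x)) := by
  have : Nonempty (Fin n) := ⟨⟨0, hn⟩⟩
  have hS := (isOpen_bgBall (r := r) hz).measurableSet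
  have hc (k : ℕ) : Continuous fun y => rise k y * rise k (1 - y) :=
    (contDiff_rise k).continuous.mul
      ((contDiff_rise k).continuous.comp (continuous_const.sub continuous_id))
  refine tendsto_integral_of_dominated_convergence (fun x => |v x * (1 * bergmanDensity x)|)
    (fun k => (integrableOn_bgBall_of_continuous hr1 hz hv (hc k)).aestronglyMeasurable)
    (integrableOn_bgBall_of_continuous hr1 hz hv (W := fun _ => 1) continuous_const).abs ?_ ?_
  · intro k
    refine Eventually.of_forall fun x => ?_
    rw [Real.norm_eq_abs, abs_mul, abs_mul, abs_mul (v x), abs_mul (1 : ℝ), abs_one]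
    have h1 : |rise k (relVolAt r z x) * rise k (1 - relVolAt r z x)| ≤ 1 := by
      rw [abs_of_nonneg (mul_nonneg (rise_nonneg _ _) (rise_nonneg _ _))]
      exact mul_le_one₀ (rise_le_one _ _) (rise_nonneg _ _) (rise_le_one _ _)
    gcongr
  · have hne : ∀ᵐ x ∂(volume.restrict (bgBall z r)), x ≠ z :=
      ae_restrict_of_ae (Measure.ae_ne volume z)
    filter_upwards [ae_restrict_mem hS, hne] with x hx hxz
    have h1 := relVolAt_pos hr0 hr1 hz hx.1 hxz
    have h2 := relVolAt_lt_one hn hr0 hr1 hz hx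
    refine tendsto_const_nhds.congr' ?_
    filter_upwards [eventually_div_succ_lt 2 h1,
      eventually_div_succ_lt 2 (show 0 < 1 - relVolAt r z x by linarith)] with k hk1 hk2
    rw [rise_eq_one hk1.le, rise_eq_one hk2.le]
    ring

/-- The factor `s·rise_k'(s)` at `s = 1 - y` is bounded uniformly in `k` and vanishes for `s ≥
2/(k+1)`. Dominated convergence applies because the prefactor `1 - y` of `bumpMass` compensates the
steep cutoff. -/
theorem tendsto_error (hn : 1 ≤ n) (hr0 : 0 < r) (hr1 : r < 1) (hz : z ∈ unitBall n)
    {v : Cn n → ℝ} (hv : LocallyIntegrableOn v (unitBall n)) :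
    Tendsto (fun k : ℕ => ∫ x in bgBall z r, v x * (((1 - relVolAt r z x) *
        deriv (rise k) (1 - relVolAt r z x) * rise k (relVolAt r z x)) * bergmanDensity x)) atTop
      (𝓝 0) := by
  have hS := (isOpen_bgBall (r := r) hz).measurableSet
  obtain ⟨C, hC0, hC⟩ := exists_deriv_smoothTransition_le
  have hc (k : ℕ) : Continuous fun y => (1 - y) * deriv (rise k) (1 - y) * rise k y :=
    ((continuous_const.sub continuous_id).mul ((continuous_deriv_rise k).comp
      (continuous_const.sub continuous_id))).mul (contDiff_rise k).continuous
  have hbd (k : ℕ) {s : ℝ} (hs : 0 ≤ s) : |s * deriv (rise k) s| ≤ 2 * C := by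
    have hk : (0 : ℝ) < (k : ℝ) + 1 := by positivity
    by_cases h : 2 / ((k : ℝ) + 1) ≤ s
    · rw [deriv_rise_eq_zero h]; simp; positivity
    · rw [not_le, lt_div_iff₀ hk] at h
      rw [deriv_rise, ← mul_assoc, abs_mul, abs_of_nonneg (by positivity)]
      exact mul_le_mul h.le (hC _) (abs_nonneg _) (by norm_num)
  have := tendsto_integral_of_dominated_convergence (μ := volume.restrict (bgBall z r))
    (F := fun k x => v x * (((1 - relVolAt r z x) *
        deriv (rise k) (1 - relVolAt r z x) * rise k (relVolAt r z x)) * bergmanDensity x))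
    (f := fun _ => 0)
    (fun x => |v x * (2 * C * bergmanDensity x)|)
    (fun k => (integrableOn_bgBall_of_continuous hr1 hz hv (hc k)).aestronglyMeasurable)
    (integrableOn_bgBall_of_continuous hr1 hz hv (W := fun _ => 2 * C) continuous_const).abs ?_ ?_
  · simpa using this
  · intro k
    filter_upwards [ae_restrict_mem hS] with x hx
    have h2 := relVolAt_lt_one hn hr0 hr1 hz hx
    rw [Real.norm_eq_abs, abs_mul, abs_mul, abs_mul (v x), abs_mul (2 * C)]
    have h1 : |(1 - relVolAt r z x) * deriv (rise k) (1 - relVolAt r z x) *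
        rise k (relVolAt r z x)| ≤ |2 * C| := by
      rw [abs_mul, abs_of_nonneg (rise_nonneg _ _), abs_of_nonneg (show 0 ≤ 2 * C by positivity)]
      have := hbd k (show 0 ≤ 1 - relVolAt r z x by linarith)
      calc _ ≤ 2 * C * 1 := mul_le_mul this (rise_le_one _ _) (rise_nonneg _ _) (by positivity)
        _ = _ := mul_one _
    gcongr
  · filter_upwards [ae_restrict_mem hS] with x hx
    have h2 := relVolAt_lt_one hn hr0 hr1 hz hx
    refine tendsto_const_nhds.congr' ?_
    filter_upwards [eventually_div_succ_lt 2 (show 0 < 1 - relVolAt r z x by linarith)] with k hk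
    rw [deriv_rise_eq_zero hk.le]
    ring

/-- The weights differ from the exactly normalised `rise_k'/V_n(r)` by a factor lying between `1 -
2/(k+1)` and `1` on the support of `rise_k'` for large `k`, so they form an approximate identity at
`z`. -/
theorem tendsto_pointMass (hn : 1 ≤ n) (hr0 : 0 < r) (hr1 : r < 1) (hz : z ∈ unitBall n)
    {u : Cn n → EReal} (hv : LocallyIntegrableOn (fun x => (u x).toReal) (unitBall n))
    (hae : ∀ᵐ x, x ∈ unitBall n → u x ≠ ⊥ ∧ u x ≠ ⊤) (hu : ContinuousAt u z) :
    Tendsto (fun k : ℕ => (((V n r)⁻¹ * ∫ x in bgBall z r, (u x).toReal * (((1 - relVolAt r z x) *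
        rise k (1 - relVolAt r z x) * deriv (rise k) (relVolAt r z x)) * bergmanDensity x) : ℝ) :
        EReal)) atTop (𝓝 (u z)) := by
  have hS := (isOpen_bgBall (r := r) hz).measurableSet
  have hV := V_pos hn hr0 hr1
  have hc (k : ℕ) : Continuous fun y => (1 - y) * rise k (1 - y) * deriv (rise k) y :=
    ((continuous_const.sub continuous_id).mul ((contDiff_rise k).continuous.comp
      (continuous_const.sub continuous_id))).mul (continuous_deriv_rise k)
  set w : ℕ → Cn n → ℝ := fun k x => (V n r)⁻¹ * (((1 - relVolAt r z x) *
        rise k (1 - relVolAt r z x) * deriv (rise k) (relVolAt r z x)) * bergmanDensity x) with hw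
  set p : ℕ → Cn n → ℝ := fun k x =>
    (V n r)⁻¹ * (deriv (rise k) (relVolAt r z x) * bergmanDensity x) with hp
  have hwi (k : ℕ) : IntegrableOn (w k) (bgBall z r) := by
    have := (integrableOn_bgBall_of_continuous hr1 hz
      (locallyIntegrableOn_const 1) (hc k)).const_mul (V n r)⁻¹
    simpa only [one_mul] using! this
  have hpi (k : ℕ) : IntegrableOn (p k) (bgBall z r) := by
    have := (integrableOn_bgBall_of_continuous hr1 hz
      (locallyIntegrableOn_const 1) (continuous_deriv_rise k)).const_mul (V n r)⁻¹
    simpa only [one_mul] using! this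
  have hp1 : ∀ᶠ k in atTop, ∫ x in bgBall z r, p k x = 1 := by
    filter_upwards [eventually_ge_atTop 1] with k hk
    rw [hp]
    simp only
    rw [integral_const_mul, integral_deriv_rise hn hr0 hr1 hz hk, inv_mul_cancel₀ hV.ne']
  have key := tendsto_integral_approxIdentity hS (w := w) hu
    (hae.mono fun x hx hxS => hx hxS.1) ?_ ?_ hwi ?_ ?_
  · refine key.congr fun k => ?_
    rw [← integral_const_mul]
    congr 2
    ext x
    simp only [hw]
    ring
  · intro k x hx
    have h2 := relVolAt_lt_one hn hr0 hr1 hz hx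
    have h3 := rise_nonneg k (1 - relVolAt r z x)
    have h4 := deriv_rise_nonneg k (relVolAt r z x)
    have h5 := (bergmanDensity_pos x).le
    have h6 : 0 ≤ 1 - relVolAt r z x := by linarith
    simp only [hw]
    positivity
  · intro O hO
    obtain ⟨ε, hε, hεO⟩ := exists_relVolAt_lt hr0 hr1 hz hO
    filter_upwards [eventually_div_succ_lt 2 hε] with k hk x hx hxO
    have : ε ≤ relVolAt r z x := by
      by_contra! h
      exact hxO (hεO x hx.1 h)
    simp [hw, deriv_rise_eq_zero (hk.le.trans this)]
  · have hlow : Tendsto (fun k : ℕ => 1 - 2 / ((k : ℝ) + 1)) atTop (𝓝 1) := by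
      simpa using (tendsto_div_succ 2).const_sub 1
    refine tendsto_of_tendsto_of_tendsto_of_le_of_le' hlow tendsto_const_nhds ?_ ?_
    · filter_upwards [hp1, eventually_ge_atTop 3] with k hk hk3
      calc 1 - 2 / ((k : ℝ) + 1) = ∫ x in bgBall z r, (1 - 2 / ((k : ℝ) + 1)) * p k x := by
            rw [integral_const_mul, hk, mul_one]
        _ ≤ _ := by
            refine setIntegral_mono_on ((hpi k).const_mul _) (hwi k) hS fun x hx => ?_
            by_cases h : 2 / ((k : ℝ) + 1) ≤ relVolAt r z x
            · simp [hw, hp, deriv_rise_eq_zero h]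
            · rw [not_le] at h
              -- From `k ≥ 3` one gets `2/(k+1) ≤ 1/2`. The two transition regions of `bumpMass` are
              -- then separated, and the outer cutoff equals `1` on the support of the inner
              -- derivative.
              have hk4 : (4 : ℝ) ≤ (k : ℝ) + 1 := by
                have : (3 : ℝ) ≤ k := by exact_mod_cast hk3
                linarith
              have h1 : 2 / ((k : ℝ) + 1) ≤ 1 / 2 := by
                rw [div_le_div_iff₀ (by positivity) (by norm_num)]; linarith
              have h2 : rise k (1 - relVolAt r z x) = 1 := rise_eq_one (by linarith)
              have h4 := deriv_rise_nonneg k (relVolAt r z x)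
              have h5 := (bergmanDensity_pos x).le
              have h6 := (inv_pos.mpr hV).le
              simp only [hw, hp, h2, mul_one]
              have : 1 - 2 / ((k : ℝ) + 1) ≤ 1 - relVolAt r z x := by linarith
              calc _ ≤ (1 - relVolAt r z x) *
                    ((V n r)⁻¹ * (deriv (rise k) (relVolAt r z x) * bergmanDensity x)) := by gcongr
                _ = _ := by ring
    · filter_upwards [hp1] with k hk
      rw [← hk]
      refine setIntegral_mono_on (hwi k) (hpi k) hS fun x hx => ?_
      have h0 := relVolAt_nonneg hr0 hr1 hz hx.1
      have h2 := relVolAt_lt_one hn hr0 hr1 hz hx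
      have h3 := rise_nonneg k (1 - relVolAt r z x)
      have h3' := rise_le_one k (1 - relVolAt r z x)
      have h4 := deriv_rise_nonneg k (relVolAt r z x)
      have h5 := (bergmanDensity_pos x).le
      have h6 := (inv_pos.mpr hV).le
      have : (1 - relVolAt r z x) * rise k (1 - relVolAt r z x) ≤ 1 :=
        mul_le_one₀ (by linarith) h3 h3'
      simp only [hw, hp]
      calc _ ≤ (V n r)⁻¹ * (1 * deriv (rise k) (relVolAt r z x) * bergmanDensity x) := by gcongr
        _ = _ := by ring
  · intro k
    have := (integrableOn_bgBall_of_continuous hr1 hz hv (hc k)).const_mul (V n r)⁻¹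
    refine this.congr (Eventually.of_forall fun x => ?_)
    simp only [hw]
    ring

/-- The Riesz formula for `u` on the ball `E(z,r)`. -/
theorem lintegral_rieszKernel (hn : 1 ≤ n) (hr0 : 0 < r) (hr1 : r < 1) (hz : z ∈ unitBall n)
    {u : Cn n → EReal} {μ : Measure (Cn n)}
    (hv : LocallyIntegrableOn (fun x => (u x).toReal) (unitBall n))
    (hfin : ∀ K ⊆ unitBall n, IsCompact K → μ K < ⊤)
    (hpair : ∀ φ : Cn n → ℝ, IsTestFunction φ →
      ∫ x, φ x ∂μ = ∫ x in unitBall n, (u x).toReal * lapDensity φ x)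
    (hae : ∀ᵐ x, x ∈ unitBall n → u x ≠ ⊥ ∧ u x ≠ ⊤) (hu : ContinuousAt u z) :
    ((∫⁻ x in unitBall n, rieszKernel n r (1 - gap z x) ∂μ : ℝ≥0∞) : EReal)
      = (((V n r)⁻¹ * ∫ x in bgBall z r, (u x).toReal * bergmanDensity x : ℝ) : EReal) - u z := by
  have hS := (isOpen_bgBall (r := r) hz).measurableSet
  have hV := V_pos hn hr0 hr1
  have hδ (k : ℕ) : 0 < 1 / ((k : ℝ) + 1) := by positivity
  have htest (k : ℕ) : IsTestFunction (fun x => profile n r (bumpMass k) (1 - gap z x)) :=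
    isTestFunction_profile hn hr0 hr1 hz (contDiff_bumpMass k) (hδ k)
      (fun y hy => bumpMass_eq_zero_of_le hy) (fun y hy => bumpMass_eq_zero_of_ge hy)
  set A : ℕ → ℝ := fun k => ∫ x, -profile n r (bumpMass k) (1 - gap z x) ∂μ with hA
  have hA0 (k : ℕ) : 0 ≤ A k := integral_nonneg fun x => neg_profile_bumpMass_nonneg hr0 hr1 k _
  have hint (k : ℕ) : Integrable (fun x => -profile n r (bumpMass k) (1 - gap z x)) μ := by
    refine Integrable.neg ?_
    rw [← integrableOn_iff_integrable_of_support_subset (subset_tsupport _)]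
    exact (htest k).1.continuous.continuousOn.integrableOn_of_subset_isCompact (htest k).2.1
      (isClosed_tsupport _).measurableSet (Subset.refl _) (hfin _ (htest k).2.2 (htest k).2.1).ne
  -- First evaluation of the limit, on the side of `μ`: the test functions `-profile` increase with
  -- `k`, and their supremum is the kernel.
  have hlim1 : Tendsto (fun k => ((A k : ℝ) : EReal)) atTop
      (𝓝 ((∫⁻ x in unitBall n, rieszKernel n r (1 - gap z x) ∂μ : ℝ≥0∞) : EReal)) := by
    have h1 (k : ℕ) : ((A k : ℝ) : EReal) = ((∫⁻ x in unitBall n,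
        ENNReal.ofReal (-profile n r (bumpMass k) (1 - gap z x)) ∂μ : ℝ≥0∞) : EReal) := by
      rw [setLIntegral_eq_of_support_subset, ← ofReal_integral_eq_lintegral_ofReal (hint k)
        (Eventually.of_forall fun x => neg_profile_bumpMass_nonneg hr0 hr1 k _),
        EReal.coe_ennreal_ofReal, max_eq_left (hA0 k)]
      intro x hx
      by_contra h
      refine hx ?_
      have : x ∉ tsupport fun x => profile n r (bumpMass k) (1 - gap z x) :=
        fun h' => h ((htest k).2.2 h')
      have := image_eq_zero_of_notMem_tsupport this
      simp [this]
    simp only [h1]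
    refine (continuous_coe_ennreal_ereal.tendsto _).comp ?_
    unfold rieszKernel
    have hmeas (k : ℕ) : Measurable fun x : Cn n =>
        ENNReal.ofReal (-profile n r (bumpMass k) (1 - gap z x)) :=
      ((htest k).1.continuous.measurable.neg).ennreal_ofReal
    rw [lintegral_iSup hmeas
      (fun k l hkl x => ENNReal.ofReal_le_ofReal (neg_profile_bumpMass_mono hn hr0 hr1 hkl _))]
    exact tendsto_atTop_iSup fun k l hkl => lintegral_mono fun x =>
      ENNReal.ofReal_le_ofReal (neg_profile_bumpMass_mono hn hr0 hr1 hkl _)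
  -- Second evaluation, on the side of `u`: the pairing turns the potential into its mass density,
  -- which vanishes off `E(z,r)` and splits into the three terms of `deriv_bumpMass`.
  have hAk (k : ℕ) : A k = (V n r)⁻¹ * (∫ x in bgBall z r, (u x).toReal *
        ((rise k (relVolAt r z x) * rise k (1 - relVolAt r z x)) * bergmanDensity x))
      + (V n r)⁻¹ * (∫ x in bgBall z r, (u x).toReal * (((1 - relVolAt r z x) *
        deriv (rise k) (1 - relVolAt r z x) * rise k (relVolAt r z x)) * bergmanDensity x))
      - (V n r)⁻¹ * ∫ x in bgBall z r, (u x).toReal * (((1 - relVolAt r z x) *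
        rise k (1 - relVolAt r z x) * deriv (rise k) (relVolAt r z x)) * bergmanDensity x) := by
    have hcr : Continuous (rise k) := (contDiff_rise k).continuous
    have hcr1 : Continuous fun y => rise k (1 - y) := hcr.comp (continuous_const.sub continuous_id)
    have hcd := continuous_deriv_rise k
    have hcd1 : Continuous fun y => deriv (rise k) (1 - y) :=
      hcd.comp (continuous_const.sub continuous_id)
    have hcs : Continuous fun y : ℝ => 1 - y := continuous_const.sub continuous_id
    have i1 := integrableOn_bgBall_of_continuous hr1 hz hv (hcr.mul hcr1)
    have i2 := integrableOn_bgBall_of_continuous hr1 hz hv ((hcs.mul hcd1).mul hcr)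
    have i3 := integrableOn_bgBall_of_continuous hr1 hz hv ((hcs.mul hcr1).mul hcd)
    rw [← mul_add, ← mul_sub]
    simp only [Pi.mul_apply] at i1 i2 i3
    have i12 := i1.add i2
    simp only [Pi.add_def] at i12
    rw [← integral_add i1 i2, ← integral_sub i12 i3, ← integral_const_mul, hA]
    simp only
    rw [integral_neg, hpair _ (htest k), ← integral_neg,
      setIntegral_eq_of_subset_of_forall_sdiff_eq_zero isOpen_unitBall.measurableSet
        (s := bgBall z r) (fun x hx => hx.1)]
    · refine setIntegral_congr_fun hS fun x hx => ?_
      rw [lapDensity_profile hn hr0 hr1 hz hx.1 (contDiff_bumpMass k) (hδ k)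
        (fun y hy => bumpMass_eq_zero_of_le hy), deriv_bumpMass, relVolAt]
      ring
    · intro x hx
      rw [lapDensity_profile hn hr0 hr1 hz hx.1 (contDiff_bumpMass k) (hδ k)
        (fun y hy => bumpMass_eq_zero_of_le hy),
        show relVol n r (1 - gap z x) = relVolAt r z x from rfl,
        deriv_bumpMass_eq_zero (one_le_relVolAt hr0 hr1 hz hx.1 hx.2)]
      ring
  have hlim2 : Tendsto (fun k => ((A k : ℝ) : EReal)) atTop
      (𝓝 ((((V n r)⁻¹ * ∫ x in bgBall z r, (u x).toReal * bergmanDensity x : ℝ) : EReal) - u z)) := by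
    have t1 := ((tendsto_average hn hr0 hr1 hz hv).const_mul (V n r)⁻¹).add
      ((tendsto_error hn hr0 hr1 hz hv).const_mul (V n r)⁻¹)
    rw [mul_zero, add_zero] at t1
    have t1' := (continuous_coe_real_ereal.tendsto _).comp t1
    have t2 := tendsto_pointMass hn hr0 hr1 hz hv hae hu
    have t2' := (continuous_neg.tendsto (u z)).comp t2
    -- Addition of extended reals is continuous here because the limit of the averages is a real
    -- number, even when `u z` is infinite.
    have t3 := (EReal.continuousAt_add (p := (((((V n r)⁻¹ *
      ∫ x in bgBall z r, (u x).toReal * bergmanDensity x : ℝ) : EReal)), -u z))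
      (Or.inl (EReal.coe_ne_top _)) (Or.inl (EReal.coe_ne_bot _))).tendsto.comp
        (t1'.prodMk_nhds t2')
    rw [sub_eq_add_neg]
    refine t3.congr fun k => ?_
    simp only [Function.comp_apply]
    rw [hAk k, EReal.coe_sub, sub_eq_add_neg]
  exact tendsto_nhds_unique hlim1 hlim2

end Riesz

end BergmanBall
end

noncomputable section
namespace BergmanBall

/-! ### The Green's function -/

section GreenProfile

variable {n : ℕ}

theorem continuousOn_greenKernel : ContinuousOn (greenKernel n) (Ioi 0) :=
  ((continuous_const.sub continuous_id).pow _).continuousOn.div (continuous_pow n).continuousOn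
    fun _ hu => pow_ne_zero _ (ne_of_gt hu)

theorem greenKernel_nonneg {u : ℝ} (h0 : 0 ≤ u) (h1 : u ≤ 1) : 0 ≤ greenKernel n u := by
  have : 0 ≤ 1 - u := by linarith
  unfold greenKernel; positivity

theorem intervalIntegrable_greenKernel {s t : ℝ} (hs : 0 < s) (ht : 0 < t) :
    IntervalIntegrable (greenKernel n) volume s t :=
  (continuousOn_greenKernel.mono fun _ hu =>
    (lt_min hs ht).trans_le (mem_Icc.mp hu).1).intervalIntegrable

/-- The Green profile as a real function on `(0,1]`. -/
def greenReal (n : ℕ) (t : ℝ) : ℝ := greenConst n * ∫ u in t..1, greenKernel n u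

theorem greenReal_nonneg {t : ℝ} (h0 : 0 < t) (h1 : t ≤ 1) : 0 ≤ greenReal n t :=
  mul_nonneg (greenConst_pos n).le (intervalIntegral.integral_nonneg h1 fun _ hu =>
    greenKernel_nonneg (h0.le.trans hu.1) hu.2)

theorem greenProfile_eq {t : ℝ} (h0 : 0 < t) (h1 : t ≤ 1) :
    greenProfile n t = ENNReal.ofReal (greenReal n t) := by
  have e : ∫⁻ u in Ioo t 1, ENNReal.ofReal ((1 - u) ^ (n - 1) / u ^ n)
      = ENNReal.ofReal (∫ u in t..1, greenKernel n u) := by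
    rw [intervalIntegral.integral_of_le h1, ← restrict_Ioo_eq_restrict_Ioc,
      ofReal_integral_eq_lintegral_ofReal]
    · rfl
    · exact ((intervalIntegrable_iff_integrableOn_Ioo_of_le h1).mp
        (intervalIntegrable_greenKernel h0 one_pos))
    · filter_upwards [ae_restrict_mem measurableSet_Ioo] with u hu
      exact greenKernel_nonneg (h0.le.trans hu.1.le) hu.2.le
  rw [greenProfile, e, greenReal, ENNReal.ofReal_mul (greenConst_pos n).le]
  rfl

theorem greenProfile_antitone : Antitone (greenProfile n) := fun s t hst => by
  unfold greenProfile
  gcongr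

theorem greenProfile_of_one_le {t : ℝ} (h : 1 ≤ t) : greenProfile n t = 0 := by
  simp [greenProfile, Ioo_eq_empty (not_lt.mpr h)]

theorem continuousAt_greenProfile {t : ℝ} (h0 : 0 < t) : ContinuousAt (greenProfile n) t := by
  have e : greenProfile n =ᶠ[𝓝 t] fun s => ENNReal.ofReal (greenReal n (min s 1)) := by
    filter_upwards [Ioi_mem_nhds h0] with s hs
    rcases le_total s 1 with h | h
    · rw [min_eq_left h, greenProfile_eq hs h]
    · rw [min_eq_right h, greenProfile_of_one_le h, greenReal]
      simp
  refine ContinuousAt.congr ?_ e.symm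
  refine ENNReal.continuous_ofReal.continuousAt.comp (continuousAt_const.mul ?_)
  have hm : 0 < min t 1 := lt_min h0 one_pos
  have : ContinuousAt (fun s => ∫ u in s..1, greenKernel n u) (min t 1) :=
    (intervalIntegral.integral_hasDerivAt_left (intervalIntegrable_greenKernel hm one_pos)
      (continuousOn_greenKernel.stronglyMeasurableAtFilter isOpen_Ioi _ hm)
      (continuousOn_greenKernel.continuousAt (Ioi_mem_nhds hm))).continuousAt
  exact ContinuousAt.comp (f := fun s : ℝ => min s 1) (x := t) this
    (continuous_id.min continuous_const).continuousAt

/-- Monotone exhaustion of the interval gives continuity up to the pole in `ℝ≥0∞`. Hence the Green's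
function is continuous at its pole as an extended real function, as the mean-value formula requires.
-/
theorem tendsto_greenProfile_zero : Tendsto (greenProfile n) (𝓝[≥] 0) (𝓝 (greenProfile n 0)) := by
  have hsup : greenProfile n 0 = ⨆ k : ℕ, greenProfile n (1 / ((k : ℝ) + 1)) := by
    have hU : Ioo (0 : ℝ) 1 = ⋃ k : ℕ, Ioo (1 / ((k : ℝ) + 1)) 1 := by
      ext u
      simp only [mem_Ioo, mem_iUnion]
      constructor
      · intro hu
        obtain ⟨k, hk⟩ := exists_nat_one_div_lt hu.1
        exact ⟨k, hk, hu.2⟩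
      · rintro ⟨k, hk, hu⟩
        exact ⟨lt_trans (by positivity) hk, hu⟩
    have hmono : Monotone fun k : ℕ => Ioo (1 / ((k : ℝ) + 1)) 1 := fun k l hkl =>
      Ioo_subset_Ioo_left (by gcongr)
    unfold greenProfile
    rw [hU, setLIntegral_iUnion_of_directed _ hmono.directed_le, ENNReal.mul_iSup]
  rw [tendsto_order]
  constructor
  · intro c hc
    rw [hsup, lt_iSup_iff] at hc
    obtain ⟨k, hk⟩ := hc
    filter_upwards [mem_nhdsWithin_of_mem_nhds (Iio_mem_nhds
      (show (0 : ℝ) < 1 / ((k : ℝ) + 1) by positivity))] with t ht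
    exact hk.trans_le (greenProfile_antitone (le_of_lt ht))
  · intro c hc
    filter_upwards [self_mem_nhdsWithin] with t ht
    exact (greenProfile_antitone ht).trans_lt hc

/-- For `u ≥ y²` one has `y^{2n-1} u^{-n} ≤ u^{-1/2}`, whose integral over `(0,1)` is `2`. The polar
weight `y^{2n-1}` thus compensates the pole, and `G_B` is locally integrable. -/
theorem greenReal_sq_le (hn : 1 ≤ n) {y : ℝ} (h0 : 0 < y) (h1 : y < 1) :
    y ^ (2 * n - 1) * greenReal n (y ^ 2) ≤ 2 * greenConst n := by
  have hy2 : y ^ 2 ≤ 1 := by nlinarith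
  have hc := greenConst_pos n
  have hd (u : ℝ) (hu : u ∈ uIcc (y ^ 2) 1) :
      HasDerivAt (fun u => 2 * √u) ((√u)⁻¹) u := by
    rw [uIcc_of_le hy2] at hu
    have hu0 : u ≠ 0 := (lt_of_lt_of_le (by positivity) hu.1).ne'
    have := (Real.hasDerivAt_sqrt hu0).const_mul 2
    refine this.congr_deriv ?_
    rw [one_div, mul_inv, ← mul_assoc, mul_inv_cancel₀ two_ne_zero, one_mul]
  have hcont : ContinuousOn (fun u : ℝ => (√u)⁻¹) (uIcc (y ^ 2) 1) := by
    refine Real.continuous_sqrt.continuousOn.inv₀ fun u hu => ?_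
    rw [uIcc_of_le hy2] at hu
    exact (Real.sqrt_pos.mpr (lt_of_lt_of_le (by positivity) hu.1)).ne'
  have hint : ∫ u in y ^ 2..1, (√u)⁻¹ ≤ 2 := by
    rw [intervalIntegral.integral_eq_sub_of_hasDerivAt hd hcont.intervalIntegrable]
    have := Real.sqrt_nonneg (y ^ 2)
    rw [Real.sqrt_one]; linarith
  have key : ∫ u in y ^ 2..1, y ^ (2 * n - 1) * greenKernel n u ≤ ∫ u in y ^ 2..1, (√u)⁻¹ := by
    refine intervalIntegral.integral_mono_on hy2
      ((intervalIntegrable_greenKernel (by positivity) one_pos).const_mul _)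
      hcont.intervalIntegrable fun u hu => ?_
    have hu0 : 0 < u := lt_of_lt_of_le (by positivity) hu.1
    have hs : 0 < √u := Real.sqrt_pos.mpr hu0
    have hys : y ≤ √u := Real.le_sqrt_of_sq_le hu.1
    have h2 : (1 - u) ^ (n - 1) ≤ 1 := pow_le_one₀ (by linarith [hu.2]) (by linarith)
    have h3 : y ^ (2 * n - 1) ≤ √u ^ (2 * n - 1) := by gcongr
    have h4 : u ^ n = √u ^ (2 * n - 1) * √u := by
      rw [← pow_succ, show 2 * n - 1 + 1 = 2 * n by omega, pow_mul, Real.sq_sqrt hu0.le]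
    have h5 : 0 ≤ (1 - u) ^ (n - 1) := pow_nonneg (by linarith [hu.2]) _
    rw [greenKernel, h4, ← mul_div_assoc, div_le_iff₀ (by positivity),
      mul_comm (√u ^ (2 * n - 1)), inv_mul_cancel_left₀ hs.ne']
    calc _ ≤ √u ^ (2 * n - 1) * 1 := by gcongr
      _ = _ := mul_one _
  rw [intervalIntegral.integral_const_mul] at key
  unfold greenReal
  nlinarith

/-- Since `rise k ≤ 1`, the smoothed potentials are dominated, uniformly in `k`, by the Green's
function itself plus a constant. -/
theorem profile_rise_bound {r : ℝ} (hr0 : 0 < r) (hr1 : r < 1) (hn : 1 ≤ n) {t : ℝ} (h0 : 0 < t)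
    (h1 : t < 1) (k : ℕ) : |profile n r (rise k) t| ≤ greenReal n t + greenReal n (r ^ 2) := by
  have hr2 : r ^ 2 < 1 := by nlinarith
  have hr2' : 0 < r ^ 2 := by positivity
  have hc := greenConst_pos n
  have hM (u : ℝ) (hu : 0 < u) (hu1 : u < 1) : |massKernel n r (rise k) u|
      ≤ greenConst n * greenKernel n u := by
    rw [massKernel, if_pos ⟨hu, hu1⟩, abs_of_nonneg]
    · have := rise_le_one k (relVol n r u)
      have := greenKernel_nonneg (n := n) hu.le hu1.le
      calc _ ≤ greenConst n * (1 * greenKernel n u) := by gcongr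
        _ = _ := by rw [one_mul]
    · exact mul_nonneg hc.le (mul_nonneg (rise_nonneg _ _) (greenKernel_nonneg hu.le hu1.le))
  have hle {s t : ℝ} (hs : 0 < s) (hst : s ≤ t) (ht : t < 1) :
      |∫ u in s..t, massKernel n r (rise k) u| ≤ greenReal n s := by
    refine (intervalIntegral.abs_integral_le_integral_abs hst).trans ?_
    have i1 := intervalIntegrable_massKernel (r := r) hn (contDiff_rise k) (δ := 1 / ((k : ℝ) + 1))
      (by positivity) (fun y hy => rise_eq_zero hy) (hst.trans_lt ht) ht
    have ht0 := hs.trans_le hst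
    calc _ ≤ ∫ u in s..t, greenConst n * greenKernel n u :=
          intervalIntegral.integral_mono_on hst i1.abs
            ((intervalIntegrable_greenKernel hs ht0).const_mul _)
            fun u hu => hM u (hs.trans_le hu.1) (hu.2.trans_lt ht)
      _ ≤ greenReal n s := by
          rw [intervalIntegral.integral_const_mul, greenReal,
            ← intervalIntegral.integral_add_adjacent_intervals
              (intervalIntegrable_greenKernel hs ht0) (intervalIntegrable_greenKernel ht0 one_pos)]
          have : 0 ≤ ∫ u in t..1, greenKernel n u := intervalIntegral.integral_nonneg ht.le
            fun u hu => greenKernel_nonneg (ht0.le.trans hu.1) hu.2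
          gcongr
          linarith
  have g1 := greenReal_nonneg (n := n) h0 h1.le
  have g2 := greenReal_nonneg (n := n) hr2' hr2.le
  rw [profile, abs_neg]
  rcases le_total t (r ^ 2) with h | h
  · linarith [hle h0 h hr2]
  · rw [intervalIntegral.integral_symm, abs_neg]
    linarith [hle hr2' h h1]

/-- At a fixed `t > 0` the sequence is eventually constant: for large `k` the cutoff is `1` between
`t` and `r²`. -/
theorem tendsto_profile_rise {r : ℝ} (hr0 : 0 < r) (hr1 : r < 1) {t : ℝ} (h0 : 0 < t)
    (h1 : t < 1) : Tendsto (fun k => profile n r (rise k) t) atTop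
      (𝓝 (greenReal n (r ^ 2) - greenReal n t)) := by
  have hr2 : r ^ 2 < 1 := by nlinarith
  have hr2' : 0 < r ^ 2 := by positivity
  have hm : 0 < min t (r ^ 2) := lt_min h0 hr2'
  refine tendsto_const_nhds.congr' ?_
  filter_upwards [eventually_div_succ_lt 2 (relVol_pos (n := n) hr0 hr1 hm
    ((min_le_left _ _).trans_lt h1))] with k hk
  have e : ∫ u in t..r ^ 2, massKernel n r (rise k) u
      = ∫ u in t..r ^ 2, greenConst n * greenKernel n u := by
    refine intervalIntegral.integral_congr fun u hu => ?_
    have hu0 := hm.trans_le hu.1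
    have hu1 : u < 1 := hu.2.trans_lt (max_lt h1 hr2)
    rw [massKernel, if_pos ⟨hu0, hu1⟩,
      rise_eq_one (hk.le.trans (relVol_mono hr0 hr1 hm.le hu.1 hu1)), one_mul]
  rw [profile, e, intervalIntegral.integral_const_mul, greenReal, greenReal,
    ← intervalIntegral.integral_add_adjacent_intervals
      (intervalIntegrable_greenKernel h0 hr2') (intervalIntegrable_greenKernel hr2' one_pos)]
  ring

end GreenProfile

/-! ### The Green's function: continuity, boundary values, distributional Laplacian. -/

section Green

variable {n : ℕ} {a : Cn n}

theorem green_eq (ha : a ∈ unitBall n) {x : Cn n} (hx : x ∈ unitBall n) :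
    green x a = -((greenProfile n (1 - gap a x) : ℝ≥0∞) : EReal) := by
  rw [green, norm_F_sq (norm_lt_one ha) (norm_lt_one hx).le]

theorem toReal_green_eq (ha : a ∈ unitBall n) {x : Cn n} (hx : x ∈ unitBall n) (hxa : x ≠ a) :
    (green x a).toReal = -greenReal n (1 - gap a x) := by
  have h0 := one_sub_gap_pos ha hx hxa
  have h1 := (one_sub_gap_lt_one ha hx).le
  rw [green_eq ha hx, EReal.toReal_neg_eq, EReal.toReal_coe_ennreal, greenProfile_eq h0 h1,
    ENNReal.toReal_ofReal (greenReal_nonneg h0 h1)]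

theorem continuousAt_gap {x : Cn n} (ha : a ∈ unitBall n) (hx : ‖x‖ ≤ 1) :
    ContinuousAt (gap a) x := by
  unfold gap
  refine ContinuousAt.div (continuousAt_const.mul (contDiff_defFun (m := 0)).continuous.continuousAt)
    (by fun_prop) (pow_ne_zero _ (norm_ne_zero_iff.mpr
      (one_sub_inner_ne_zero (norm_lt_one ha) hx)))

theorem continuousAt_green (ha : a ∈ unitBall n) {x : Cn n} (hx : x ∈ unitBall n) :
    ContinuousAt (fun y => green y a) x := by
  have e : (fun y => green y a) =ᶠ[𝓝 x] fun y => -((greenProfile n (1 - gap a y) : ℝ≥0∞) : EReal) :=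
    by filter_upwards [isOpen_unitBall.mem_nhds hx] with y hy using green_eq ha hy
  refine ContinuousAt.congr ?_ e.symm
  refine continuous_neg.continuousAt.comp (continuous_coe_ennreal_ereal.continuousAt.comp ?_)
  have hg : ContinuousAt (fun y => 1 - gap a y) x :=
    continuousAt_const.sub (continuousAt_gap ha (norm_lt_one hx).le)
  by_cases h : x = a
  · subst h
    have h0 : 1 - gap x x = 0 := by
      rw [← norm_F_sq (norm_lt_one hx) (norm_lt_one hx).le, (F_eq_zero_iff ha hx).mpr rfl]
      simp
    have : Tendsto (fun y => 1 - gap x y) (𝓝 x) (𝓝[≥] 0) := by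
      refine tendsto_nhdsWithin_iff.mpr ⟨by simpa only [h0] using hg.tendsto, ?_⟩
      filter_upwards [isOpen_unitBall.mem_nhds hx] with y hy using one_sub_gap_nonneg ha hy
    have := (tendsto_greenProfile_zero (n := n)).comp this
    rw [← h0] at this
    exact this
  · exact ContinuousAt.comp (f := fun y => 1 - gap a y) (x := x)
      (continuousAt_greenProfile (one_sub_gap_pos ha hx h)) hg

theorem green_ne (ha : a ∈ unitBall n) {x : Cn n} (hx : x ∈ unitBall n) (hxa : x ≠ a) :
    green x a ≠ ⊥ ∧ green x a ≠ ⊤ := by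
  rw [green_eq ha hx, greenProfile_eq (one_sub_gap_pos ha hx hxa) (one_sub_gap_lt_one ha hx).le,
    EReal.coe_ennreal_ofReal, ← EReal.coe_neg]
  exact ⟨EReal.coe_ne_bot _, EReal.coe_ne_top _⟩

theorem tendsto_green_boundary (ha : a ∈ unitBall n) {ξ : Cn n} (hξ : ‖ξ‖ = 1) :
    Tendsto (fun y => green y a) (𝓝[unitBall n] ξ) (𝓝 0) := by
  have e : (fun y => green y a) =ᶠ[𝓝[unitBall n] ξ]
      fun y => -((greenProfile n (1 - gap a y) : ℝ≥0∞) : EReal) := by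
    filter_upwards [self_mem_nhdsWithin] with y hy using green_eq ha hy
  refine Tendsto.congr' e.symm ?_
  have hg : Tendsto (fun y => 1 - gap a y) (𝓝[unitBall n] ξ) (𝓝 1) := by
    have := ((continuousAt_gap ha hξ.le).tendsto.const_sub 1).mono_left
      (nhdsWithin_le_nhds (s := unitBall n))
    have h0 : gap a ξ = 0 := by simp [gap, defFun, hξ]
    simpa [h0] using this
  have := (continuous_neg.tendsto _).comp ((continuous_coe_ennreal_ereal.tendsto _).comp
    ((continuousAt_greenProfile (n := n) one_pos).tendsto.comp hg))
  rw [greenProfile_of_one_le le_rfl, EReal.coe_ennreal_zero, neg_zero] at this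
  exact this

theorem integrableOn_greenProfile (hn : 1 ≤ n) {ρ : ℝ} (hρ : ρ < 1) :
    IntegrableOn (fun x : Cn n => (greenProfile n (‖x‖ ^ 2)).toReal) (Metric.ball 0 ρ) := by
  have : Nonempty (Fin n) := ⟨⟨0, hn⟩⟩
  refine (integrableOn_fun_norm_addHaar volume
    (f := fun y : ℝ => (greenProfile n (y ^ 2)).toReal)).mpr ?_
  rw [finrank_Cn]
  refine Integrable.mono' (g := fun _ => 2 * greenConst n)
    (integrableOn_const (by simp)) ?_ ?_
  · refine ((measurable_id.pow_const _).smul ?_).aestronglyMeasurable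
    exact (greenProfile_antitone.measurable.comp (measurable_id.pow_const 2)).ennreal_toReal
  · filter_upwards [ae_restrict_mem measurableSet_Ioo] with y hy
    have hy0 := hy.1
    have hy1 := hy.2.trans hρ
    have h2 : y ^ 2 ≤ 1 := by nlinarith
    have h3 := greenReal_nonneg (n := n) (pow_pos hy0 2) h2
    rw [greenProfile_eq (by positivity) h2, ENNReal.toReal_ofReal h3, smul_eq_mul, Real.norm_eq_abs,
      abs_of_nonneg (by positivity)]
    exact greenReal_sq_le hn hy0 hy1

theorem locallyIntegrableOn_green (hn : 1 ≤ n) (ha : a ∈ unitBall n) :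
    LocallyIntegrableOn (fun x => (green x a).toReal) (unitBall n) := by
  intro x hx
  have hFx := norm_lt_one (F_mem_unitBall ha hx)
  obtain ⟨ρ, h1, h2⟩ := exists_between hFx
  have hρ0 : 0 < ρ := (norm_nonneg _).trans_lt h1
  have hbB : Metric.ball (0 : Cn n) ρ ⊆ unitBall n := Metric.ball_subset_ball h2.le
  refine IntegrableAtFilter.filter_mono nhdsWithin_le_nhds ⟨bgBall a ρ,
    (isOpen_bgBall ha).mem_nhds ⟨hx, h1⟩, ?_⟩
  have hK := isCompact_closedBgBall ha h2
  have hKB := closedBgBall_subset ha h2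
  have i1 : IntegrableOn (fun x => (green x a).toReal * bergmanDensity x) (bgBall a ρ) := by
    rw [← F_image_ball ha h2.le, integrableOn_image_F hn ha measurableSet_ball hbB]
    have := (integrableOn_greenProfile hn h2).neg.mul_continuousOn_of_subset
      (continuousOn_bergmanDensity.mono (closedBall_subset_unitBall h2)) measurableSet_ball
      (isCompact_closedBall 0 ρ) Metric.ball_subset_closedBall
    refine this.congr_fun (fun y hy => ?_) measurableSet_ball
    have hyB := hbB hy
    simp only [Pi.neg_apply]
    rw [green, F_F (norm_lt_one ha) (norm_lt_one hyB).le, EReal.toReal_neg_eq,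
      EReal.toReal_coe_ennreal]
  -- The change of variables controls integrability for `ω_B^n`; the positive continuous density is
  -- divided out on a compact neighbourhood to return to Lebesgue measure.
  have i2 := i1.mul_continuousOn_of_subset (g' := fun x => (bergmanDensity x)⁻¹)
    ((continuousOn_bergmanDensity.mono hKB).inv₀ fun y _ => (bergmanDensity_pos y).ne')
    (isOpen_bgBall ha).measurableSet hK (bgBall_subset_closedBgBall ha)
  refine i2.congr_fun (fun y _ => ?_) (isOpen_bgBall ha).measurableSet
  exact mul_inv_cancel_right₀ (bergmanDensity_pos y).ne' _

theorem tendsto_integral_mul_deriv_rise (hn : 1 ≤ n) {r : ℝ} (hr0 : 0 < r) (hr1 : r < 1)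
    (ha : a ∈ unitBall n) {φ : Cn n → ℝ} (hφ : Continuous φ) :
    Tendsto (fun k : ℕ => ∫ x in unitBall n,
      φ x * ((V n r)⁻¹ * deriv (rise k) (relVolAt r a x) * bergmanDensity x)) atTop (𝓝 (φ a)) := by
  have hV := V_pos hn hr0 hr1
  have hS := (isOpen_bgBall (r := r) ha).measurableSet
  have key := tendsto_integral_approxIdentity hS
    (μ := volume) (u := fun x => ((φ x : ℝ) : EReal)) (z := a) (w := fun (k : ℕ) x =>
      (V n r)⁻¹ * deriv (rise k) (relVolAt r a x) * bergmanDensity x)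
    (continuous_coe_real_ereal.comp hφ).continuousAt
    (Eventually.of_forall fun x _ => ⟨EReal.coe_ne_bot _, EReal.coe_ne_top _⟩)
    (fun k x _ => mul_nonneg (mul_nonneg (inv_pos.mpr hV).le (deriv_rise_nonneg _ _))
      (bergmanDensity_pos x).le) ?_ ?_ ?_ ?_
  · rw [← EReal.tendsto_coe]
    refine key.congr' ?_
    filter_upwards [eventually_ge_atTop 1] with k hk
    simp only [EReal.toReal_coe]
    congr 1
    symm
    refine setIntegral_eq_of_subset_of_forall_sdiff_eq_zero isOpen_unitBall.measurableSet
      (fun x hx => hx.1) fun x hx => ?_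
    rw [deriv_rise_eq_zero]
    · ring
    · have : (1 : ℝ) ≤ k := by exact_mod_cast hk
      refine le_trans ?_ (one_le_relVolAt hr0 hr1 ha hx.1 hx.2)
      rw [div_le_one (by positivity)]; linarith
  · intro O hO
    obtain ⟨ε, hε, hεO⟩ := exists_relVolAt_lt hr0 hr1 ha hO
    filter_upwards [eventually_div_succ_lt 2 hε] with k hk x hx hxO
    have : ε ≤ relVolAt r a x := by
      by_contra! h
      exact hxO (hεO x hx.1 h)
    rw [deriv_rise_eq_zero (hk.le.trans this)]
    ring
  · intro k
    have := (integrableOn_bgBall_of_continuous hr1 ha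
      (locallyIntegrableOn_const 1) (continuous_deriv_rise k)).const_mul (V n r)⁻¹
    simpa only [one_mul, mul_assoc] using! this
  · refine tendsto_const_nhds.congr' ?_
    filter_upwards [eventually_ge_atTop 1] with k hk
    simp only [mul_assoc]
    rw [integral_const_mul, integral_deriv_rise hn hr0 hr1 ha hk, inv_mul_cancel₀ hV.ne']
  · intro k
    have := (integrableOn_bgBall_of_continuous hr1 ha
      ((hφ.locallyIntegrable).locallyIntegrableOn _) (continuous_deriv_rise k)).const_mul (V n r)⁻¹
    refine this.congr (Eventually.of_forall fun x => ?_)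
    simp only [EReal.toReal_coe]
    ring

theorem integral_lapDensity_eq_zero {φ : Cn n → ℝ} (hφ : IsTestFunction φ) (c : ℝ) :
    ∫ x in unitBall n, c * lapDensity φ x = 0 := by
  rw [integral_mul_lapDensity_comm (u := fun _ => c) (fun x _ => contDiffAt_const) hφ]
  simp [lapDensity_const]

/-- The smooth potentials of the masses `rise k` have Laplacians forming an approximate identity at
`a`, and they converge to `G_B(·,a)` plus a constant. Symmetry of the Laplacian holds at each stage
and passes to the limit. -/
theorem integral_green_mul_lapDensity (hn : 1 ≤ n) (ha : a ∈ unitBall n) {φ : Cn n → ℝ}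
    (hφ : IsTestFunction φ) :
    ∫ x in unitBall n, (green x a).toReal * lapDensity φ x = φ a := by
  have : Nonempty (Fin n) := ⟨⟨0, hn⟩⟩
  -- The radius is auxiliary: it normalises the potentials to vanish at `r²`, and the resulting
  -- constant is annihilated because the Laplacian of a test function has integral zero.
  obtain ⟨r, hr0, hr1⟩ := exists_between (zero_lt_one (α := ℝ))
  have hδ (k : ℕ) : 0 < 1 / ((k : ℝ) + 1) := by positivity
  have hsm (k : ℕ) : ∀ x ∈ unitBall n,
      ContDiffAt ℝ ∞ (fun x => profile n r (rise k) (1 - gap a x)) x := fun x hx =>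
    ContDiffAt.comp (f := fun x => 1 - gap a x) x
      (contDiffAt_profile hn hr0 hr1 (contDiff_rise k) (hδ k) (fun y hy => rise_eq_zero hy)
      (one_sub_gap_lt_one ha hx)) (contDiffAt_const.sub (contDiffAt_gap ha hx))
  have hG := locallyIntegrableOn_green hn ha
  have hlim1 := tendsto_integral_mul_deriv_rise hn hr0 hr1 ha hφ.1.continuous
  have heq (k : ℕ) : ∫ x in unitBall n, φ x *
        ((V n r)⁻¹ * deriv (rise k) (relVolAt r a x) * bergmanDensity x)
      = ∫ x in unitBall n, profile n r (rise k) (1 - gap a x) * lapDensity φ x := by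
    rw [integral_mul_lapDensity_comm (hsm k) hφ]
    refine setIntegral_congr_fun isOpen_unitBall.measurableSet fun x hx => ?_
    rw [lapDensity_profile hn hr0 hr1 ha hx (contDiff_rise k) (hδ k) (fun y hy => rise_eq_zero hy),
      relVolAt]
  simp only [heq] at hlim1
  have iG := hφ.integrable_mul_lapDensity hG
  have ic := hφ.integrable_mul_lapDensity (locallyIntegrableOn_const (greenReal n (r ^ 2)))
  have hne : ∀ᵐ x ∂(volume.restrict (unitBall n)), x ≠ a := ae_restrict_of_ae (Measure.ae_ne volume a)
  have hlim2 : Tendsto (fun k => ∫ x in unitBall n,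
      profile n r (rise k) (1 - gap a x) * lapDensity φ x) atTop
      (𝓝 (∫ x in unitBall n, ((green x a).toReal * lapDensity φ x
        + greenReal n (r ^ 2) * lapDensity φ x))) := by
    refine tendsto_integral_of_dominated_convergence
      (fun x => |(green x a).toReal * lapDensity φ x| + |greenReal n (r ^ 2) * lapDensity φ x|)
      (fun k => ?_) (iG.abs.add ic.abs) (fun k => ?_) ?_
    · refine (hφ.integrable_mul_lapDensity ?_).aestronglyMeasurable
      exact ContinuousOn.locallyIntegrableOn
        (fun x hx => (hsm k x hx).continuousAt.continuousWithinAt) isOpen_unitBall.measurableSet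
    · filter_upwards [hne, ae_restrict_mem isOpen_unitBall.measurableSet] with x hxa hx
      have h0 := one_sub_gap_pos ha hx hxa
      have h1 := one_sub_gap_lt_one ha hx
      rw [Real.norm_eq_abs, abs_mul, abs_mul, abs_mul, ← add_mul, toReal_green_eq ha hx hxa, abs_neg,
        abs_of_nonneg (greenReal_nonneg h0 h1.le), abs_of_nonneg (greenReal_nonneg (by positivity)
          (show r ^ 2 ≤ 1 by nlinarith))]
      exact mul_le_mul_of_nonneg_right (profile_rise_bound hr0 hr1 hn h0 h1 k) (abs_nonneg _)
    · filter_upwards [hne, ae_restrict_mem isOpen_unitBall.measurableSet] with x hxa hx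
      rw [← add_mul, toReal_green_eq ha hx hxa, neg_add_eq_sub]
      exact (tendsto_profile_rise hr0 hr1 (one_sub_gap_pos ha hx hxa)
        (one_sub_gap_lt_one ha hx)).mul_const _
  rw [integral_add iG ic, integral_lapDensity_eq_zero hφ, add_zero] at hlim2
  exact tendsto_nhds_unique hlim2 hlim1

theorem isGreenFunction_green (hn : 1 ≤ n) (ha : a ∈ unitBall n) :
    IsGreenFunction a (fun z => green z a) where
  locallyIntegrable := locallyIntegrableOn_green hn ha
  laplacian φ hφ := by
    simpa only [lapDensity, mul_assoc] using integral_green_mul_lapDensity hn ha hφ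
  boundary ξ hξ := tendsto_green_boundary ha hξ

/-- The mean-value formula for `u = G_B(·,a)` and `μ = δ_a` evaluates the kernel at `a` on one side
and gives the average of `G_B(·,a)` minus its value at `z` on the other. In particular `Γ_r ≤ 0`. -/
theorem rieszKernel_gap_eq (hn : 1 ≤ n) {r : ℝ} (hr0 : 0 < r) (hr1 : r < 1) {z : Cn n}
    (hz : z ∈ unitBall n) (ha : a ∈ unitBall n) :
    Gam r z a = -((rieszKernel n r (1 - gap z a) : ℝ≥0∞) : EReal) := by
  have : Nonempty (Fin n) := ⟨⟨0, hn⟩⟩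
  have key := lintegral_rieszKernel hn hr0 hr1 hz (u := fun x => green x a) (μ := Measure.dirac a)
    (locallyIntegrableOn_green hn ha) (fun K _ _ => measure_lt_top _ _) (fun φ hφ => by
      rw [integral_dirac, integral_green_mul_lapDensity hn ha hφ])
    (by filter_upwards [Measure.ae_ne volume a] with x hxa hx using green_ne ha hx hxa)
    (continuousAt_green ha hz)
  classical
  rw [setLIntegral_dirac, if_pos ha] at key
  rw [key, Gam, EReal.neg_sub (Or.inl (EReal.coe_ne_bot _)) (Or.inl (EReal.coe_ne_top _)), add_comm,
    sub_eq_add_neg]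

end Green

end BergmanBall
end

noncomputable section
namespace BergmanBall

/-! ### Holomorphic functions of several variables are smooth -/

section Holomorphic

variable {E : Type*} [NormedAddCommGroup E] [NormedSpace ℂ E] {U : Set E} {T : E → ℂ}

theorem differentiableOn_line (hT : DifferentiableOn ℂ T U) {x v : E} {s : Set ℂ}
    (h : ∀ w ∈ s, x + w • v ∈ U) : DifferentiableOn ℂ (fun w : ℂ => T (x + w • v)) s :=
  hT.comp (f := fun w : ℂ => x + w • v) (by fun_prop) h

theorem deriv_line (hU : IsOpen U) (hT : DifferentiableOn ℂ T U) {x : E} (hx : x ∈ U) (v : E) :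
    deriv (fun w : ℂ => T (x + w • v)) 0 = fderiv ℂ T x v := by
  have h1 : HasFDerivAt T (fderiv ℂ T x) (x + (0 : ℂ) • v) := by
    rw [zero_smul, add_zero]
    exact (hT.differentiableAt (hU.mem_nhds hx)).hasFDerivAt
  have h2 : HasDerivAt (fun w : ℂ => x + w • v) v 0 := by
    simpa using ((hasDerivAt_id (0 : ℂ)).smul_const v).const_add x
  exact (h1.comp_hasDerivAt (0 : ℂ) h2).deriv

/-- The Cauchy estimate for the derivative. -/
theorem norm_fderiv_le (hU : IsOpen U) (hT : DifferentiableOn ℂ T U) {x : E} {δ M : ℝ} (hδ : 0 < δ)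
    (hM : 0 ≤ M) (hx : Metric.closedBall x δ ⊆ U) (hb : ∀ y ∈ Metric.closedBall x δ, ‖T y‖ ≤ M) :
    ‖fderiv ℂ T x‖ ≤ M / δ := by
  refine ContinuousLinearMap.opNorm_le_bound _ (by positivity) fun v => ?_
  rcases eq_or_ne v 0 with rfl | hv
  · simp
  have hv' := norm_pos_iff.mpr hv
  have hmem : ∀ w ∈ Metric.closedBall (0 : ℂ) (δ / ‖v‖), x + w • v ∈ Metric.closedBall x δ := by
    intro w hw
    rw [mem_closedBall_zero_iff, le_div_iff₀ hv'] at hw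
    rw [mem_closedBall_iff_norm, add_sub_cancel_left, norm_smul]
    exact hw
  rw [← deriv_line hU hT (hx (Metric.mem_closedBall_self hδ.le)) v]
  refine (Complex.norm_deriv_le_of_forall_mem_sphere_norm_le (R := δ / ‖v‖) (C := M)
    (by positivity) ?_ fun w hw => hb _ (hmem w (Metric.sphere_subset_closedBall hw))).trans_eq
      (by field_simp)
  refine DifferentiableOn.diffContOnCl ?_
  rw [closure_ball _ (by positivity)]
  exact differentiableOn_line hT fun w hw => hx (hmem w hw)

variable [FiniteDimensional ℂ E] [MeasurableSpace E] [BorelSpace E]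

/-- Cauchy's formula on the complex line through `x` in direction `v` expresses the directional
derivative by values of `T` on a circle whose radius does not depend on `x` locally. This integral
can be differentiated in `x`; iterating gives smoothness. -/
theorem differentiableOn_fderiv_apply (hU : IsOpen U) (hT : DifferentiableOn ℂ T U) (v : E) :
    DifferentiableOn ℂ (fun x => fderiv ℂ T x v) U := by
  intro z hz
  refine DifferentiableAt.differentiableWithinAt ?_
  have hc : ContinuousAt T z := (hT.differentiableAt (hU.mem_nhds hz)).continuousAt
  obtain ⟨M, hM0, hMb⟩ : ∃ M : ℝ, 0 ≤ M ∧ ∀ᶠ x in 𝓝 z, ‖T x‖ ≤ M :=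
    ⟨‖T z‖ + 1, by positivity, by
      filter_upwards [hc.norm.eventually_lt continuousAt_const (lt_add_one ‖T z‖)] with x hx
      exact hx.le⟩
  obtain ⟨R, hR, hRb⟩ := Metric.eventually_nhds_iff_ball.mp (hMb.and (hU.eventually_mem hz))
  -- Three nested radii: points within `δ` of `z`, moved by the circle, stay within `2δ`; closed
  -- `δ`-balls around those lie in the `R`-ball where `|T| ≤ M`, so the Cauchy estimate bounds the
  -- derivative by `M/δ`.
  set δ := R / 3 with hδ
  have hδ0 : 0 < δ := by positivity
  set ρ := δ / (‖v‖ + 1) with hρ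
  have hρ0 : 0 < ρ := by positivity
  have hρv : ρ * ‖v‖ ≤ δ := by
    rw [hρ, div_mul_eq_mul_div, div_le_iff₀ (by positivity)]
    nlinarith [norm_nonneg v]
  have hmem : ∀ x ∈ Metric.ball z δ, ∀ w ∈ Metric.closedBall (0 : ℂ) ρ,
      x + w • v ∈ Metric.ball z (2 * δ) := by
    intro x hx w hw
    rw [mem_closedBall_zero_iff] at hw
    rw [mem_ball_iff_norm] at hx ⊢
    have : x + w • v - z = (x - z) + w • v := by abel
    rw [this]
    refine (norm_add_le _ _).trans_lt ?_
    rw [norm_smul]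
    have : ‖w‖ * ‖v‖ ≤ ρ * ‖v‖ := by gcongr
    linarith
  have hcb : ∀ y ∈ Metric.ball z (2 * δ), Metric.closedBall y δ ⊆ Metric.ball z R := by
    intro y hy x hx
    rw [Metric.mem_ball] at hy ⊢
    rw [Metric.mem_closedBall] at hx
    have := dist_triangle x y z
    linarith
  have hballU : Metric.ball z (2 * δ) ⊆ U := fun y hy =>
    (hRb y (hcb y hy (Metric.mem_closedBall_self hδ0.le))).2
  have hfd : ∀ y ∈ Metric.ball z (2 * δ), ‖fderiv ℂ T y‖ ≤ M / δ := fun y hy =>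
    norm_fderiv_le hU hT hδ0 hM0 (fun x hx => (hRb x (hcb y hy hx)).2)
      fun x hx => (hRb x (hcb y hy hx)).1
  have hsph (θ : ℝ) : circleMap 0 ρ θ ∈ Metric.closedBall (0 : ℂ) ρ :=
    circleMap_mem_closedBall 0 hρ0.le θ
  set k : ℝ → ℂ := fun θ => deriv (circleMap 0 ρ) θ * ((circleMap 0 ρ θ - 0) ^ 2)⁻¹ with hk
  have hkc : Continuous k := by
    have h1 : Continuous (deriv (circleMap 0 ρ)) := by
      have : deriv (circleMap 0 ρ) = fun θ => circleMap 0 ρ θ * Complex.I := by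
        ext θ; simp [deriv_circleMap]
      rw [this]; fun_prop
    refine h1.mul (Continuous.inv₀ (by fun_prop) fun θ => pow_ne_zero _ ?_)
    rw [sub_zero]
    exact circleMap_ne_center hρ0.ne'
  set c : ℂ := (2 * Real.pi * Complex.I)⁻¹
  have hF : (fun x => fderiv ℂ T x v) =ᶠ[𝓝 z]
      fun x => c * ∫ θ in (0 : ℝ)..2 * Real.pi, k θ * T (x + circleMap 0 ρ θ • v) := by
    filter_upwards [Metric.ball_mem_nhds z hδ0] with x hx
    have hxU : x ∈ U := hballU (Metric.ball_subset_ball (by linarith) hx)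
    rw [← deriv_line hU hT hxU v,
      ← Complex.two_pi_I_inv_smul_circleIntegral_sub_sq_inv_smul_of_differentiable
        (U := {w | x + w • v ∈ U}) (c := 0) (R := ρ) (hU.preimage (by fun_prop))
        (fun w hw => hballU (hmem x hx w hw)) (differentiableOn_line hT fun w hw => hw)
        (Metric.mem_ball_self hρ0)]
    simp only [circleIntegral, smul_eq_mul, hk, ← mul_assoc]
    rfl
  refine DifferentiableAt.congr_of_eventuallyEq ?_ hF
  refine DifferentiableAt.const_mul ?_ c
  have hcont : ∀ x ∈ Metric.ball z δ, Continuous fun θ => k θ * T (x + circleMap 0 ρ θ • v) := by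
    intro x hx
    refine hkc.mul ?_
    exact hT.continuousOn.comp_continuous (by fun_prop) fun θ => hballU (hmem x hx _ (hsph θ))
  obtain ⟨C, hC⟩ : ∃ C, ∀ θ ∈ uIcc (0 : ℝ) (2 * Real.pi), ‖k θ‖ ≤ C :=
    isCompact_uIcc.exists_bound_of_continuousOn hkc.continuousOn
  refine (intervalIntegral.hasFDerivAt_integral_of_dominated_of_fderiv_le
    (F' := fun x θ => k θ • fderiv ℂ T (x + circleMap 0 ρ θ • v)) (bound := fun _ => C * (M / δ))
    (s := Metric.ball z δ) (Metric.ball_mem_nhds z hδ0) ?_ ?_ ?_ ?_ ?_ ?_).differentiableAt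
  · filter_upwards [Metric.ball_mem_nhds z hδ0] with x hx
    exact (hcont x hx).aestronglyMeasurable
  · exact (hcont z (Metric.mem_ball_self hδ0)).intervalIntegrable _ _
  -- Continuity of the derivative is not yet known here; measurability of `fderiv` suffices for
  -- differentiating under the integral.
  · refine hkc.aestronglyMeasurable.smul ?_
    have : Measurable fun θ : ℝ => z + circleMap 0 ρ θ • v := by fun_prop
    exact ((measurable_fderiv ℂ T).comp this).aestronglyMeasurable
  · refine Eventually.of_forall fun θ hθ x hx => ?_
    rw [norm_smul]
    gcongr
    · exact (norm_nonneg _).trans (hC θ (uIoc_subset_uIcc hθ))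
    · exact hC θ (uIoc_subset_uIcc hθ)
    · exact hfd _ (hmem x hx _ (hsph θ))
  · exact intervalIntegrable_const
  · refine Eventually.of_forall fun θ _ x hx => ?_
    have h1 := (hT.differentiableAt (hU.mem_nhds (hballU (hmem x hx _ (hsph θ))))).hasFDerivAt
    exact (HasFDerivAt.comp x h1 ((hasFDerivAt_id x).add_const _)).const_mul (k θ)

theorem contDiffOn_of_differentiableOn (hU : IsOpen U) (hT : DifferentiableOn ℂ T U) :
    ContDiffOn ℂ ∞ T U := by
  rw [contDiffOn_infty]
  intro m
  induction m generalizing T with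
  | zero => exact contDiffOn_zero.mpr hT.continuousOn
  | succ m ih =>
    push_cast
    rw [contDiffOn_succ_iff_fderiv_of_isOpen hU]
    refine ⟨hT, by simp, contDiffOn_clm_apply.mpr fun v => ih (differentiableOn_fderiv_apply hU hT v)⟩

end Holomorphic

end BergmanBall
end

noncomputable section
namespace BergmanBall

/-! ### Smoothness of alternating-map-valued functions -/

section Alternating

variable {X V : Type*} [NormedAddCommGroup X] [NormedSpace ℝ X] [NormedAddCommGroup V]
  [NormedSpace ℝ V] {p : ℕ} {m : WithTop ℕ∞} {x : X}

theorem contDiffAt_clm_alternating {f : X → V [⋀^Fin p]→L[ℝ] ℝ} (hf : ContDiffAt ℝ m f x)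
    (K : Fin p → V) : ContDiffAt ℝ m (fun x => f x K) x :=
  (ContinuousAlternatingMap.apply ℝ V ℝ K).contDiff.contDiffAt.comp x hf

variable [FiniteDimensional ℝ V]

/-- A map into the alternating forms is smooth if its components are. -/
theorem contDiffAt_alternating {f : X → V [⋀^Fin p]→L[ℝ] ℝ}
    (h : ∀ K : Fin p → V, ContDiffAt ℝ m (fun x => f x K) x) : ContDiffAt ℝ m f x := by
  let b := Module.finBasis ℝ V
  let ev : (V [⋀^Fin p]→L[ℝ] ℝ) →ₗ[ℝ] ((Fin p → Fin (Module.finrank ℝ V)) → ℝ) :=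
    { toFun := fun A c => A fun i => b (c i)
      map_add' := fun A B => by ext c; simp
      map_smul' := fun t A => by ext c; simp }
  -- Evaluation on basis tuples is an injective linear map into a finite product, so a linear left
  -- inverse reconstructs the form from its smooth components.
  have hinj : LinearMap.ker ev = ⊥ := by
    rw [LinearMap.ker_eq_bot]
    intro A B hAB
    have : A.toMultilinearMap = B.toMultilinearMap :=
      Module.Basis.ext_multilinear (fun _ => b) fun c => congrFun hAB c
    ext K
    exact MultilinearMap.congr_fun this K
  obtain ⟨L, hL⟩ := LinearMap.exists_leftInverse_of_injective ev hinj
  have e : f = fun x => LinearMap.toContinuousLinearMap L fun c => f x fun i => b (c i) := by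
    ext1 x
    exact (LinearMap.congr_fun hL (f x)).symm
  rw [e]
  exact (LinearMap.toContinuousLinearMap L).contDiff.contDiffAt.comp x
    (contDiffAt_pi.mpr fun c => h _)

theorem contDiffAt_alternating_apply {f : X → V [⋀^Fin p]→L[ℝ] ℝ} {g : Fin p → X → V}
    (hf : ContDiffAt ℝ m f x) (hg : ∀ i, ContDiffAt ℝ m (g i) x) :
    ContDiffAt ℝ m (fun x => f x fun i => g i x) x := by
  let b := Module.finBasis ℝ V
  have e : (fun x => f x fun i => g i x) = fun x => ∑ c : Fin p → Fin (Module.finrank ℝ V),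
      (∏ i, b.repr (g i x) (c i)) * f x fun i => b (c i) := by
    ext x
    have h1 : (fun i => g i x) = fun i => ∑ j, b.repr (g i x) j • b j := by
      ext i; rw [b.sum_repr]
    conv_lhs => rw [h1]
    have h2 := (f x).toMultilinearMap.map_sum (fun i j => b.repr (g i x) j • b j)
    refine h2.trans (Finset.sum_congr rfl fun c _ => ?_)
    exact (f x).toMultilinearMap.map_smul_univ (fun i => b.repr (g i x) (c i)) fun i => b (c i)
  rw [e]
  refine ContDiffAt.sum fun c _ => ContDiffAt.mul (contDiffAt_prod fun i _ => ?_)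
    (contDiffAt_clm_alternating hf _)
  exact (LinearMap.toContinuousLinearMap (b.coord (c i))).contDiff.contDiffAt.comp x (hg i)

theorem contDiffAt_compContinuousLinearMap {Y : Type*} [NormedAddCommGroup Y] [NormedSpace ℝ Y]
    [FiniteDimensional ℝ Y] {f : X → V [⋀^Fin p]→L[ℝ] ℝ} {g : X → Y →L[ℝ] V}
    (hf : ContDiffAt ℝ m f x) (hg : ContDiffAt ℝ m g x) :
    ContDiffAt ℝ m (fun x => (f x).compContinuousLinearMap (g x)) x :=
  contDiffAt_alternating fun K => contDiffAt_alternating_apply (g := fun i x => g x (K i)) hf fun _ =>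
    hg.clm_apply contDiffAt_const

/-- The exterior derivative of a smooth form is smooth. -/
theorem contDiffAt_extDeriv {η : V → V [⋀^Fin p]→L[ℝ] ℝ} {x : V} (h : ContDiffAt ℝ ∞ η x) :
    ContDiffAt ℝ ∞ (extDeriv η) x := by
  refine contDiffAt_alternating fun K => ?_
  have e : (fun x => extDeriv η x K) =ᶠ[𝓝 x] fun x => ∑ i : Fin (p + 1),
      (-1) ^ i.val • fderiv ℝ (fun y => η y (i.removeNth K)) x (K i) := by
    have : ∀ᶠ y in 𝓝 x, ContDiffAt ℝ 1 η y :=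
      (h.of_le (by norm_cast)).eventually (by simp)
    filter_upwards [this] with y hy
    exact extDeriv_apply (hy.differentiableAt (by norm_num)) K
  refine ContDiffAt.congr_of_eventuallyEq ?_ e
  refine ContDiffAt.sum fun i _ => ContDiffAt.const_smul _ ?_
  exact ((contDiffAt_clm_alternating h _).fderiv_right (m := ∞) (by simp)).clm_apply contDiffAt_const

end Alternating

/-! ### Integration by parts in directions of invariance -/

section Invariant

variable {V : Type*} [NormedAddCommGroup V] [NormedSpace ℝ V] {v h : V → ℝ} {w u : V}

theorem integrable_mul_of_hasCompactSupport {α : Type*} [TopologicalSpace α] [MeasurableSpace α]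
    [OpensMeasurableSpace α] [T2Space α] [LocallyCompactSpace α] {μ : Measure α} {v h : α → ℝ}
    (hv : LocallyIntegrable v μ) (hh : Continuous h) (hc : HasCompactSupport h) :
    Integrable (fun x => v x * h x) μ := by
  simpa only [smul_eq_mul, mul_comm] using hv.integrable_smul_left_of_hasCompactSupport hh hc

theorem continuous_fderiv_apply (hh : ContDiff ℝ 1 h) (w : V) : Continuous fun x => fderiv ℝ h x w :=
  (hh.continuous_fderiv (by norm_num)).clm_apply continuous_const

theorem fderiv_fderiv_comm (hh : ContDiff ℝ 2 h) (x u w : V) :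
    fderiv ℝ (fun y => fderiv ℝ h y u) x w = fderiv ℝ (fun y => fderiv ℝ h y w) x u := by
  have hd : DifferentiableAt ℝ (fderiv ℝ h) x :=
    (hh.fderiv_right (m := 1) (by norm_num)).differentiable (by norm_num) x
  have hs : IsSymmSndFDerivAt ℝ h x :=
    hh.contDiffAt.isSymmSndFDerivAt (by simp)
  rw [fderiv_clm_apply hd (differentiableAt_const u), fderiv_clm_apply hd (differentiableAt_const w)]
  simpa using hs w u

variable [FiniteDimensional ℝ V] [MeasurableSpace V] [BorelSpace V] {μ : Measure V}
  [μ.IsAddHaarMeasure]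

/-- A function that is only locally integrable but invariant along `w` has line derivative zero in
that direction, so integration by parts moves the derivative off `h`. -/
theorem integral_mul_fderiv_eq_zero (hv : LocallyIntegrable v μ) (hinv : ∀ x (t : ℝ), v (x + t • w) = v x)
    (hh : ContDiff ℝ 1 h) (hc : HasCompactSupport h) : ∫ x, v x * fderiv ℝ h x w ∂μ = 0 := by
  have key := integral_bilinear_hasLineDerivAt_right_eq_neg_left_of_integrable (μ := μ)
    (f := v) (f' := fun _ => 0) (g := h) (g' := fun x => fderiv ℝ h x w) (v := w)
    (B := ContinuousLinearMap.mul ℝ ℝ) (by simp)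
    (by simpa using integrable_mul_of_hasCompactSupport hv (continuous_fderiv_apply hh w)
          (hc.fderiv_apply ℝ w))
    (by simpa using integrable_mul_of_hasCompactSupport hv hh.continuous hc)
    (fun x _ => by
      have : (fun t : ℝ => v (x + t • w)) = fun _ => v x := funext fun t => hinv x t
      rw [HasLineDerivAt, this]
      exact hasDerivAt_const _ _)
    (fun x _ => (hh.differentiable (by norm_num) x).hasFDerivAt.hasLineDerivAt w)
  simpa using key

theorem integral_mul_fderiv_fderiv_eq_zero (hv : LocallyIntegrable v μ)
    (hinv : ∀ x (t : ℝ), v (x + t • u) = v x) (hh : ContDiff ℝ 2 h) (hc : HasCompactSupport h) (w : V) :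
    ∫ x, v x * fderiv ℝ (fun y => fderiv ℝ h y u) x w ∂μ = 0 := by
  simp only [fun x => fderiv_fderiv_comm hh x u w]
  exact integral_mul_fderiv_eq_zero hv hinv
    ((hh.fderiv_right (m := 1) (by norm_num)).clm_apply contDiff_const) (hc.fderiv_apply ℝ w)

end Invariant

/-! ### The operator `dd^c` paired with functions of one complex coordinate. -/

section DDC

variable {n p : ℕ} {η : RForm n p} {v : Cn n → ℝ}

theorem J_apply (x : Cn n) : J n x = Complex.I • x := by
  simp [J]

theorem J_J (x : Cn n) : J n (J n x) = -x := by
  rw [J_apply, J_apply, smul_smul, Complex.I_mul_I, neg_one_smul]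

/-- `-2 d^c η`. -/
theorem contDiff_dJ (hη : ContDiff ℝ ∞ η) :
    ContDiff ℝ ∞ fun z => (-(1 / 2 : ℝ)) • (extDeriv η z).compContinuousLinearMap (J n) :=
  contDiff_iff_contDiffAt.mpr fun _ => (contDiffAt_compContinuousLinearMap
    (contDiffAt_extDeriv hη.contDiffAt) contDiffAt_const).const_smul _

theorem contDiff_ddc (hη : ContDiff ℝ ∞ η) : ContDiff ℝ ∞ (ddc η) :=
  contDiff_iff_contDiffAt.mpr fun _ => contDiffAt_extDeriv (contDiff_dJ hη).contDiffAt

theorem extDeriv_eq_zero_of_notMem {V : Type*} [NormedAddCommGroup V] [NormedSpace ℝ V]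
    {η : V → V [⋀^Fin p]→L[ℝ] ℝ} {x : V} (hx : x ∉ tsupport η) :
    extDeriv η x = 0 := by
  have : η =ᶠ[𝓝 x] fun _ => 0 := notMem_tsupport_iff_eventuallyEq.mp hx
  rw [this.extDeriv_eq]
  ext K
  rw [extDeriv_apply (differentiableAt_const _)]
  simp

theorem tsupport_ddc_subset : tsupport (ddc η) ⊆ tsupport η := by
  refine closure_minimal (fun x hx => ?_) (isClosed_tsupport _)
  by_contra h
  refine hx (extDeriv_eq_zero_of_notMem fun h' => h ?_)
  refine closure_minimal (fun y hy => ?_) (isClosed_tsupport _) h'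
  by_contra h2
  refine hy ?_
  beta_reduce
  rw [extDeriv_eq_zero_of_notMem h2]
  ext K
  simp

theorem hasCompactSupport_ddc (hc : HasCompactSupport η) : HasCompactSupport (ddc η) :=
  hc.of_isClosed_subset (isClosed_tsupport _) tsupport_ddc_subset

theorem hasCompactSupport_apply {X V : Type*} [TopologicalSpace X] [NormedAddCommGroup V]
    [NormedSpace ℝ V] {f : X → V [⋀^Fin p]→L[ℝ] ℝ} (hc : HasCompactSupport f) (K : Fin p → V) :
    HasCompactSupport fun x => f x K :=
  hc.comp_left (g := fun A : V [⋀^Fin p]→L[ℝ] ℝ => A K) rfl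

theorem contDiff_apply_frame {X V : Type*} [NormedAddCommGroup X] [NormedSpace ℝ X]
    [NormedAddCommGroup V] [NormedSpace ℝ V] {f : X → V [⋀^Fin p]→L[ℝ] ℝ} {m : WithTop ℕ∞}
    (hf : ContDiff ℝ m f) (K : Fin p → V) : ContDiff ℝ m fun x => f x K :=
  contDiff_iff_contDiffAt.mpr fun _ => contDiffAt_clm_alternating hf.contDiffAt K

/-- Integration of `d^c η`, differentiated in direction `u`, against a function invariant in all but
the first direction. -/
theorem integral_mul_fderiv_dJ (hv : LocallyIntegrable v) (hη : ContDiff ℝ ∞ η)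
    (hc : HasCompactSupport η) (u : Cn n) (K : Fin (p + 1) → Cn n)
    (hinv : ∀ (j : Fin p) x (t : ℝ), v (x + t • J n (K j.succ)) = v x) :
    ∫ x, v x * fderiv ℝ (fun y => ((-(1 / 2 : ℝ)) • (extDeriv η y).compContinuousLinearMap (J n)) K) x u
      = -(1 / 2) * ∫ x, v x *
        fderiv ℝ (fun y => fderiv ℝ (fun z => η z fun j => J n (K j.succ)) y (J n (K 0))) x u := by
  have hsm (G : Fin p → Cn n) : ContDiff ℝ 2 fun z => η z G :=
    (contDiff_apply_frame hη G).of_le (by norm_cast)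
  have hsm1 (G : Fin p → Cn n) (w : Cn n) : ContDiff ℝ 1 fun y => fderiv ℝ (fun z => η z G) y w :=
    ((hsm G).fderiv_right (m := 1) (by norm_num)).clm_apply contDiff_const
  have hcs (G : Fin p → Cn n) (w : Cn n) : HasCompactSupport fun y => fderiv ℝ (fun z => η z G) y w :=
    (hasCompactSupport_apply hc G).fderiv_apply ℝ w
  have e1 (y : Cn n) : ((-(1 / 2 : ℝ)) • (extDeriv η y).compContinuousLinearMap (J n)) K
      = ∑ j : Fin (p + 1), (-(1 / 2 : ℝ)) * (-1) ^ j.val *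
        fderiv ℝ (fun z => η z (j.removeNth fun i => J n (K i))) y (J n (K j)) := by
    rw [ContinuousAlternatingMap.smul_apply, ContinuousAlternatingMap.compContinuousLinearMap_apply,
      extDeriv_apply (hη.differentiable (by norm_num) y), smul_eq_mul, Finset.mul_sum]
    refine Finset.sum_congr rfl fun j _ => ?_
    rw [zsmul_eq_mul, ← mul_assoc]
    push_cast
    rfl
  simp only [e1]
  have e2 (x : Cn n) : v x * fderiv ℝ (fun y => ∑ j : Fin (p + 1), (-(1 / 2 : ℝ)) * (-1) ^ j.val *
        fderiv ℝ (fun z => η z (j.removeNth fun i => J n (K i))) y (J n (K j))) x u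
      = ∑ j : Fin (p + 1), (-(1 / 2 : ℝ)) * (-1) ^ j.val * (v x * fderiv ℝ (fun y =>
        fderiv ℝ (fun z => η z (j.removeNth fun i => J n (K i))) y (J n (K j))) x u) := by
    have hd (j : Fin (p + 1)) : DifferentiableAt ℝ (fun y =>
        fderiv ℝ (fun z => η z (j.removeNth fun i => J n (K i))) y (J n (K j))) x :=
      (hsm1 _ _).differentiable (by norm_num) x
    rw [fderiv_fun_sum fun j _ => (hd j).const_mul _, sum_apply, Finset.mul_sum]
    refine Finset.sum_congr rfl fun j _ => ?_
    rw [fderiv_const_mul (hd j), smul_apply, smul_eq_mul]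
    ring
  simp only [e2]
  rw [integral_finsetSum _ fun j _ => Integrable.const_mul
    (integrable_mul_of_hasCompactSupport hv (continuous_fderiv_apply (hsm1 _ _) u)
      ((hcs _ _).fderiv_apply ℝ u)) _]
  simp only [integral_const_mul]
  -- All summands but the first contain a derivative of `η` in a direction along which `v` is
  -- invariant, and so integrate to zero.
  rw [Fin.sum_univ_succ, Finset.sum_eq_zero, add_zero]
  · simp only [Fin.val_zero, pow_zero, mul_one]
    rfl
  · intro j _
    rw [integral_mul_fderiv_fderiv_eq_zero hv (hinv j) (hsm _) (hasCompactSupport_apply hc _), mul_zero]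

/-- `∫ v dd^c η` when `v` depends on one complex coordinate only. -/
theorem integral_mul_ddc (hv : LocallyIntegrable v) (hη : ContDiff ℝ ∞ η)
    (hc : HasCompactSupport η) (hJ : ∀ z, (η z).compContinuousLinearMap (J n) = η z)
    (K : Fin (p + 1 + 1) → Cn n) (h01 : J n (K 0) = K 1)
    (hinv : ∀ (j : Fin p) x (t : ℝ), v (x + t • K j.succ.succ) = v x)
    (hinvJ : ∀ (j : Fin p) x (t : ℝ), v (x + t • J n (K j.succ.succ)) = v x) :
    ∫ x, v x * ddc η x K = ∫ x, v x * (1 / 2 *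
      (fderiv ℝ (fun y => fderiv ℝ (fun z => η z fun j => K j.succ.succ) y (K 0)) x (K 0)
        + fderiv ℝ (fun y => fderiv ℝ (fun z => η z fun j => K j.succ.succ) y (K 1)) x (K 1))) := by
  set α : RForm n (p + 1) :=
    fun z => (-(1 / 2 : ℝ)) • (extDeriv η z).compContinuousLinearMap (J n) with hα
  have hαs : ContDiff ℝ ∞ α := contDiff_dJ hη
  have hαc : HasCompactSupport α := by
    refine hc.of_isClosed_subset (isClosed_tsupport _) (closure_minimal (fun x hx => ?_)
      (isClosed_tsupport _))
    by_contra h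
    refine hx ?_
    rw [hα]
    beta_reduce
    rw [extDeriv_eq_zero_of_notMem h]
    ext K
    simp
  have hsm1 (G : Fin (p + 1) → Cn n) : ContDiff ℝ 1 fun z => α z G :=
    (contDiff_apply_frame hαs G).of_le (by norm_cast)
  have hi (G : Fin (p + 1) → Cn n) (w : Cn n) :
      Integrable fun x => v x * fderiv ℝ (fun z => α z G) x w :=
    integrable_mul_of_hasCompactSupport hv (continuous_fderiv_apply (hsm1 G) w)
      ((hasCompactSupport_apply hαc G).fderiv_apply ℝ w)
  have e1 (x : Cn n) : v x * ddc η x K = ∑ i : Fin (p + 1 + 1), (-1) ^ i.val *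
      (v x * fderiv ℝ (fun z => α z (i.removeNth K)) x (K i)) := by
    rw [ddc, extDeriv_apply (hαs.differentiable (by norm_num) x), Finset.mul_sum]
    refine Finset.sum_congr rfl fun j _ => ?_
    rw [zsmul_eq_mul]
    push_cast
    ring
  set f : Cn n → ℝ := fun z => η z fun j => K j.succ.succ with hf
  -- The hypothesis that `η` has type `(p,p)` enters here: the `J` coming from `d^c` disappears from
  -- the remaining arguments.
  have hfJ : (fun z => η z fun j => J n (K j.succ.succ)) = f := by
    ext z
    exact DFunLike.congr_fun (hJ z) _
  have hfs : ContDiff ℝ 2 f := (contDiff_apply_frame hη _).of_le (by norm_cast)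
  have hfi (w : Cn n) : Integrable fun x => v x * fderiv ℝ (fun y => fderiv ℝ f y w) x w :=
    integrable_mul_of_hasCompactSupport hv (continuous_fderiv_apply
      ((hfs.fderiv_right (m := 1) (by norm_num)).clm_apply contDiff_const) w)
      (((hasCompactSupport_apply hc _).fderiv_apply ℝ w).fderiv_apply ℝ w)
  simp only [e1]
  rw [integral_finsetSum _ fun i _ => (hi _ _).const_mul _]
  simp only [integral_const_mul]
  -- Of the outer derivatives only those along `K 0` and `K 1` survive; by the preceding lemma the
  -- inner derivative must then be along `J (K 1)`, respectively `J (K 0)`.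
  rw [Fin.sum_univ_succ, Fin.sum_univ_succ, Finset.sum_eq_zero (s := Finset.univ), add_zero]
  · rw [integral_mul_fderiv_dJ hv hη hc, integral_mul_fderiv_dJ hv hη hc]
    · have k0 (j : Fin p) : (Fin.removeNth (0 : Fin (p + 1 + 1)) K) j.succ = K j.succ.succ := by
        simp [Fin.removeNth]
      have k1 (j : Fin p) : (Fin.removeNth (Fin.succ 0 : Fin (p + 1 + 1)) K) j.succ
          = K j.succ.succ := by
        simp [Fin.removeNth]
      have k00 : (Fin.removeNth (0 : Fin (p + 1 + 1)) K) 0 = K 1 := by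
        simp [Fin.removeNth]
      have k10 : (Fin.removeNth (Fin.succ 0 : Fin (p + 1 + 1)) K) 0 = K 0 := by
        simp [Fin.removeNth]
      simp only [k0, k1, k00, k10, hfJ]
      -- From `J (K 0) = K 1` follows `J (K 1) = -K 0`. This sign, and the alternating sign of the
      -- second summand, turn both factors `-1/2` into `+1/2`.
      rw [← h01, J_J, h01]
      simp only [map_neg, fderiv_fun_neg, neg_apply, mul_neg, integral_neg]
      simp only [mul_left_comm _ (1 / 2 : ℝ), mul_add]
      rw [integral_add ((hfi _).const_mul _) ((hfi _).const_mul _), integral_const_mul,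
        integral_const_mul]
      simp
    · intro j x t
      simpa [Fin.removeNth] using hinvJ j x t
    · intro j x t
      simpa [Fin.removeNth, Fin.tail] using hinvJ j x t
  · intro i _
    rw [integral_mul_fderiv_eq_zero hv (hinv i) (hsm1 _) (hasCompactSupport_apply hαc _), mul_zero]

end DDC

end BergmanBall
end

/-! ### The Poincaré–Lelong formula for a coordinate function. -/

noncomputable section
namespace BergmanBall

/-! ### The one-variable model -/

section OneVariable

/-- For real `φ` the mixed second derivatives contribute only to the imaginary part, so their
symmetry is not needed. -/
theorem re_dz_dzbar {n : ℕ} {φ : Cn n → ℝ} (hφ : ContDiff ℝ ∞ φ) (j : Fin n) (x : Cn n) :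
    (dz j (dzbar j fun x => (φ x : ℂ)) x).re = 1 / 4 *
      (fderiv ℝ (fun y => fderiv ℝ φ y (EuclideanSpace.single j 1)) x (EuclideanSpace.single j 1)
        + fderiv ℝ (fun y => fderiv ℝ φ y (EuclideanSpace.single j Complex.I)) x
          (EuclideanSpace.single j Complex.I)) := by
  have h2 (w : Cn n) : ContDiff ℝ 1 fun y => fderiv ℝ φ y w :=
    ((hφ.fderiv_right (m := 1) (by norm_cast)).clm_apply contDiff_const)
  have hd (w : Cn n) : DifferentiableAt ℝ (fun y => fderiv ℝ φ y w) x :=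
    (h2 w).differentiable (by norm_num) x
  have hc (w : Cn n) : DifferentiableAt ℝ (fun y => ((fderiv ℝ φ y w : ℝ) : ℂ)) x :=
    Complex.ofRealCLM.differentiableAt.comp x (hd w)
  have e : dzbar j (fun x => (φ x : ℂ)) = fun y => (1 / 2 : ℂ) *
      (((fderiv ℝ φ y (EuclideanSpace.single j 1) : ℝ) : ℂ)
        + Complex.I * ((fderiv ℝ φ y (EuclideanSpace.single j Complex.I) : ℝ) : ℂ)) := by
    ext y
    have := hφ.differentiable (by norm_num) y
    simp only [dzbar, fderiv_ofReal_comp this]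
  have e2 (w : Cn n) : fderiv ℝ (dzbar j fun x => (φ x : ℂ)) x w = (1 / 2 : ℂ) *
      (((fderiv ℝ (fun y => fderiv ℝ φ y (EuclideanSpace.single j 1)) x w : ℝ) : ℂ)
        + Complex.I *
          ((fderiv ℝ (fun y => fderiv ℝ φ y (EuclideanSpace.single j Complex.I)) x w : ℝ) : ℂ)) := by
    rw [e, fderiv_const_mul ((hc _).fun_add ((hc _).const_mul _)), smul_apply,
      fderiv_fun_add (hc _) ((hc _).const_mul _), add_apply, fderiv_const_mul (hc _), smul_apply,
      fderiv_ofReal_comp (hd _), fderiv_ofReal_comp (hd _), smul_eq_mul, smul_eq_mul]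
  rw [dz, e2, e2]
  simp
  ring

theorem greenReal_one {t : ℝ} (ht : 0 < t) :
    greenReal 1 t = -(2 * Real.pi)⁻¹ * Real.log t := by
  have : ∫ u in t..1, greenKernel 1 u = -Real.log t := by
    simp [greenKernel, integral_inv_of_pos ht one_pos]
  rw [greenReal, this, greenConst]
  simp

theorem zero_mem_unitBall {n : ℕ} : (0 : Cn n) ∈ unitBall n := Metric.mem_ball_self one_pos

theorem toReal_green_one {x : Cn 1} (hx : x ∈ unitBall 1) (hx0 : x ≠ 0) :
    (green x 0).toReal = (2 * Real.pi)⁻¹ * Real.log (‖x‖ ^ 2) := by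
  have h : 1 - gap 0 x = ‖x‖ ^ 2 := by simp [gap, defFun]
  rw [toReal_green_eq zero_mem_unitBall hx hx0, h, greenReal_one (by
    have := norm_pos_iff.mpr hx0
    positivity)]
  ring

/-- In dimension one no factor `ω_B` is present in `dd^c φ`, so the powers of `1-|x|²` cancel and
half the Euclidean Laplacian remains. -/
theorem lapDensity_one {φ : Cn 1 → ℝ} (hφ : ContDiff ℝ ∞ φ) {x : Cn 1} (hx : x ∈ unitBall 1) :
    lapDensity φ x = 1 / 2 *
      (fderiv ℝ (fun y => fderiv ℝ φ y (EuclideanSpace.single 0 1)) x (EuclideanSpace.single 0 1)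
        + fderiv ℝ (fun y => fderiv ℝ φ y (EuclideanSpace.single 0 Complex.I)) x
          (EuclideanSpace.single 0 Complex.I)) := by
  have hs := defFun_pos hx
  have h1 : (1 : ℂ) - x 0 * (starRingEnd ℂ) (x 0) = (defFun x : ℝ) := by
    rw [defFun, EuclideanSpace.norm_sq_eq, Complex.mul_conj, Complex.normSq_eq_norm_sq]
    simp
  rw [lapDensity, bergmanLaplacian_mul_density hx, cLap]
  simp only [Finset.univ_unique, Fin.default_eq_zero, Finset.sum_singleton, if_true]
  rw [h1, Complex.re_ofReal_mul, re_dz_dzbar hφ]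
  norm_num
  field_simp
  ring

/-- `∫ log|x|² (√-1/2) ∂∂̄`-Laplacian on the disc. -/
theorem integral_log_mul_laplacian {φ : Cn 1 → ℝ} (hφ : IsTestFunction φ) :
    ∫ x, Real.log (‖x‖ ^ 2) * (1 / 2 *
      (fderiv ℝ (fun y => fderiv ℝ φ y (EuclideanSpace.single 0 1)) x (EuclideanSpace.single 0 1)
        + fderiv ℝ (fun y => fderiv ℝ φ y (EuclideanSpace.single 0 Complex.I)) x
          (EuclideanSpace.single 0 Complex.I))) = 2 * Real.pi * φ 0 := by
  -- For `n = 1` the Green's function with pole `0` is `(2π)⁻¹ log|x|²`, so the general theorem on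
  -- `G_B` already contains the one-variable formula.
  rw [← integral_green_mul_lapDensity le_rfl zero_mem_unitBall hφ, ← integral_const_mul,
    ← setIntegral_eq_integral_of_forall_compl_eq_zero (s := unitBall 1)]
  · refine setIntegral_congr_ae isOpen_unitBall.measurableSet ?_
    filter_upwards [Measure.ae_ne volume 0] with x hx0 hx
    rw [toReal_green_one hx hx0, lapDensity_one hφ.1 hx]
    have := Real.pi_pos
    field_simp
  · intro x hx
    have h0 (w : Cn 1) : fderiv ℝ (fun y => fderiv ℝ φ y w) x w = 0 := by
      refine image_eq_zero_of_notMem_tsupport (f := fun x => fderiv ℝ (fun y => fderiv ℝ φ y w) x w)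
        fun h => hx (hφ.2.2 ?_)
      exact tsupport_fderiv_apply_subset ℝ w (tsupport_fderiv_apply_subset ℝ w h)
    rw [h0, h0]
    simp

theorem locallyIntegrable_log_norm : LocallyIntegrable fun x : Cn 1 => Real.log (‖x‖ ^ 2) := by
  intro x
  refine ⟨Metric.ball 0 (‖x‖ + 1), Metric.isOpen_ball.mem_nhds (by simp), ?_⟩
  refine (integrableOn_fun_norm_addHaar volume (f := fun y : ℝ => Real.log (y ^ 2))).mpr ?_
  rw [finrank_Cn]
  have : (fun y : ℝ => y ^ (2 * 1 - 1) • Real.log (y ^ 2)) = fun y => 2 * (y * Real.log y) := by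
    ext y
    rw [Real.log_pow]
    simp
    ring
  rw [this]
  exact ((Real.continuous_mul_log.const_mul 2).integrableOn_Icc).mono_set Ioo_subset_Icc_self

end OneVariable

/-! ### Splitting off the first coordinate -/

section Join

variable {m : ℕ}

/-- The point with first coordinate `x` and remaining coordinates `y`. -/
def join (x : Cn 1) (y : Cn m) : Cn (m + 1) := WithLp.toLp 2 (Fin.cons (x 0) y.ofLp)

@[simp] theorem join_zero (x : Cn 1) (y : Cn m) : join x y 0 = x 0 := rfl

@[simp] theorem join_succ (x : Cn 1) (y : Cn m) (j : Fin m) : join x y j.succ = y j := rfl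

theorem norm_Cn_one (x : Cn 1) : ‖x 0‖ = ‖x‖ := by
  rw [EuclideanSpace.norm_eq]
  simp

theorem norm_join_sq (x : Cn 1) (y : Cn m) : ‖join x y‖ ^ 2 = ‖x‖ ^ 2 + ‖y‖ ^ 2 := by
  rw [EuclideanSpace.norm_sq_eq, EuclideanSpace.norm_sq_eq y, Fin.sum_univ_succ, ← norm_Cn_one]
  rfl

/-- `join` as a complex linear map in both arguments. -/
def joinL (m : ℕ) : (Cn 1 × Cn m) ≃ₗ[ℂ] Cn (m + 1) where
  toFun p := join p.1 p.2
  map_add' p q := by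
    ext j; refine Fin.cases ?_ (fun j => ?_) j <;> simp
  map_smul' c p := by
    ext j; refine Fin.cases ?_ (fun j => ?_) j <;> simp
  invFun z := (WithLp.toLp 2 fun _ => z 0, WithLp.toLp 2 fun j => z j.succ)
  left_inv p := by
    refine Prod.ext ?_ ?_
    · ext j; rw [Subsingleton.elim j 0]; rfl
    · ext j; rfl
  right_inv z := by
    ext j; refine Fin.cases ?_ (fun j => ?_) j <;> rfl

/-- The isometry underlying `join`. -/
def joinIso (m : ℕ) : WithLp 2 (Cn 1 × Cn m) ≃ₗᵢ[ℝ] Cn (m + 1) where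
  toLinearEquiv := (WithLp.linearEquiv 2 ℝ (Cn 1 × Cn m)).trans ((joinL m).restrictScalars ℝ)
  norm_map' p := by
    refine (sq_eq_sq₀ (norm_nonneg _) (norm_nonneg _)).mp ?_
    rw [WithLp.prod_norm_sq_eq_of_L2]
    exact norm_join_sq _ _

theorem measurePreserving_join :
    MeasurePreserving (fun p : Cn 1 × Cn m => join p.1 p.2) (volume.prod volume) volume :=
  (joinIso m).measurePreserving.comp (WithLp.volume_preserving_toLp (Cn 1) (Cn m))

/-- `join` as a continuous linear equivalence. -/
def joinCL (m : ℕ) : (Cn 1 × Cn m) ≃L[ℂ] Cn (m + 1) := (joinL m).toContinuousLinearEquiv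

theorem measurableEmbedding_join : MeasurableEmbedding (fun p : Cn 1 × Cn m => join p.1 p.2) :=
  (joinCL m).toHomeomorph.measurableEmbedding

theorem integral_join {G : Cn (m + 1) → ℝ} (hG : Integrable G) :
    ∫ z, G z = ∫ y : Cn m, ∫ x : Cn 1, G (join x y) := by
  rw [← (measurePreserving_join (m := m)).integral_comp measurableEmbedding_join,
    integral_prod_symm]
  exact (measurePreserving_join.integrable_comp_emb measurableEmbedding_join).mpr hG

theorem locallyIntegrable_log_coord :
    LocallyIntegrable fun z : Cn (m + 1) => Real.log (‖z 0‖ ^ 2) := by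
  intro z
  set R := ‖z‖ + 1
  have hsub : (fun p : Cn 1 × Cn m => join p.1 p.2) ⁻¹' (Metric.ball 0 R)
      ⊆ Metric.ball 0 R ×ˢ Metric.ball 0 R := by
    intro p hp
    rw [mem_preimage, mem_ball_zero_iff] at hp
    have h := norm_join_sq p.1 p.2
    rw [mem_prod, mem_ball_zero_iff, mem_ball_zero_iff]
    constructor
    · refine lt_of_le_of_lt (abs_le_of_sq_le_sq' ?_ (norm_nonneg _)).2 hp
      nlinarith [sq_nonneg ‖p.2‖]
    · refine lt_of_le_of_lt (abs_le_of_sq_le_sq' ?_ (norm_nonneg _)).2 hp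
      nlinarith [sq_nonneg ‖p.1‖]
  refine ⟨Metric.ball 0 R, Metric.isOpen_ball.mem_nhds (by simp [R]), ?_⟩
  rw [← measurePreserving_join.integrableOn_comp_preimage measurableEmbedding_join]
  refine IntegrableOn.mono_set ?_ hsub
  have h1 : IntegrableOn (fun x : Cn 1 => Real.log (‖x‖ ^ 2)) (Metric.ball 0 R) :=
    (locallyIntegrable_log_norm.integrableOn_isCompact (isCompact_closedBall 0 R)).mono_set
      Metric.ball_subset_closedBall
  rw [IntegrableOn, ← Measure.prod_restrict]
  have : IsFiniteMeasure ((volume : Measure (Cn m)).restrict (Metric.ball 0 R)) :=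
    ⟨by simp [measure_ball_lt_top]⟩
  refine (h1.comp_fst ((volume : Measure (Cn m)).restrict (Metric.ball 0 R))).congr
    (Eventually.of_forall fun p => ?_)
  simp [norm_Cn_one]

theorem join_single (c : ℂ) : join (EuclideanSpace.single 0 c) (0 : Cn m) = EuclideanSpace.single 0 c := by
  ext j
  refine Fin.cases ?_ (fun j => ?_) j <;> simp

theorem fderiv_join {f : Cn (m + 1) → ℝ} (hf : Differentiable ℝ f) (x : Cn 1) (y : Cn m) (w : Cn 1) :
    fderiv ℝ (fun x => f (join x y)) x w = fderiv ℝ f (join x y) (join w 0) := by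
  have h1 : HasFDerivAt (fun x : Cn 1 => join x y)
      (((joinCL m : (Cn 1 × Cn m) →L[ℂ] Cn (m + 1)).restrictScalars ℝ).comp
        (ContinuousLinearMap.inl ℝ (Cn 1) (Cn m))) x := by
    exact HasFDerivAt.comp (f := fun x : Cn 1 => (x, y)) (g := fun p : Cn 1 × Cn m => join p.1 p.2) x
      (((joinCL m : (Cn 1 × Cn m) →L[ℂ] Cn (m + 1)).restrictScalars ℝ).hasFDerivAt)
      ((hasFDerivAt_id x).prodMk (hasFDerivAt_const y x))
  have h2 := ((hf (join x y)).hasFDerivAt.comp x h1).fderiv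
  have h3 : fderiv ℝ (fun x => f (join x y)) x = _ := h2
  rw [h3]
  rfl

theorem contDiff_join (y : Cn m) : ContDiff ℝ ∞ fun x : Cn 1 => join x y :=
  ((joinCL m : (Cn 1 × Cn m) →L[ℂ] Cn (m + 1)).restrictScalars ℝ).contDiff.comp
    (contDiff_id.prodMk contDiff_const)

/-- The Poincaré–Lelong formula for the coordinate function `z₀`. -/
theorem integral_log_coord_mul_laplacian {f : Cn (m + 1) → ℝ} (hf : ContDiff ℝ ∞ f)
    (hc : HasCompactSupport f) (hs : tsupport f ⊆ {z | ‖z 0‖ < 1}) :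
    ∫ z, Real.log (‖z 0‖ ^ 2) * (1 / 2 *
      (fderiv ℝ (fun y => fderiv ℝ f y (EuclideanSpace.single 0 1)) z (EuclideanSpace.single 0 1)
        + fderiv ℝ (fun y => fderiv ℝ f y (EuclideanSpace.single 0 Complex.I)) z
          (EuclideanSpace.single 0 Complex.I))) = 2 * Real.pi * ∫ y : Cn m, f (join 0 y) := by
  have hsm1 (w : Cn (m + 1)) : ContDiff ℝ 1 fun y => fderiv ℝ f y w :=
    (hf.fderiv_right (m := 1) (by norm_cast)).clm_apply contDiff_const
  have hcont (w : Cn (m + 1)) : Continuous fun z => fderiv ℝ (fun y => fderiv ℝ f y w) z w :=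
    continuous_fderiv_apply (hsm1 w) w
  have hcs (w : Cn (m + 1)) : HasCompactSupport fun z => fderiv ℝ (fun y => fderiv ℝ f y w) z w :=
    (hc.fderiv_apply ℝ w).fderiv_apply ℝ w
  rw [integral_join, ← integral_const_mul]
  · congr 1
    ext y
    -- The support condition `|z₀| < 1` makes every slice a test function on the unit disc.
    have hφ : IsTestFunction fun x : Cn 1 => f (join x y) := by
      have hsub : tsupport (fun x : Cn 1 => f (join x y)) ⊆ (fun x => join x y) ⁻¹' tsupport f :=
        tsupport_comp_subset_preimage f (contDiff_join y).continuous
      have hsub2 : tsupport (fun x : Cn 1 => f (join x y)) ⊆ unitBall 1 := fun x hx => by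
        have := hs (hsub hx)
        rw [mem_ofPred_eq, join_zero, norm_Cn_one] at this
        exact mem_ball_zero_iff.mpr this
      exact ⟨hf.comp (contDiff_join y), (isCompact_closedBall (0 : Cn 1) 1).of_isClosed_subset
        (isClosed_tsupport _) (hsub2.trans Metric.ball_subset_closedBall), hsub2⟩
    rw [← integral_log_mul_laplacian hφ]
    congr 1
    ext x
    have h2 (c : ℂ) : fderiv ℝ (fun x => fderiv ℝ (fun x => f (join x y)) x
          (EuclideanSpace.single 0 c)) x (EuclideanSpace.single 0 c)
        = fderiv ℝ (fun z => fderiv ℝ f z (EuclideanSpace.single 0 c)) (join x y)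
          (EuclideanSpace.single 0 c) := by
      simp only [fderiv_join (hf.differentiable (by norm_num)), join_single]
      rw [fderiv_join ((hsm1 _).differentiable (by norm_num)), join_single]
    rw [h2, h2, join_zero, norm_Cn_one]
  · exact integrable_mul_of_hasCompactSupport locallyIntegrable_log_coord
      (((hcont _).add (hcont _)).const_mul _) (((hcs _).add (hcs _)).mul_left)

end Join

end BergmanBall
end

noncomputable section
namespace BergmanBall

/-! ### The positively oriented frame -/

section Frame

variable {n m : ℕ}

theorem span_frame_eq_top : ⊤ ≤ Submodule.span ℝ (range fun i : Fin (2 * n) => frame n i) := by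
  intro x _
  have hmem (j : Fin n) (b : ℕ) (hb : b < 2) :
      (EuclideanSpace.single j (if b = 0 then 1 else Complex.I) : Cn n)
        ∈ Submodule.span ℝ (range fun i : Fin (2 * n) => frame n i) := by
    refine Submodule.subset_span ⟨⟨2 * j + b, by omega⟩, ?_⟩
    have h1 : (2 * (j : ℕ) + b) / 2 = j := by omega
    have h2 : (2 * (j : ℕ) + b) % 2 = b := by omega
    simp [frame, h1, h2]
  have e : x = ∑ j, ((x j).re • (EuclideanSpace.single j (1 : ℂ) : Cn n)
      + (x j).im • (EuclideanSpace.single j Complex.I : Cn n)) := by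
    ext k
    rw [WithLp.ofLp_sum, Finset.sum_apply, Finset.sum_eq_single k]
    · simp
    · intro j _ hj
      simp [hj.symm]
    · simp
  rw [e]
  refine Submodule.sum_mem _ fun j _ => Submodule.add_mem _ (Submodule.smul_mem _ _ ?_)
    (Submodule.smul_mem _ _ ?_)
  · simpa using hmem j 0 (by norm_num)
  · simpa using hmem j 1 (by norm_num)

/-- The frame as a real basis. -/
def frameBasis (n : ℕ) : Module.Basis (Fin (2 * n)) ℝ (Cn n) :=
  basisOfTopLeSpanOfCardEqFinrank (fun i : Fin (2 * n) => frame n i) span_frame_eq_top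
    (by rw [Fintype.card_fin, finrank_Cn])

/-- Top-degree forms transform by the Jacobian determinant. -/
theorem map_frame_det {p : ℕ} (hp : p = 2 * n) (A : Cn n [⋀^Fin p]→L[ℝ] ℝ) (L : Cn n →L[ℂ] Cn n) :
    A (fun i => L (frame n i)) = |(L.restrictScalars ℝ).det| * A fun i => frame n i := by
  subst hp
  have hb : (fun i : Fin (2 * n) => frame n i) = frameBasis n := by
    simp [frameBasis]
  have h1 := AlternatingMap.eq_smul_basis_det (frameBasis n) A.toAlternatingMap
  have hdet : 0 ≤ (L.restrictScalars ℝ).det := by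
    have : (L.restrictScalars ℝ).det = Algebra.norm ℝ L.det := by
      rw [ContinuousLinearMap.det, ContinuousLinearMap.det, ← LinearMap.det_restrictScalars]
      rfl
    -- The real determinant of a complex linear map is the squared modulus of the complex one;
    -- holomorphic changes of coordinates therefore preserve orientation.
    rw [this, Algebra.norm_complex_apply]
    exact Complex.normSq_nonneg _
  have h2 : A (fun i => L (frame n i)) = A.toAlternatingMap
      ((L.restrictScalars ℝ : Cn n →ₗ[ℝ] Cn n) ∘ frameBasis n) := by
    rw [← hb]; rfl
  rw [h2, h1, AlternatingMap.smul_apply, Module.Basis.det_comp, Module.Basis.det_self,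
    abs_of_nonneg hdet, hb, smul_eq_mul, mul_one, mul_comm]
  rfl

theorem frame_succ_succ (i : ℕ) : frame (m + 1) (i + 2) = join 0 (frame m i) := by
  have h1 : (i + 2) / 2 = i / 2 + 1 := by omega
  have h2 : (i + 2) % 2 = i % 2 := by omega
  unfold frame
  by_cases h : i / 2 < m
  · have h' : (i + 2) / 2 < m + 1 := by omega
    rw [dif_pos h, dif_pos h', h2]
    have h3 : (⟨(i + 2) / 2, h'⟩ : Fin (m + 1)) = Fin.succ ⟨i / 2, h⟩ := Fin.ext h1
    rw [h3]
    ext j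
    refine Fin.cases ?_ (fun j => ?_) j
    · simp
    · simp [Fin.ext_iff]
  · have h' : ¬ (i + 2) / 2 < m + 1 := by omega
    rw [dif_neg h, dif_neg h']
    ext j
    refine Fin.cases ?_ (fun j => ?_) j <;> simp

theorem frame_zero : frame (m + 1) 0 = EuclideanSpace.single 0 1 := by
  simp [frame]

theorem frame_one : frame (m + 1) 1 = EuclideanSpace.single 0 Complex.I := by
  simp [frame]

end Frame

/-! ### Holomorphic charts straightening a function -/

section Chart

variable {m : ℕ} {g : Cn (m + 1) → ℂ}

/-- The map with first coordinate `g` and remaining coordinates `π`. -/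
def straighten (g : Cn (m + 1) → ℂ) (π : Cn (m + 1) →L[ℂ] Cn m) (x : Cn (m + 1)) : Cn (m + 1) :=
  join (g x • EuclideanSpace.single 0 1) (π x)

theorem straighten_zero (π : Cn (m + 1) →L[ℂ] Cn m) (x : Cn (m + 1)) :
    straighten g π x 0 = g x := by
  simp [straighten]

/-- `straighten g π` maps `N` biholomorphically onto `Y`, with inverse `Ψ`. -/
structure IsChart (g : Cn (m + 1) → ℂ) (π : Cn (m + 1) →L[ℂ] Cn m) (N Y : Set (Cn (m + 1)))
    (Ψ : Cn (m + 1) → Cn (m + 1)) : Prop where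
  isOpen_source : IsOpen N
  isOpen_target : IsOpen Y
  differentiableOn : DifferentiableOn ℂ g N
  differentiableOn_symm : DifferentiableOn ℂ Ψ Y
  symm_mem : ∀ y ∈ Y, Ψ y ∈ N
  mem : ∀ x ∈ N, straighten g π x ∈ Y
  left_inv : ∀ x ∈ N, Ψ (straighten g π x) = x
  right_inv : ∀ y ∈ Y, straighten g π (Ψ y) = y

/-- Take `π` to forget a coordinate `k` with `l(e_k) ≠ 0`: the other coordinates and the value of
`l` then determine the point. -/
theorem exists_injective_straighten {l : Cn (m + 1) →L[ℂ] ℂ} (hl : l ≠ 0) :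
    ∃ π : Cn (m + 1) →L[ℂ] Cn m, Function.Injective (straighten l π) := by
  obtain ⟨k, hk⟩ : ∃ k, l (EuclideanSpace.single k 1) ≠ 0 := by
    by_contra! h
    apply hl
    have : (l : Cn (m + 1) →ₗ[ℂ] ℂ) = 0 := by
      refine (EuclideanSpace.basisFun (Fin (m + 1)) ℂ).toBasis.ext fun k => ?_
      simpa using h k
    ext x
    exact LinearMap.congr_fun this x
  let π₀ : Cn (m + 1) →ₗ[ℂ] Cn m :=
    { toFun := fun x => WithLp.toLp 2 fun j => x (k.succAbove j)
      map_add' := fun x y => by ext j; simp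
      map_smul' := fun c x => by ext j; simp }
  refine ⟨LinearMap.toContinuousLinearMap π₀, fun x y hxy => ?_⟩
  have h0 : l x = l y := by
    rw [← straighten_zero (g := l) (LinearMap.toContinuousLinearMap π₀) x, hxy, straighten_zero]
  have hj (j : Fin m) : x (k.succAbove j) = y (k.succAbove j) := by
    have := congrFun (congrArg WithLp.ofLp hxy) j.succ
    simpa [straighten, π₀] using this
  have hsub : x - y = (x k - y k) • EuclideanSpace.single k 1 := by
    ext i
    rcases Fin.eq_self_or_eq_succAbove k i with rfl | ⟨j, rfl⟩
    · simp
    · simp [hj j, Fin.succAbove_ne]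
  have h1 : (x k - y k) * l (EuclideanSpace.single k 1) = 0 := by
    rw [← smul_eq_mul, ← map_smul, ← hsub, map_sub, h0, sub_self]
  rw [(mul_eq_zero.mp h1).resolve_right hk, zero_smul] at hsub
  exact sub_eq_zero.mp hsub

theorem hasFDerivAt_straighten {l : Cn (m + 1) →L[ℂ] ℂ} {x : Cn (m + 1)} (hg : HasFDerivAt g l x)
    (π : Cn (m + 1) →L[ℂ] Cn m) : HasFDerivAt (straighten g π)
      ((joinCL m : (Cn 1 × Cn m) →L[ℂ] Cn (m + 1)).comp
        ((l.smulRight (EuclideanSpace.single 0 1)).prod π)) x :=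
  HasFDerivAt.comp (f := fun x => (g x • (EuclideanSpace.single 0 1 : Cn 1), π x))
    (g := fun p : Cn 1 × Cn m => join p.1 p.2) x
    ((joinCL m : (Cn 1 × Cn m) →L[ℂ] Cn (m + 1)).hasFDerivAt)
    ((hg.smul_const (EuclideanSpace.single 0 1)).prodMk π.hasFDerivAt)

theorem exists_isChart {O : Set (Cn (m + 1))} (hO : IsOpen O) (hg : DifferentiableOn ℂ g O)
    {w : Cn (m + 1)} (hw : w ∈ O) (hd : fderiv ℂ g w ≠ 0) :
    ∃ π N Y Ψ, IsChart g π N Y Ψ ∧ w ∈ N ∧ N ⊆ O := by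
  obtain ⟨π, hπ⟩ := exists_injective_straighten hd
  set L := (joinCL m : (Cn 1 × Cn m) →L[ℂ] Cn (m + 1)).comp
        (((fderiv ℂ g w).smulRight (EuclideanSpace.single 0 1)).prod π) with hL
  let A : Cn (m + 1) ≃L[ℂ] Cn (m + 1) :=
    (LinearEquiv.ofInjectiveEndo (L : Cn (m + 1) →ₗ[ℂ] Cn (m + 1)) hπ).toContinuousLinearEquiv
  have hgs : ContDiffAt ℂ ∞ g w := (contDiffOn_of_differentiableOn hO hg).contDiffAt (hO.mem_nhds hw)
  have hes : ContDiffAt ℂ 1 (straighten g π) w :=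
    ((joinCL m : (Cn 1 × Cn m) →L[ℂ] Cn (m + 1)).contDiff.contDiffAt.comp w
      ((hgs.smul contDiffAt_const).prodMk π.contDiff.contDiffAt)).of_le (by norm_cast)
  have hA : HasFDerivAt (straighten g π) (A : Cn (m + 1) →L[ℂ] Cn (m + 1)) w :=
    (hasFDerivAt_straighten (hg.differentiableAt (hO.mem_nhds hw)).hasFDerivAt π).congr_fderiv
      (by ext x : 1; rfl)
  set h := hes.toOpenPartialHomeomorph (straighten g π) hA one_ne_zero with hh
  have hcoe : (h : Cn (m + 1) → Cn (m + 1)) = straighten g π := rfl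
  have hwh : w ∈ h.source := hes.mem_toOpenPartialHomeomorph_source hA one_ne_zero
  have hsymm : ContDiffAt ℂ 1 h.symm (straighten g π w) := hes.to_localInverse hA one_ne_zero
  have hev : ∀ᶠ y in 𝓝 (straighten g π w), DifferentiableAt ℂ h.symm y := by
    filter_upwards [hsymm.eventually (by simp)] with y hy
    exact hy.differentiableAt (by norm_num)
  obtain ⟨D, hDsub, hDo, hDw⟩ := eventually_nhds_iff.mp hev
  -- The target is cut down so that the local inverse lands in `O` and is differentiable everywhere,
  -- not merely at the base point.
  have hY : IsOpen (h.target ∩ h.symm ⁻¹' O ∩ D) := (h.isOpen_inter_preimage_symm hO).inter hDo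
  refine ⟨π, h.source ∩ h ⁻¹' (h.target ∩ h.symm ⁻¹' O ∩ D), h.target ∩ h.symm ⁻¹' O ∩ D, h.symm,
    ⟨h.isOpen_inter_preimage hY, hY, ?_, ?_, ?_, ?_, ?_, ?_⟩, ?_, ?_⟩
  · refine hg.mono fun x hx => ?_
    have := hx.2.1.2
    rwa [mem_preimage, h.left_inv hx.1] at this
  · exact fun y hy => (hDsub y hy.2).differentiableWithinAt
  · intro y hy
    refine ⟨h.map_target hy.1.1, ?_⟩
    rw [mem_preimage, h.right_inv hy.1.1]
    exact hy
  · exact fun x hx => hx.2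
  · exact fun x hx => h.left_inv hx.1
  · exact fun y hy => h.right_inv hy.1.1
  · refine ⟨hwh, ⟨h.map_source hwh, ?_⟩, ?_⟩
    · rw [mem_preimage, h.left_inv hwh]
      exact hw
    · exact hDw
  · intro x hx
    have := hx.2.1.2
    rwa [mem_preimage, h.left_inv hx.1] at this

end Chart

end BergmanBall
end

noncomputable section
namespace BergmanBall

/-! ### Pull-back to a chart -/

theorem differentiableOn_coord {n m : ℕ} {Ψ : Cn n → Cn m} {Y : Set (Cn n)}
    (hΨ : DifferentiableOn ℂ Ψ Y) (j : Fin m) : DifferentiableOn ℂ (fun y => Ψ y j) Y :=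
  differentiableOn_euclidean.mp hΨ j

theorem contDiffAt_of_differentiableOn {n m : ℕ} {Ψ : Cn n → Cn m} {Y : Set (Cn n)} (hY : IsOpen Y)
    (hΨ : DifferentiableOn ℂ Ψ Y) {y : Cn n} (hy : y ∈ Y) : ContDiffAt ℝ ∞ Ψ y := by
  have h : ContDiffAt ℂ ∞ Ψ y := contDiffAt_euclidean.mpr fun j =>
    (contDiffOn_of_differentiableOn hY (differentiableOn_coord hΨ j)).contDiffAt (hY.mem_nhds hy)
  exact h.restrict_scalars ℝ

section Pullback

variable {m p : ℕ} {g : Cn (m + 1) → ℂ} {π : Cn (m + 1) →L[ℂ] Cn m} {N Y : Set (Cn (m + 1))}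
  {Ψ : Cn (m + 1) → Cn (m + 1)} {θ : RForm (m + 1) p}

open Classical in
/-- The pull-back of a form under `Ψ : Y → N`, extended by zero. -/
def pullback (Y : Set (Cn (m + 1))) (Ψ : Cn (m + 1) → Cn (m + 1)) (θ : RForm (m + 1) p) :
    RForm (m + 1) p :=
  fun y => if y ∈ Y then (θ (Ψ y)).compContinuousLinearMap (fderiv ℝ Ψ y) else 0

theorem pullback_of_mem {y : Cn (m + 1)} (hy : y ∈ Y) :
    pullback Y Ψ θ y = (θ (Ψ y)).compContinuousLinearMap (fderiv ℝ Ψ y) := if_pos hy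

namespace IsChart

theorem hasFDerivAt_symm (h : IsChart g π N Y Ψ) {y : Cn (m + 1)} (hy : y ∈ Y) :
    HasFDerivAt Ψ ((fderiv ℂ Ψ y).restrictScalars ℝ) y :=
  (h.differentiableOn_symm.differentiableAt (h.isOpen_target.mem_nhds hy)).hasFDerivAt.restrictScalars ℝ

theorem fderiv_symm (h : IsChart g π N Y Ψ) {y : Cn (m + 1)} (hy : y ∈ Y) :
    fderiv ℝ Ψ y = (fderiv ℂ Ψ y).restrictScalars ℝ := (h.hasFDerivAt_symm hy).fderiv

theorem contDiffAt_symm (h : IsChart g π N Y Ψ) {y : Cn (m + 1)} (hy : y ∈ Y) :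
    ContDiffAt ℝ ∞ Ψ y :=
  contDiffAt_of_differentiableOn h.isOpen_target h.differentiableOn_symm hy

theorem apply_symm (h : IsChart g π N Y Ψ) {y : Cn (m + 1)} (hy : y ∈ Y) : g (Ψ y) = y 0 := by
  rw [← straighten_zero (g := g) π, h.right_inv y hy]

theorem injOn_symm (h : IsChart g π N Y Ψ) : InjOn Ψ Y := fun x hx y hy hxy => by
  rw [← h.right_inv x hx, hxy, h.right_inv y hy]

theorem image_symm (h : IsChart g π N Y Ψ) : Ψ '' Y = N := by
  ext x
  constructor
  · rintro ⟨y, hy, rfl⟩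
    exact h.symm_mem y hy
  · exact fun hx => ⟨_, h.mem x hx, h.left_inv x hx⟩

theorem continuousOn_straighten (h : IsChart g π N Y Ψ) : ContinuousOn (straighten g π) N := by
  have : Continuous fun p : Cn 1 × Cn m => join p.1 p.2 := (joinCL m).continuous
  exact this.comp_continuousOn
    ((h.differentiableOn.continuousOn.smul continuousOn_const).prodMk π.continuous.continuousOn)

theorem pullback_support (h : IsChart g π N Y Ψ) (hc : HasCompactSupport θ) (hs : tsupport θ ⊆ N) :
    IsCompact (straighten g π '' tsupport θ) ∧ straighten g π '' tsupport θ ⊆ Y ∧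
      tsupport (pullback Y Ψ θ) ⊆ straighten g π '' tsupport θ := by
  have hK : IsCompact (straighten g π '' tsupport θ) :=
    hc.image_of_continuousOn (h.continuousOn_straighten.mono hs)
  refine ⟨hK, ?_, closure_minimal (fun y hy => ?_) hK.isClosed⟩
  · rintro _ ⟨x, hx, rfl⟩
    exact h.mem x (hs hx)
  · by_cases hyY : y ∈ Y
    · refine ⟨Ψ y, ?_, h.right_inv y hyY⟩
      by_contra hn
      refine hy ?_
      rw [pullback_of_mem hyY, image_eq_zero_of_notMem_tsupport hn]
      rfl
    · exact absurd (if_neg hyY) hy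

theorem hasCompactSupport_pullback (h : IsChart g π N Y Ψ) (hc : HasCompactSupport θ)
    (hs : tsupport θ ⊆ N) : HasCompactSupport (pullback Y Ψ θ) :=
  (h.pullback_support hc hs).1.of_isClosed_subset (isClosed_tsupport _) (h.pullback_support hc hs).2.2

theorem eventuallyEq_pullback (h : IsChart g π N Y Ψ) {y : Cn (m + 1)} (hy : y ∈ Y) :
    pullback Y Ψ θ =ᶠ[𝓝 y] fun y => (θ (Ψ y)).compContinuousLinearMap (fderiv ℝ Ψ y) := by
  filter_upwards [h.isOpen_target.mem_nhds hy] with x hx using pullback_of_mem hx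

theorem contDiff_pullback (h : IsChart g π N Y Ψ) (hθ : ContDiff ℝ ∞ θ) (hc : HasCompactSupport θ)
    (hs : tsupport θ ⊆ N) : ContDiff ℝ ∞ (pullback Y Ψ θ) := by
  rw [contDiff_iff_contDiffAt]
  intro y
  by_cases hy : y ∈ tsupport (pullback Y Ψ θ)
  · have hyY := (h.pullback_support hc hs).2.1 ((h.pullback_support hc hs).2.2 hy)
    refine ContDiffAt.congr_of_eventuallyEq ?_ (h.eventuallyEq_pullback hyY)
    exact contDiffAt_compContinuousLinearMap
      (hθ.contDiffAt.comp y (h.contDiffAt_symm hyY))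
      ((h.contDiffAt_symm hyY).fderiv_right (m := ∞) (by simp))
  · exact contDiffAt_const.congr_of_eventuallyEq (notMem_tsupport_iff_eventuallyEq.mp hy)

theorem comp_J (h : IsChart g π N Y Ψ) {y : Cn (m + 1)} (hy : y ∈ Y) :
    (fderiv ℝ Ψ y).comp (J (m + 1)) = (J (m + 1)).comp (fderiv ℝ Ψ y) := by
  rw [h.fderiv_symm hy]
  ext x : 1
  simp only [ContinuousLinearMap.comp_apply, J_apply, ContinuousLinearMap.coe_restrictScalars',
    map_smul]

theorem pullback_J (h : IsChart g π N Y Ψ)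
    (hJ : ∀ z, (θ z).compContinuousLinearMap (J (m + 1)) = θ z) (y : Cn (m + 1)) :
    (pullback Y Ψ θ y).compContinuousLinearMap (J (m + 1)) = pullback Y Ψ θ y := by
  by_cases hy : y ∈ Y
  · rw [pullback_of_mem hy]
    ext K
    have h1 := h.comp_J hy
    have h2 (i : Fin p) : fderiv ℝ Ψ y (J (m + 1) (K i)) = J (m + 1) (fderiv ℝ Ψ y (K i)) :=
      DFunLike.congr_fun h1 (K i)
    have h3 := DFunLike.congr_fun (hJ (Ψ y)) fun i => fderiv ℝ Ψ y (K i)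
    simp only [ContinuousAlternatingMap.compContinuousLinearMap_apply, Function.comp_def] at h3 ⊢
    simp only [h2, h3]
  · rw [pullback, if_neg hy]
    rfl

/-- The exterior derivative commutes with pull-back, and `J` does because the differential of the
holomorphic map `Ψ` is complex linear. -/
theorem ddc_pullback (h : IsChart g π N Y Ψ) (hθ : ContDiff ℝ ∞ θ) {y : Cn (m + 1)} (hy : y ∈ Y) :
    ddc (pullback Y Ψ θ) y = (ddc θ (Ψ y)).compContinuousLinearMap (fderiv ℝ Ψ y) := by
  have hmin : minSmoothness ℝ 2 ≤ (∞ : WithTop ℕ∞) := by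
    rw [minSmoothness_of_isRCLikeNormedField]
    norm_cast
  have e1 : (fun z => (-(1 / 2 : ℝ)) •
        (extDeriv (pullback Y Ψ θ) z).compContinuousLinearMap (J (m + 1)))
      =ᶠ[𝓝 y] fun z => ((-(1 / 2 : ℝ)) • (extDeriv θ (Ψ z)).compContinuousLinearMap
        (J (m + 1))).compContinuousLinearMap (fderiv ℝ Ψ z) := by
    filter_upwards [h.isOpen_target.mem_nhds hy] with z hz
    rw [(h.eventuallyEq_pullback hz).extDeriv_eq,
      extDeriv_pullback (hθ.differentiable (by norm_num) _) (h.contDiffAt_symm hz) hmin]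
    ext K
    have h2 (i : Fin (p + 1)) : fderiv ℝ Ψ z (J (m + 1) (K i)) = J (m + 1) (fderiv ℝ Ψ z (K i)) :=
      DFunLike.congr_fun (h.comp_J hz) (K i)
    simp only [ContinuousAlternatingMap.smul_apply,
      ContinuousAlternatingMap.compContinuousLinearMap_apply, Function.comp_def, h2]
  rw [ddc, e1.extDeriv_eq, extDeriv_pullback
    ((contDiff_dJ hθ).differentiable (by norm_num) _) (h.contDiffAt_symm hy) hmin]
  rfl

theorem notMem_tsupport_ddc_eq_zero {n : ℕ} {θ : RForm n p} {x : Cn n} (hx : x ∉ tsupport θ) :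
    ddc θ x = 0 :=
  image_eq_zero_of_notMem_tsupport fun h => hx (tsupport_ddc_subset h)

end IsChart

end Pullback

/-- The Poincaré–Lelong formula in a chart. -/
theorem IsChart.ddcCurrent_eq {m : ℕ} {g : Cn (m + 1) → ℂ} {π : Cn (m + 1) →L[ℂ] Cn m}
    {N Y : Set (Cn (m + 1))} {Ψ : Cn (m + 1) → Cn (m + 1)} {θ : RForm (m + 1) (2 * m)}
    (h : IsChart g π N Y Ψ) (hNB : N ⊆ unitBall (m + 1)) (hg1 : ∀ x ∈ N, ‖g x‖ < 1)
    (hθ : ContDiff ℝ ∞ θ) (hc : HasCompactSupport θ) (hs : tsupport θ ⊆ N)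
    (hJ : ∀ z, (θ z).compContinuousLinearMap (J (m + 1)) = θ z) :
    ∫ z in unitBall (m + 1), logSq g z * ddc θ z (fun i => frame (m + 1) i)
      = 2 * Real.pi * ∫ y : Cn m, pullback Y Ψ θ (join 0 y) fun j => join 0 (frame m j) := by
  have hη := h.contDiff_pullback hθ hc hs
  have hηc := h.hasCompactSupport_pullback hc hs
  obtain ⟨hK, hKY, hηK⟩ := h.pullback_support hc hs
  have hY := h.isOpen_target.measurableSet
  set η := pullback Y Ψ θ with hηdef
  rw [setIntegral_eq_of_subset_of_forall_sdiff_eq_zero isOpen_unitBall.measurableSet hNB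
    fun x hx => by
      rw [IsChart.notMem_tsupport_ddc_eq_zero fun h' => hx.2 (hs h')]
      simp]
  rw [← h.image_symm, integral_image_eq_integral_abs_det_fderiv_smul volume hY
    (fun y hy => (h.hasFDerivAt_symm hy).hasFDerivWithinAt) h.injOn_symm]
  have e1 : ∀ y ∈ Y, |((fderiv ℂ Ψ y).restrictScalars ℝ).det| •
      (logSq g (Ψ y) * ddc θ (Ψ y) fun i => frame (m + 1) i)
      = Real.log (‖y 0‖ ^ 2) * ddc η y fun i => frame (m + 1) i := by
    intro y hy
    -- The Jacobian of the change of variables is absorbed into the pulled-back top-degree form,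
    -- while `log|g|²` becomes `log|y₀|²`.
    have := map_frame_det (p := 2 * m + 1 + 1) (n := m + 1) rfl (ddc θ (Ψ y)) (fderiv ℂ Ψ y)
    rw [smul_eq_mul, mul_left_comm, ← this, logSq, h.apply_symm hy, h.ddc_pullback hθ hy,
      h.fderiv_symm hy]
    rfl
  rw [setIntegral_congr_fun hY e1, setIntegral_eq_integral_of_forall_compl_eq_zero fun y hy => by
    rw [IsChart.notMem_tsupport_ddc_eq_zero fun h' => hy (hKY (hηK h'))]
    simp]
  have k2 (j : Fin (2 * m)) : frame (m + 1) ((j.succ.succ : Fin (2 * m + 1 + 1)) : ℕ)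
      = join 0 (frame m j) := frame_succ_succ _
  rw [integral_mul_ddc locallyIntegrable_log_coord hη hηc (h.pullback_J hJ)]
  · simp only [k2]
    rw [← integral_log_coord_mul_laplacian (f := fun z => η z fun j => join 0 (frame m j))
      (contDiff_apply_frame hη _) (hasCompactSupport_apply hηc _)]
    · simp only [Fin.val_zero, Fin.val_one, frame_zero, frame_one]
    · intro y hy
      have hy' : y ∈ straighten g π '' tsupport θ := by
        refine hηK (closure_mono (fun x hx => ?_) hy)
        intro h0
        exact hx (by simp [h0])
      obtain ⟨x, hx, rfl⟩ := hy'
      rw [mem_ofPred_eq, straighten_zero]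
      exact hg1 x (hs hx)
  · simp only [Fin.val_zero, Fin.val_one, frame_zero, frame_one, J_apply, single_I]
  · intro j x t
    rw [k2]
    simp
  · intro j x t
    rw [k2]
    simp [J_apply]

end BergmanBall
end

noncomputable section
namespace BergmanBall

/-! ### The zero set in a chart -/

section Slice

variable {m : ℕ} {g : Cn (m + 1) → ℂ} {π : Cn (m + 1) →L[ℂ] Cn m} {N Y W : Set (Cn (m + 1))}
  {Ψ : Cn (m + 1) → Cn (m + 1)}

/-- The inclusion of the hyperplane `z₀ = 0`. -/
def joinZero (m : ℕ) : Cn m →L[ℂ] Cn (m + 1) :=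
  (joinCL m : (Cn 1 × Cn m) →L[ℂ] Cn (m + 1)).comp (ContinuousLinearMap.inr ℂ (Cn 1) (Cn m))

theorem join_zero_injective : Function.Injective fun y : Cn m => join 0 y := fun x y h => by
  ext j
  exact congrFun (congrArg WithLp.ofLp h) j.succ

theorem straighten_of_eq_zero {x : Cn (m + 1)} (hx : g x = 0) :
    straighten g π x = join 0 (π x) := by
  rw [straighten, hx, zero_smul]

namespace IsChart

variable (h : IsChart g π N Y Ψ)
include h

theorem proj_symm_join {y : Cn m} (hy : join 0 y ∈ Y) : π (Ψ (join 0 y)) = y := by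
  ext j
  exact congrFun (congrArg WithLp.ofLp (h.right_inv _ hy)) j.succ

theorem isOpen_slice : IsOpen {y : Cn m | join 0 y ∈ Y} :=
  h.isOpen_target.preimage (joinZero m).continuous

theorem hasFDerivAt_slice {y : Cn m} (hy : join 0 y ∈ Y) :
    HasFDerivAt (fun y : Cn m => Ψ (join 0 y)) ((fderiv ℂ Ψ (join 0 y)).comp (joinZero m)) y :=
  HasFDerivAt.comp (f := fun y : Cn m => join 0 y) (g := Ψ) y
    (h.differentiableOn_symm.differentiableAt (h.isOpen_target.mem_nhds hy)).hasFDerivAt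
    (joinZero m).hasFDerivAt

/-- The chart parametrizes the zero set of `g`. -/
theorem isParam_slice (hW : W ∩ N = {x ∈ N | g x = 0}) :
    IsParam W {y : Cn m | join 0 y ∈ Y} (fun y : Cn m => Ψ (join 0 y)) ∧
      W ∩ N ⊆ (fun y : Cn m => Ψ (join 0 y)) '' {y : Cn m | join 0 y ∈ Y} := by
  have himg : (fun y : Cn m => Ψ (join 0 y)) '' {y : Cn m | join 0 y ∈ Y} = W ∩ N := by
    rw [hW]
    ext x
    constructor
    · rintro ⟨y, hy, rfl⟩
      exact ⟨h.symm_mem _ hy, by rw [h.apply_symm hy]; simp⟩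
    · rintro ⟨hx, hgx⟩
      have e := straighten_of_eq_zero (π := π) hgx
      refine ⟨π x, ?_, ?_⟩
      · rw [mem_ofPred_eq, ← e]
        exact h.mem x hx
      · beta_reduce
        rw [← e, h.left_inv x hx]
  refine ⟨⟨h.isOpen_slice, fun y hy => (h.hasFDerivAt_slice hy).differentiableAt.differentiableWithinAt,
    fun x hx y hy hxy => ?_, fun y hy => ?_, N, h.isOpen_source, himg⟩, himg.symm.subset⟩
  · rw [← h.proj_symm_join hx, ← h.proj_symm_join hy]
    exact congrArg π hxy
  · have h1 := π.hasFDerivAt.comp y (h.hasFDerivAt_slice hy)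
    have h2 : (π ∘ fun y : Cn m => Ψ (join 0 y)) =ᶠ[𝓝 y] id := by
      filter_upwards [h.isOpen_slice.mem_nhds hy] with z hz using h.proj_symm_join hz
    have h3 := (h1.congr_of_eventuallyEq h2.symm).unique (hasFDerivAt_id y)
    have h4 : fderiv ℂ (fun y : Cn m => Ψ (join 0 y)) y = _ := (h.hasFDerivAt_slice hy).fderiv
    intro a b hab
    have hab' : (fderiv ℂ Ψ (join 0 y)).comp (joinZero m) a
        = (fderiv ℂ Ψ (join 0 y)).comp (joinZero m) b := by
      rw [← h4]; exact hab
    have h5 (v : Cn m) : π ((fderiv ℂ Ψ (join 0 y)).comp (joinZero m) v) = v := DFunLike.congr_fun h3 v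
    rw [← h5 a, ← h5 b, hab']

/-- The zeros of `g` are contained in the image of part of the hyperplane `y₀ = 0` under the
differentiable map `Ψ`, which preserves null sets. -/
theorem volume_zeros : volume {x ∈ N | g x = 0} = 0 := by
  have h1 : {x ∈ N | g x = 0} ⊆ Ψ '' (Y ∩ {y | y 0 = 0}) := by
    rintro x ⟨hx, hgx⟩
    exact ⟨straighten g π x, ⟨h.mem x hx, by rw [mem_ofPred_eq, straighten_zero, hgx]⟩, h.left_inv x hx⟩
  refine measure_mono_null h1 (addHaar_image_eq_zero_of_differentiableOn_of_addHaar_eq_zero volume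
    (fun y hy => (h.hasFDerivAt_symm hy.1).differentiableAt.differentiableWithinAt) ?_)
  refine measure_mono_null inter_subset_right ?_
  let S : Submodule ℝ (Cn (m + 1)) :=
    { carrier := {y | y 0 = 0}
      add_mem' := fun {a b} ha hb => by
        rw [mem_ofPred_eq] at *
        simp [ha, hb]
      zero_mem' := rfl
      smul_mem' := fun c a ha => by
        rw [mem_ofPred_eq] at *
        simp [ha] }
  refine Measure.addHaar_submodule volume S fun htop => ?_
  have : (EuclideanSpace.single 0 1 : Cn (m + 1)) ∈ S := htop ▸ Submodule.mem_top
  have h2 : (EuclideanSpace.single 0 1 : Cn (m + 1)) 0 = 0 := this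
  simp at h2

theorem locallyIntegrableOn_logSq : LocallyIntegrableOn (logSq g) N := by
  intro x hx
  have hy := h.mem x hx
  obtain ⟨δ, hδ, hδY⟩ := Metric.nhds_basis_closedBall.mem_iff.mp (h.isOpen_target.mem_nhds hy)
  set b := Metric.ball (straighten g π x) δ with hb
  have hbo : IsOpen b := Metric.isOpen_ball
  have hxb : straighten g π x ∈ b := Metric.mem_ball_self hδ
  have hno : IsOpen (N ∩ straighten g π ⁻¹' b) :=
    h.continuousOn_straighten.isOpen_inter_preimage h.isOpen_source hbo
  have hbY : b ⊆ Y := Metric.ball_subset_closedBall.trans hδY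
  refine IntegrableAtFilter.filter_mono nhdsWithin_le_nhds ⟨Ψ '' b, ?_, ?_⟩
  · refine mem_of_superset (hno.mem_nhds ⟨hx, hxb⟩) ?_
    rintro z ⟨hz, hzb⟩
    exact ⟨_, hzb, h.left_inv z hz⟩
  · rw [integrableOn_image_iff_integrableOn_abs_det_fderiv_smul volume measurableSet_ball
      (fun y hy => (h.hasFDerivAt_symm (hbY hy)).hasFDerivWithinAt) (h.injOn_symm.mono hbY)]
    have i1 : IntegrableOn (fun z : Cn (m + 1) => Real.log (‖z 0‖ ^ 2)) b :=
      (locallyIntegrable_log_coord.integrableOn_isCompact (isCompact_closedBall _ δ)).mono_set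
        Metric.ball_subset_closedBall
    have hcont : ContinuousOn (fun y => |((fderiv ℂ Ψ y).restrictScalars ℝ).det|)
        (Metric.closedBall (straighten g π x) δ) := by
      intro y hy
      have h1 : ContinuousAt (fderiv ℝ Ψ) y :=
        ((h.contDiffAt_symm (hδY hy)).fderiv_right (m := 0) (by simp)).continuousAt
      have h2 : ContinuousAt (fun y => |(fderiv ℝ Ψ y).det|) y :=
        (ContinuousLinearMap.continuous_det.continuousAt.comp h1).abs
      refine (h2.congr ?_).continuousWithinAt
      filter_upwards [h.isOpen_target.mem_nhds (hδY hy)] with z hz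
      rw [h.fderiv_symm hz]
    refine (i1.mul_continuousOn_of_subset hcont measurableSet_ball (isCompact_closedBall _ δ)
      Metric.ball_subset_closedBall).congr_fun (fun y hy => ?_) measurableSet_ball
    beta_reduce
    rw [logSq, h.apply_symm (hbY hy), smul_eq_mul, mul_comm]

/-- Any parametrization computes the integral over the zero set. -/
theorem integral_param {θ : RForm (m + 1) (2 * m)} (hW : W ∩ N = {x ∈ N | g x = 0})
    (hθ : ContDiff ℝ ∞ θ) (hc : HasCompactSupport θ) (hs : tsupport θ ⊆ N)
    {U : Set (Cn m)} {Φ : Cn m → Cn (m + 1)} (hP : IsParam (n := m + 1) W U Φ)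
    (hsub : W ∩ tsupport θ ⊆ Φ '' U) :
    IntegrableOn (fun y => θ (Φ y) fun i => fderiv ℂ Φ y (frame m i)) U ∧
      ∫ y in U, θ (Φ y) (fun i => fderiv ℂ Φ y (frame m i))
        = ∫ y : Cn m, pullback Y Ψ θ (join 0 y) fun j => join 0 (frame m j) := by
  set G : Cn m → ℝ := fun y => pullback Y Ψ θ (join 0 y) fun j => join 0 (frame m j) with hG
  have hGi : Integrable G := by
    have hcl : IsClosedEmbedding (joinZero m) :=
      LinearMap.isClosedEmbedding_of_injective (𝕜 := ℂ) (f := (joinZero m : Cn m →ₗ[ℂ] Cn (m + 1)))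
        (LinearMap.ker_eq_bot.mpr join_zero_injective)
    refine Continuous.integrable_of_hasCompactSupport ?_ ?_
    · exact (contDiff_apply_frame (h.contDiff_pullback hθ hc hs) _).continuous.comp
        (joinZero m).continuous
    · exact (hasCompactSupport_apply (h.hasCompactSupport_pullback hc hs) _).comp_isClosedEmbedding hcl
  have hUo : IsOpen U := hP.isOpen
  have hΦd : DifferentiableOn ℂ Φ U := hP.holomorphic
  have hΦW : ∀ u ∈ U, Φ u ∈ W := by
    obtain ⟨O, -, hO⟩ := hP.image
    intro u hu
    have : Φ u ∈ Φ '' U := ⟨u, hu, rfl⟩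
    exact (hO.subset this).1
  -- Since `θ` is supported in `N`, only `V` contributes to the left side. On it the transition map
  -- `π ∘ Φ` is injective and holomorphic, and `Φ` is the chart's parametrization composed with it;
  -- the change of variables is along this map.
  set V := U ∩ Φ ⁻¹' N with hV
  have hVo : IsOpen V := hΦd.continuousOn.isOpen_inter_preimage hUo h.isOpen_source
  have hVg : ∀ u ∈ V, g (Φ u) = 0 := fun u hu => (hW.subset ⟨hΦW u hu.1, hu.2⟩).2
  have hVY : ∀ u ∈ V, join 0 (π (Φ u)) ∈ Y := fun u hu => by
    rw [← straighten_of_eq_zero (hVg u hu)]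
    exact h.mem _ hu.2
  have hVΦ : ∀ u ∈ V, Φ u = Ψ (join 0 (π (Φ u))) := fun u hu => by
    rw [← straighten_of_eq_zero (hVg u hu), h.left_inv _ hu.2]
  have hτ : ∀ u ∈ V, HasFDerivAt (fun u => π (Φ u)) (π.comp (fderiv ℂ Φ u)) u := fun u hu =>
    π.hasFDerivAt.comp u (hΦd.differentiableAt (hUo.mem_nhds hu.1)).hasFDerivAt
  have hτr : ∀ u ∈ V, HasFDerivWithinAt (fun u => π (Φ u))
      ((π.comp (fderiv ℂ Φ u)).restrictScalars ℝ) V u := fun u hu =>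
    ((hτ u hu).restrictScalars ℝ).hasFDerivWithinAt
  have hτi : InjOn (fun u => π (Φ u)) V := fun u hu v hv huv => by
    refine hP.injOn hu.1 hv.1 ?_
    rw [hVΦ u hu, hVΦ v hv]
    exact congrArg (fun y => Ψ (join 0 y)) huv
  have key : ∀ u ∈ V, |((π.comp (fderiv ℂ Φ u)).restrictScalars ℝ).det| • G (π (Φ u))
      = θ (Φ u) fun i => fderiv ℂ Φ u (frame m i) := by
    intro u hu
    have hd : fderiv ℂ Φ u
        = ((fderiv ℂ Ψ (join 0 (π (Φ u)))).comp (joinZero m)).comp (π.comp (fderiv ℂ Φ u)) := by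
      have h1 := (h.hasFDerivAt_slice (hVY u hu)).comp u (hτ u hu)
      have h2 : Φ =ᶠ[𝓝 u] ((fun y : Cn m => Ψ (join 0 y)) ∘ fun u => π (Φ u)) := by
        filter_upwards [hVo.mem_nhds hu] with v hv using hVΦ v hv
      exact (h1.congr_of_eventuallyEq h2).fderiv
    have h3 := map_frame_det (p := 2 * m) rfl ((pullback Y Ψ θ (join 0 (π (Φ u)))).compContinuousLinearMap
      ((joinZero m).restrictScalars ℝ)) (π.comp (fderiv ℂ Φ u))
    rw [smul_eq_mul]
    refine h3.symm.trans ?_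
    rw [pullback_of_mem (hVY u hu), ← hVΦ u hu, h.fderiv_symm (hVY u hu)]
    conv_rhs => rw [hd]
    rfl
  have hzero : ∀ u ∈ U \ V, (θ (Φ u) fun i => fderiv ℂ Φ u (frame m i)) = 0 := by
    intro u hu
    rw [image_eq_zero_of_notMem_tsupport fun h' => hu.2 ⟨hu.1, hs h'⟩]
    rfl
  -- The covering hypothesis enters here: slice points missed by the transition map are not sent
  -- into the support of `θ`.
  have hGzero : ∀ y, y ∉ (fun u => π (Φ u)) '' V → G y = 0 := by
    intro y hy
    by_cases hyY : join 0 y ∈ Y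
    · have hnot : Ψ (join 0 y) ∉ tsupport θ := by
        intro hθy
        have hmem := (h.isParam_slice hW).1
        have hyW : Ψ (join 0 y) ∈ W := (hW.symm.subset
          ⟨h.symm_mem _ hyY, by rw [h.apply_symm hyY]; simp⟩).1
        obtain ⟨u, hu, hue⟩ := hsub ⟨hyW, hθy⟩
        refine hy ⟨u, ⟨hu, ?_⟩, ?_⟩
        · rw [mem_preimage, hue]
          exact h.symm_mem _ hyY
        · beta_reduce
          rw [hue, h.proj_symm_join hyY]
      rw [hG]
      beta_reduce
      rw [pullback_of_mem hyY, image_eq_zero_of_notMem_tsupport hnot]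
      rfl
    · rw [hG]
      beta_reduce
      rw [pullback, if_neg hyY]
      rfl
  have hiV : IntegrableOn (fun y => θ (Φ y) fun i => fderiv ℂ Φ y (frame m i)) V :=
    ((integrableOn_image_iff_integrableOn_abs_det_fderiv_smul volume hVo.measurableSet hτr hτi G).mp
      hGi.integrableOn).congr_fun key hVo.measurableSet
  constructor
  · exact hiV.of_forall_sdiff_eq_zero hUo.measurableSet hzero
  · rw [setIntegral_eq_of_subset_of_forall_sdiff_eq_zero hUo.measurableSet inter_subset_left hzero,
      ← setIntegral_congr_fun hVo.measurableSet key,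
      ← integral_image_eq_integral_abs_det_fderiv_smul volume hVo.measurableSet hτr hτi G]
    exact setIntegral_eq_integral_of_forall_compl_eq_zero hGzero

end IsChart

end Slice

end BergmanBall
end

noncomputable section
namespace BergmanBall

/-! ### Linearity of `dd^c` -/

section Linear

variable {n p : ℕ} {S S' : Set (Cn n)} {θ θ' : RForm n p}

/-- Smooth `J`-invariant forms with compact support in `S`. -/
def IsFormOn (S : Set (Cn n)) (θ : RForm n p) : Prop :=
  ContDiff ℝ ∞ θ ∧ HasCompactSupport θ ∧ tsupport θ ⊆ S ∧
    ∀ z, (θ z).compContinuousLinearMap (J n) = θ z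

theorem IsFormOn.mono (hθ : IsFormOn S θ) (h : tsupport θ ⊆ S') : IsFormOn S' θ :=
  ⟨hθ.1, hθ.2.1, h, hθ.2.2.2⟩

theorem tsupport_smul_form {χ : Cn n → ℝ} :
    tsupport (fun z => χ z • θ z) ⊆ tsupport χ ∩ tsupport θ :=
  subset_inter (tsupport_smul_subset_left χ θ) (tsupport_smul_subset_right χ θ)

theorem IsFormOn.smul (hθ : IsFormOn S θ) {χ : Cn n → ℝ} (hχ : ContDiff ℝ ∞ χ) :
    IsFormOn (S ∩ tsupport χ) fun z => χ z • θ z := by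
  refine ⟨hχ.smul hθ.1, hθ.2.1.of_isClosed_subset (isClosed_tsupport _)
    (tsupport_smul_form.trans inter_subset_right),
    fun x hx => ⟨hθ.2.2.1 (tsupport_smul_form hx).2, (tsupport_smul_form hx).1⟩, fun z => ?_⟩
  ext K
  exact congrArg (χ z • ·) (DFunLike.congr_fun (hθ.2.2.2 z) K)

theorem ddc_add (hθ : ContDiff ℝ ∞ θ) (hθ' : ContDiff ℝ ∞ θ') (x : Cn n) :
    ddc (fun z => θ z + θ' z) x = ddc θ x + ddc θ' x := by
  have h1 : (fun z => (-(1 / 2 : ℝ)) •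
      (extDeriv (fun z => θ z + θ' z) z).compContinuousLinearMap (J n))
      = fun z => (-(1 / 2 : ℝ)) • (extDeriv θ z).compContinuousLinearMap (J n)
        + (-(1 / 2 : ℝ)) • (extDeriv θ' z).compContinuousLinearMap (J n) := by
    ext z K
    rw [extDeriv_fun_add (hθ.differentiable (by norm_num) z) (hθ'.differentiable (by norm_num) z)]
    simp only [ContinuousAlternatingMap.add_apply, ContinuousAlternatingMap.smul_apply,
      ContinuousAlternatingMap.compContinuousLinearMap_apply, smul_eq_mul]
    ring
  rw [ddc, h1, extDeriv_fun_add ((contDiff_dJ hθ).differentiable (by norm_num) x)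
    ((contDiff_dJ hθ').differentiable (by norm_num) x)]
  rfl

theorem ddc_zero (x : Cn n) : ddc (fun _ => 0 : RForm n p) x = 0 :=
  IsChart.notMem_tsupport_ddc_eq_zero (by
    have : tsupport (fun _ => 0 : RForm n p) = ∅ := tsupport_eq_empty_iff.mpr rfl
    rw [this]
    exact notMem_empty x)

theorem ddc_sum {ι : Type*} (s : Finset ι) {ψ : ι → RForm n p} (hψ : ∀ i ∈ s, ContDiff ℝ ∞ (ψ i))
    (x : Cn n) : ddc (fun z => ∑ i ∈ s, ψ i z) x = ∑ i ∈ s, ddc (ψ i) x := by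
  classical
  induction s using Finset.induction_on with
  | empty => simpa using ddc_zero x
  | insert a s ha ih =>
    simp only [Finset.sum_insert ha]
    rw [ddc_add (hψ a (Finset.mem_insert_self a s))
      (ContDiff.sum fun i hi => hψ i (Finset.mem_insert_of_mem hi)),
      ih fun i hi => hψ i (Finset.mem_insert_of_mem hi)]

theorem integrableOn_mul_ddc {u : Cn n → ℝ} {N : Set (Cn n)} (hu : LocallyIntegrableOn u N)
    (hθ : IsFormOn N θ) {S : Set (Cn n)} (hS : MeasurableSet S) (K : Fin (p + 1 + 1) → Cn n) :
    IntegrableOn (fun z => u z * ddc θ z K) S := by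
  refine integrableOn_of_zero_off (K := tsupport θ) ?_ hS fun x _ hx => ?_
  · exact (hu.integrableOn_compact_subset hθ.2.2.1 hθ.2.1).mul_continuousOn
      (contDiff_apply_frame (contDiff_ddc hθ.1) K).continuous.continuousOn hθ.2.1
  · rw [IsChart.notMem_tsupport_ddc_eq_zero hx]
    simp

end Linear

section CurrentLinear

variable {n : ℕ} {u : Cn n → ℝ}

theorem ddcCurrent_sum (hu : LocallyIntegrableOn u (unitBall n)) {ι : Type*} (s : Finset ι)
    {ψ : ι → RForm n (2 * (n - 1))} (hψ : ∀ i ∈ s, IsFormOn (unitBall n) (ψ i)) :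
    ddcCurrent u (fun z => ∑ i ∈ s, ψ i z) = ∑ i ∈ s, ddcCurrent u (ψ i) := by
  unfold ddcCurrent
  rw [← integral_finsetSum s fun i hi => integrableOn_mul_ddc hu (hψ i hi)
    isOpen_unitBall.measurableSet _]
  congr 1
  ext z
  rw [ddc_sum s (fun i hi => (hψ i hi).1), ContinuousAlternatingMap.sum_apply, Finset.mul_sum]

end CurrentLinear

/-- Smooth partitions of unity on compact sets. -/
theorem exists_partition {n : ℕ} {K : Set (Cn n)} (hK : IsCompact K) {N : Cn n → Set (Cn n)}
    (hN : ∀ w ∈ K, IsOpen (N w) ∧ w ∈ N w) :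
    ∃ (k : ℕ) (c : Fin k → Cn n) (ρ : Fin k → Cn n → ℝ),
      (∀ i, c i ∈ K ∧ ContDiff ℝ ∞ (ρ i) ∧ tsupport (ρ i) ⊆ N (c i)) ∧
      ∀ x ∈ K, ∑ i, ρ i x = 1 := by
  obtain ⟨t, ht⟩ := hK.elim_finite_subcover (fun w : K => N w) (fun w => (hN w w.2).1)
    fun x hx => mem_iUnion.mpr ⟨⟨x, hx⟩, (hN x hx).2⟩
  let e : Fin t.card ≃ t := t.equivFin.symm
  obtain ⟨f, hf⟩ := SmoothPartitionOfUnity.exists_isSubordinate (modelWithCornersSelf ℝ (Cn n))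
    hK.isClosed (fun i : Fin t.card => N (e i : K)) (fun i => (hN _ (e i : K).2).1) (by
      intro x hx
      obtain ⟨w, hw, hxw⟩ := mem_iUnion₂.mp (ht hx)
      exact mem_iUnion.mpr ⟨e.symm ⟨w, hw⟩, by simpa using hxw⟩)
  refine ⟨t.card, fun i => (e i : K), fun i => f i, fun i => ⟨(e i : K).2, (f i).contMDiff.contDiff,
    hf i⟩, fun x hx => ?_⟩
  have := f.sum_eq_one hx
  rwa [finsum_eq_sum_of_fintype] at this

/-! ### The Poincaré–Lelong formula near a point -/

section Local

variable {m : ℕ}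

/-- Constants have zero `dd^c`. This permits rescaling a holomorphic function inside the logarithm.
-/
theorem ddcCurrent_one_eq_zero {θ : RForm (m + 1) (2 * m)} (hθ : IsFormOn (unitBall (m + 1)) θ) :
    ∫ z in unitBall (m + 1), ddc θ z (fun i => frame (m + 1) i) = 0 := by
  have h := integral_mul_ddc (v := fun _ => 1) (continuous_const.locallyIntegrable) hθ.1 hθ.2.1
    hθ.2.2.2 (fun i : Fin (2 * m + 1 + 1) => frame (m + 1) i)
    (by simp only [Fin.val_zero, Fin.val_one, frame_zero, frame_one, J_apply, single_I])
    (fun _ _ _ => rfl) (fun _ _ _ => rfl)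
  simp only [one_mul] at h
  rw [setIntegral_eq_integral_of_forall_compl_eq_zero fun z hz => by
    rw [IsChart.notMem_tsupport_ddc_eq_zero fun h' => hz (hθ.2.2.1 h')]
    simp, h, integral_const_mul]
  set f : Cn (m + 1) → ℝ := fun z => θ z fun j : Fin (2 * m) =>
    frame (m + 1) ((j.succ.succ : Fin (2 * m + 1 + 1)) : ℕ)
  have hf : ContDiff ℝ ∞ f := contDiff_apply_frame hθ.1 _
  have hfc : HasCompactSupport f := hasCompactSupport_apply hθ.2.1 _
  have h1 (w : Cn (m + 1)) : ContDiff ℝ 1 fun y => fderiv ℝ f y w :=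
    (hf.fderiv_right (m := 1) (by norm_cast)).clm_apply contDiff_const
  have h2 (w : Cn (m + 1)) : HasCompactSupport fun y => fderiv ℝ f y w := hfc.fderiv_apply ℝ w
  have hi (w : Cn (m + 1)) : Integrable fun x => fderiv ℝ (fun y => fderiv ℝ f y w) x w :=
    (continuous_fderiv_apply (h1 w) w).integrable_of_hasCompactSupport ((h2 w).fderiv_apply ℝ w)
  rw [integral_add (hi _) (hi _), integral_fderiv_eq_zero (h1 _) (h2 _),
    integral_fderiv_eq_zero (h1 _) (h2 _)]
  simp

theorem logSq_const_mul {n : ℕ} {g : Cn n → ℂ} {c : ℂ} (hc : c ≠ 0) {x : Cn n} (hx : g x ≠ 0) :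
    logSq (fun x => c * g x) x = Real.log (‖c‖ ^ 2) + logSq g x := by
  rw [logSq, logSq, norm_mul, mul_pow, Real.log_mul (by simpa using hc) (by simpa using hx)]

theorem continuousAt_logSq {n : ℕ} {g : Cn n → ℂ} {x : Cn n} (hg : ContinuousAt g x) (hx : g x ≠ 0) :
    ContinuousAt (logSq g) x :=
  (hg.norm.pow 2).log (by simpa using hx)

theorem locallyIntegrableOn_logSq_of_ne_zero {n : ℕ} {g : Cn n → ℂ} {N : Set (Cn n)} (hN : IsOpen N)
    (hg : ContinuousOn g N) (h0 : ∀ x ∈ N, g x ≠ 0) : LocallyIntegrableOn (logSq g) N :=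
  ContinuousOn.locallyIntegrableOn (fun x hx => (continuousAt_logSq (hg.continuousAt (hN.mem_nhds hx))
    (h0 x hx)).continuousWithinAt) hN.measurableSet

/-- `dd^c log|g|² = 0` where `g` and `dg` have no zeros. -/
theorem exists_ddcCurrent_eq_zero {O : Set (Cn (m + 1))} (hO : IsOpen O) (hOB : O ⊆ unitBall (m + 1))
    {g : Cn (m + 1) → ℂ} (hg : DifferentiableOn ℂ g O) {w : Cn (m + 1)} (hw : w ∈ O) (h0 : g w ≠ 0)
    (hd : fderiv ℂ g w ≠ 0) : ∃ N, IsOpen N ∧ w ∈ N ∧ N ⊆ O ∧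
      ∀ θ : RForm (m + 1) (2 * m), IsFormOn N θ →
        ∫ z in unitBall (m + 1), logSq g z * ddc θ z (fun i => frame (m + 1) i) = 0 := by
  -- With this factor `c·g` equals `1/2` at `w`, so near `w` its modulus is below `1`, as the chart
  -- formula demands, and it has no zeros.
  set c : ℂ := (2 * g w)⁻¹
  have hc : c ≠ 0 := inv_ne_zero (mul_ne_zero two_ne_zero h0)
  have hg1 : DifferentiableOn ℂ (fun x => c * g x) O := hg.const_mul c
  set O' := O ∩ (fun x => c * g x) ⁻¹' {t | t ≠ 0 ∧ ‖t‖ < 1} with hO'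
  have hO'o : IsOpen O' := hg1.continuousOn.isOpen_inter_preimage hO
    (isOpen_ne.inter (isOpen_lt continuous_norm continuous_const))
  have hcw : c * g w = 1 / 2 := by
    simp only [c]
    field_simp
  have hwO' : w ∈ O' := by
    refine ⟨hw, ?_, ?_⟩
    · exact mul_ne_zero hc h0
    · show ‖c * g w‖ < 1
      rw [hcw]
      norm_num
  have hd1 : fderiv ℂ (fun x => c * g x) w ≠ 0 := by
    rw [fderiv_const_mul (hg.differentiableAt (hO.mem_nhds hw))]
    exact smul_ne_zero hc hd
  obtain ⟨π, N, Y, Ψ, hch, hwN, hNO⟩ := exists_isChart hO'o (hg1.mono inter_subset_left) hwO' hd1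
  have hNB : N ⊆ unitBall (m + 1) := (hNO.trans inter_subset_left).trans hOB
  refine ⟨N, hch.isOpen_source, hwN, hNO.trans inter_subset_left, fun θ hθ => ?_⟩
  have h1 := hch.ddcCurrent_eq hNB (fun x hx => (hNO hx).2.2) hθ.1 hθ.2.1 hθ.2.2.1 hθ.2.2.2
  -- The chart misses the hyperplane `y₀ = 0`, so the right side of the chart formula is zero. No
  -- separate computation off the zero set is required.
  have h2 (y : Cn m) : pullback Y Ψ θ (join 0 y) = 0 := by
    refine if_neg fun hy => ?_
    have h3 : c * g (Ψ (join 0 y)) ≠ 0 := (hNO (hch.symm_mem _ hy)).2.1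
    have h4 : c * g (Ψ (join 0 y)) = _ := hch.apply_symm hy
    rw [h4] at h3
    simp at h3
  simp only [h2, ContinuousAlternatingMap.coe_zero, Pi.zero_apply, integral_zero, mul_zero] at h1
  have hi1 := integrableOn_mul_ddc (locallyIntegrableOn_logSq_of_ne_zero hch.isOpen_source
    hch.differentiableOn.continuousOn fun x hx => (hNO hx).2.1) hθ isOpen_unitBall.measurableSet
    (fun i => frame (m + 1) i)
  have hi2 := integrableOn_mul_ddc (u := fun _ => Real.log (‖c‖ ^ 2))
    (continuous_const.locallyIntegrable.locallyIntegrableOn N) hθ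
    isOpen_unitBall.measurableSet (fun i => frame (m + 1) i)
  have e : ∀ z ∈ unitBall (m + 1), logSq g z * ddc θ z (fun i => frame (m + 1) i)
      = logSq (fun x => c * g x) z * ddc θ z (fun i => frame (m + 1) i)
        - Real.log (‖c‖ ^ 2) * ddc θ z (fun i => frame (m + 1) i) := by
    intro z _
    by_cases hz : z ∈ tsupport θ
    · have : g z ≠ 0 := right_ne_zero_of_mul (hNO (hθ.2.2.1 hz)).2.1
      rw [logSq_const_mul hc this]
      ring
    · rw [IsChart.notMem_tsupport_ddc_eq_zero hz]
      simp
  rw [setIntegral_congr_fun isOpen_unitBall.measurableSet e, integral_sub hi1 hi2, h1,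
    integral_const_mul, ddcCurrent_one_eq_zero (hθ.mono (hθ.2.2.1.trans hNB))]
  simp

/-- `dd^c log|T|² = 0` off the zeros of `T`. -/
theorem exists_ddcCurrent_eq_zero' {T : Cn (m + 1) → ℂ}
    (hT : DifferentiableOn ℂ T (unitBall (m + 1))) {w : Cn (m + 1)} (hw : w ∈ unitBall (m + 1))
    (h0 : T w ≠ 0) : ∃ N, IsOpen N ∧ w ∈ N ∧ N ⊆ unitBall (m + 1) ∧ (∀ x ∈ N, T x ≠ 0) ∧
      ∀ θ : RForm (m + 1) (2 * m), IsFormOn N θ →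
        ∫ z in unitBall (m + 1), logSq T z * ddc θ z (fun i => frame (m + 1) i) = 0 := by
  set O := unitBall (m + 1) ∩ T ⁻¹' {0}ᶜ with hO
  have hOo : IsOpen O := hT.continuousOn.isOpen_inter_preimage isOpen_unitBall isOpen_compl_singleton
  have hwO : w ∈ O := ⟨hw, h0⟩
  have hOB : O ⊆ unitBall (m + 1) := inter_subset_left
  have hTO : DifferentiableOn ℂ T O := hT.mono hOB
  by_cases hd : fderiv ℂ T w = 0
  -- At a critical point no chart has `T` as coordinate. Instead `log|T|² = log|T e^{z₀}|² -
  -- log|e^{z₀}|²`, where both `T e^{z₀}` and `e^{z₀}` are nonzero with nonzero differential at `w`.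
  · let l : Cn (m + 1) →L[ℂ] ℂ := EuclideanSpace.proj (0 : Fin (m + 1))
    have hl : l ≠ 0 := by
      intro h
      have h1 : l (EuclideanSpace.single 0 1) = 1 := by simp [l]
      rw [h] at h1
      simp at h1
    set g₂ : Cn (m + 1) → ℂ := fun x => Complex.exp (l x) with hg₂
    have hg₂d (x : Cn (m + 1)) : HasFDerivAt g₂ (Complex.exp (l x) • l) x := l.hasFDerivAt.cexp
    have hg₂D : Differentiable ℂ g₂ := fun x => (hg₂d x).differentiableAt
    have hg₂0 (x : Cn (m + 1)) : g₂ x ≠ 0 := Complex.exp_ne_zero _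
    have hd₂ : fderiv ℂ g₂ w ≠ 0 := by
      rw [(hg₂d w).fderiv]
      exact smul_ne_zero (Complex.exp_ne_zero _) hl
    have hd₁ : fderiv ℂ (fun x => T x * g₂ x) w ≠ 0 := by
      have hTw := (hTO.differentiableAt (hOo.mem_nhds hwO)).hasFDerivAt
      have := (hTw.mul (hg₂d w)).fderiv
      have h2 : fderiv ℂ (fun x => T x * g₂ x) w = _ := this
      have h3 : g₂ w • (0 : Cn (m + 1) →L[ℂ] ℂ) = 0 := by
        ext v
        simp
      rw [h2, hd, h3, add_zero]
      exact smul_ne_zero h0 (smul_ne_zero (Complex.exp_ne_zero _) hl)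
    obtain ⟨N₁, hN₁, hwN₁, hN₁O, h₁⟩ := exists_ddcCurrent_eq_zero
      (g := fun x => T x * g₂ x) hOo hOB
      (hTO.mul hg₂D.differentiableOn) hwO (mul_ne_zero h0 (hg₂0 w)) hd₁
    obtain ⟨N₂, hN₂, hwN₂, hN₂O, h₂⟩ := exists_ddcCurrent_eq_zero hOo hOB
      hg₂D.differentiableOn hwO (hg₂0 w) hd₂
    refine ⟨N₁ ∩ N₂, hN₁.inter hN₂, ⟨hwN₁, hwN₂⟩, fun x hx => hOB (hN₁O hx.1), fun x hx =>
      (hN₁O hx.1).2, fun θ hθ => ?_⟩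
    have hθ₁ := hθ.mono (hθ.2.2.1.trans inter_subset_left)
    have hθ₂ := hθ.mono (hθ.2.2.1.trans inter_subset_right)
    have hi₁ := integrableOn_mul_ddc (locallyIntegrableOn_logSq_of_ne_zero
      (g := fun x => T x * g₂ x) hN₁ ((hTO.mono hN₁O).continuousOn.mul hg₂D.continuous.continuousOn)
      fun x hx => mul_ne_zero (hN₁O hx).2 (hg₂0 x)) hθ₁ isOpen_unitBall.measurableSet
      (fun i => frame (m + 1) i)
    have hi₂ := integrableOn_mul_ddc (locallyIntegrableOn_logSq_of_ne_zero
      (g := g₂) hN₂ hg₂D.continuous.continuousOn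
      fun x hx => hg₂0 x) hθ₂ isOpen_unitBall.measurableSet (fun i => frame (m + 1) i)
    have e : ∀ z ∈ unitBall (m + 1), logSq T z * ddc θ z (fun i => frame (m + 1) i)
        = logSq (fun x => T x * g₂ x) z * ddc θ z (fun i => frame (m + 1) i)
          - logSq g₂ z * ddc θ z (fun i => frame (m + 1) i) := by
      intro z _
      by_cases hz : z ∈ tsupport θ
      · have hTz : T z ≠ 0 := (hN₁O (hθ.2.2.1 hz).1).2
        have : logSq (fun x => T x * g₂ x) z = logSq T z + logSq g₂ z := by
          rw [logSq, logSq, logSq, norm_mul, mul_pow,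
            Real.log_mul (by simpa using hTz) (by simpa using hg₂0 z)]
        rw [this]
        ring
      · rw [IsChart.notMem_tsupport_ddc_eq_zero hz]
        simp
    rw [setIntegral_congr_fun isOpen_unitBall.measurableSet e, integral_sub hi₁ hi₂, h₁ θ hθ₁,
      h₂ θ hθ₂, sub_zero]
  · obtain ⟨N, hN, hwN, hNO, h⟩ := exists_ddcCurrent_eq_zero hOo hOB hTO hwO h0 hd
    exact ⟨N, hN, hwN, hNO.trans hOB, fun x hx => (hNO hx).2, h⟩

end Local

end BergmanBall
end

noncomputable section
namespace BergmanBall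

/-! ### The Poincaré–Lelong formula -/

section PoincareLelong

variable {m : ℕ} {T : Cn (m + 1) → ℂ} {W : Set (Cn (m + 1))}

/-- The Poincaré–Lelong formula holds for test forms supported in `N`. -/
structure IsPoincareLelong (T : Cn (m + 1) → ℂ) (W N : Set (Cn (m + 1))) : Prop where
  isOpen : IsOpen N
  subset : N ⊆ unitBall (m + 1)
  locallyIntegrable : LocallyIntegrableOn (logSq T) N
  null : volume (W ∩ N) = 0
  exists_param : ∃ (U : Set (Cn m)) (Φ : Cn m → Cn (m + 1)),
    IsParam (n := m + 1) W U Φ ∧ W ∩ N ⊆ Φ '' U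
  formula : ∀ θ : RForm (m + 1) (2 * m), IsFormOn N θ → ∀ (U : Set (Cn m)) (Φ : Cn m → Cn (m + 1)),
    IsParam (n := m + 1) W U Φ → W ∩ tsupport θ ⊆ Φ '' U →
    IntegrableOn (fun y => θ (Φ y) fun i => fderiv ℂ Φ y (frame m i)) U ∧
    ∫ z in unitBall (m + 1), logSq T z * ddc θ z (fun i => frame (m + 1) i)
      = 2 * Real.pi * ∫ y in U, θ (Φ y) fun i => fderiv ℂ Φ y (frame m i)

theorem IsParam.mem {n : ℕ} {W : Set (Cn n)} {U : Set (Cn (n - 1))} {Φ : Cn (n - 1) → Cn n}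
    (h : IsParam W U Φ) {u : Cn (n - 1)} (hu : u ∈ U) : Φ u ∈ W := by
  obtain ⟨O, -, hO⟩ := h.image
  exact (hO.subset ⟨u, hu, rfl⟩).1

theorem exists_isPoincareLelong (hT : DifferentiableOn ℂ T (unitBall (m + 1)))
    (hW : W = {z ∈ unitBall (m + 1) | T z = 0}) (hdT : ∀ w ∈ W, fderiv ℂ T w ≠ 0)
    {w : Cn (m + 1)} (hw : w ∈ unitBall (m + 1)) : ∃ N, w ∈ N ∧ IsPoincareLelong T W N := by
  by_cases h0 : T w = 0
  · set O := unitBall (m + 1) ∩ T ⁻¹' Metric.ball 0 1 with hO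
    have hOo : IsOpen O :=
      hT.continuousOn.isOpen_inter_preimage isOpen_unitBall Metric.isOpen_ball
    have hwO : w ∈ O := ⟨hw, by rw [mem_preimage, h0]; exact Metric.mem_ball_self one_pos⟩
    obtain ⟨π, N, Y, Ψ, hch, hwN, hNO⟩ := exists_isChart hOo (hT.mono inter_subset_left) hwO
      (hdT w (hW ▸ ⟨hw, h0⟩))
    have hNB : N ⊆ unitBall (m + 1) := hNO.trans inter_subset_left
    have hWN : W ∩ N = {x ∈ N | T x = 0} := by
      rw [hW]
      ext x
      exact ⟨fun h => ⟨h.2, h.1.2⟩, fun h => ⟨⟨hNB h.1, h.2⟩, h.1⟩⟩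
    refine ⟨N, hwN, hch.isOpen_source, hNB, hch.locallyIntegrableOn_logSq, ?_,
      ⟨_, _, hch.isParam_slice hWN⟩, fun θ hθ U Φ hP hsub => ?_⟩
    · rw [hWN]
      exact hch.volume_zeros
    · obtain ⟨h1, h2⟩ := hch.integral_param hWN hθ.1 hθ.2.1 hθ.2.2.1 hP hsub
      refine ⟨h1, ?_⟩
      rw [h2]
      exact hch.ddcCurrent_eq hNB (fun x hx => by simpa using (hNO hx).2) hθ.1 hθ.2.1 hθ.2.2.1 hθ.2.2.2
  · obtain ⟨N, hN, hwN, hNB, hN0, h⟩ := exists_ddcCurrent_eq_zero' hT hw h0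
    have hWN : W ∩ N = ∅ := by
      rw [hW]
      ext x
      exact ⟨fun h => hN0 x h.2 h.1.2, fun h => h.elim⟩
    -- Off the hypersurface the empty parametrization serves, and every integral over a
    -- parametrization vanishes because it takes its values in `W`.
    refine ⟨N, hwN, hN, hNB, locallyIntegrableOn_logSq_of_ne_zero hN (hT.mono hNB).continuousOn hN0,
      by rw [hWN, measure_empty], ⟨∅, fun _ => 0, ⟨isOpen_empty, differentiableOn_empty,
        injOn_empty _, fun y hy => hy.elim, ∅, isOpen_empty, by simp⟩, by simp [hWN]⟩,
      fun θ hθ U Φ hP hsub => ?_⟩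
    have hz : ∀ y ∈ U, (θ (Φ y) fun i => fderiv ℂ Φ y (frame m i)) = 0 := fun y hy => by
      have : Φ y ∉ tsupport θ := fun h' => by
        have : Φ y ∈ W ∩ N := ⟨hP.mem hy, hθ.2.2.1 h'⟩
        rw [hWN] at this
        exact this
      rw [image_eq_zero_of_notMem_tsupport this]
      rfl
    have hU : MeasurableSet U := hP.isOpen.measurableSet
    refine ⟨(integrableOn_zero (μ := volume)).congr_fun (fun y hy => (hz y hy).symm) hU, ?_⟩
    rw [setIntegral_congr_fun hU hz, h θ hθ]
    simp

variable (hT : DifferentiableOn ℂ T (unitBall (m + 1)))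
  (hW : W = {z ∈ unitBall (m + 1) | T z = 0}) (hdT : ∀ w ∈ W, fderiv ℂ T w ≠ 0)
include hT hW hdT

theorem locallyIntegrableOn_logSq : LocallyIntegrableOn (logSq T) (unitBall (m + 1)) := by
  intro w hw
  obtain ⟨N, hwN, h⟩ := exists_isPoincareLelong hT hW hdT hw
  have := h.locallyIntegrable w hwN
  rw [h.isOpen.nhdsWithin_eq hwN] at this
  exact this.filter_mono nhdsWithin_le_nhds

theorem volume_zeros : volume W = 0 := by
  refine measure_null_of_locally_null W fun w hw => ?_
  obtain ⟨N, hwN, h⟩ := exists_isPoincareLelong hT hW hdT (hW.subset hw).1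
  exact ⟨W ∩ N, inter_mem_nhdsWithin W (h.isOpen.mem_nhds hwN), h.null⟩

theorem exists_poincareLelong_partition {K : Set (Cn (m + 1))} (hK : IsCompact K)
    (hKB : K ⊆ unitBall (m + 1)) : ∃ (k : ℕ) (N : Fin k → Set (Cn (m + 1)))
      (ρ : Fin k → Cn (m + 1) → ℝ),
      (∀ i, IsPoincareLelong T W (N i) ∧ ContDiff ℝ ∞ (ρ i) ∧ tsupport (ρ i) ⊆ N i) ∧
      ∀ x ∈ K, ∑ i, ρ i x = 1 := by
  choose! N hN using fun w (hw : w ∈ K) => exists_isPoincareLelong hT hW hdT (hKB hw)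
  obtain ⟨k, c, ρ, hρ, h1⟩ := exists_partition hK (N := N) fun w hw => ⟨(hN w hw).2.isOpen, (hN w hw).1⟩
  exact ⟨k, fun i => N (c i), ρ, fun i => ⟨(hN _ (hρ i).1).2, (hρ i).2⟩, h1⟩

theorem exists_hasIntegralOver {θ : RForm (m + 1) (2 * (m + 1 - 1))} (hθ : IsTestForm θ) :
    ∃ c, HasIntegralOver W θ c := by
  obtain ⟨k, N, ρ, h, h1⟩ := exists_poincareLelong_partition hT hW hdT hθ.2.1 hθ.2.2.1
  choose U Φ hP using fun i => (h i).1.exists_param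
  exact ⟨_, k, U, Φ, ρ, fun i => ⟨(hP i).1, (h i).2.1, fun x hx =>
    (hP i).2 ⟨hx.2, (h i).2.2 hx.1⟩⟩, fun w hw => h1 w hw.2, rfl⟩

/-- The Poincaré–Lelong formula `dd^c log|T|² = 2π [W]`. -/
theorem ddcCurrent_logSq {θ : RForm (m + 1) (2 * (m + 1 - 1))} (hθ : IsTestForm θ) {c : ℝ}
    (hc : HasIntegralOver W θ c) : ddcCurrent (logSq T) θ = 2 * Real.pi * c := by
  have hθB : IsFormOn (unitBall (m + 1)) θ := hθ
  obtain ⟨M, U, Φ, χ, hχ, hχ1, rfl⟩ := hc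
  obtain ⟨k, N, ρ, hρ, hρ1⟩ := exists_poincareLelong_partition hT hW hdT hθ.2.1 hθ.2.2.1
  -- The given functions sum to `1` only on `W ∩ supp θ`. Adding the complement `1 - ∑ χ_j` under
  -- the index `none` makes the sum `1` everywhere, and the extra piece contributes nothing since it
  -- vanishes on `W ∩ supp θ`.
  set χ' : Option (Fin M) → Cn (m + 1) → ℝ := fun o =>
    o.elim (fun z => 1 - ∑ j, χ j z) χ with hχ'
  have hχ's : ∀ o, ContDiff ℝ ∞ (χ' o) := by
    rintro (_ | j)
    · exact contDiff_const.sub (ContDiff.sum fun j _ => (hχ j).2.1)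
    · exact (hχ j).2.1
  -- The second partition `ρ` localises to sets where the local formula holds. Each piece then lies
  -- both in such a set and, along `W`, in one of the given parametrizations.
  set ψ : Fin k × Option (Fin M) → RForm (m + 1) (2 * (m + 1 - 1)) := fun p z =>
    ρ p.1 z • χ' p.2 z • θ z with hψ
  have hψN (p) : IsFormOn (N p.1) (ψ p) :=
    ((hθB.smul (hχ's p.2)).smul (hρ p.1).2.1).mono
        (((hθB.smul (hχ's p.2)).smul (hρ p.1).2.1).2.2.1.trans
          (inter_subset_right.trans (hρ p.1).2.2))
  have hψB (p) : IsFormOn (unitBall (m + 1)) (ψ p) :=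
    (hψN p).mono ((hψN p).2.2.1.trans (hρ p.1).1.subset)
  have hsum : θ = fun z => ∑ p, ψ p z := by
    ext1 z
    rw [Fintype.sum_prod_type]
    simp only [hψ, ← Finset.smul_sum, ← Finset.sum_smul]
    have h1 : ∑ o, χ' o z = 1 := by simp [hχ', Fintype.sum_option]
    rw [h1, one_smul]
    by_cases hz : z ∈ tsupport θ
    · rw [hρ1 z hz, one_smul]
    · rw [image_eq_zero_of_notMem_tsupport hz, smul_zero]
  have hnone (i) : ddcCurrent (logSq T) (ψ (i, none)) = 0 := by
    obtain ⟨V, Ξ, hP, hV⟩ := (hρ i).1.exists_param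
    have h1 := ((hρ i).1.formula _ (hψN (i, none)) V Ξ hP fun x hx =>
      hV ⟨hx.1, (hψN (i, none)).2.2.1 hx.2⟩).2
    have h2 : ∀ y ∈ V, (ψ (i, none) (Ξ y) fun j => fderiv ℂ Ξ y (frame m j)) = 0 := by
      intro y hy
      have h3 : ψ (i, none) (Ξ y) = 0 := by
        by_cases hz : Ξ y ∈ tsupport θ
        · have : χ' none (Ξ y) = 0 := by
            simp only [hχ', Option.elim_none, hχ1 _ ⟨hP.mem hy, hz⟩, sub_self]
          simp only [hψ, this, zero_smul, smul_zero]
        · simp only [hψ, image_eq_zero_of_notMem_tsupport hz, smul_zero]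
      rw [h3]
      rfl
    exact h1.trans ((congrArg (2 * Real.pi * ·) (setIntegral_eq_zero_of_forall_eq_zero h2)).trans
      (mul_zero _))
  have hsome (j) : ∑ i, ddcCurrent (logSq T) (ψ (i, some j))
      = 2 * Real.pi * paramIntegral (U j) (Φ j) fun z => χ j z • θ z := by
    have h1 (i) := (hρ i).1.formula _ (hψN (i, some j)) (U j) (Φ j) (hχ j).1 fun x hx =>
      (hχ j).2.2 ⟨(tsupport_smul_form (tsupport_smul_form hx.2).2).1, hx.1⟩
    have h2 (i) : ddcCurrent (logSq T) (ψ (i, some j)) = _ := (h1 i).2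
    simp only [h2]
    rw [← Finset.mul_sum, paramIntegral, ← integral_finsetSum _ fun i _ => (h1 i).1]
    congr 2
    ext y
    rw [← ContinuousAlternatingMap.sum_apply]
    refine DFunLike.congr_fun ?_ _
    simp only [hψ, hχ', Option.elim_some, ← Finset.sum_smul]
    by_cases hz : Φ j y ∈ tsupport θ
    · rw [hρ1 _ hz, one_smul]
    · rw [image_eq_zero_of_notMem_tsupport hz, smul_zero, smul_zero]
  conv_lhs => rw [hsum]
  rw [ddcCurrent_sum (locallyIntegrableOn_logSq hT hW hdT) _ fun p _ => hψB p,
    Fintype.sum_prod_type_right, Fintype.sum_option]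
  simp only [hnone, hsome, Finset.sum_const_zero, zero_add, Finset.mul_sum]

end PoincareLelong

end BergmanBall
end

/-! ### Plurisubharmonicity of `log|T|²` and positivity of its Laplacian. -/

noncomputable section
namespace BergmanBall

/-! ### The measure `ω_B^{n-1} ∧ dd^c log|T|²` -/

section Positive

variable {n : ℕ} {T : Cn n → ℂ} {z : Cn n}

theorem lapDensity_const_mul {φ : Cn n → ℝ} (hφ : ContDiffAt ℝ ∞ φ z) (c : ℝ) :
    lapDensity (fun x => c * φ x) z = c * lapDensity φ z := by
  have h : leviMatrix (fun x => c * φ x) z = (c : ℂ) • leviMatrix φ z := by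
    ext j k
    rw [leviMatrix_comp (g := fun t => c * t) (g₁ := fun _ => c) (g₂ := 0) hφ
      (Eventually.of_forall fun t => by simpa using (hasDerivAt_id t).const_mul c)
      (hasDerivAt_const _ _)]
    simp
  simp only [lapDensity, bergmanLaplacian, h, Matrix.smul_mul, Matrix.trace_smul, smul_eq_mul,
    Complex.re_ofReal_mul]
  ring

/-- Up to positive factors the Laplacian is `∑|∂_jT|² - |∑ z_j ∂_jT|²`, which is nonnegative by
Cauchy–Schwarz and `|z| < 1`. -/
theorem lapDensity_log_normSq_add_nonneg (hT : DifferentiableOn ℂ T (unitBall n))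
    (hz : z ∈ unitBall n) {ε : ℝ} (hε : 0 < ε) :
    0 ≤ lapDensity (fun x => Real.log (‖T x‖ ^ 2 + ε)) z := by
  have hB := (isOpen_unitBall (n := n)).mem_nhds hz
  have hTe : ∀ᶠ x in 𝓝 z, DifferentiableAt ℂ T x := by
    filter_upwards [hB] with x hx using hT.differentiableAt (isOpen_unitBall.mem_nhds hx)
  have hTs : ContDiffAt ℝ ∞ T z :=
    ((contDiffOn_of_differentiableOn isOpen_unitBall hT).contDiffAt hB).restrict_scalars ℝ
  have hpos : 0 < ‖T z‖ ^ 2 + ε := by positivity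
  rw [lapDensity, bergmanLaplacian_mul_density hz]
  have h1 : cLap (fun x => ((Real.log (‖T x‖ ^ 2 + ε) : ℝ) : ℂ)) z
      = ((ε / (‖T z‖ ^ 2 + ε) ^ 2 * (∑ j, ‖dz j T z‖ ^ 2 - ‖∑ j, z j * dz j T z‖ ^ 2) : ℝ) : ℂ) := by
    have h2 (j k : Fin n) := leviMatrix_log_normSq_add hTe hTs hpos j k
    have h3 (j k : Fin n) : dz j (dzbar k fun x => ((Real.log (‖T x‖ ^ 2 + ε) : ℝ) : ℂ)) z = _ := h2 j k
    simp only [cLap, h3]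
    have h4 := sum_hermitian (x := z) (fun j => dz j T z) (fun k => starRingEnd ℂ (dz k T z))
    have h5 : ∑ k, starRingEnd ℂ (z k) * starRingEnd ℂ (dz k T z)
        = starRingEnd ℂ (∑ k, z k * dz k T z) := by
      rw [map_sum]
      exact Finset.sum_congr rfl fun k _ => (map_mul _ _ _).symm
    rw [h5, Complex.mul_conj'] at h4
    simp only [Complex.mul_conj'] at h4
    push_cast
    rw [← h4, Finset.mul_sum]
    refine Finset.sum_congr rfl fun j _ => ?_
    rw [Finset.mul_sum]
    refine Finset.sum_congr rfl fun k _ => ?_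
    ring
  rw [h1, Complex.ofReal_re]
  have h6 : ‖∑ j, z j * dz j T z‖ ^ 2 ≤ ∑ j, ‖dz j T z‖ ^ 2 := by
    calc ‖∑ j, z j * dz j T z‖ ^ 2 ≤ (∑ j, ‖z j‖ * ‖dz j T z‖) ^ 2 := by
          gcongr
          exact norm_sum_le_of_le _ fun j _ => (norm_mul _ _).le
      _ ≤ (∑ j, ‖z j‖ ^ 2) * ∑ j, ‖dz j T z‖ ^ 2 := Finset.sum_mul_sq_le_sq_mul_sq _ _ _
      _ ≤ 1 * ∑ j, ‖dz j T z‖ ^ 2 := by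
          gcongr
          rw [← EuclideanSpace.norm_sq_eq]
          exact pow_le_one₀ (norm_nonneg _) (norm_lt_one hz).le
      _ = _ := one_mul _
  have h7 := defFun_pos hz
  have h8 : 0 ≤ ∑ j, ‖dz j T z‖ ^ 2 - ‖∑ j, z j * dz j T z‖ ^ 2 := sub_nonneg.mpr h6
  positivity

theorem integral_logSq_mul_lapDensity_nonneg (hT : DifferentiableOn ℂ T (unitBall n))
    (hi : LocallyIntegrableOn (logSq T) (unitBall n)) (hnull : volume {z ∈ unitBall n | T z = 0} = 0)
    {φ : Cn n → ℝ} (hφ : IsTestFunction φ) (h0 : ∀ x, 0 ≤ φ x) :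
    0 ≤ ∫ x in unitBall n, logSq T x * lapDensity φ x := by
  have hBm : MeasurableSet (unitBall n) := isOpen_unitBall.measurableSet
  have hTc : ContinuousOn T (unitBall n) := hT.continuousOn
  set ε : ℕ → ℝ := fun k => 1 / ((k : ℝ) + 1) with hε
  have hε0 (k) : 0 < ε k := by positivity
  have hε1 (k) : ε k ≤ 1 := by
    simp only [hε]
    rw [div_le_one (by positivity)]
    linarith [Nat.cast_nonneg (α := ℝ) k]
  have hsm (k) : ∀ x ∈ unitBall n, ContDiffAt ℝ ∞ (fun x => Real.log (‖T x‖ ^ 2 + ε k)) x :=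
    fun x hx => (contDiffAt_normSq_add (((contDiffOn_of_differentiableOn isOpen_unitBall hT).contDiffAt
      (isOpen_unitBall.mem_nhds hx)).restrict_scalars ℝ) _).log (by have := hε0 k; positivity)
  have hpos (k) : 0 ≤ ∫ x in unitBall n, Real.log (‖T x‖ ^ 2 + ε k) * lapDensity φ x := by
    rw [integral_mul_lapDensity_comm (hsm k) hφ]
    exact setIntegral_nonneg hBm fun x hx => mul_nonneg (h0 x)
      (lapDensity_log_normSq_add_nonneg hT hx (hε0 k))
  -- For `0 < ε ≤ 1` and `T ≠ 0` the regularisation lies between `log|T|²` and `log(|T|²+1)`, which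
  -- gives an integrable bound uniform in `ε`.
  have hbd : LocallyIntegrableOn (fun x => |logSq T x| + Real.log (‖T x‖ ^ 2 + 1)) (unitBall n) := by
    refine hi.norm.add (ContinuousOn.locallyIntegrableOn ?_ hBm)
    exact ((hTc.norm.pow 2).add continuousOn_const).log fun x _ =>
      (by positivity : ‖T x‖ ^ 2 + (1 : ℝ) ≠ 0)
  refine ge_of_tendsto' (tendsto_integral_of_dominated_convergence
    (F := fun k x => Real.log (‖T x‖ ^ 2 + ε k) * lapDensity φ x)
    (fun x => ‖(|logSq T x| + Real.log (‖T x‖ ^ 2 + 1)) * lapDensity φ x‖) (fun k => ?_)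
    (hφ.integrable_mul_lapDensity hbd).norm (fun k => ?_) ?_) hpos
  · exact (hφ.integrable_mul_lapDensity (ContinuousOn.locallyIntegrableOn (fun x hx =>
      (hsm k x hx).continuousAt.continuousWithinAt) hBm)).aestronglyMeasurable
  all_goals
    have hne : ∀ᵐ x ∂volume.restrict (unitBall n), T x ≠ 0 := by
      rw [ae_restrict_iff' hBm, ae_iff]
      convert hnull using 3
      simp
    filter_upwards [hne] with x hx
    have hx2 : 0 < ‖T x‖ ^ 2 := by positivity
  · rw [norm_mul, norm_mul]
    gcongr
    have h1 : logSq T x ≤ Real.log (‖T x‖ ^ 2 + ε k) :=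
      Real.log_le_log hx2 (by linarith [hε0 k])
    have h2 : Real.log (‖T x‖ ^ 2 + ε k) ≤ Real.log (‖T x‖ ^ 2 + 1) :=
      Real.log_le_log (by linarith [hε0 k]) (by linarith [hε1 k])
    have h3 : 0 ≤ Real.log (‖T x‖ ^ 2 + 1) := Real.log_nonneg (by linarith)
    rw [Real.norm_eq_abs, Real.norm_eq_abs, abs_of_nonneg (a := |logSq T x| + _) (by positivity)]
    refine abs_le.mpr ⟨?_, ?_⟩
    · linarith [neg_abs_le (logSq T x)]
    · linarith [abs_nonneg (logSq T x)]
  · refine Tendsto.mul_const _ ?_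
    have h1 : Tendsto (fun k => ‖T x‖ ^ 2 + ε k) atTop (𝓝 (‖T x‖ ^ 2)) := by
      have := (tendsto_const_nhds (x := ‖T x‖ ^ 2)).add
        (tendsto_one_div_add_atTop_nhds_zero_nat (𝕜 := ℝ))
      rwa [add_zero] at this
    exact h1.log hx2.ne'

end Positive

/-! ### Representation of positive distributions on the ball by Radon measures. -/

section Measure

variable {n : ℕ}

/-- Test functions as a vector space. -/
def testSubmodule (n : ℕ) : Submodule ℝ (Cn n → ℝ) where
  carrier := {φ | IsTestFunction φ}
  add_mem' := fun {a b} ha hb => ⟨ha.1.add hb.1, ha.2.1.add hb.2.1,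
    (tsupport_add a b).trans (union_subset ha.2.2 hb.2.2)⟩
  zero_mem' := ⟨contDiff_const, HasCompactSupport.zero, by
    rw [tsupport_eq_empty_iff.mpr rfl]
    exact empty_subset _⟩
  smul_mem' := fun c φ hφ => ⟨contDiff_const.smul hφ.1,
    hφ.2.1.of_isClosed_subset (isClosed_tsupport _) (tsupport_smul_subset_right (fun _ => c) φ),
    (tsupport_smul_subset_right (fun _ => c) φ).trans hφ.2.2⟩

/-- Restriction of test functions to the ball. -/
def restrictTest (n : ℕ) : testSubmodule n →ₗ[ℝ] CompactlySupportedContinuousMap (unitBall n) ℝ where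
  toFun φ := ⟨⟨fun x => φ.1 x, φ.2.1.continuous.comp continuous_subtype_val⟩, by
    have h : IsCompact ((↑) ⁻¹' tsupport φ.1 : Set (unitBall n)) := by
      rw [Subtype.isCompact_iff, Subtype.image_preimage_coe, inter_eq_right.mpr φ.2.2.2]
      exact φ.2.2.1
    exact HasCompactSupport.of_support_subset_isCompact h fun x hx => subset_tsupport φ.1 hx⟩
  map_add' _ _ := rfl
  map_smul' _ _ := rfl

theorem restrictTest_injective : Function.Injective (restrictTest n) := by
  intro φ ψ h
  ext x
  by_cases hx : x ∈ unitBall n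
  · exact DFunLike.congr_fun h ⟨x, hx⟩
  · rw [image_eq_zero_of_notMem_tsupport fun h' => hx (φ.2.2.2 h'),
      image_eq_zero_of_notMem_tsupport fun h' => hx (ψ.2.2.2 h')]

theorem IsTestFunction.nonneg {φ : Cn n → ℝ} (hφ : IsTestFunction φ) (h : ∀ x ∈ unitBall n, 0 ≤ φ x)
    (x : Cn n) : 0 ≤ φ x := by
  by_cases hx : x ∈ unitBall n
  · exact h x hx
  · rw [image_eq_zero_of_notMem_tsupport fun h' => hx (hφ.2.2 h')]

/-- Compact subsets of the ball have cut-off functions. -/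
theorem exists_isTestFunction_eq_one {K : Set (Cn n)} (hK : IsCompact K) (hKB : K ⊆ unitBall n) :
    ∃ φ : Cn n → ℝ, IsTestFunction φ ∧ (∀ x, 0 ≤ φ x) ∧ ∀ x ∈ K, φ x = 1 := by
  obtain ⟨ρ, hρ1, hKρ⟩ : ∃ ρ < 1, K ⊆ Metric.closedBall (0 : Cn n) ρ := by
    rcases K.eq_empty_or_nonempty with rfl | hne
    · exact ⟨0, one_pos, empty_subset _⟩
    · obtain ⟨x, hx, hmax⟩ := hK.exists_isMaxOn hne continuous_norm.continuousOn
      exact ⟨‖x‖, norm_lt_one (hKB hx), fun y hy => by simpa using hmax hy⟩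
  set s := max ρ (1 / 2) with hs
  have hs0 : 0 < s := lt_of_lt_of_le (by norm_num) (le_max_right _ _)
  have hs1 : s < 1 := max_lt hρ1 (by norm_num)
  let f : ContDiffBump (0 : Cn n) := ⟨s, (s + 1) / 2, hs0, by linarith⟩
  refine ⟨f, ⟨f.contDiff, f.hasCompactSupport, ?_⟩, fun x => f.nonneg, fun x hx =>
    f.one_of_mem_closedBall (Metric.closedBall_subset_closedBall (le_max_left _ _) (hKρ hx))⟩
  rw [f.tsupport_eq]
  exact Metric.closedBall_subset_ball (by change (s + 1) / 2 < 1; linarith)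

/-- Positive distributions are measures. -/
theorem exists_isWedgeMeasure {u : Cn n → ℝ} (hu : LocallyIntegrableOn u (unitBall n))
    (hpos : ∀ φ, IsTestFunction φ → (∀ x, 0 ≤ φ x) → 0 ≤ ∫ x in unitBall n, u x * lapDensity φ x) :
    ∃ μ, IsWedgeMeasure u μ := by
  let Λ₀ : testSubmodule n →ₗ[ℝ] ℝ :=
    { toFun := fun φ => ∫ x in unitBall n, u x * lapDensity φ.1 x
      map_add' := fun φ ψ => by
        rw [← integral_add (φ.2.integrable_mul_lapDensity hu) (ψ.2.integrable_mul_lapDensity hu)]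
        congr 1
        ext x
        rw [← mul_add, ← lapDensity_add φ.2.1.contDiffAt ψ.2.1.contDiffAt]
        rfl
      map_smul' := fun c φ => by
        rw [RingHom.id_apply, smul_eq_mul, ← integral_const_mul]
        congr 1
        ext x
        rw [mul_left_comm, ← lapDensity_const_mul φ.2.1.contDiffAt]
        rfl }
  let e := LinearEquiv.ofInjective (restrictTest n) restrictTest_injective
  let f : CompactlySupportedContinuousMap (unitBall n) ℝ →ₗ.[ℝ] ℝ :=
    ⟨LinearMap.range (restrictTest n), Λ₀ ∘ₗ (e.symm : _ →ₗ[ℝ] testSubmodule n)⟩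
  let s : PointedCone ℝ (CompactlySupportedContinuousMap (unitBall n) ℝ) :=
    { carrier := {g | ∀ x, 0 ≤ g x}
      add_mem' := fun ha hb x => add_nonneg (ha x) (hb x)
      zero_mem' := fun x => le_rfl
      smul_mem' := fun c g hg x => mul_nonneg c.2 (hg x) }
  have hf (φ : testSubmodule n) : f (e φ) = Λ₀ φ := congrArg Λ₀ (e.symm_apply_apply φ)
  -- M. Riesz's theorem extends the functional positively from test functions to all compactly
  -- supported continuous functions. Its cofinality hypothesis holds because a multiple of a cutoff
  -- equal to `1` on the support of `y`, added to `y`, is nonnegative.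
  obtain ⟨g, hg, hg0⟩ := riesz_extension s f (by
    intro x hx
    obtain ⟨φ, rfl⟩ := e.surjective x
    rw [hf]
    exact hpos _ φ.2 (φ.2.nonneg fun y hy => hx ⟨y, hy⟩)) (by
    intro y
    have hK : IsCompact ((↑) '' tsupport y : Set (Cn n)) := y.2.isCompact.image continuous_subtype_val
    obtain ⟨φ, hφ, hφ0, hφ1⟩ := exists_isTestFunction_eq_one hK (by
      rintro _ ⟨x, -, rfl⟩
      exact x.2)
    obtain ⟨C, hC⟩ := y.2.exists_bound_of_continuous y.1.continuous
    refine ⟨e (C • ⟨φ, hφ⟩), fun x => ?_⟩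
    change 0 ≤ C * φ x + y x
    have hCx := hC x
    by_cases hx : x ∈ tsupport y
    · rw [hφ1 x ⟨x, hx, rfl⟩]
      have := neg_abs_le (y x)
      have h2 : |y x| ≤ C := hCx
      linarith
    · rw [image_eq_zero_of_notMem_tsupport hx]
      have := mul_nonneg ((norm_nonneg _).trans hCx) (hφ0 x)
      linarith)
  have hg' : ∀ x : CompactlySupportedContinuousMap (unitBall n) ℝ, 0 ≤ x → 0 ≤ g x :=
    fun x hx => hg0 x fun y => hx y
  have : LocallyCompactSpace (unitBall n) := isOpen_unitBall.locallyCompactSpace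
  let Λ := PositiveLinearMap.mk₀ g hg'
  let ν := RealRMK.rieszMeasure Λ
  have hemb : MeasurableEmbedding ((↑) : unitBall n → Cn n) :=
    MeasurableEmbedding.subtype_coe isOpen_unitBall.measurableSet
  refine ⟨ν.map (↑), hu, ?_, fun K hKB hK => ?_, fun φ hφ => ?_⟩
  · rw [hemb.map_apply]
    convert measure_empty (μ := ν)
    ext x
    simp
  · rw [hemb.map_apply]
    have : IsCompact ((↑) ⁻¹' K : Set (unitBall n)) := by
      rw [Subtype.isCompact_iff, Subtype.image_preimage_coe, inter_eq_right.mpr hKB]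
      exact hK
    exact this.measure_lt_top
  · rw [hemb.integral_map]
    have h1 : ∫ x, restrictTest n ⟨φ, hφ⟩ x ∂ν = Λ (restrictTest n ⟨φ, hφ⟩) :=
      RealRMK.integral_rieszMeasure Λ _
    have h2 : g (restrictTest n ⟨φ, hφ⟩) = Λ₀ ⟨φ, hφ⟩ := (hg (e ⟨φ, hφ⟩)).trans (hf _)
    refine h1.trans (h2.trans ?_)
    change ∫ x in unitBall n, u x * lapDensity φ x = _
    congr 1
    ext x
    rw [lapDensity, mul_assoc]

theorem isWedgeMeasure_wedgeMeasure {u : Cn n → ℝ} (h : ∃ μ, IsWedgeMeasure u μ) :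
    IsWedgeMeasure u (wedgeMeasure u) := by
  rw [wedgeMeasure, dif_pos h]
  exact h.choose_spec

end Measure

end BergmanBall
end

/-! ### Averages, their Fubini formula, and the closed form of `s_r`. -/

noncomputable section
namespace BergmanBall

/-! ### Averages over Bergman–Green balls -/

section Averages

variable {n : ℕ}

theorem one_sub_inner_ne_zero_of_mem {a x : Cn n} (ha : a ∈ unitBall n) (hx : x ∈ unitBall n) :
    1 - inner ℂ a x ≠ 0 := one_sub_inner_ne_zero (norm_lt_one ha) (norm_lt_one hx).le

/-- A formula for `F_a` without the singular denominator `|a|²`. -/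
theorem F_eq {a : Cn n} (ha : a ∈ unitBall n) (x : Cn n) :
    F a x = (1 - inner ℂ a x)⁻¹ • (a - ((Real.sqrt (1 - ‖a‖ ^ 2) : ℝ) : ℂ) • x
      - (((1 + Real.sqrt (1 - ‖a‖ ^ 2))⁻¹ : ℝ) : ℂ) • inner ℂ a x • a) := by
  rcases eq_or_ne a 0 with rfl | ha0
  · simp [F]
  have h1 := norm_lt_one ha
  have hn : 0 < ‖a‖ := norm_pos_iff.mpr ha0
  set s := Real.sqrt (1 - ‖a‖ ^ 2) with hs
  have hs2 : s ^ 2 = 1 - ‖a‖ ^ 2 := Real.sq_sqrt (by nlinarith)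
  have hs0 : 0 ≤ s := Real.sqrt_nonneg _
  -- The identity `(1-s)/|a|² = 1/(1+s)` removes the apparent singularity at `a = 0`, which is what
  -- makes `F` jointly continuous.
  have key : (1 - (s : ℂ)) * (inner ℂ a x / ((‖a‖ ^ 2 : ℝ) : ℂ))
      = (((1 + s)⁻¹ : ℝ) : ℂ) * inner ℂ a x := by
    have h2 : (1 - s) / ‖a‖ ^ 2 = (1 + s)⁻¹ := by
      have : 1 + s ≠ 0 := by positivity
      field_simp
      linear_combination -hs2
    rw [← h2]
    push_cast
    ring
  simp only [F]
  congr 1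
  rw [smul_smul, ← key]
  module

theorem continuousOn_F_prod :
    ContinuousOn (fun p : Cn n × Cn n => F p.1 p.2) (unitBall n ×ˢ unitBall n) := by
  have h : ContinuousOn (fun p : Cn n × Cn n => (1 - inner ℂ p.1 p.2)⁻¹ •
      (p.1 - ((Real.sqrt (1 - ‖p.1‖ ^ 2) : ℝ) : ℂ) • p.2
      - (((1 + Real.sqrt (1 - ‖p.1‖ ^ 2))⁻¹ : ℝ) : ℂ) • inner ℂ p.1 p.2 • p.1))
      (unitBall n ×ˢ unitBall n) := by
    have hi : Continuous fun p : Cn n × Cn n => inner ℂ p.1 p.2 := continuous_fst.inner continuous_snd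
    have hs : Continuous fun p : Cn n × Cn n => Real.sqrt (1 - ‖p.1‖ ^ 2) := by fun_prop
    have hs' : Continuous fun p : Cn n × Cn n => (1 + Real.sqrt (1 - ‖p.1‖ ^ 2))⁻¹ :=
      (continuous_const.add hs).inv₀ fun p =>
        (by positivity : 1 + Real.sqrt (1 - ‖p.1‖ ^ 2) ≠ 0)
    refine ContinuousOn.smul ((continuous_const.sub hi).continuousOn.inv₀ fun p hp =>
      one_sub_inner_ne_zero_of_mem hp.1 hp.2) (Continuous.continuousOn ?_)
    exact (continuous_fst.sub ((Complex.continuous_ofReal.comp hs).smul continuous_snd)).sub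
      ((Complex.continuous_ofReal.comp hs').smul (hi.smul continuous_fst))
  exact h.congr fun p hp => F_eq hp.1 p.2

theorem one_le_bergmanDensity {z : Cn n} (hz : z ∈ unitBall n) : 1 ≤ bergmanDensity z := by
  rw [bergmanDensity_eq hz]
  have h1 := defFun_pos hz
  have h2 : defFun z ≤ 1 := by
    rw [defFun]
    linarith [sq_nonneg ‖z‖]
  have h3 : (1 : ℝ) ≤ n.factorial := by exact_mod_cast n.factorial_pos
  have h4 : (1 : ℝ) ≤ 2 ^ n := one_le_pow₀ (by norm_num)
  have h5 : (1 : ℝ) ≤ ((n : ℝ) + 1) ^ n := one_le_pow₀ (by linarith [Nat.cast_nonneg (α := ℝ) n])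
  have h6 : 1 ≤ (defFun z ^ (n + 1))⁻¹ := (one_le_inv₀ (by positivity)).mpr (pow_le_one₀ h1.le h2)
  exact one_le_mul_of_one_le_of_one_le (one_le_mul_of_one_le_of_one_le
    (one_le_mul_of_one_le_of_one_le h4 h3) h5) h6

variable {u : Cn n → ℝ} {r : ℝ} {K : Set (Cn n)}

theorem integrableOn_mul_bergmanDensity (hu : LocallyIntegrableOn u (unitBall n)) (hK : IsCompact K)
    (hKB : K ⊆ unitBall n) : IntegrableOn (fun x => u x * bergmanDensity x) K :=
  (hu.integrableOn_compact_subset hKB hK).mul_continuousOn (continuousOn_bergmanDensity.mono hKB) hK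

theorem integrableOn_bgBall (hu : LocallyIntegrableOn u (unitBall n)) (hr1 : r < 1) {z : Cn n}
    (hz : z ∈ unitBall n) : IntegrableOn (fun x => u x * bergmanDensity x) (bgBall z r) :=
  (integrableOn_mul_bergmanDensity hu (isCompact_closedBgBall hz hr1)
    (closedBgBall_subset hz hr1)).mono_set (bgBall_subset_closedBgBall hz)

theorem ball_subset_unitBall (hr1 : r < 1) : Metric.ball (0 : Cn n) r ⊆ unitBall n :=
  Metric.ball_subset_ball hr1.le

/-- Joint integrability of `u(F_z(ζ))` in `z` and `ζ`. -/
theorem integrable_comp_F_mul (hn : 1 ≤ n) (hu : LocallyIntegrableOn u (unitBall n)) (hr1 : r < 1)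
    (hK : IsCompact K) (hKB : K ⊆ unitBall n)
    (hm : AEStronglyMeasurable (fun p : Cn n × Cn n => u (F p.1 p.2))
      ((volume.restrict K).prod (volume.restrict (Metric.ball 0 r)))) :
    Integrable (fun p : Cn n × Cn n => u (F p.1 p.2) * bergmanDensity p.2)
      ((volume.restrict K).prod (volume.restrict (Metric.ball 0 r))) := by
  have hb : MeasurableSet (Metric.ball (0 : Cn n) r) := measurableSet_ball
  have hd : AEStronglyMeasurable (fun p : Cn n × Cn n => bergmanDensity p.2)
      ((volume.restrict K).prod (volume.restrict (Metric.ball 0 r))) :=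
    ((continuousOn_bergmanDensity.mono (ball_subset_unitBall hr1)).aestronglyMeasurable
      hb).comp_snd
  have hm' := hm.mul hd
  have hfib {z : Cn n} (hz : z ∈ unitBall n) :
      IntegrableOn (fun ζ => u (F z ζ) * bergmanDensity ζ) (Metric.ball 0 r) := by
    rw [← integrableOn_image_F hn hz hb (ball_subset_unitBall hr1), F_image_ball hz hr1.le]
    exact integrableOn_bgBall hu hr1 hz
  -- This compact subset of `B` contains every `E(z,r)` with `z ∈ K`. By invariance of `ω_B^n` the
  -- inner integrals are bounded, uniformly in `z`, by `∫_L |u| ω_B^n`.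
  set L : Set (Cn n) := (fun p : Cn n × Cn n => F p.1 p.2) '' (K ×ˢ Metric.closedBall 0 r) with hL
  have hsub : K ×ˢ Metric.closedBall (0 : Cn n) r ⊆ unitBall n ×ˢ unitBall n :=
    prod_mono hKB (closedBall_subset_unitBall hr1)
  have hLc : IsCompact L :=
    (hK.prod (isCompact_closedBall 0 r)).image_of_continuousOn (continuousOn_F_prod.mono hsub)
  have hLB : L ⊆ unitBall n := by
    rintro _ ⟨p, hp, rfl⟩
    exact F_mem_unitBall (hsub hp).1 (hsub hp).2
  have hLi := integrableOn_mul_bergmanDensity hu hLc hLB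
  refine (integrable_prod_iff hm').mpr ⟨?_, ?_⟩
  · filter_upwards [ae_restrict_mem hK.measurableSet] with z hz using hfib (hKB hz)
  · have : IsFiniteMeasure (volume.restrict K) := ⟨by simpa using hK.measure_lt_top⟩
    refine Integrable.of_bound hm'.norm.integral_prod_right' (∫ x in L, ‖u x * bergmanDensity x‖) ?_
    filter_upwards [ae_restrict_mem hK.measurableSet] with z hz
    rw [Real.norm_of_nonneg (integral_nonneg fun _ => norm_nonneg _)]
    have h1 := setIntegral_image_F hn (hKB hz) hb (ball_subset_unitBall hr1) fun x => |u x|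
    have h2 (x : Cn n) (t : ℝ) : |t| * bergmanDensity x = ‖t * bergmanDensity x‖ := by
      rw [norm_mul, Real.norm_of_nonneg (bergmanDensity_pos x).le, Real.norm_eq_abs]
    simp only [h2] at h1
    change ∫ ζ in Metric.ball 0 r, ‖u (F z ζ) * bergmanDensity ζ‖ ≤ _
    rw [← h1]
    refine setIntegral_mono_set hLi.norm (Eventually.of_forall fun _ => norm_nonneg _)
      (LE.le.eventuallyLE ?_)
    rintro _ ⟨y, hy, rfl⟩
    exact ⟨(z, y), ⟨hz, Metric.ball_subset_closedBall hy⟩, rfl⟩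

theorem integrableOn_comp_F (hn : 1 ≤ n) (hu : LocallyIntegrableOn u (unitBall n)) (hr1 : r < 1)
    (hK : IsCompact K) (hKB : K ⊆ unitBall n)
    (hm : AEStronglyMeasurable (fun p : Cn n × Cn n => u (F p.1 p.2))
      ((volume.restrict K).prod (volume.restrict (Metric.ball 0 r)))) :
    IntegrableOn (fun p : Cn n × Cn n => u (F p.1 p.2)) (K ×ˢ Metric.ball 0 r) := by
  have h := integrable_comp_F_mul hn hu hr1 hK hKB hm
  rw [IntegrableOn, Measure.volume_eq_prod, ← Measure.prod_restrict]
  refine h.mono hm ?_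
  rw [Measure.prod_restrict]
  filter_upwards [ae_restrict_mem (hK.measurableSet.prod measurableSet_ball)] with p hp
  rw [norm_mul]
  refine le_mul_of_one_le_right (norm_nonneg _) ?_
  have := one_le_bergmanDensity (ball_subset_unitBall hr1 hp.2)
  exact this.trans (Real.le_norm_self _)

theorem aestronglyMeasurable_logSq_comp_F {T : Cn n → ℂ} (hT : ContinuousOn T (unitBall n))
    (hr1 : r < 1) (hK : IsCompact K) (hKB : K ⊆ unitBall n) :
    AEStronglyMeasurable (fun p : Cn n × Cn n => logSq T (F p.1 p.2))
      ((volume.restrict K).prod (volume.restrict (Metric.ball 0 r))) := by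
  rw [Measure.prod_restrict]
  have hsub : K ×ˢ Metric.ball (0 : Cn n) r ⊆ unitBall n ×ˢ unitBall n :=
    prod_mono hKB (ball_subset_unitBall hr1)
  have h1 : ContinuousOn (fun p : Cn n × Cn n => ‖T (F p.1 p.2)‖ ^ 2) (K ×ˢ Metric.ball 0 r) :=
    (hT.comp (continuousOn_F_prod.mono hsub) fun p hp =>
      F_mem_unitBall (hsub hp).1 (hsub hp).2).norm.pow 2
  exact (Real.measurable_log.comp_aemeasurable
    (h1.aemeasurable (hK.measurableSet.prod measurableSet_ball))).aestronglyMeasurable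

/-- The average of `u` over the ball `E(z,r)`. -/
def bgAverage (r : ℝ) (u : Cn n → ℝ) (z : Cn n) : ℝ :=
  (V n r)⁻¹ * ∫ ζ in bgBall z r, u ζ * bergmanDensity ζ

theorem bgAverage_eq (hn : 1 ≤ n) (hr1 : r < 1) {z : Cn n} (hz : z ∈ unitBall n) :
    bgAverage r u z = (V n r)⁻¹ * ∫ ζ in Metric.ball 0 r, u (F z ζ) * bergmanDensity ζ := by
  rw [bgAverage, ← F_image_ball hz hr1.le,
    setIntegral_image_F hn hz measurableSet_ball (ball_subset_unitBall hr1)]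

theorem locallyIntegrableOn_bgAverage (hn : 1 ≤ n) (hu : LocallyIntegrableOn u (unitBall n))
    (hr1 : r < 1) (hm : ∀ K ⊆ unitBall n, IsCompact K →
      AEStronglyMeasurable (fun p : Cn n × Cn n => u (F p.1 p.2))
      ((volume.restrict K).prod (volume.restrict (Metric.ball 0 r)))) :
    LocallyIntegrableOn (bgAverage r u) (unitBall n) := by
  refine (locallyIntegrableOn_iff isOpen_unitBall.isLocallyClosed).mpr fun K hKB hK => ?_
  have h := (integrable_comp_F_mul hn hu hr1 hK hKB (hm K hKB hK)).integral_prod_left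
  refine IntegrableOn.congr_fun (h.const_mul (V n r)⁻¹) (fun z hz => ?_) hK.measurableSet
  exact (bgAverage_eq hn hr1 (hKB hz)).symm

/-- Applied with `ℓ` the coefficient of `dd^c θ`, this says that `dd^c` of the average is the
average of the currents `dd^c_z u(F_z(ζ))`. Pulling `E(z,r)` back to a ball independent of `z` is
what allows Fubini. -/
theorem integral_bgAverage_mul (hn : 1 ≤ n) (hu : LocallyIntegrableOn u (unitBall n)) (hr1 : r < 1)
    (hm : ∀ K ⊆ unitBall n, IsCompact K →
      AEStronglyMeasurable (fun p : Cn n × Cn n => u (F p.1 p.2))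
      ((volume.restrict K).prod (volume.restrict (Metric.ball 0 r))))
    {ℓ : Cn n → ℝ} (hℓ : Continuous ℓ) (hℓc : HasCompactSupport ℓ) (hℓB : tsupport ℓ ⊆ unitBall n) :
    ∫ z in unitBall n, bgAverage r u z * ℓ z = (V n r)⁻¹ * ∫ ζ in Metric.ball 0 r,
      (∫ z in unitBall n, u (F z ζ) * ℓ z) * bergmanDensity ζ := by
  have hBm : MeasurableSet (unitBall n) := isOpen_unitBall.measurableSet
  have hred (v : Cn n → ℝ) :
      ∫ z in unitBall n, v z * ℓ z = ∫ z in tsupport ℓ, v z * ℓ z :=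
    setIntegral_eq_of_subset_of_forall_sdiff_eq_zero hBm hℓB fun x hx => by
      rw [image_eq_zero_of_notMem_tsupport hx.2, mul_zero]
  simp only [hred]
  have hi := integrable_comp_F_mul hn hu hr1 hℓc hℓB (hm _ hℓB hℓc)
  obtain ⟨C, hC⟩ := hℓc.exists_bound_of_continuous hℓ
  have hi2 : Integrable (Function.uncurry fun z ζ => u (F z ζ) * bergmanDensity ζ * ℓ z)
      ((volume.restrict (tsupport ℓ)).prod (volume.restrict (Metric.ball 0 r))) :=
    hi.mul_bdd (c := C) (hℓ.comp continuous_fst).aestronglyMeasurable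
      (Eventually.of_forall fun p => hC p.1)
  have e1 : ∫ z in tsupport ℓ, bgAverage r u z * ℓ z = (V n r)⁻¹ * ∫ z in tsupport ℓ,
      ∫ ζ in Metric.ball 0 r, u (F z ζ) * bergmanDensity ζ * ℓ z := by
    rw [← integral_const_mul]
    refine setIntegral_congr_fun hℓc.measurableSet fun z hz => ?_
    beta_reduce
    rw [bgAverage_eq hn hr1 (hℓB hz), integral_mul_const, mul_assoc]
  rw [e1, integral_integral_swap hi2]
  congr 2
  ext ζ
  rw [← integral_mul_const]
  congr 1
  ext z
  ring

end Averages

/-! ### The function `s_r` -/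

section SFun

variable {n : ℕ} {T : Cn n → ℂ} {r : ℝ} {z : Cn n}

theorem toReal_log_enorm_sq (t : ℂ) : (ENNReal.log (‖t‖ₑ ^ 2)).toReal = Real.log (‖t‖ ^ 2) := by
  rcases eq_or_ne t 0 with rfl | ht
  -- At a zero both sides are `0`: `toReal` sends `-∞` to `0`, and the real logarithm of `0` is `0`.
  · simp
  · have h1 : ‖t‖ₑ ^ 2 ≠ 0 := by simpa using ht
    rw [ENNReal.log_pos_real h1 (by simp), EReal.toReal_coe]
    simp

theorem log_enorm_sq_ne_top (t : ℂ) : ENNReal.log (‖t‖ₑ ^ 2) ≠ ⊤ := by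
  simp

/-- Since `Γ_r ≤ 0` the positive part of the integrand vanishes, so the integral is well defined,
without a difference `∞ - ∞`. -/
theorem sFun_eq_neg_lintegral (hn : 1 ≤ n) (hr0 : 0 < r) (hr1 : r < 1) (hz : z ∈ unitBall n) :
    ∫⁻ ζ in unitBall n, (Gam r z ζ).toENNReal ∂(wedgeMeasure (logSq T)) = 0 ∧
    sFun T r z = -((∫⁻ ζ in unitBall n, rieszKernel n r (1 - gap z ζ) ∂(wedgeMeasure (logSq T)) :
      ℝ≥0∞) : EReal) := by
  have hB : MeasurableSet (unitBall n) := isOpen_unitBall.measurableSet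
  have h1 : ∫⁻ ζ in unitBall n, (Gam r z ζ).toENNReal ∂(wedgeMeasure (logSq T)) = 0 := by
    rw [setLIntegral_congr_fun (g := fun _ => 0) hB, lintegral_zero]
    intro ζ hζ
    beta_reduce
    rw [rieszKernel_gap_eq hn hr0 hr1 hz hζ, EReal.toENNReal_of_nonpos]
    exact EReal.neg_le_zero.mpr (EReal.coe_ennreal_nonneg _)
  refine ⟨h1, ?_⟩
  rw [sFun, eintegral, h1, EReal.coe_ennreal_zero, zero_sub]
  congr 2
  refine setLIntegral_congr_fun hB fun ζ hζ => ?_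
  rw [rieszKernel_gap_eq hn hr0 hr1 hz hζ, neg_neg, EReal.toENNReal_coe]

/-- The extended logarithm is continuous with value `-∞` at the zeros of `T`, so the mean-value
formula applies at points of `W` as well. -/
theorem sFun_eq (hn : 1 ≤ n) (hr0 : 0 < r) (hr1 : r < 1) (hT : DifferentiableOn ℂ T (unitBall n))
    (hμ : IsWedgeMeasure (logSq T) (wedgeMeasure (logSq T)))
    (hnull : volume {z ∈ unitBall n | T z = 0} = 0) (hz : z ∈ unitBall n) :
    sFun T r z = ENNReal.log (‖T z‖ₑ ^ 2) - (bgAverage r (logSq T) z : EReal) := by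
  have hu (x : Cn n) : (ENNReal.log (‖T x‖ₑ ^ 2)).toReal = logSq T x := toReal_log_enorm_sq (T x)
  have h := lintegral_rieszKernel hn hr0 hr1 hz (u := fun x => ENNReal.log (‖T x‖ₑ ^ 2))
    (μ := wedgeMeasure (logSq T)) (by simpa only [hu] using hμ.locallyIntegrable)
    hμ.finite_on_compact (fun φ hφ => by
      rw [hμ.pairing φ hφ]
      simp only [hu, lapDensity, mul_assoc]) (by
      have : ∀ᵐ x, ¬(x ∈ unitBall n ∧ T x = 0) := by
        rw [ae_iff]
        simpa only [not_not] using hnull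
      filter_upwards [this] with x hx hxB
      refine ⟨?_, log_enorm_sq_ne_top _⟩
      simpa using fun h0 => hx ⟨hxB, h0⟩) (by
      have h1 : ContinuousAt T z := hT.continuousOn.continuousAt (isOpen_unitBall.mem_nhds hz)
      exact ENNReal.continuous_log.continuousAt.comp
        (((ENNReal.continuous_pow 2).continuousAt).comp h1.enorm))
  rw [(sFun_eq_neg_lintegral hn hr0 hr1 hz).2, h, EReal.neg_sub (Or.inl (EReal.coe_ne_bot _))
    (Or.inl (EReal.coe_ne_top _)), add_comm, sub_eq_add_neg]
  simp only [hu]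
  rfl

/-- Only almost everywhere: on the null set `T = 0` the value `-∞` is replaced by `0` under
`toReal`, which currents do not see. -/
theorem toReal_sFun (hn : 1 ≤ n) (hr0 : 0 < r) (hr1 : r < 1) (hT : DifferentiableOn ℂ T (unitBall n))
    (hμ : IsWedgeMeasure (logSq T) (wedgeMeasure (logSq T)))
    (hnull : volume {z ∈ unitBall n | T z = 0} = 0) :
    ∀ᵐ z ∂volume.restrict (unitBall n), (sFun T r z).toReal = logSq T z - bgAverage r (logSq T) z := by
  rw [ae_restrict_iff' isOpen_unitBall.measurableSet]
  have : ∀ᵐ x, ¬(x ∈ unitBall n ∧ T x = 0) := by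
    rw [ae_iff]
    simpa only [not_not] using hnull
  filter_upwards [this] with z hz hzB
  have h0 : ENNReal.log (‖T z‖ₑ ^ 2) ≠ ⊥ := by simpa using fun h0 => hz ⟨hzB, h0⟩
  rw [sFun_eq hn hr0 hr1 hT hμ hnull hzB, EReal.toReal_sub (log_enorm_sq_ne_top _) h0
    (EReal.coe_ne_top _) (EReal.coe_ne_bot _), EReal.toReal_coe, toReal_log_enorm_sq]
  rfl

end SFun

end BergmanBall
end

theorem proposition5p1 (n : ℕ) (hn : 1 ≤ n) (T : Cn n → ℂ)
    (hT : DifferentiableOn ℂ T (unitBall n))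
    (W : Set (Cn n)) (hW : W = {z ∈ unitBall n | T z = 0})
    (hdT : ∀ w ∈ W, fderiv ℂ T w ≠ 0)
    (r : ℝ) (hr0 : 0 < r) (hr1 : r < 1) :
    -- `G_B(·,a)` is the Green's function with pole `a`
    (∀ a ∈ unitBall n, IsGreenFunction a (fun z => green z a)) ∧
    -- `ω_B^{n-1} ∧ dd^c log|T|²` is a positive measure
    IsWedgeMeasure (logSq T) (wedgeMeasure (logSq T)) ∧
    -- the integral `s_r(z)` is well defined, and it has the asserted closed form
    (∀ z ∈ unitBall n,
      ∫⁻ ζ in unitBall n, (Gam r z ζ).toENNReal ∂(wedgeMeasure (logSq T)) < ⊤ ∧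
      IntegrableOn (fun ζ => logSq T ζ * bergmanDensity ζ) (bgBall z r) ∧
      sFun T r z = ENNReal.log (‖T z‖ₑ ^ 2)
        - (((V n r)⁻¹ * ∫ ζ in bgBall z r, logSq T ζ * bergmanDensity ζ : ℝ) : EReal)) ∧
    -- the objects in the equation of currents are well defined
    LocallyIntegrableOn (fun z => (sFun T r z).toReal) (unitBall n) ∧
    (∀ K ⊆ unitBall n, IsCompact K →
      IntegrableOn (fun p : Cn n × Cn n => logSq T (F p.1 p.2)) (K ×ˢ Metric.ball 0 r)) ∧
    (∀ θ : RForm n (2 * (n - 1)), IsTestForm θ → ∃ c, HasIntegralOver W θ c) ∧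
    -- `(1/2π) dd^c s_r = [W] - (1/2π) Υ_r^W` as currents on `B`
    (∀ θ : RForm n (2 * (n - 1)), IsTestForm θ →
      1 / (2 * Real.pi) * ddcCurrent (fun z => (sFun T r z).toReal) θ
        = integrationCurrent W θ - 1 / (2 * Real.pi) * Upsilon T r θ) := by
  obtain ⟨m, rfl⟩ : ∃ m, n = m + 1 := ⟨n - 1, by omega⟩
  have hloc := locallyIntegrableOn_logSq hT hW hdT
  have hnull : volume {z ∈ unitBall (m + 1) | T z = 0} = 0 := hW ▸ volume_zeros hT hW hdT
  have hμ := isWedgeMeasure_wedgeMeasure (exists_isWedgeMeasure hloc fun φ hφ h0 =>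
    integral_logSq_mul_lapDensity_nonneg hT hloc hnull hφ h0)
  have hm : ∀ K ⊆ unitBall (m + 1), IsCompact K →
      AEStronglyMeasurable (fun p : Cn (m + 1) × Cn (m + 1) => logSq T (F p.1 p.2))
        ((volume.restrict K).prod (volume.restrict (Metric.ball 0 r))) := fun K hKB hK =>
    aestronglyMeasurable_logSq_comp_F hT.continuousOn hr1 hK hKB
  have havg := locallyIntegrableOn_bgAverage hn hloc hr1 hm
  have hae := toReal_sFun hn hr0 hr1 hT hμ hnull
  refine ⟨fun a ha => isGreenFunction_green hn ha, hμ, fun z hz => ⟨?_, integrableOn_bgBall hloc hr1 hz,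
    sFun_eq hn hr0 hr1 hT hμ hnull hz⟩, ?_, fun K hKB hK => integrableOn_comp_F hn hloc hr1 hK hKB
      (hm K hKB hK), fun θ hθ => exists_hasIntegralOver hT hW hdT hθ, fun θ hθ => ?_⟩
  · rw [(sFun_eq_neg_lintegral hn hr0 hr1 hz).1]
    exact ENNReal.zero_lt_top
  · refine (locallyIntegrableOn_iff isOpen_unitBall.isLocallyClosed).mpr fun K hKB hK => ?_
    refine Integrable.congr ((hloc.integrableOn_compact_subset hKB hK).sub
      (havg.integrableOn_compact_subset hKB hK)) ?_
    filter_upwards [ae_restrict_of_ae_restrict_of_subset hKB hae] with z hz using hz.symm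
  -- The value of `[W]` is picked by choice among admissible ones, but `ddcCurrent_logSq` holds for
  -- each of them, so the choice is immaterial.
  · have hc : HasIntegralOver W θ (integrationCurrent W θ) := by
      have h := exists_hasIntegralOver hT hW hdT hθ
      rw [integrationCurrent, dif_pos h]
      exact h.choose_spec
    have hθB : IsFormOn (unitBall (m + 1)) θ := hθ
    have h1 : ddcCurrent (fun z => (sFun T r z).toReal) θ
        = ddcCurrent (logSq T) θ - ddcCurrent (bgAverage r (logSq T)) θ := by
      unfold ddcCurrent
      rw [← integral_sub (integrableOn_mul_ddc hloc hθB isOpen_unitBall.measurableSet _)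
        (integrableOn_mul_ddc havg hθB isOpen_unitBall.measurableSet _)]
      refine integral_congr_ae ?_
      filter_upwards [hae] with z hz
      rw [hz, sub_mul]
    -- The coefficient of `dd^c θ` on the frame is a continuous function with compact support in
    -- `B`, as the Fubini formula requires.
    have h2 : ddcCurrent (bgAverage r (logSq T)) θ = Upsilon T r θ :=
      integral_bgAverage_mul hn hloc hr1 hm
        (contDiff_apply_frame (contDiff_ddc hθ.1) fun i => frame (m + 1) i).continuous
        (hasCompactSupport_apply (hasCompactSupport_ddc hθ.2.1) _)
        ((closure_mono fun z hz => by
          rw [Function.mem_support] at hz ⊢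
          intro h
          rw [h] at hz
          exact hz rfl).trans (tsupport_ddc_subset.trans hθ.2.2.1))
    rw [h1, h2, ddcCurrent_logSq hT hW hdT hθ hc]
    field_simp
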